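/- Let $d\ge 1$, let $\Omega\subset\mathbb R^d$ be a bounded convex open set with smooth boundary and outer unit normal $n$, let $T,\sigma,b_1,b_2>0$, and let $\Phi_1,\Phi_2:\Omega\to\mathbb R$ be Lipschitz. Suppose that $(A_1(t),A_2(t),p_1,p_2)_{t\in[0,T]}$ is a smooth classical solution of the Muskat problem with surface tension, that is: (a) for every $t\in[0,T]$ the sets $A_1(t),A_2(t)\subset\Omega$ are open and disjoint and, with $\Gamma_t:=\partial A_1(t)\cap\partial A_2(t)$, one has $\Omega\subset A_1(t)\cup A_2(t)\cup\Gamma_t$; the set $\Gamma=\bigcup_{t\in[0,T]}\{t\}\times\Gamma_t$ contains the intersection of the closures of the two space-time phases $\bigcup_t\{t\}\times A_i(t)$, and near each of its points, within $[0,T]\times\overline\Omega$, it is the zero set of a $C^2$ function $\varphi(t,x)$ with $\nabla_x\varphi\neq0$, with $A_1=\{\varphi>0\}$ and $A_2=\{\varphi<0\}$ in $\Omega$. Write $\nu=\nabla\varphi/|\nabla\varphi|$ for the unit normal of $\Gamma_t$ pointing into $A_1(t)$, $\kappa=\nabla\cdot\nu$ for its mean curvature (the sum of the principal curvatures, positive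 where $A_2(t)$ is strictly convex), and $V=-\partial_t\varphi/|\nabla\varphi|$ for the speed of $\Gamma_t$ in the direction $\nu$; (b) $p_i(t,\cdot)$ and $\Phi_i$ are $C^2$ in $A_i(t)$, and they and their spatial gradients extend continuously to $\{(t,x):t\in[0,T],\,x\in\overline{A_i(t)}\}$; (c) for $i=1,2$ and all $t\in[0,T]$, $-\Delta p_i=\Delta\Phi_i$ in $A_i(t)$; $\partial_n(p_i+\Phi_i)=0$ on $\partial\Omega\cap\overline{A_i(t)}$; $V=b_i^{-1}\partial_{-\nu}(p_i+\Phi_i)$ on $\Gamma_t$ (traces from $A_i(t)$, $-\nu$ being the outer normal of $A_1(t)$); $p_1-p_2=\frac\sigma2\kappa$ on $\Gamma_t$; and at every point of $\Gamma_t\cap\partial\Omega$ the outward conormal $\tilde n$ of $\Gamma_t$ equals $n$. Put $\rho_i(t,\cdot)=\chi_{A_i(t)}$ and $v_i=-b_i^{-1}(\nabla p_i+\nabla\Phi_i)$ in $A_i(t)$. Then the following holds. 1. (Continuity equation) For $i=1,2$ and every $\psi\in C^\infty([0,T]\times\overline\Omega)$, $$\int_0^T\!\!\int_\Omega\big(\rho_iv_i\cdot\nabla\psi+\rho_i\,\partial_t\psi\big)\,dx\,dt=\int_\Omega\rho_i(T,x)\psi(T,x)\,dx-\int_\Omega\rho_i(0,x)\psi(0,x)\,dx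 .$$ 2. (Surface measure and pressure) There are a finite measure $\mu=(\mathcal H^{d-1}\llcorner\Gamma_t)\otimes(\mathcal L^1\llcorner[0,T])$, that is, $\mu(B)=\int_0^T\mathcal H^{d-1}(\{x\in\Gamma_t:(t,x)\in B\})\,dt$ for all Borel sets $B$, and a bounded linear functional $p=p_1\rho_1+p_2\rho_2+\sigma\mu$ on $C([0,T]\times\overline\Omega)$, that is, $\langle p,f\rangle=\int_0^T\int_\Omega(p_1\rho_1+p_2\rho_2)f\,dx\,dt+\sigma\int f\,d\mu$. 3. (Weak curvature equation) For every $t\in[0,T]$, $\rho_1(t,\cdot),\rho_2(t,\cdot)\in BV(\Omega)$, and for every $\xi\in C^\infty([0,T]\times\overline\Omega;\mathbb R^d)$ with zero normal component on $\partial\Omega$, $$\int_0^T\!\!\int_\Omega\sum_i\rho_i(b_iv_i+\nabla\Phi_i)\cdot\xi\,dx\,dt-\langle p,\nabla\cdot\xi\rangle+\frac\sigma2\int_0^T\!\!\int_\Omega\Big(\frac{D\rho_1}{|D\rho_1|}\otimes\frac{D\rho_1}{|D\rho_1|}:\nabla\xi+\nabla\cdot\xi\Big)\,\frac{d|D\rho_1|+d|D\rho_2|}{2}\,dt=0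 .$$ All integrals above converge absolutely. -/

import Mathlib

open Set Filter Topology MeasureTheory
open scoped ContDiff Gradient InnerProductSpace

noncomputable section

namespace Muskat

/-- The Euclidean space `ℝᵈ`. -/
abbrev Space (d : ℕ) : Type := EuclideanSpace ℝ (Fin d)

variable {d : ℕ}

/-! ### Differential operators in space -/

/-- The divergence of a vector field on `ℝᵈ`. -/
def div (F : Space d → Space d) (x : Space d) : ℝ :=
  ∑ k : Fin d, (fderiv ℝ F x (EuclideanSpace.single k 1)) k

/-- The matrix contraction `w ⊗ w : ∇F` at the point `x`. -/
def quadGrad (F : Space d → Space d) (w x : Space d) : ℝ :=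
  ⟪w, fderiv ℝ F x w⟫_ℝ

/-! ### Domains with smooth boundary -/

/-- `g` is a smooth defining function of `Ω` on the open set `U`:
`Ω ∩ U = {g < 0} ∩ U` and `∇g ≠ 0` on `U`. -/
structure IsBoundaryChart (Ω U : Set (Space d)) (g : Space d → ℝ) : Prop where
  isOpen : IsOpen U
  smooth : ContDiffOn ℝ ∞ g U
  regular : ∀ y ∈ U, ∇ g y ≠ 0
  domain : ∀ y ∈ U, (y ∈ Ω ↔ g y < 0)

/-- Every boundary point of `Ω` has a neighbourhood with a smooth defining function. -/
def HasSmoothBoundary (Ω : Set (Space d)) : Prop :=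
  ∀ x ∈ frontier Ω, ∃ (U : Set (Space d)) (g : Space d → ℝ), x ∈ U ∧ IsBoundaryChart Ω U g

/-- `n` is the outer unit normal of `Ω` at its boundary point `x`. -/
def IsOuterNormal (Ω : Set (Space d)) (x n : Space d) : Prop :=
  x ∈ frontier Ω ∧ ∃ (U : Set (Space d)) (g : Space d → ℝ),
    x ∈ U ∧ IsBoundaryChart Ω U g ∧ n = ‖∇ g x‖⁻¹ • ∇ g x

/-! ### Phases and interface

The phases are indexed by `Fin 2`: index `0` is the first fluid and index `1` the second one. -/

/-- The interface `Γ_t = ∂A₁(t) ∩ ∂A₂(t)`. -/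
def interface (A : Fin 2 → ℝ → Set (Space d)) (t : ℝ) : Set (Space d) :=
  frontier (A 0 t) ∩ frontier (A 1 t)

/-- The space-time region `{(t, x) : 0 ≤ t ≤ T, x ∈ S t}`. -/
def spaceTime (T : ℝ) (S : ℝ → Set (Space d)) : Set (ℝ × Space d) :=
  {z | z.1 ∈ Icc 0 T ∧ z.2 ∈ S z.1}

/-- `φ` is a `C²` level-set function of the interface on the open space-time set `U`, with
non-vanishing spatial gradient: there, within `[0,T] × closure Ω`, the interface is `{φ = 0}`, the
first phase is `{φ > 0}` and the second phase is `{φ < 0}`. -/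
structure IsInterfaceChart (Ω : Set (Space d)) (T : ℝ) (A : Fin 2 → ℝ → Set (Space d))
    (U : Set (ℝ × Space d)) (φ : ℝ → Space d → ℝ) : Prop where
  isOpen : IsOpen U
  smooth : ContDiffOn ℝ 2 (Function.uncurry φ) U
  regular : ∀ t x, (t, x) ∈ U → ∇ (φ t) x ≠ 0
  phase_one : ∀ t x, (t, x) ∈ U → t ∈ Icc 0 T → x ∈ Ω → (x ∈ A 0 t ↔ 0 < φ t x)
  phase_two : ∀ t x, (t, x) ∈ U → t ∈ Icc 0 T → x ∈ Ω → (x ∈ A 1 t ↔ φ t x < 0)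
  zero_set : ∀ t x, (t, x) ∈ U → t ∈ Icc 0 T → x ∈ closure Ω →
    (x ∈ interface A t ↔ φ t x = 0)

/-- The unit normal `ν = ∇φ / |∇φ|` of the level sets of `φ t`, pointing into `{φ > 0}`. -/
def unitNormal (φ : ℝ → Space d → ℝ) (t : ℝ) (x : Space d) : Space d :=
  ‖∇ (φ t) x‖⁻¹ • ∇ (φ t) x

/-- The mean curvature (sum of the principal curvatures) `div ν` of the level sets of `φ t`. It is
positive for a sphere with `{φ < 0}` on the inside. -/
def meanCurvature (φ : ℝ → Space d → ℝ) (t : ℝ) (x : Space d) : ℝ :=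
  div (unitNormal φ t) x

/-- The speed `- ∂ₜφ / |∇φ|` of the moving level sets of `φ` in the direction `ν`. -/
def normalSpeed (φ : ℝ → Space d → ℝ) (t : ℝ) (x : Space d) : ℝ :=
  -(deriv (fun s => φ s x) t) / ‖∇ (φ t) x‖

/-- `w` is the outward unit conormal along the boundary of a hypersurface `Γ` with unit normal `ν`
that ends on a wall with outer unit normal `n`: the unit vector that is tangent to `Γ`, orthogonal
to `∂Γ` (whose tangent vectors are those orthogonal to both `ν` and `n`) and points out through
the wall. -/
structure IsOutwardConormal (ν n w : Space d) : Prop where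
  unit : ‖w‖ = 1
  tangent : ⟪w, ν⟫_ℝ = 0
  orthogonal : ∀ τ : Space d, ⟪τ, ν⟫_ℝ = 0 → ⟪τ, n⟫_ℝ = 0 → ⟪w, τ⟫_ℝ = 0
  outward : 0 < ⟪w, n⟫_ℝ

/-! ### Classical solutions -/

/-- On the moving open region `A`, the function `f` is `C²` in space, and it is `C¹` in space up to
the boundary: `f` and its spatial gradient extend continuously to
`{(t, x) : 0 ≤ t ≤ T, x ∈ closure (A t)}`. -/
structure IsRegularOnPhase (T : ℝ) (A : ℝ → Set (Space d)) (f : ℝ → Space d → ℝ) : Prop where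
  contDiffOn : ∀ t ∈ Icc 0 T, ContDiffOn ℝ 2 (f t) (A t)
  continuousOn : ContinuousOn (Function.uncurry f) (spaceTime T fun t => closure (A t))
  gradient : ∃ G : ℝ × Space d → Space d,
    ContinuousOn G (spaceTime T fun t => closure (A t)) ∧
    ∀ t ∈ Icc 0 T, ∀ x ∈ A t, G (t, x) = ∇ (f t) x

/-- The boundary value at `x`, taken from inside `S`, of the component of the field `F` in the
direction `n` is `c`. -/
def HasNormalTrace (S : Set (Space d)) (F : Space d → Space d) (x n : Space d) (c : ℝ) : Prop :=
  Tendsto (fun y => ⟪F y, n⟫_ℝ) (𝓝[S] x) (𝓝 c)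

/-- Smooth classical solutions of the Muskat problem with surface tension on `[0,T]`, with phases
`A i t ⊆ Ω`, pressures `p i`, potentials `Φ i`, mobilities `b i` and surface tension `σ`. -/
structure IsClassicalSolution (Ω : Set (Space d)) (T σ : ℝ) (b : Fin 2 → ℝ)
    (Φ : Fin 2 → Space d → ℝ) (A : Fin 2 → ℝ → Set (Space d))
    (p : Fin 2 → ℝ → Space d → ℝ) : Prop where
  phase_open : ∀ i, ∀ t ∈ Icc 0 T, IsOpen (A i t)
  phase_subset : ∀ i, ∀ t ∈ Icc 0 T, A i t ⊆ Ω
  phase_disjoint : ∀ t ∈ Icc 0 T, Disjoint (A 0 t) (A 1 t)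
  /-- The two phases and the interface fill the domain. -/
  phase_cover : ∀ t ∈ Icc 0 T, Ω ⊆ A 0 t ∪ A 1 t ∪ interface A t
  /-- In space-time, too, the phases only meet along `⋃ₜ {t} × Γ_t` (no jumps in time). -/
  phase_meet : closure (spaceTime T (A 0)) ∩ closure (spaceTime T (A 1)) ⊆
    spaceTime T (interface A)
  /-- The interface is a `C²` hypersurface. -/
  interface_smooth : ∀ t ∈ Icc 0 T, ∀ x ∈ interface A t,
    ∃ (U : Set (ℝ × Space d)) (φ : ℝ → Space d → ℝ), (t, x) ∈ U ∧ IsInterfaceChart Ω T A U φ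
  pressure_regular : ∀ i, IsRegularOnPhase T (A i) (p i)
  potential_regular : ∀ i, IsRegularOnPhase T (A i) (fun _ => Φ i)
  /-- `-Δ pᵢ = Δ Φᵢ` in the `i`-th phase. -/
  bulk : ∀ i, ∀ t ∈ Icc 0 T, ∀ x ∈ A i t,
    -Laplacian.laplacian (p i t) x = Laplacian.laplacian (Φ i) x
  /-- `∂ₙ (pᵢ + Φᵢ) = 0` on the part of `∂Ω` that bounds the `i`-th phase. -/
  no_flux : ∀ i, ∀ t ∈ Icc 0 T, ∀ x ∈ frontier Ω ∩ closure (A i t), ∀ n, IsOuterNormal Ω x n →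
    HasNormalTrace (A i t) (fun y => ∇ (p i t) y + ∇ (Φ i) y) x n 0
  /-- `V = bᵢ⁻¹ ∂ₙ (pᵢ + Φᵢ)` on `Γ_t` for both `i`, where `n = -ν` is the normal that points out
  of the first phase and `V` is the speed of the interface in the direction `ν`. -/
  kinematic : ∀ U φ, IsInterfaceChart Ω T A U φ → ∀ i, ∀ t ∈ Icc 0 T, ∀ x ∈ interface A t,
    (t, x) ∈ U →
    HasNormalTrace (A i t) (fun y => (b i)⁻¹ • (∇ (p i t) y + ∇ (Φ i) y)) x
      (-unitNormal φ t x) (normalSpeed φ t x)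
  /-- `p₁ - p₂ = (σ/2) κ` on `Γ_t`. -/
  jump : ∀ U φ, IsInterfaceChart Ω T A U φ → ∀ t ∈ Icc 0 T, ∀ x ∈ interface A t,
    (t, x) ∈ U → p 0 t x - p 1 t x = σ / 2 * meanCurvature φ t x
  /-- Where `Γ_t` meets `∂Ω`, its outward conormal is the outer normal `n` of `Ω`. -/
  contact : ∀ U φ, IsInterfaceChart Ω T A U φ → ∀ t ∈ Icc 0 T,
    ∀ x ∈ interface A t ∩ frontier Ω, (t, x) ∈ U → ∀ n, IsOuterNormal Ω x n →
    IsOutwardConormal (unitNormal φ t x) n n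

/-! ### Weak formulation -/

/-- `f ∈ BV(Ω)` with `|Df| = m` and `Df / |Df| = ν`: `m` is a finite measure on `Ω`, `|ν| = 1`
`m`-almost everywhere, and `∫_Ω f div ζ dx = - ∫_Ω ζ · ν dm` for all `ζ ∈ C¹_c(Ω; ℝᵈ)`. -/
structure IsPolarDerivative (Ω : Set (Space d)) (f : Space d → ℝ) (m : Measure (Space d))
    (ν : Space d → Space d) : Prop where
  integrable : IntegrableOn f Ω
  finite : IsFiniteMeasure m
  concentrated : m Ωᶜ = 0
  measurable : Measurable ν
  unit : ∀ᵐ x ∂m, ‖ν x‖ = 1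
  parts : ∀ ζ : Space d → Space d, ContDiff ℝ 1 ζ → HasCompactSupport ζ → tsupport ζ ⊆ Ω →
    ∫ x in Ω, f x * div ζ x = -∫ x, ⟪ζ x, ν x⟫_ℝ ∂m

/-- The weak continuity equation for a density `ρ` and a velocity `v` on `[0,T] × Ω`, tested with
all `ψ ∈ C^∞([0,T] × closure Ω)`. -/
def WeakContinuityEq (Ω : Set (Space d)) (T : ℝ) (ρ : ℝ → Space d → ℝ)
    (v : ℝ → Space d → Space d) : Prop :=
  ∀ ψ : ℝ → Space d → ℝ, ContDiff ℝ ∞ (Function.uncurry ψ) →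
    IntegrableOn (fun z : ℝ × Space d => ρ z.1 z.2 * ⟪v z.1 z.2, ∇ (ψ z.1) z.2⟫_ℝ
      + ρ z.1 z.2 * deriv (fun s => ψ s z.2) z.1) (Icc 0 T ×ˢ Ω) ∧
    IntegrableOn (fun x => ρ 0 x * ψ 0 x) Ω ∧
    IntegrableOn (fun x => ρ T x * ψ T x) Ω ∧
    ∫ t in (0 : ℝ)..T, ∫ x in Ω, (ρ t x * ⟪v t x, ∇ (ψ t) x⟫_ℝ
      + ρ t x * deriv (fun s => ψ s x) t)
      = (∫ x in Ω, ρ T x * ψ T x) - ∫ x in Ω, ρ 0 x * ψ 0 x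

/-- The closed space-time cylinder `[0,T] × closure Ω`. -/
def cylinder (Ω : Set (Space d)) (T : ℝ) : Set (ℝ × Space d) := Icc 0 T ×ˢ closure Ω

/-- The divergence of a smooth time-dependent vector field is continuous in space-time. -/
theorem continuous_div {ξ : ℝ → Space d → Space d} (hξ : ContDiff ℝ ∞ (Function.uncurry ξ)) :
    Continuous fun z : ℝ × Space d => div (ξ z.1) z.2 := by
  have h : ∀ z : ℝ × Space d, ∀ w : Space d, fderiv ℝ (ξ z.1) z.2 w =
      fderiv ℝ (Function.uncurry ξ) z (0, w) := by
    intro z w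
    have h1 : HasFDerivAt (Function.uncurry ξ) (fderiv ℝ (Function.uncurry ξ) z) (z.1, z.2) :=
      (hξ.differentiable (by simp) z).hasFDerivAt
    have h2 : HasFDerivAt (fun y : Space d => (z.1, y)) (ContinuousLinearMap.inr ℝ ℝ (Space d))
        z.2 := hasFDerivAt_prodMk_right z.1 z.2
    have h3 := h1.comp z.2 h2
    have h4 : (Function.uncurry ξ ∘ fun y : Space d => (z.1, y)) = ξ z.1 := rfl
    rw [h4] at h3
    rw [h3.fderiv]
    simp
  unfold div
  simp only [h]
  have hc := hξ.continuous_fderiv (by simp)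
  fun_prop

/-- The divergence of a smooth time-dependent vector field, as an element of
`C([0,T] × closure Ω)`. -/
def divOn (Ω : Set (Space d)) (T : ℝ) (ξ : ℝ → Space d → Space d)
    (hξ : ContDiff ℝ ∞ (Function.uncurry ξ)) : C(cylinder Ω T, ℝ) :=
  (⟨fun z => div (ξ z.1) z.2, continuous_div hξ⟩ : C(ℝ × Space d, ℝ)).restrict (cylinder Ω T)

/-- The weak curvature equation for densities `ρ i`, velocities `v i` and a pressure `P` in the dual
of `C([0,T] × closure Ω)`, tested with all `ξ ∈ C^∞([0,T] × closure Ω; ℝᵈ)` whose normal component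
vanishes on `∂Ω`. The half sum `(|Dρ₁| + |Dρ₂|) / 2` counts the interface once. -/
def WeakCurvatureEq (Ω : Set (Space d)) (T σ : ℝ) (b : Fin 2 → ℝ) (Φ : Fin 2 → Space d → ℝ)
    (ρ : Fin 2 → ℝ → Space d → ℝ) (v : Fin 2 → ℝ → Space d → Space d)
    (P : C(cylinder Ω T, ℝ) →L[ℝ] ℝ) : Prop :=
  ∃ (m : Fin 2 → ℝ → Measure (Space d)) (ν : Fin 2 → ℝ → Space d → Space d),
    (∀ i, ∀ t ∈ Icc 0 T, IsPolarDerivative Ω (ρ i t) (m i t) (ν i t)) ∧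
    ∀ (ξ : ℝ → Space d → Space d) (hξ : ContDiff ℝ ∞ (Function.uncurry ξ)),
      (∀ t ∈ Icc 0 T, ∀ x n, IsOuterNormal Ω x n → ⟪ξ t x, n⟫_ℝ = 0) →
      IntegrableOn (fun z : ℝ × Space d =>
        ∑ i, ρ i z.1 z.2 * ⟪b i • v i z.1 z.2 + ∇ (Φ i) z.2, ξ z.1 z.2⟫_ℝ) (Icc 0 T ×ˢ Ω) ∧
      (∀ t ∈ Icc 0 T, Integrable (fun x => quadGrad (ξ t) (ν 0 t x) x + div (ξ t) x)
        (m 0 t + m 1 t)) ∧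
      IntervalIntegrable (fun t => ∫ x, (quadGrad (ξ t) (ν 0 t x) x + div (ξ t) x)
        ∂(m 0 t + m 1 t)) volume 0 T ∧
      (∫ t in (0 : ℝ)..T, ∫ x in Ω,
          ∑ i, ρ i t x * ⟪b i • v i t x + ∇ (Φ i) x, ξ t x⟫_ℝ)
        - P (divOn Ω T ξ hξ)
        + σ / 2 * ∫ t in (0 : ℝ)..T,
            (1 / 2 * ∫ x, (quadGrad (ξ t) (ν 0 t x) x + div (ξ t) x) ∂(m 0 t + m 1 t)) = 0

/-! ### The objects attached to a classical solution -/

/-- The density `ρᵢ = χ_{Aᵢ}`. -/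
def density (A : ℝ → Set (Space d)) (t : ℝ) : Space d → ℝ := (A t).indicator 1

/-- The velocity `v = - b⁻¹ (∇p + ∇Φ)`. -/
def velocity (b : ℝ) (Φ : Space d → ℝ) (p : ℝ → Space d → ℝ) (t : ℝ) (x : Space d) : Space d :=
  -(b⁻¹ • (∇ (p t) x + ∇ Φ x))

/-- `μ = (ℋ^{d-1} ⌞ Γ_t) ⊗ (ℒ¹ ⌞ [0,T])`, by disintegration. -/
def IsSurfaceMeasure (T : ℝ) (Γ : ℝ → Set (Space d)) (μ : Measure (ℝ × Space d)) : Prop :=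
  ∀ B : Set (ℝ × Space d), MeasurableSet B →
    AEMeasurable (fun t => μHE[d - 1] (Γ t ∩ {x | (t, x) ∈ B})) (volume.restrict (Icc 0 T)) ∧
    μ B = ∫⁻ t in Icc 0 T, μHE[d - 1] (Γ t ∩ {x | (t, x) ∈ B})

/-- `P = p₁ ρ₁ + p₂ ρ₂ + σ μ` as an element of the dual of `C([0,T] × closure Ω)`. The
functions in `C([0,T] × closure Ω)` are written as restrictions of continuous functions. -/
def IsWeakPressure (Ω : Set (Space d)) (T σ : ℝ) (ρ p : Fin 2 → ℝ → Space d → ℝ)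
    (μ : Measure (ℝ × Space d)) (P : C(cylinder Ω T, ℝ) →L[ℝ] ℝ) : Prop :=
  ∀ f : C(ℝ × Space d, ℝ),
    IntegrableOn (fun z : ℝ × Space d => (∑ i, p i z.1 z.2 * ρ i z.1 z.2) * f z)
      (Icc 0 T ×ˢ Ω) ∧
    Integrable (fun z => f z) μ ∧
    P (f.restrict (cylinder Ω T)) =
      (∫ t in (0 : ℝ)..T, ∫ x in Ω, (∑ i, p i t x * ρ i t x) * f (t, x)) + σ * ∫ z, f z ∂μ

end Muskat

end

/-! Both identities are integrations by parts over the moving phases. The velocities and pressure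
gradients are only continuous up to the boundary, so boundary terms are never obtained by
differentiating there. They are produced by a cutoff `cut (a / ε)`, where the level function `a` is
`±φ` for the interface or a defining function `β` for the wall, and evaluated as `ε → 0`. The
gradient of the cutoff is `ε⁻¹ cut'(a/ε) ∇a`, carried by the layer `ε ≤ a ≤ 2ε` of volume `O(ε)`. If
the remaining factor vanishes on `{a = 0}`, compactness makes the term tend to zero
(`exists_forall_abs_le_of_zero`, `tendsto_integral_deriv_cut_zero`). Otherwise Fubini along a
coordinate direction and the area formula for graphs turn it into a surface integral
(`IsGraphBox.tendsto_integral_deriv_cut`).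

Continuity equation: `∂ₜψ + v·∇ψ` is the derivative of `ψ` in the space-time direction `(1, v)`. If
`ψ` is supported inside the phase, the equation is the fundamental theorem of calculus in time
together with `div v = 0` at each time. A general `ψ` is cut off. The error contains `∂ₜφ + v·∇φ`,
which vanishes on the interface by the kinematic condition, and `v·∇β`, which vanishes on the wall
by the no-flux condition (`IsFlowLevel.integral_fderiv_eq`).

Curvature equation: `bᵢvᵢ + ∇Φᵢ = -∇pᵢ`, and the integral of `∇pᵢ·ξ + pᵢ div ξ` over a phase is a
surface integral of `pᵢ ξ·ν` with opposite signs for the two phases; the wall contributes nothing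
because `ξ` is tangential to it. The sum is `-∫ (p₁ - p₂) ξ·ν = -(σ/2) ∫ κ ξ·ν`. The divergence
theorem on `Γ_t` replaces `∫ κ ξ·ν` by `∫ (div ξ - ν⊗ν:∇ξ)`, since its boundary term contains the
conormal, which is `n`, and `ξ·n = 0`. It is proved with the field `W = |∇φ| (ξ - (ξ·ν)ν)`, which is
tangential to all level sets and has divergence `|∇φ| (div ξ - ν⊗ν:∇ξ - κ ξ·ν)` (`div_tangential`).
The part `σμ` of the pressure accounts for the rest: `-σ div ξ + (σ/2)(ν⊗ν:∇ξ + div ξ) = -(σ/2)(div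
ξ - ν⊗ν:∇ξ)`.

Surface measure: the right contact angle makes `Γ_t` transversal to the wall, so `Γ_t ∩ ∂Ω` is a
null set, and the surface measure of `Γ_t` is that of `Γ_t ∩ Ω`, which is `|Dρᵢ|`. Boxes in which
the interface is a graph for a whole interval of times bound the area uniformly in time. Layer
integrals depend measurably on time, hence so do their limits, and the area measures form a finite
kernel (`exists_kernel`); `μ` is its product with Lebesgue measure. -/

namespace Muskat

noncomputable section

variable {d n : ℕ}

/-! ### A smooth cutoff -/

/-- A smooth function that vanishes on `(-∞, 1]` and equals `1` on `[2, ∞)`. -/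
def cut (s : ℝ) : ℝ := Real.smoothTransition (s - 1)

theorem contDiff_cut {n : ℕ∞} : ContDiff ℝ n cut :=
  Real.smoothTransition.contDiff.comp (contDiff_id.sub contDiff_const)

theorem cut_of_le {s : ℝ} (h : s ≤ 1) : cut s = 0 :=
  Real.smoothTransition.zero_of_nonpos (by linarith)

theorem cut_of_ge {s : ℝ} (h : 2 ≤ s) : cut s = 1 :=
  Real.smoothTransition.one_of_one_le (by linarith)

theorem cut_nonneg (s : ℝ) : 0 ≤ cut s := Real.smoothTransition.nonneg _

theorem cut_le_one (s : ℝ) : cut s ≤ 1 := Real.smoothTransition.le_one _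

theorem abs_cut_le_one (s : ℝ) : |cut s| ≤ 1 := by
  rw [abs_of_nonneg (cut_nonneg s)]; exact cut_le_one s

theorem continuous_cut : Continuous cut := (contDiff_cut (n := 0)).continuous

theorem hasDerivAt_cut (s : ℝ) : HasDerivAt cut (deriv cut s) s :=
  ((contDiff_cut (n := 1)).differentiable (by simp) s).hasDerivAt

theorem continuous_deriv_cut : Continuous (deriv cut) :=
  (contDiff_cut (n := 1)).continuous_deriv (by simp)

theorem deriv_cut_of_lt {s : ℝ} (h : s < 1) : deriv cut s = 0 := by
  have : cut =ᶠ[𝓝 s] fun _ => 0 := by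
    filter_upwards [Iio_mem_nhds h] with u hu using cut_of_le (le_of_lt hu)
  rw [this.deriv_eq]; simp

theorem deriv_cut_of_gt {s : ℝ} (h : 2 < s) : deriv cut s = 0 := by
  have : cut =ᶠ[𝓝 s] fun _ => 1 := by
    filter_upwards [Ioi_mem_nhds h] with u hu using cut_of_ge (le_of_lt hu)
  rw [this.deriv_eq]; simp

theorem mem_Icc_of_deriv_cut_ne_zero {s : ℝ} (h : deriv cut s ≠ 0) : s ∈ Icc (1 : ℝ) 2 := by
  by_contra hs
  rw [mem_Icc, not_and_or, not_le, not_le] at hs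
  rcases hs with hs | hs
  · exact h (deriv_cut_of_lt hs)
  · exact h (deriv_cut_of_gt hs)

theorem hasCompactSupport_deriv_cut : HasCompactSupport (deriv cut) :=
  HasCompactSupport.intro (isCompact_Icc (a := (1 : ℝ)) (b := 2)) fun _ hs => by
    by_contra h
    exact hs (mem_Icc_of_deriv_cut_ne_zero h)

theorem exists_bound_deriv_cut : ∃ C, 0 < C ∧ ∀ s, |deriv cut s| ≤ C := by
  obtain ⟨C, hC⟩ := hasCompactSupport_deriv_cut.exists_bound_of_continuous continuous_deriv_cut
  exact ⟨max C 1, by positivity, fun s => (hC s).trans (le_max_left _ _)⟩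

theorem integral_deriv_cut : ∫ s, deriv cut s = 1 := by
  have h : ∫ s in (0 : ℝ)..3, deriv cut s = cut 3 - cut 0 :=
    intervalIntegral.integral_eq_sub_of_hasDerivAt (fun s _ => hasDerivAt_cut s)
      (continuous_deriv_cut.intervalIntegrable _ _)
  rw [cut_of_ge (by norm_num), cut_of_le (by norm_num),
    intervalIntegral.integral_of_le (by norm_num), setIntegral_eq_integral_of_forall_compl_eq_zero] at h
  · simpa using h
  · intro s hs
    by_contra h'
    have := mem_Icc_of_deriv_cut_ne_zero h'
    exact hs ⟨by linarith [this.1], by linarith [this.2]⟩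

/-- The cutoff recovers the open set `{a > 0}`: nothing is counted on the zero level itself, where
`cut 0 = 0`. -/
theorem tendsto_cut_div (a : ℝ) :
    Tendsto (fun ε : ℝ => cut (a / ε)) (𝓝[>] 0) (𝓝 (if 0 < a then 1 else 0)) := by
  split_ifs with ha
  · refine tendsto_const_nhds.congr' ?_
    have : Ioo (0 : ℝ) (a / 2) ∈ 𝓝[>] (0 : ℝ) := Ioo_mem_nhdsGT (by linarith)
    filter_upwards [this] with ε hε
    rw [cut_of_ge]
    rw [le_div_iff₀ hε.1]
    linarith [hε.2]
  · refine tendsto_const_nhds.congr' ?_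
    filter_upwards [self_mem_nhdsWithin] with ε hε
    rw [cut_of_le]
    have : a / ε ≤ 0 := div_nonpos_of_nonpos_of_nonneg (not_lt.1 ha) (le_of_lt hε)
    linarith

/-! ### The divergence theorem for compactly supported fields -/


theorem continuous_fderiv_component {F : Space d → Space d} (hF : ContDiff ℝ 1 F) (v : Space d)
    (k : Fin d) : Continuous fun x => (fderiv ℝ F x v) k := by
  have := hF.continuous_fderiv (by simp)
  fun_prop

theorem fderiv_component {F : Space d → Space d} {x : Space d} (hF : DifferentiableAt ℝ F x)
    (v : Space d) (k : Fin d) : fderiv ℝ (fun y => F y k) x v = (fderiv ℝ F x v) k := by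
  have h := ((EuclideanSpace.proj k : Space d →L[ℝ] ℝ).hasFDerivAt.comp x hF.hasFDerivAt).fderiv
  have h' : ((EuclideanSpace.proj k : Space d →L[ℝ] ℝ) ∘ F) = fun y => F y k := rfl
  rw [h'] at h
  rw [h]; rfl

/-- Integration by parts against the constant function `1`. -/
theorem integral_fderiv_eq_zero {f : Space d → ℝ} (hf : ContDiff ℝ 1 f) (hc : HasCompactSupport f)
    (v : Space d) : ∫ x, fderiv ℝ f x v = 0 := by
  have h := integral_mul_fderiv_eq_neg_fderiv_mul_of_integrable (μ := (volume : Measure (Space d)))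
    (f := fun _ => (1 : ℝ)) (g := f) (v := v) (by simp) ?_ ?_ (by simp) ?_
  · simpa using h
  · simp only [one_mul]
    refine Continuous.integrable_of_hasCompactSupport ?_ ?_
    · have := hf.continuous_fderiv (by simp)
      fun_prop
    · exact (hc.fderiv (𝕜 := ℝ)).comp_left (g := fun L : Space d →L[ℝ] ℝ => L v) (by simp)
  · simpa using hf.continuous.integrable_of_hasCompactSupport hc
  · intro x _
    exact hf.differentiable (by simp) x

theorem integral_div_eq_zero {F : Space d → Space d} (hF : ContDiff ℝ 1 F)
    (hc : HasCompactSupport F) : ∫ x, div F x = 0 := by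
  unfold div
  rw [integral_finsetSum]
  · refine Finset.sum_eq_zero fun k _ => ?_
    have : ∀ x, (fderiv ℝ F x (EuclideanSpace.single k 1)) k =
        fderiv ℝ (fun y => F y k) x (EuclideanSpace.single k 1) := fun x =>
      (fderiv_component (hF.differentiable (by simp) x) _ k).symm
    simp only [this]
    refine integral_fderiv_eq_zero ?_ ?_ _
    · exact (EuclideanSpace.proj k : Space d →L[ℝ] ℝ).contDiff.comp hF
    · exact hc.comp_left (g := fun y : Space d => y k) rfl
  · intro k _
    refine Continuous.integrable_of_hasCompactSupport (continuous_fderiv_component hF _ k) ?_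
    exact (hc.fderiv (𝕜 := ℝ)).comp_left
      (g := fun L : Space d →L[ℝ] Space d => (L (EuclideanSpace.single k 1)) k) (by simp)

/-- If a function vanishes on `S` and has a non-zero derivative within `S` at all points of `S`,
then `S` is a null set. -/
theorem volume_eq_zero_of_hasFDerivWithinAt_zero {S : Set (Space d)} {u : Space d → ℝ}
    (h0 : ∀ x ∈ S, u x = 0)
    (h : ∀ x ∈ S, ∃ u' : Space d →L[ℝ] ℝ, u' ≠ 0 ∧ HasFDerivWithinAt u u' S x) :
    volume S = 0 := by
  choose! u' hne hd using h
  have hm : ∀ x ∈ S, ∃ m : Space d, u' x m = 1 := by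
    intro x hx
    obtain ⟨w, hw⟩ : ∃ w, u' x w ≠ 0 := by
      by_contra! hcon
      exact hne x hx (ContinuousLinearMap.ext hcon)
    exact ⟨(u' x w)⁻¹ • w, by simp [hw]⟩
  choose! m hm using hm
  -- On `S` the identity coincides with `y ↦ y - u y • m x`, because `u` vanishes there. The
  -- derivative of this map at `x` kills `m x`, since `u' x (m x) = 1`. So the identity has a
  -- singular derivative within `S` at every point of `S`, and its image, which is `S`, is a null
  -- set.
  have key := addHaar_image_eq_zero_of_det_fderivWithin_eq_zero (volume : Measure (Space d))
    (f := id) (s := S)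
    (f' := fun x => ContinuousLinearMap.id ℝ (Space d) - (u' x).smulRight (m x)) ?_ ?_
  · simpa using key
  · intro x hx
    have h1 : HasFDerivWithinAt (fun y => y - u y • m x)
        (ContinuousLinearMap.id ℝ (Space d) - (u' x).smulRight (m x)) S x :=
      (hasFDerivWithinAt_id x S).sub ((hd x hx).smul_const (m x))
    refine h1.congr (fun y hy => ?_) ?_
    · simp [h0 y hy]
    · simp [h0 x hx]
  · intro x hx
    rw [ContinuousLinearMap.det]
    by_contra hdet
    have hker := (LinearMap.equivOfDetNeZero _ hdet).injective (a₁ := m x) (a₂ := 0) (by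
      simp [LinearMap.equivOfDetNeZero, hm x hx])
    have := hm x hx
    simp [hker] at this

/-! ### Splitting off a coordinate -/

/-- The linear isomorphism `ℝ × ℝⁿ ≃ ℝⁿ⁺¹` that inserts the first component as `k`-th coordinate. -/
def coord (k : Fin (n + 1)) : (ℝ × Space n) ≃L[ℝ] Space (n + 1) :=
  LinearEquiv.toContinuousLinearEquiv
    { toFun := fun p => WithLp.toLp 2 (k.insertNth p.1 p.2.ofLp)
      invFun := fun x => (x k, WithLp.toLp 2 fun i => x (k.succAbove i))
      map_add' := fun p q => by
        ext j
        refine Fin.succAboveCases k ?_ (fun i => ?_) j <;> simp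
      map_smul' := fun c p => by
        ext j
        refine Fin.succAboveCases k ?_ (fun i => ?_) j <;> simp
      left_inv := fun p => by
        refine Prod.ext (by simp) ?_
        ext i; simp
      right_inv := fun x => by
        ext j
        refine Fin.succAboveCases k ?_ (fun i => ?_) j <;> simp }

/-- The point of `ℝⁿ⁺¹` with `k`-th coordinate `s` and remaining coordinates `y`. -/
def ins (k : Fin (n + 1)) (s : ℝ) (y : Space n) : Space (n + 1) := coord k (s, y)

/-- The coordinates other than the `k`-th one. -/
def rem (k : Fin (n + 1)) (x : Space (n + 1)) : Space n := ((coord k).symm x).2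

@[simp] theorem ins_apply_same (k : Fin (n + 1)) (s : ℝ) (y : Space n) : ins k s y k = s := by
  change k.insertNth (α := fun _ => ℝ) s y.ofLp k = s
  simp

@[simp] theorem ins_apply_succAbove (k : Fin (n + 1)) (s : ℝ) (y : Space n) (i : Fin n) :
    ins k s y (k.succAbove i) = y i := by
  change k.insertNth (α := fun _ => ℝ) s y.ofLp (k.succAbove i) = y i
  simp

@[simp] theorem rem_ins (k : Fin (n + 1)) (s : ℝ) (y : Space n) : rem k (ins k s y) = y := by
  simp [rem, ins]

@[simp] theorem ins_rem (k : Fin (n + 1)) (x : Space (n + 1)) : ins k (x k) (rem k x) = x :=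
  (coord k).apply_symm_apply x

theorem ins_sub (k : Fin (n + 1)) (s t : ℝ) (y z : Space n) :
    ins k s y - ins k t z = ins k (s - t) (y - z) := by
  simp only [ins, ← map_sub, Prod.mk_sub_mk]

theorem ins_eq_add (k : Fin (n + 1)) (s : ℝ) (y : Space n) :
    ins k s y = s • ins k 1 0 + ins k 0 y := by
  simp only [ins, ← map_smul, ← map_add]; simp

theorem ins_one_zero (k : Fin (n + 1)) : ins k 1 (0 : Space n) = EuclideanSpace.single k 1 := by
  ext j
  refine Fin.succAboveCases k ?_ (fun i => ?_) j <;> simp [Fin.succAbove_ne]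

theorem continuous_ins (k : Fin (n + 1)) : Continuous fun p : ℝ × Space n => ins k p.1 p.2 :=
  (coord k).continuous

theorem continuous_rem (k : Fin (n + 1)) : Continuous (rem k : Space (n + 1) → Space n) :=
  continuous_snd.comp (coord k).symm.continuous

theorem norm_ins_sq (k : Fin (n + 1)) (s : ℝ) (y : Space n) :
    ‖ins k s y‖ ^ 2 = s ^ 2 + ‖y‖ ^ 2 := by
  rw [EuclideanSpace.norm_sq_eq, EuclideanSpace.norm_sq_eq, Fin.sum_univ_succAbove _ k]
  simp

theorem norm_ins_zero (k : Fin (n + 1)) (y : Space n) : ‖ins k 0 y‖ = ‖y‖ := by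
  have := norm_ins_sq k 0 y
  rw [← sq_eq_sq₀ (norm_nonneg _) (norm_nonneg _), this]; simp

theorem norm_le_norm_ins (k : Fin (n + 1)) (s : ℝ) (y : Space n) : ‖y‖ ≤ ‖ins k s y‖ := by
  rw [← sq_le_sq₀ (norm_nonneg _) (norm_nonneg _), norm_ins_sq]
  nlinarith [sq_nonneg s]

theorem norm_ins_le (k : Fin (n + 1)) (s : ℝ) (y : Space n) : ‖ins k s y‖ ≤ |s| + ‖y‖ := by
  rw [ins_eq_add]
  refine (norm_add_le _ _).trans ?_
  rw [norm_smul, norm_ins_zero, ins_one_zero]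
  simp

/-- The map factors through the product spaces with their sup norms, where splitting off a
coordinate is known to preserve volume. -/
theorem measurePreserving_coord (k : Fin (n + 1)) :
    MeasurePreserving (coord k : ℝ × Space n → Space (n + 1)) := by
  have h1 : MeasurePreserving (Prod.map id (WithLp.ofLp : Space n → Fin n → ℝ))
      (volume : Measure (ℝ × Space n)) (volume : Measure (ℝ × (Fin n → ℝ))) :=
    (MeasurePreserving.id volume).prod (PiLp.volume_preserving_ofLp (Fin n))
  have h2 := (volume_preserving_piFinSuccAbove (fun _ : Fin (n + 1) => ℝ) k).symm
  have h3 := PiLp.volume_preserving_toLp (Fin (n + 1))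
  exact h3.comp (h2.comp h1)

theorem measurableEmbedding_coord (k : Fin (n + 1)) :
    MeasurableEmbedding (coord k : ℝ × Space n → Space (n + 1)) :=
  (coord k).toHomeomorph.measurableEmbedding

theorem integral_eq_integral_ins (k : Fin (n + 1)) {f : Space (n + 1) → ℝ} (hf : Integrable f) :
    ∫ x, f x = ∫ y : Space n, ∫ s : ℝ, f (ins k s y) := by
  rw [← (measurePreserving_coord k).integral_comp (measurableEmbedding_coord k) f]
  have : Integrable (fun p : ℝ × Space n => f (coord k p)) (volume.prod volume) :=
    ((measurePreserving_coord k).integrable_comp_emb (measurableEmbedding_coord k)).2 hf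
  exact integral_prod_symm _ this

theorem volume_eq_lintegral_ins (k : Fin (n + 1)) {S : Set (Space (n + 1))}
    (hS : MeasurableSet S) : volume S = ∫⁻ y : Space n, volume {s : ℝ | ins k s y ∈ S} := by
  rw [← (measurePreserving_coord k).measure_preimage_emb (measurableEmbedding_coord k) S]
  exact Measure.prod_apply_symm ((measurableEmbedding_coord k).measurable hS)

theorem isOpen_prod_ins {I : Set ℝ} {B : Set (Space n)} (k : Fin (n + 1)) (hI : IsOpen I)
    (hB : IsOpen B) : IsOpen {x : Space (n + 1) | x k ∈ I ∧ rem k x ∈ B} :=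
  (hI.preimage (by fun_prop)).inter (hB.preimage (continuous_rem k))

/-! ### Volume of strips -/

/-- If `u` grows at least linearly along the `k`-th coordinate, then the parts of its strips in a
bounded set have a volume proportional to their width. -/
theorem volume_strip_le (k : Fin (n + 1)) {S : Set (Space (n + 1))} {u : Space (n + 1) → ℝ}
    {c r : ℝ} {y₀ : Space n} (hc : 0 < c) (hS : ∀ x ∈ S, rem k x ∈ Metric.ball y₀ r)
    (hu : ∀ y s s', ins k s y ∈ S → ins k s' y ∈ S → c * |s - s'| ≤ |u (ins k s y) - u (ins k s' y)|)
    {a b : ℝ} (hm : MeasurableSet {x ∈ S | u x ∈ Icc a b}) :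
    volume {x ∈ S | u x ∈ Icc a b} ≤
      ENNReal.ofReal ((b - a) / c) * volume (Metric.ball y₀ r) := by
  rw [volume_eq_lintegral_ins k hm]
  -- Fubini: every line in the `k`-th direction meets the strip in a set of diameter at most `(b -
  -- a) / c`, and only lines over the ball meet it at all.
  calc ∫⁻ y : Space n, volume {s : ℝ | ins k s y ∈ {x ∈ S | u x ∈ Icc a b}}
      ≤ ∫⁻ y : Space n, (Metric.ball y₀ r).indicator (fun _ => ENNReal.ofReal ((b - a) / c)) y := by
        refine lintegral_mono fun y => ?_
        by_cases hy : y ∈ Metric.ball y₀ r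
        · rw [indicator_of_mem hy]
          refine (Real.volume_le_diam _).trans ?_
          refine Metric.ediam_le_of_forall_dist_le fun s hs s' hs' => ?_
          rw [Real.dist_eq, le_div_iff₀ hc, mul_comm]
          refine (hu y s s' hs.1 hs'.1).trans ?_
          rw [abs_le]
          constructor <;> linarith [hs.2.1, hs.2.2, hs'.2.1, hs'.2.2]
        · rw [indicator_of_notMem hy]
          have : {s : ℝ | ins k s y ∈ {x ∈ S | u x ∈ Icc a b}} = ∅ := by
            ext s
            simp only [mem_ofPred_eq, mem_empty_iff_false, iff_false]
            rintro ⟨h, -⟩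
            exact hy (by simpa using hS _ h)
          rw [this]; simp
    _ = ENNReal.ofReal ((b - a) / c) * volume (Metric.ball y₀ r) := by
        rw [lintegral_indicator Metric.isOpen_ball.measurableSet]
        simp

/-- Level functions are controlled only on their charts. Extended by zero they become globally
measurable, and nothing changes where they are multiplied by functions supported in the chart. -/
theorem measurable_indicator_of_continuousOn {X Y : Type*} [TopologicalSpace X] [MeasurableSpace X]
    [BorelSpace X] [TopologicalSpace Y] [MeasurableSpace Y] [BorelSpace Y] [Zero Y] {f : X → Y}
    {s : Set X} (hs : MeasurableSet s) (hf : ContinuousOn f s) : Measurable (s.indicator f) := by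
  classical
  have := hf.measurable_piecewise (continuousOn_const (c := (0 : Y)) (s := sᶜ)) hs
  rw [← Set.piecewise_eq_indicator]
  exact this

/-! ### Approximate identities on a line -/

/-- The one-dimensional limit behind the level-set approximation of surface integrals. -/
theorem tendsto_integral_deriv_cut_div {f φ : ℝ → ℝ} {I : Set ℝ} {s₀ m c M : ℝ} (hI : IsOpen I)
    (hs₀ : s₀ ∈ I) (hf : ∀ s, s ∉ I → f s = 0) (hM : ∀ s, |f s| ≤ M)
    (hfm : Measurable f) (hfc : ContinuousAt f s₀) (hφc : ContinuousOn φ I)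
    (hφ : HasDerivAt φ m s₀) (h0 : φ s₀ = 0) (hc : 0 < c)
    (hφl : ∀ s ∈ I, c * |s - s₀| ≤ |φ s|) :
    Tendsto (fun ε : ℝ => ∫ s, f s * (ε⁻¹ * deriv cut (φ s / ε))) (𝓝[>] 0) (𝓝 (f s₀ / |m|)) := by
  obtain ⟨C, hC0, hC⟩ := exists_bound_deriv_cut
  have hM0 : 0 ≤ M := (abs_nonneg _).trans (hM s₀)
  -- The growth bound survives in the difference quotients at `s₀`; in particular `m ≠ 0`.
  have hm : c ≤ |m| := by
    have h1 : Tendsto (fun h => |h⁻¹ • (φ (s₀ + h) - φ s₀)|) (𝓝[≠] 0) (𝓝 |m|) :=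
      (hasDerivAt_iff_tendsto_slope_zero.1 hφ).abs
    refine ge_of_tendsto h1 ?_
    have h2 : ∀ᶠ h in 𝓝[≠] (0 : ℝ), s₀ + h ∈ I := by
      have : Tendsto (fun h => s₀ + h) (𝓝[≠] (0 : ℝ)) (𝓝 s₀) := by
        have : ContinuousAt (fun h : ℝ => s₀ + h) 0 := by fun_prop
        simpa [ContinuousAt] using this.tendsto.mono_left nhdsWithin_le_nhds
      exact this (hI.mem_nhds hs₀)
    filter_upwards [h2, self_mem_nhdsWithin] with h hh hne
    have := hφl _ hh
    rw [h0, sub_zero, smul_eq_mul, abs_mul, abs_inv]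
    have hpos : 0 < |h| := abs_pos.2 hne
    rw [← div_eq_inv_mul, le_div_iff₀ hpos]
    simpa using this
  have hm0 : m ≠ 0 := by
    intro h; rw [h, abs_zero] at hm; linarith
  -- Substitution `s = s₀ + ε u`, which absorbs the factor `ε⁻¹`.
  have hscale : ∀ ε : ℝ, 0 < ε → ∫ s, f s * (ε⁻¹ * deriv cut (φ s / ε)) =
      ∫ u, f (s₀ + ε * u) * deriv cut (φ (s₀ + ε * u) / ε) := by
    intro ε hε
    have h1 := integral_add_left_eq_self (μ := (volume : Measure ℝ))
      (fun s => f s * (ε⁻¹ * deriv cut (φ s / ε))) s₀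
    have h2 := Measure.integral_comp_mul_left
      (fun s => f (s₀ + s) * (ε⁻¹ * deriv cut (φ (s₀ + s) / ε))) ε
    rw [h1, abs_of_pos (inv_pos.2 hε), smul_eq_mul] at h2
    rw [eq_inv_mul_iff_mul_eq₀ hε.ne'] at h2
    rw [← h2, ← integral_const_mul]
    congr 1
    ext u
    field_simp
  -- The profile `cut'` has total mass `1`, and the scaling by `m` contributes `1 / |m|`.
  have hlim : ∫ u, f s₀ * deriv cut (m * u) = f s₀ / |m| := by
    rw [integral_const_mul, Measure.integral_comp_mul_left (deriv cut) m, integral_deriv_cut]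
    simp [abs_inv, div_eq_mul_inv]
  rw [← hlim]
  have hmeas : Measurable (I.indicator φ) := measurable_indicator_of_continuousOn hI.measurableSet hφc
  have hprod : ∀ s ε, f s * deriv cut (φ s / ε) = f s * deriv cut (I.indicator φ s / ε) := by
    intro s ε
    by_cases hs : s ∈ I
    · rw [indicator_of_mem hs]
    · rw [hf s hs]; simp
  have : Tendsto (fun ε : ℝ => ∫ u, f (s₀ + ε * u) * deriv cut (φ (s₀ + ε * u) / ε)) (𝓝[>] 0)
      (𝓝 (∫ u, f s₀ * deriv cut (m * u))) := by
    -- The integrand is non-zero only if `|φ| ≤ 2ε`. Since `|φ|` grows at least at rate `c`, this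
    -- confines the rescaled variable to `|u| ≤ 2 / c` for all `ε`.
    refine tendsto_integral_filter_of_dominated_convergence
      (fun u => (Icc (-(2 / c)) (2 / c)).indicator (fun _ => M * C) u) ?_ ?_ ?_ ?_
    · refine Eventually.of_forall fun ε => ?_
      simp only [hprod]
      refine Measurable.aestronglyMeasurable ?_
      have := continuous_deriv_cut.measurable
      fun_prop
    · filter_upwards [self_mem_nhdsWithin] with ε (hε : 0 < ε)
      refine Eventually.of_forall fun u => ?_
      by_cases hu : u ∈ Icc (-(2 / c)) (2 / c)
      · rw [indicator_of_mem hu, Real.norm_eq_abs, abs_mul]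
        exact mul_le_mul (hM _) (hC _) (abs_nonneg _) hM0
      · rw [indicator_of_notMem hu]
        by_cases hs : s₀ + ε * u ∈ I
        · have h1 := hφl _ hs
          have : deriv cut (φ (s₀ + ε * u) / ε) = 0 := by
            by_contra hne
            have h2 := mem_Icc_of_deriv_cut_ne_zero hne
            apply hu
            rw [mem_Icc, ← abs_le]
            have h3 : |φ (s₀ + ε * u)| ≤ 2 * ε := by
              have h4 : 0 < φ (s₀ + ε * u) / ε := by linarith [h2.1]
              have h5 : 0 < φ (s₀ + ε * u) := by
                by_contra hneg
                exact absurd h4 (not_lt.2 (div_nonpos_of_nonpos_of_nonneg (not_lt.1 hneg) hε.le))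
              rw [abs_of_pos h5]
              exact (div_le_iff₀ hε).1 h2.2
            rw [le_div_iff₀ hc]
            rw [add_sub_cancel_left, abs_mul, abs_of_pos hε] at h1
            nlinarith
          rw [this]; simp
        · rw [hf _ hs]; simp
    · exact (integrable_indicator_iff measurableSet_Icc).2
        (integrableOn_const (by simp))
    · refine Eventually.of_forall fun u => ?_
      have hs : Tendsto (fun ε : ℝ => s₀ + ε * u) (𝓝[>] 0) (𝓝 s₀) := by
        have : ContinuousAt (fun ε : ℝ => s₀ + ε * u) 0 := by fun_prop
        simpa [ContinuousAt] using this.tendsto.mono_left nhdsWithin_le_nhds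
      refine (hfc.tendsto.comp hs).mul ?_
      refine (continuous_deriv_cut.tendsto _).comp ?_
      -- Since `φ s₀ = 0`, the argument `φ (s₀ + ε u) / ε` of the profile is a difference quotient
      -- with limit `m u`.
      have hd : HasDerivAt (fun ε : ℝ => φ (s₀ + ε * u)) (m * u) 0 := by
        have h1 : HasDerivAt (fun ε : ℝ => s₀ + ε * u) u 0 := by
          simpa using ((hasDerivAt_id (0 : ℝ)).mul_const u).const_add s₀
        have h2 : HasDerivAt φ m (s₀ + 0 * u) := by simpa using hφ
        exact h2.comp (0 : ℝ) h1
      have := (hasDerivAt_iff_tendsto_slope_zero.1 hd).mono_left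
        (nhdsWithin_mono 0 (fun x (hx : (0 : ℝ) < x) => hx.ne'))
      refine this.congr fun ε => ?_
      simp [h0, div_eq_inv_mul]
  refine this.congr' ?_
  filter_upwards [self_mem_nhdsWithin] with ε hε
  exact (hscale ε hε).symm

/-! ### The area formula -/

/-- On `g '' S` the map `f ∘ g⁻¹` is well defined and `K`-Lipschitz for any choice of the inverse,
as points with equal `g` have equal `f`. Comparing two maps, instead of one map with the identity,
lets the same lemma estimate a parametrisation by its linearisation and conversely. -/
theorem euclideanHausdorffMeasure_image_le_of_dist_le {X E F : Type*} [Nonempty X]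
    [MetricSpace E] [MeasurableSpace E] [BorelSpace E] [MetricSpace F]
    [MeasurableSpace F] [BorelSpace F] {f : X → F} {g : X → E} {S : Set X} {K : NNReal}
    (h : ∀ y ∈ S, ∀ z ∈ S, dist (f y) (f z) ≤ K * dist (g y) (g z)) (n : ℕ) :
    μHE[n] (f '' S) ≤ (K : ENNReal) ^ n * μHE[n] (g '' S) := by
  have hinv : ∀ x ∈ S, Function.invFunOn g S (g x) ∈ S ∧ g (Function.invFunOn g S (g x)) = g x :=
    fun x hx => ⟨Function.invFunOn_mem ⟨x, hx, rfl⟩, Function.invFunOn_eq ⟨x, hx, rfl⟩⟩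
  have hlip : LipschitzOnWith K (f ∘ Function.invFunOn g S) (g '' S) := by
    refine LipschitzOnWith.of_dist_le_mul ?_
    rintro _ ⟨x, hx, rfl⟩ _ ⟨y, hy, rfl⟩
    have := h _ (hinv x hx).1 _ (hinv y hy).1
    rwa [(hinv x hx).2, (hinv y hy).2] at this
  have himg : (f ∘ Function.invFunOn g S) '' (g '' S) = f '' S := by
    rw [← image_comp]
    refine image_congr fun x hx => ?_
    have := h _ (hinv x hx).1 _ hx
    rw [(hinv x hx).2, dist_self, mul_zero] at this
    exact dist_le_zero.1 this
  have := hlip.hausdorffMeasure_image_le (d := n) (by positivity)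
  rw [himg] at this
  simp only [Measure.euclideanHausdorffMeasure_def, Measure.smul_apply, ENNReal.smul_def, smul_eq_mul]
  rw [mul_left_comm]
  gcongr
  simpa using this

theorem le_of_forall_one_lt_mul {a b : ENNReal} (h : ∀ K : NNReal, 1 < K → a ≤ K * b) : a ≤ b := by
  have h1 : Tendsto (fun K : NNReal => (K : ENNReal) * b) (𝓝[>] 1) (𝓝 (1 * b)) := by
    refine ENNReal.Tendsto.mul_const ?_ (Or.inl (by simp))
    have : Tendsto (fun K : NNReal => (K : ENNReal)) (𝓝 1) (𝓝 ((1 : NNReal) : ENNReal)) :=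
      ENNReal.continuous_coe.tendsto _
    simpa using this.mono_left nhdsWithin_le_nhds
  rw [one_mul] at h1
  exact ge_of_tendsto h1 (by filter_upwards [self_mem_nhdsWithin] with K hK using h K hK)

/-- An inequality between measures that holds locally holds globally. -/
theorem measure_le_of_forall_exists_nhds {X : Type*} [TopologicalSpace X] [SecondCountableTopology X]
    [MeasurableSpace X] [OpensMeasurableSpace X] {μ ν : Measure X} {B : Set X}
    (h : ∀ x ∈ B, ∃ N ∈ 𝓝 x, ∀ S ⊆ N ∩ B, MeasurableSet S → μ S ≤ ν S) {S : Set X} (hS : S ⊆ B)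
    (hm : MeasurableSet S) : μ S ≤ ν S := by
  choose! N hN h using h
  -- By the Lindelöf property countably many of the neighbourhoods suffice. Making them disjoint
  -- splits `S` into countably many pieces, each inside one neighbourhood.
  obtain ⟨t, htB, htc, ht⟩ := TopologicalSpace.countable_cover_nhdsWithin
    (f := fun x => interior (N x)) (s := B) (fun x hx => mem_nhdsWithin_of_mem_nhds
      (interior_mem_nhds.2 (hN x hx)))
  rcases t.eq_empty_or_nonempty with rfl | hne
  · have : S = ∅ := by
      rw [← subset_empty_iff]; exact hS.trans (by simpa using ht)
    simp [this]
  obtain ⟨e, he⟩ := htc.exists_eq_range hne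
  have hcov : S = ⋃ i, S ∩ disjointed (fun i => interior (N (e i))) i := by
    rw [← inter_iUnion, iUnion_disjointed]
    refine (inter_eq_left.2 ?_).symm
    refine hS.trans (ht.trans ?_)
    rw [he]; simp
  have hmeas : ∀ i, MeasurableSet (S ∩ disjointed (fun i => interior (N (e i))) i) := fun i =>
    hm.inter (MeasurableSet.disjointed (fun i => isOpen_interior.measurableSet) i)
  have hdisj : Pairwise (Function.onFun Disjoint
      fun i => S ∩ disjointed (fun i => interior (N (e i))) i) := fun i j hij =>
    (disjoint_disjointed (fun i => interior (N (e i))) hij).mono inter_subset_right inter_subset_right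
  rw [hcov, measure_iUnion hdisj hmeas, measure_iUnion hdisj hmeas]
  refine ENNReal.tsum_le_tsum fun i => h (e i) (htB (he ▸ mem_range_self i)) _ ?_ (hmeas i)
  exact fun x hx => ⟨interior_subset
    (disjointed_subset (fun i => interior (N (e i))) i hx.2), hS hx.1⟩

/-- The area formula, up to a factor close to `1`, near a point. -/
theorem exists_nhds_area_le {f : Space n → Space d} {f' : Space n →L[ℝ] Space d} {y₀ : Space n}
    {V : Set (Space n)}
    (hf : HasStrictFDerivAt f f' y₀) (hf' : ∀ w, ‖w‖ ≤ ‖f' w‖)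
    (hlow : ∀ y ∈ V, ∀ z ∈ V, ‖y - z‖ ≤ ‖f y - f z‖) {K : NNReal} (hK : 1 < K) :
    ∃ N ∈ 𝓝 y₀, ∀ S ⊆ N ∩ V,
      μHE[n] (f '' S) ≤ (K : ENNReal) ^ n *
        (ENNReal.ofReal (LinearMap.normDet (f' : Space n →ₗ[ℝ] Space d)) * volume S) ∧
      ENNReal.ofReal (LinearMap.normDet (f' : Space n →ₗ[ℝ] Space d)) * volume S ≤
        (K : ENNReal) ^ n * μHE[n] (f '' S) := by
  have hK' : (0 : ℝ) < K - 1 := by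
    have : (1 : ℝ) < K := by exact_mod_cast hK
    linarith
  have hb := (hasStrictFDerivAt_iff_isLittleO.1 hf).def hK'
  rw [nhds_prod_eq] at hb
  obtain ⟨N, hN, hNb⟩ : ∃ N ∈ 𝓝 y₀, ∀ y ∈ N, ∀ z ∈ N,
      ‖f y - f z - f' (y - z)‖ ≤ (K - 1) * ‖y - z‖ := by
    obtain ⟨p, hp, q, hq, h⟩ := Filter.eventually_prod_iff.1 hb
    exact ⟨{y | p y ∧ q y}, hp.and hq, fun y hy z hz => h hy.1 hz.2⟩
  refine ⟨N, hN, fun S hS => ?_⟩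
  have hvol : μHE[n] (f' '' S) =
      ENNReal.ofReal (LinearMap.normDet (f' : Space n →ₗ[ℝ] Space d)) * volume S := by
    have := LinearMap.euclideanHausdorffMeasure_image_eq_normDet_mul_volume
      (f' : Space n →ₗ[ℝ] Space d) S
    rw [finrank_euclideanSpace_fin] at this
    exact this
  rw [← hvol]
  -- Strict differentiability bounds the linearisation error between any two nearby points by `(K -
  -- 1) ‖y - z‖`. Both `‖f' (y - z)‖` and `‖f y - f z‖` are at least `‖y - z‖`, so the error is
  -- relative to either of them and gives the ratio `K` in both directions.
  have hbd : ∀ y ∈ S, ∀ z ∈ S, ‖f y - f z - f' (y - z)‖ ≤ (K - 1) * ‖y - z‖ := fun y hy z hz =>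
    hNb y (hS hy).1 z (hS hz).1
  constructor
  · refine euclideanHausdorffMeasure_image_le_of_dist_le (fun y hy z hz => ?_) n
    rw [dist_eq_norm, dist_eq_norm, ← map_sub]
    have h1 := hbd y hy z hz
    have h2 := hf' (y - z)
    have h3 : ‖f y - f z‖ ≤ ‖f y - f z - f' (y - z)‖ + ‖f' (y - z)‖ := by
      simpa using norm_add_le (f y - f z - f' (y - z)) (f' (y - z))
    nlinarith
  · refine euclideanHausdorffMeasure_image_le_of_dist_le (fun y hy z hz => ?_) n
    rw [dist_eq_norm, dist_eq_norm, ← map_sub]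
    have h1 := hbd y hy z hz
    have h2 := hlow y (hS hy).2 z (hS hz).2
    have h3 : ‖f' (y - z)‖ ≤ ‖f y - f z‖ + ‖f y - f z - f' (y - z)‖ := by
      simpa using norm_sub_le (f y - f z) (f y - f z - f' (y - z))
    nlinarith

/-- The area formula for a `C¹` parametrisation `f` of a surface with a measurable inverse `π`. -/
theorem area_formula {f : Space n → Space d} {f' : Space n → Space n →L[ℝ] Space d}
    {π : Space d → Space n} {B : Set (Space n)} (hB : IsOpen B)
    (hf : ∀ y ∈ B, HasStrictFDerivAt f (f' y) y) (hf' : ∀ y ∈ B, ∀ w, ‖w‖ ≤ ‖f' y w‖)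
    (hlow : ∀ y ∈ B, ∀ z ∈ B, ‖y - z‖ ≤ ‖f y - f z‖)
    (hπ : Measurable π) (hπf : ∀ y ∈ B, π (f y) = y) {J : Space n → ℝ}
    (hJ : ∀ y ∈ B, J y = LinearMap.normDet (f' y : Space n →ₗ[ℝ] Space d))
    (hJc : ContinuousOn J B) (hJ0 : ∀ y ∈ B, 0 < J y) :
    (μHE[n].restrict (f '' B)).map π =
      (volume.restrict B).withDensity fun y => ENNReal.ofReal (J y) := by
  set lam := (μHE[n].restrict (f '' B)).map π
  set kap := (volume.restrict B).withDensity fun y => ENNReal.ofReal (J y)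
  have hlam : ∀ S, MeasurableSet S → lam S = μHE[n] (f '' (S ∩ B)) := by
    intro S hS
    rw [Measure.map_apply hπ hS, Measure.restrict_apply (hπ hS)]
    congr 1
    ext x
    constructor
    · rintro ⟨h1, y, hy, rfl⟩
      refine ⟨y, ⟨?_, hy⟩, rfl⟩
      have : π (f y) ∈ S := h1
      rwa [hπf y hy] at this
    · rintro ⟨y, ⟨h1, h2⟩, rfl⟩
      refine ⟨?_, y, h2, rfl⟩
      change π (f y) ∈ S
      rwa [hπf y h2]
  have hkap : ∀ S, MeasurableSet S → S ⊆ B → kap S = ∫⁻ y in S, ENNReal.ofReal (J y) := by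
    intro S hS hSB
    rw [withDensity_apply _ hS, Measure.restrict_restrict hS, inter_eq_left.2 hSB]
  -- Near a point the two measures agree up to a factor `K`. The linear area formula costs `L ^ n`
  -- and freezing the continuous density `J` costs another `L`, hence the choice `L ^ n * L ≤ K`.
  have hloc : ∀ K : NNReal, 1 < K → ∀ y ∈ B, ∃ N ∈ 𝓝 y, ∀ S ⊆ N ∩ B, MeasurableSet S →
      lam S ≤ ((K : ENNReal) • kap) S ∧ kap S ≤ ((K : ENNReal) • lam) S := by
    intro K hK y₀ hy₀
    obtain ⟨L, hL1, hLK⟩ : ∃ L : NNReal, 1 < L ∧ L ^ n * L ≤ K := by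
      have : Tendsto (fun L : NNReal => L ^ n * L) (𝓝[>] 1) (𝓝 (1 ^ n * 1)) := by
        have hc : Continuous fun L : NNReal => L ^ n * L := by fun_prop
        exact (hc.tendsto 1).mono_left nhdsWithin_le_nhds
      rw [one_pow, one_mul] at this
      obtain ⟨L, hL⟩ := ((this.eventually (gt_mem_nhds hK)).and self_mem_nhdsWithin).exists
      exact ⟨L, hL.2, le_of_lt hL.1⟩
    obtain ⟨N, hN, hNS⟩ := exists_nhds_area_le (hf y₀ hy₀) (hf' y₀ hy₀) hlow hL1
    rw [← hJ y₀ hy₀] at hNS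
    have hL1' : (1 : ℝ) < L := by exact_mod_cast hL1
    have hJy := hJ0 y₀ hy₀
    have hJat : ContinuousAt J y₀ := hJc.continuousAt (hB.mem_nhds hy₀)
    have e1 : ∀ᶠ y in 𝓝 y₀, J y₀ < L * J y := by
      have : ContinuousAt (fun y => L * J y) y₀ := continuousAt_const.mul hJat
      exact this.eventually (lt_mem_nhds (by nlinarith))
    have e2 : ∀ᶠ y in 𝓝 y₀, J y < L * J y₀ := hJat.eventually (gt_mem_nhds (by nlinarith))
    refine ⟨N ∩ {y | J y₀ < L * J y ∧ J y < L * J y₀}, inter_mem hN (e1.and e2), fun S hS hSm => ?_⟩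
    have hSB : S ⊆ B := fun y hy => (hS hy).2
    obtain ⟨a1, a2⟩ := hNS S (fun y hy => ⟨(hS hy).1.1, (hS hy).2⟩)
    rw [Measure.smul_apply, Measure.smul_apply, hlam S hSm, hkap S hSm hSB, inter_eq_left.2 hSB,
      smul_eq_mul, smul_eq_mul]
    have b1 : ENNReal.ofReal (J y₀) * volume S ≤ L * ∫⁻ y in S, ENNReal.ofReal (J y) := by
      rw [← lintegral_const_mul' _ _ (by simp), ← setLIntegral_const]
      refine setLIntegral_mono' hSm fun y hy => ?_
      have := (hS hy).1.2.1
      rw [← ENNReal.ofReal_coe_nnreal, ← ENNReal.ofReal_mul (by positivity)]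
      exact ENNReal.ofReal_le_ofReal this.le
    have b2 : ∫⁻ y in S, ENNReal.ofReal (J y) ≤ L * (ENNReal.ofReal (J y₀) * volume S) := by
      rw [← mul_assoc, ← setLIntegral_const]
      refine setLIntegral_mono' hSm fun y hy => ?_
      have := (hS hy).1.2.2
      rw [← ENNReal.ofReal_coe_nnreal, ← ENNReal.ofReal_mul (by positivity)]
      exact ENNReal.ofReal_le_ofReal this.le
    have hLK' : (L : ENNReal) ^ n * L ≤ K := by exact_mod_cast hLK
    constructor
    · calc μHE[n] (f '' S) ≤ (L : ENNReal) ^ n * (ENNReal.ofReal (J y₀) * volume S) := a1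
        _ ≤ (L : ENNReal) ^ n * (L * ∫⁻ y in S, ENNReal.ofReal (J y)) := by gcongr
        _ = ((L : ENNReal) ^ n * L) * ∫⁻ y in S, ENNReal.ofReal (J y) := by ring
        _ ≤ K * ∫⁻ y in S, ENNReal.ofReal (J y) := by gcongr
    · calc ∫⁻ y in S, ENNReal.ofReal (J y) ≤ L * (ENNReal.ofReal (J y₀) * volume S) := b2
        _ ≤ L * ((L : ENNReal) ^ n * μHE[n] (f '' S)) := by gcongr
        _ = ((L : ENNReal) ^ n * L) * μHE[n] (f '' S) := by ring
        _ ≤ K * μHE[n] (f '' S) := by gcongr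
  -- The local comparison is globalised for fixed `K`, and then `K` tends to `1`.
  have heq : ∀ S, MeasurableSet S → S ⊆ B → lam S = kap S := by
    intro S hS hSB
    refine le_antisymm (le_of_forall_one_lt_mul fun K hK => ?_)
      (le_of_forall_one_lt_mul fun K hK => ?_)
    · refine measure_le_of_forall_exists_nhds (ν := (K : ENNReal) • kap) (fun y hy => ?_) hSB hS
      obtain ⟨N, hN, h⟩ := hloc K hK y hy
      exact ⟨N, hN, fun S hS hm => (h S hS hm).1⟩
    · refine measure_le_of_forall_exists_nhds (ν := (K : ENNReal) • lam) (fun y hy => ?_) hSB hS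
      obtain ⟨N, hN, h⟩ := hloc K hK y hy
      exact ⟨N, hN, fun S hS hm => (h S hS hm).2⟩
  ext S hS
  have h1 : lam S = lam (S ∩ B) := by
    rw [hlam S hS, hlam _ (hS.inter hB.measurableSet), inter_assoc, inter_self]
  have h2 : kap S = kap (S ∩ B) := by
    rw [withDensity_apply _ hS, withDensity_apply _ (hS.inter hB.measurableSet),
      Measure.restrict_restrict hS, Measure.restrict_restrict (hS.inter hB.measurableSet),
      inter_assoc, inter_self]
  rw [h1, h2, heq _ (hS.inter hB.measurableSet) inter_subset_right]

/-- The Gram matrix of a graph is the identity plus the rank-one matrix `a aᵀ`; the matrix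
determinant lemma gives its determinant `1 + |a|²`. -/
theorem normDet_coord_prod (k : Fin (n + 1)) (a : Space n →L[ℝ] ℝ) :
    (LinearMap.normDet (((coord k : (ℝ × Space n) →L[ℝ] Space (n + 1)).comp
      (a.prod (ContinuousLinearMap.id ℝ (Space n))) : Space n →L[ℝ] Space (n + 1)) :
        Space n →ₗ[ℝ] Space (n + 1))) ^ 2 =
      1 + ∑ i, a (EuclideanSpace.single i 1) ^ 2 := by
  have h := LinearMap.normDet_sq_eq_det_gram (((coord k : (ℝ × Space n) →L[ℝ] Space (n + 1)).comp
      (a.prod (ContinuousLinearMap.id ℝ (Space n))) : Space n →L[ℝ] Space (n + 1)) :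
        Space n →ₗ[ℝ] Space (n + 1)) (EuclideanSpace.basisFun (Fin n) ℝ)
  have hg : Matrix.gram ℝ (fun i => (((coord k : (ℝ × Space n) →L[ℝ] Space (n + 1)).comp
      (a.prod (ContinuousLinearMap.id ℝ (Space n))) : Space n →L[ℝ] Space (n + 1)) :
        Space n →ₗ[ℝ] Space (n + 1)) (EuclideanSpace.basisFun (Fin n) ℝ i)) =
      1 + Matrix.replicateCol Unit (fun i => a (EuclideanSpace.single i 1)) *
        Matrix.replicateRow Unit (fun i => a (EuclideanSpace.single i 1)) := by
    ext i j
    have hi : ∀ i, ((coord k : (ℝ × Space n) →L[ℝ] Space (n + 1)).comp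
      (a.prod (ContinuousLinearMap.id ℝ (Space n))) : Space n →L[ℝ] Space (n + 1))
        (EuclideanSpace.basisFun (Fin n) ℝ i) =
        ins k (a (EuclideanSpace.single i 1)) (EuclideanSpace.single i 1) := fun i => by
      simp [ins]
    rw [Matrix.gram_apply, ContinuousLinearMap.coe_coe, hi, hi, PiLp.inner_apply,
      Fin.sum_univ_succAbove _ k]
    simp [Matrix.mul_apply, Matrix.one_apply, mul_comm]
    rw [add_comm]
    simp only [eq_comm]
  rw [hg, Matrix.det_one_add_replicateCol_mul_replicateRow] at h
  simp only [RCLike.ofReal_real_eq_id, id] at h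
  rw [h]
  simp [dotProduct, sq]

/-! ### Hypersurfaces that are graphs over a box -/

theorem gradient_apply (φ : Space d → ℝ) (x : Space d) (k : Fin d) :
    (∇ φ x) k = fderiv ℝ φ x (EuclideanSpace.single k 1) := by
  rw [← inner_gradient_left, EuclideanSpace.inner_single_right]
  simp

theorem continuousOn_gradient {φ : Space d → ℝ} {D : Set (Space d)} (hD : IsOpen D)
    (h : ContDiffOn ℝ 1 φ D) : ContinuousOn (∇ φ) D :=
  (InnerProductSpace.toDual ℝ (Space d)).symm.continuous.comp_continuousOn
    (h.continuousOn_fderiv_of_isOpen hD le_rfl)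

/-- The points with `k`-th coordinate in `I` and the other coordinates in `B`. -/
def box (k : Fin (n + 1)) (I : Set ℝ) (B : Set (Space n)) : Set (Space (n + 1)) :=
  {x | x k ∈ I ∧ rem k x ∈ B}

/-- The zero set of `φ` in the box is a graph over `B`; the function `φ` grows at least linearly
along the lines in the `k`-th direction. -/
structure IsGraphBox (k : Fin (n + 1)) (φ : Space (n + 1) → ℝ) (I : Set ℝ) (B : Set (Space n))
    (c : ℝ) : Prop where
  isOpen_fst : IsOpen I
  isOpen_snd : IsOpen B
  bounded_fst : Bornology.IsBounded I
  bounded_snd : Bornology.IsBounded B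
  pos : 0 < c
  contDiffOn : ContDiffOn ℝ 1 φ (box k I B)
  expand : ∀ y ∈ B, ∀ s ∈ I, ∀ s' ∈ I, c * |s - s'| ≤ |φ (ins k s y) - φ (ins k s' y)|
  zero : ∀ y ∈ B, ∃ s ∈ I, φ (ins k s y) = 0

open Classical in
/-- The height function of the zero set of `φ` over `B`. -/
def height (k : Fin (n + 1)) (φ : Space (n + 1) → ℝ) (I : Set ℝ) (B : Set (Space n))
    (y : Space n) : ℝ :=
  if h : y ∈ B ∧ ∃ s ∈ I, φ (ins k s y) = 0 then h.2.choose else 0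

/-- The parametrisation of the zero set of `φ` over `B`. -/
def graph (k : Fin (n + 1)) (φ : Space (n + 1) → ℝ) (I : Set ℝ) (B : Set (Space n))
    (y : Space n) : Space (n + 1) :=
  ins k (height k φ I B y) y

theorem le_abs_of_hasDerivAt {φ : ℝ → ℝ} {I : Set ℝ} {s₀ m c : ℝ} (hI : I ∈ 𝓝 s₀)
    (hφ : HasDerivAt φ m s₀) (h : ∀ s ∈ I, c * |s - s₀| ≤ |φ s - φ s₀|) : c ≤ |m| := by
  have h1 : Tendsto (fun h => |h⁻¹ • (φ (s₀ + h) - φ s₀)|) (𝓝[≠] 0) (𝓝 |m|) :=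
    (hasDerivAt_iff_tendsto_slope_zero.1 hφ).abs
  refine ge_of_tendsto h1 ?_
  have h2 : ∀ᶠ h in 𝓝[≠] (0 : ℝ), s₀ + h ∈ I := by
    have : Tendsto (fun h => s₀ + h) (𝓝[≠] (0 : ℝ)) (𝓝 s₀) := by
      have : ContinuousAt (fun h : ℝ => s₀ + h) 0 := by fun_prop
      simpa [ContinuousAt] using this.tendsto.mono_left nhdsWithin_le_nhds
    exact this hI
  filter_upwards [h2, self_mem_nhdsWithin] with u hu hne
  have := h _ hu
  rw [smul_eq_mul, abs_mul, abs_inv]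
  have hpos : 0 < |u| := abs_pos.2 hne
  rw [← div_eq_inv_mul, le_div_iff₀ hpos]
  simpa using this

namespace IsGraphBox

variable {k : Fin (n + 1)} {φ : Space (n + 1) → ℝ} {I : Set ℝ} {B : Set (Space n)} {c : ℝ}

theorem isOpen_box (h : IsGraphBox k φ I B c) : IsOpen (box k I B) :=
  isOpen_prod_ins k h.isOpen_fst h.isOpen_snd

theorem ins_mem_box {s : ℝ} {y : Space n} : ins k s y ∈ box k I B ↔ s ∈ I ∧ y ∈ B := by
  simp [box]

theorem isBounded_box (h : IsGraphBox k φ I B c) : Bornology.IsBounded (box k I B) := by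
  have : box k I B ⊆ (coord k) '' (I ×ˢ B) := by
    rintro x ⟨h1, h2⟩
    exact ⟨(x k, rem k x), ⟨h1, h2⟩, ins_rem k x⟩
  refine Bornology.IsBounded.subset ?_ this
  exact (coord k).lipschitz.isBounded_image (h.bounded_fst.prod h.bounded_snd)

theorem height_mem (h : IsGraphBox k φ I B c) {y : Space n} (hy : y ∈ B) :
    height k φ I B y ∈ I := by
  rw [height, dif_pos ⟨hy, h.zero y hy⟩]
  exact (h.zero y hy).choose_spec.1

theorem apply_graph (h : IsGraphBox k φ I B c) {y : Space n} (hy : y ∈ B) :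
    φ (graph k φ I B y) = 0 := by
  rw [graph, height, dif_pos ⟨hy, h.zero y hy⟩]
  exact (h.zero y hy).choose_spec.2

theorem graph_mem (h : IsGraphBox k φ I B c) {y : Space n} (hy : y ∈ B) :
    graph k φ I B y ∈ box k I B :=
  ins_mem_box.2 ⟨h.height_mem hy, hy⟩

theorem le_abs_apply (h : IsGraphBox k φ I B c) {y : Space n} (hy : y ∈ B) {s : ℝ} (hs : s ∈ I) :
    c * |s - height k φ I B y| ≤ |φ (ins k s y)| := by
  have := h.expand y hy s hs _ (h.height_mem hy)
  have h0 : φ (ins k (height k φ I B y) y) = 0 := h.apply_graph hy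
  rwa [h0, sub_zero] at this

theorem eq_height (h : IsGraphBox k φ I B c) {y : Space n} (hy : y ∈ B) {s : ℝ} (hs : s ∈ I)
    (h0 : φ (ins k s y) = 0) : s = height k φ I B y := by
  have := h.le_abs_apply hy hs
  rw [h0, abs_zero] at this
  have h1 : |s - height k φ I B y| ≤ 0 := by
    by_contra hcon
    have := mul_pos h.pos (not_le.1 hcon)
    linarith
  exact sub_eq_zero.1 (abs_nonpos_iff.1 h1)

theorem zero_set_eq (h : IsGraphBox k φ I B c) :
    {x ∈ box k I B | φ x = 0} = graph k φ I B '' B := by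
  ext x
  constructor
  · rintro ⟨⟨h1, h2⟩, h3⟩
    refine ⟨rem k x, h2, ?_⟩
    have := h.eq_height h2 h1 (by simpa using h3)
    rw [graph, ← this, ins_rem]
  · rintro ⟨y, hy, rfl⟩
    exact ⟨h.graph_mem hy, h.apply_graph hy⟩

theorem differentiableAt (h : IsGraphBox k φ I B c) {x : Space (n + 1)} (hx : x ∈ box k I B) :
    DifferentiableAt ℝ φ x :=
  (h.contDiffOn.differentiableOn (by simp)).differentiableAt (h.isOpen_box.mem_nhds hx)

theorem hasStrictFDerivAt (h : IsGraphBox k φ I B c) {x : Space (n + 1)} (hx : x ∈ box k I B) :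
    HasStrictFDerivAt φ (fderiv ℝ φ x) x :=
  (h.contDiffOn.contDiffAt (h.isOpen_box.mem_nhds hx)).hasStrictFDerivAt (by simp)

theorem hasDerivAt_line {x : Space (n + 1)} (hx : DifferentiableAt ℝ φ x) :
    HasDerivAt (fun s => φ (ins k s (rem k x))) ((∇ φ x) k) (x k) := by
  have h1 : HasDerivAt (fun s => ins k s (rem k x)) (EuclideanSpace.single k 1) (x k) := by
    have : (fun s => ins k s (rem k x)) = fun s : ℝ => s • ins k 1 0 + ins k 0 (rem k x) := by
      ext1 s; rw [ins_eq_add]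
    rw [this, ← ins_one_zero]
    simpa using ((hasDerivAt_id (x k)).smul_const (ins k 1 (0 : Space n))).add_const
      (ins k 0 (rem k x))
  rw [gradient_apply]
  have h2 : HasFDerivAt φ (fderiv ℝ φ x) (ins k (x k) (rem k x)) := by
    rw [ins_rem]; exact hx.hasFDerivAt
  exact h2.comp_hasDerivAt (x k) h1

theorem le_abs_gradient (h : IsGraphBox k φ I B c) {x : Space (n + 1)} (hx : x ∈ box k I B) :
    c ≤ |(∇ φ x) k| := by
  refine le_abs_of_hasDerivAt (h.isOpen_fst.mem_nhds hx.1) (hasDerivAt_line (h.differentiableAt hx))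
    fun s hs => ?_
  exact h.expand _ hx.2 s hs _ hx.1

theorem gradient_ne_zero (h : IsGraphBox k φ I B c) {x : Space (n + 1)} (hx : x ∈ box k I B) :
    (∇ φ x) k ≠ 0 := by
  intro h0
  have := h.le_abs_gradient hx
  rw [h0, abs_zero] at this
  exact absurd h.pos (not_lt.2 this)

theorem norm_gradient_pos (h : IsGraphBox k φ I B c) {x : Space (n + 1)} (hx : x ∈ box k I B) :
    0 < ‖∇ φ x‖ := by
  refine norm_pos_iff.2 fun h0 => h.gradient_ne_zero hx ?_
  simp [h0]

/-- The value of `φ` at `(height y₀, y)` controls `c |height y - height y₀|`, and it tends to `φ =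
0` as `y → y₀`. -/
theorem continuousAt_height (h : IsGraphBox k φ I B c) {y₀ : Space n} (hy₀ : y₀ ∈ B) :
    ContinuousAt (height k φ I B) y₀ := by
  have h1 : ContinuousAt (fun y => |φ (ins k (height k φ I B y₀) y)|) y₀ := by
    have h2 : ContinuousAt (fun y => ins k (height k φ I B y₀) y) y₀ :=
      ((continuous_ins k).comp (by fun_prop : Continuous fun y : Space n =>
        (height k φ I B y₀, y))).continuousAt
    have h3 : ContinuousAt φ (ins k (height k φ I B y₀) y₀) :=
      (h.differentiableAt (h.graph_mem hy₀)).continuousAt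
    exact (ContinuousAt.comp (f := fun y => ins k (height k φ I B y₀) y) h3 h2).abs
  have h4 : Tendsto (fun y => c⁻¹ * |φ (ins k (height k φ I B y₀) y)|) (𝓝 y₀) (𝓝 0) := by
    have := (h1.tendsto.const_mul c⁻¹)
    have h0 : φ (ins k (height k φ I B y₀) y₀) = 0 := h.apply_graph hy₀
    rwa [h0, abs_zero, mul_zero] at this
  refine tendsto_iff_dist_tendsto_zero.2 ?_
  refine squeeze_zero' (Eventually.of_forall fun _ => dist_nonneg) ?_ h4
  filter_upwards [h.isOpen_snd.mem_nhds hy₀] with y hy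
  have := h.le_abs_apply hy (h.height_mem hy₀)
  rw [Real.dist_eq, abs_sub_comm, ← div_eq_inv_mul, le_div_iff₀ h.pos, mul_comm]
  exact this

theorem continuousAt_graph (h : IsGraphBox k φ I B c) {y₀ : Space n} (hy₀ : y₀ ∈ B) :
    ContinuousAt (graph k φ I B) y₀ :=
  ContinuousAt.comp (f := fun y => (height k φ I B y, y)) (g := fun p : ℝ × Space n => ins k p.1 p.2)
    (continuous_ins k).continuousAt ((h.continuousAt_height hy₀).prodMk continuousAt_id)

/-- The derivative of the height function. -/
def heightDeriv (k : Fin (n + 1)) (φ : Space (n + 1) → ℝ) (x : Space (n + 1)) : Space n →L[ℝ] ℝ :=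
  -(((∇ φ x) k)⁻¹ • (fderiv ℝ φ x).comp
    ((coord k : (ℝ × Space n) →L[ℝ] Space (n + 1)).comp (ContinuousLinearMap.inr ℝ ℝ (Space n))))

theorem heightDeriv_apply (x : Space (n + 1)) (w : Space n) :
    heightDeriv k φ x w = -(((∇ φ x) k)⁻¹ * fderiv ℝ φ x (ins k 0 w)) := rfl

/-- The implicit function theorem on the fixed base `B`. Since `φ` vanishes at both of two graph
points, strict differentiability says that `∂ₖφ` times the linearisation error `e` of the height is
`o` of the distance of these points. That distance is `O(‖e‖ + ‖w‖)`, where `w` is the difference of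
the base points, and the small multiple of `‖e‖` can be absorbed. -/
theorem hasStrictFDerivAt_height (h : IsGraphBox k φ I B c) {y₀ : Space n} (hy₀ : y₀ ∈ B) :
    HasStrictFDerivAt (height k φ I B) (heightDeriv k φ (graph k φ I B y₀)) y₀ := by
  set G := graph k φ I B
  set H := height k φ I B
  set m := (∇ φ (G y₀)) k
  have hm : m ≠ 0 := h.gradient_ne_zero (h.graph_mem hy₀)
  rw [hasStrictFDerivAt_iff_isLittleO]
  have hG2 : Tendsto (fun p : Space n × Space n => (G p.1, G p.2)) (𝓝 (y₀, y₀)) (𝓝 (G y₀, G y₀)) := by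
    rw [nhds_prod_eq, nhds_prod_eq]
    exact (h.continuousAt_graph hy₀).tendsto.prodMap (h.continuousAt_graph hy₀).tendsto
  have h1 := (hasStrictFDerivAt_iff_isLittleO.1 (h.hasStrictFDerivAt (h.graph_mem hy₀))).comp_tendsto hG2
  have hB2 : ∀ᶠ p : Space n × Space n in 𝓝 (y₀, y₀), p.1 ∈ B ∧ p.2 ∈ B :=
    (h.isOpen_snd.prod h.isOpen_snd).mem_nhds ⟨hy₀, hy₀⟩
  have hsub : ∀ p : Space n × Space n, G p.1 - G p.2 = ins k (H p.1 - H p.2) (p.1 - p.2) :=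
    fun p => ins_sub _ _ _ _ _
  have hfd : ∀ p : Space n × Space n, fderiv ℝ φ (G y₀) (G p.1 - G p.2) =
      m * (H p.1 - H p.2 - heightDeriv k φ (G y₀) (p.1 - p.2)) := by
    intro p
    rw [hsub, ins_eq_add, map_add, map_smul, ins_one_zero, ← gradient_apply, heightDeriv_apply]
    rw [smul_eq_mul, sub_neg_eq_add, mul_add, mul_inv_cancel_left₀ hm]
    ring
  set e := fun p : Space n × Space n => H p.1 - H p.2 - heightDeriv k φ (G y₀) (p.1 - p.2)
  set w := fun p : Space n × Space n => p.1 - p.2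
  have h2 : e =o[𝓝 (y₀, y₀)] fun p => G p.1 - G p.2 := by
    have h3 : (fun p => -m * e p) =o[𝓝 (y₀, y₀)] fun p => G p.1 - G p.2 := by
      refine h1.congr' ?_ EventuallyEq.rfl
      filter_upwards [hB2] with p hp
      change φ (G p.1) - φ (G p.2) - fderiv ℝ φ (G y₀) (G p.1 - G p.2) = _
      rw [h.apply_graph hp.1, h.apply_graph hp.2, hfd]
      ring
    exact (Asymptotics.isLittleO_const_mul_left_iff (neg_ne_zero.2 hm)).1 h3
  have hlin : (fun p => heightDeriv k φ (G y₀) (w p)) =O[𝓝 (y₀, y₀)] w :=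
    ContinuousLinearMap.isBigO_comp _ _ _
  have h4 : (fun p : Space n × Space n => G p.1 - G p.2) =O[𝓝 (y₀, y₀)]
      fun p => ‖e p‖ + ‖w p‖ := by
    have h5 : (fun p : Space n × Space n => G p.1 - G p.2) =O[𝓝 (y₀, y₀)]
        fun p => ‖H p.1 - H p.2‖ + ‖w p‖ := by
      refine Asymptotics.IsBigO.of_bound 1 (Eventually.of_forall fun p => ?_)
      rw [hsub, one_mul, Real.norm_of_nonneg (by positivity)]
      exact norm_ins_le _ _ _
    refine h5.trans (Asymptotics.IsBigO.add ?_ ?_)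
    · have h6 : (fun p => H p.1 - H p.2) = fun p => e p + heightDeriv k φ (G y₀) (w p) := by
        ext p; simp [e, w]
      refine Asymptotics.IsBigO.norm_left ?_
      rw [h6]
      refine Asymptotics.IsBigO.add ?_ ?_
      · refine Asymptotics.IsBigO.of_bound 1 (Eventually.of_forall fun p => ?_)
        rw [one_mul, Real.norm_of_nonneg (by positivity : 0 ≤ ‖e p‖ + ‖w p‖)]
        linarith [norm_nonneg (w p)]
      · refine hlin.trans (Asymptotics.IsBigO.of_bound 1 (Eventually.of_forall fun p => ?_))
        rw [one_mul, Real.norm_of_nonneg (by positivity : 0 ≤ ‖e p‖ + ‖w p‖)]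
        linarith [norm_nonneg (e p)]
    · refine Asymptotics.IsBigO.of_bound 1 (Eventually.of_forall fun p => ?_)
      rw [one_mul, norm_norm, Real.norm_of_nonneg (by positivity : 0 ≤ ‖e p‖ + ‖w p‖)]
      linarith [norm_nonneg (e p)]
  have h7 := h2.trans_isBigO h4
  refine Asymptotics.isLittleO_iff.2 fun ε hε => ?_
  -- With this constant, `‖e‖ ≤ ε / (1 + ε) * (‖e‖ + ‖w‖)` is exactly `‖e‖ ≤ ε ‖w‖`.
  have hε' : 0 < ε / (1 + ε) := by positivity
  filter_upwards [h7.def hε'] with p hp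
  rw [Real.norm_of_nonneg (by positivity : 0 ≤ ‖e p‖ + ‖w p‖), div_mul_eq_mul_div,
    le_div_iff₀ (by positivity)] at hp
  change ‖e p‖ ≤ ε * ‖w p‖
  nlinarith

/-- The derivative of the parametrisation. -/
def graphDeriv (k : Fin (n + 1)) (φ : Space (n + 1) → ℝ) (x : Space (n + 1)) :
    Space n →L[ℝ] Space (n + 1) :=
  (coord k : (ℝ × Space n) →L[ℝ] Space (n + 1)).comp
    ((heightDeriv k φ x).prod (ContinuousLinearMap.id ℝ (Space n)))

theorem graphDeriv_apply (x : Space (n + 1)) (w : Space n) :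
    graphDeriv k φ x w = ins k (heightDeriv k φ x w) w := rfl

theorem hasStrictFDerivAt_graph (h : IsGraphBox k φ I B c) {y₀ : Space n} (hy₀ : y₀ ∈ B) :
    HasStrictFDerivAt (graph k φ I B) (graphDeriv k φ (graph k φ I B y₀)) y₀ := by
  have h1 := (h.hasStrictFDerivAt_height hy₀).prodMk (hasStrictFDerivAt_id y₀)
  exact (coord k : (ℝ × Space n) →L[ℝ] Space (n + 1)).hasStrictFDerivAt.comp y₀ h1

/-- Every tangent vector is in the range of the derivative of the parametrisation. -/
theorem graphDeriv_rem (h : IsGraphBox k φ I B c) {x : Space (n + 1)} (hx : x ∈ box k I B)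
    {v : Space (n + 1)} (hv : ⟪∇ φ x, v⟫_ℝ = 0) : graphDeriv k φ x (rem k v) = v := by
  rw [graphDeriv_apply, heightDeriv_apply]
  have h1 : fderiv ℝ φ x v = v k * (∇ φ x) k + fderiv ℝ φ x (ins k 0 (rem k v)) := by
    conv_lhs => rw [← ins_rem k v, ins_eq_add, map_add, map_smul, ins_one_zero, ← gradient_apply]
    rfl
  rw [inner_gradient_left] at hv
  rw [hv] at h1
  have h2 : -(((∇ φ x) k)⁻¹ * fderiv ℝ φ x (ins k 0 (rem k v))) = v k := by
    have := h.gradient_ne_zero hx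
    field_simp
    linarith
  rw [h2, ins_rem]

/-- The slopes of the graph are `-∂ᵢφ / ∂ₖφ`, so `1 + |slope|² = |∇φ|² / (∂ₖφ)²`. -/
theorem normDet_graphDeriv (h : IsGraphBox k φ I B c) {x : Space (n + 1)} (hx : x ∈ box k I B) :
    LinearMap.normDet (graphDeriv k φ x : Space n →ₗ[ℝ] Space (n + 1)) =
      ‖∇ φ x‖ / |(∇ φ x) k| := by
  have hk := h.gradient_ne_zero hx
  rw [← sq_eq_sq₀ (LinearMap.normDet_nonneg _) (by positivity)]
  refine (normDet_coord_prod k (heightDeriv k φ x)).trans ?_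
  rw [div_pow, sq_abs, EuclideanSpace.norm_sq_eq, Fin.sum_univ_succAbove _ k, add_div, Finset.sum_div]
  congr 1
  · rw [Real.norm_eq_abs, sq_abs, div_self (by positivity)]
  · refine Finset.sum_congr rfl fun i _ => ?_
    have h1 : ins k 0 (EuclideanSpace.single i (1 : ℝ)) = EuclideanSpace.single (k.succAbove i) 1 := by
      ext j
      refine Fin.succAboveCases k ?_ (fun l => ?_) j
      · simp [Fin.ne_succAbove]
      · simp
    rw [heightDeriv_apply, h1, ← gradient_apply, Real.norm_eq_abs, sq_abs]
    field_simp

theorem measurable_height (h : IsGraphBox k φ I B c) : Measurable (height k φ I B) := by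
  have h1 : height k φ I B = B.indicator (height k φ I B) := by
    ext y
    by_cases hy : y ∈ B
    · rw [indicator_of_mem hy]
    · rw [indicator_of_notMem hy, height, dif_neg (fun h => hy h.1)]
  rw [h1]
  exact measurable_indicator_of_continuousOn h.isOpen_snd.measurableSet
    fun y hy => (h.continuousAt_height hy).continuousWithinAt

theorem measurable_graph (h : IsGraphBox k φ I B c) : Measurable (graph k φ I B) :=
  (continuous_ins k).measurable.comp (h.measurable_height.prodMk measurable_id)

/-- The area element of the zero set of `φ` over the `k`-th coordinate plane. -/
def areaElement (k : Fin (n + 1)) (φ : Space (n + 1) → ℝ) (x : Space (n + 1)) : ℝ :=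
  ‖∇ φ x‖ / |(∇ φ x) k|

theorem continuousOn_areaElement (h : IsGraphBox k φ I B c) :
    ContinuousOn (fun y => areaElement k φ (graph k φ I B y)) B := by
  have h1 : ContinuousOn (areaElement k φ) (box k I B) := by
    have h2 := continuousOn_gradient h.isOpen_box h.contDiffOn
    have h3 : ContinuousOn (fun x => (∇ φ x) k) (box k I B) :=
      (by fun_prop : Continuous fun z : Space (n + 1) => z k).comp_continuousOn h2
    exact h2.norm.div h3.abs fun x hx => abs_ne_zero.2 (h.gradient_ne_zero hx)
  exact h1.comp (fun y hy => (h.continuousAt_graph hy).continuousWithinAt) fun y hy => h.graph_mem hy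

theorem areaElement_pos (h : IsGraphBox k φ I B c) {x : Space (n + 1)} (hx : x ∈ box k I B) :
    0 < areaElement k φ x :=
  div_pos (h.norm_gradient_pos hx) (abs_pos.2 (h.gradient_ne_zero hx))

/-- The area formula for `graph`, with the projection `rem k` as inverse. A graph and its derivative
retain the base coordinates, so neither shortens distances. -/
theorem map_rem_restrict (h : IsGraphBox k φ I B c) :
    (μHE[n].restrict {x ∈ box k I B | φ x = 0}).map (rem k) =
      (volume.restrict B).withDensity
        fun y => ENNReal.ofReal (areaElement k φ (graph k φ I B y)) := by
  rw [h.zero_set_eq]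
  refine area_formula (f' := fun y => graphDeriv k φ (graph k φ I B y)) h.isOpen_snd
    (fun y hy => h.hasStrictFDerivAt_graph hy) (fun y _ w => ?_) (fun y _ z _ => ?_)
    (continuous_rem k).measurable (fun y _ => ?_)
    (fun y hy => (h.normDet_graphDeriv (h.graph_mem hy)).symm) h.continuousOn_areaElement
    (fun y hy => h.areaElement_pos (h.graph_mem hy))
  · rw [graphDeriv_apply]; exact norm_le_norm_ins _ _ _
  · rw [graph, graph, ins_sub]; exact norm_le_norm_ins _ _ _
  · simp [graph]

theorem measurableSet_zero (h : IsGraphBox k φ I B c) :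
    MeasurableSet {x ∈ box k I B | φ x = 0} := by
  have h1 : {x ∈ box k I B | φ x = 0} = box k I B ∩ ((box k I B).indicator φ) ⁻¹' {0} := by
    ext x
    constructor
    · rintro ⟨h2, h3⟩
      exact ⟨h2, by simp [h2, h3]⟩
    · rintro ⟨h2, h3⟩
      exact ⟨h2, by simpa [h2] using h3⟩
  rw [h1]
  exact h.isOpen_box.measurableSet.inter (measurable_indicator_of_continuousOn
    h.isOpen_box.measurableSet h.contDiffOn.continuousOn (measurableSet_singleton 0))

/-- The surface measure on the zero set of `φ`, by the parametrisation. -/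
theorem restrict_eq_map (h : IsGraphBox k φ I B c) :
    (μHE[n] : Measure (Space (n + 1))).restrict {x ∈ box k I B | φ x = 0} =
      ((volume.restrict B).withDensity
        fun y => ENNReal.ofReal (areaElement k φ (graph k φ I B y))).map (graph k φ I B) := by
  rw [← h.map_rem_restrict, Measure.map_map h.measurable_graph (continuous_rem k).measurable]
  have : (graph k φ I B ∘ rem k) =ᵐ[μHE[n].restrict {x ∈ box k I B | φ x = 0}] id := by
    filter_upwards [ae_restrict_mem h.measurableSet_zero] with x hx
    obtain ⟨y, -, rfl⟩ := h.zero_set_eq.subset hx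
    simp [graph]
  rw [Measure.map_congr this, Measure.map_id]

theorem measurable_areaElement (h : IsGraphBox k φ I B c) :
    AEMeasurable (fun y => areaElement k φ (graph k φ I B y)) (volume.restrict B) :=
  h.continuousOn_areaElement.aemeasurable h.isOpen_snd.measurableSet

/-- The surface integral over the zero set of `φ`, by the parametrisation. -/
theorem integral_zero_set (h : IsGraphBox k φ I B c) {f : Space (n + 1) → ℝ} (hf : Measurable f) :
    ∫ x in {x ∈ box k I B | φ x = 0}, f x ∂μHE[n] =
      ∫ y in B, areaElement k φ (graph k φ I B y) * f (graph k φ I B y) := by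
  rw [h.restrict_eq_map, integral_map h.measurable_graph.aemeasurable hf.aestronglyMeasurable,
    integral_withDensity_eq_integral_toReal_smul₀ h.measurable_areaElement.ennreal_ofReal
      (Eventually.of_forall fun _ => ENNReal.ofReal_lt_top)]
  refine setIntegral_congr_fun h.isOpen_snd.measurableSet fun y hy => ?_
  simp only [smul_eq_mul]
  rw [ENNReal.toReal_ofReal (h.areaElement_pos (h.graph_mem hy)).le]

/-- The area of a part of the zero set of `φ`, by the parametrisation. -/
theorem measure_zero_set_inter (h : IsGraphBox k φ I B c) {S : Set (Space (n + 1))}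
    (hS : MeasurableSet S) :
    μHE[n] ({x ∈ box k I B | φ x = 0} ∩ S) =
      ∫⁻ y in B ∩ (graph k φ I B) ⁻¹' S, ENNReal.ofReal (areaElement k φ (graph k φ I B y)) := by
  rw [inter_comm, ← Measure.restrict_apply hS, h.restrict_eq_map,
    Measure.map_apply h.measurable_graph hS, withDensity_apply _ (h.measurable_graph hS),
    Measure.restrict_restrict (h.measurable_graph hS), inter_comm]

end IsGraphBox

/-! ### Thin layers and transversal intersections -/

theorem integrable_of_bounded_of_support {X : Type*} [MeasurableSpace X] {μ : Measure X} {f : X → ℝ}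
    {S : Set X} {M : ℝ} (hS : μ S ≠ ⊤) (hf : AEStronglyMeasurable f μ) (hM : ∀ x, |f x| ≤ M)
    (h0 : ∀ x, x ∉ S → f x = 0) : Integrable f μ := by
  refine (integrableOn_iff_integrable_of_support_subset (s := S) ?_).1 ?_
  · intro x hx
    by_contra hxS
    exact hx (h0 x hxS)
  · exact Measure.integrableOn_of_bounded hS hf (Eventually.of_forall hM)

theorem measurable_mul_of_continuousOn {f φ : Space d → ℝ} {D : Set (Space d)}
    (hD : MeasurableSet D) (hf : Measurable f) (h0 : ∀ x, x ∉ D → f x = 0) (hφ : ContinuousOn φ D)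
    {g : ℝ → ℝ} (hg : Measurable g) : Measurable fun x => f x * g (φ x) := by
  have h1 : (fun x => f x * g (φ x)) = fun x => f x * g (D.indicator φ x) := by
    ext x
    by_cases hx : x ∈ D
    · rw [indicator_of_mem hx]
    · rw [h0 x hx]; simp
  rw [h1]
  exact hf.mul (hg.comp (measurable_indicator_of_continuousOn hD hφ))

theorem deriv_cut_div_eq_zero {s ε : ℝ} (hε : 0 < ε) (h : s ∉ Icc ε (2 * ε)) :
    deriv cut (s / ε) = 0 := by
  by_contra hne
  have := mem_Icc_of_deriv_cut_ne_zero hne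
  refine h ⟨?_, (div_le_iff₀ hε).1 this.2⟩
  have := (le_div_iff₀ hε).1 this.1
  linarith

namespace IsGraphBox

variable {k : Fin (n + 1)} {φ : Space (n + 1) → ℝ} {I : Set ℝ} {B : Set (Space n)} {c : ℝ}

/-- Surface integrals over level sets as limits of integrals over thin layers. -/
theorem tendsto_integral_deriv_cut (h : IsGraphBox k φ I B c) {f : Space (n + 1) → ℝ} {M : ℝ}
    (hf : Measurable f) (hM : ∀ x, |f x| ≤ M) (h0 : ∀ x, x ∉ box k I B → f x = 0)
    (hc : ∀ᵐ y ∂volume.restrict B, ContinuousAt f (graph k φ I B y)) :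
    Tendsto (fun ε : ℝ => ∫ x, f x * (ε⁻¹ * deriv cut (φ x / ε))) (𝓝[>] 0)
      (𝓝 (∫ x in {x ∈ box k I B | φ x = 0}, f x / ‖∇ φ x‖ ∂μHE[n])) := by
  obtain ⟨C, hC0, hC⟩ := exists_bound_deriv_cut
  have hM0 : 0 ≤ M := (abs_nonneg _).trans (hM 0)
  have hDm := h.isOpen_box.measurableSet
  set F : ℝ → Space (n + 1) → ℝ := fun ε x => f x * (ε⁻¹ * deriv cut (φ x / ε)) with hF
  have hFm : ∀ ε, Measurable (F ε) := fun ε =>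
    measurable_mul_of_continuousOn (g := fun s => ε⁻¹ * deriv cut (s / ε)) hDm hf h0
      h.contDiffOn.continuousOn (by
        have := continuous_deriv_cut.measurable
        fun_prop)
  have hF0 : ∀ ε x, x ∉ box k I B → F ε x = 0 := fun ε x hx => by simp [hF, h0 x hx]
  have hFM : ∀ ε, 0 < ε → ∀ x, |F ε x| ≤ M * (ε⁻¹ * C) := by
    intro ε hε x
    rw [hF, abs_mul, abs_mul, abs_of_pos (inv_pos.2 hε)]
    gcongr
    · exact hM x
    · exact hC _
  have hFi : ∀ ε, 0 < ε → Integrable (F ε) := fun ε hε =>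
    integrable_of_bounded_of_support h.isBounded_box.measure_lt_top.ne (hFm ε).aestronglyMeasurable
      (hFM ε hε) (hF0 ε)
  -- The area element `|∇φ| / |∂ₖφ|` and the weight `1 / |∇φ|` combine to `1 / |∂ₖφ|`, which is what
  -- the one-dimensional limit on each line produces.
  have hlimit : ∫ x in {x ∈ box k I B | φ x = 0}, f x / ‖∇ φ x‖ ∂μHE[n] =
      ∫ y, B.indicator (fun y => f (graph k φ I B y) / |(∇ φ (graph k φ I B y)) k|) y := by
    rw [integral_indicator h.isOpen_snd.measurableSet]
    have h1 : ∫ x in {x ∈ box k I B | φ x = 0}, f x / ‖∇ φ x‖ ∂μHE[n] =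
        ∫ x in {x ∈ box k I B | φ x = 0}, f x / ‖(box k I B).indicator (∇ φ) x‖ ∂μHE[n] := by
      refine setIntegral_congr_fun h.measurableSet_zero fun x hx => ?_
      rw [indicator_of_mem hx.1]
    rw [h1, h.integral_zero_set]
    · refine setIntegral_congr_fun h.isOpen_snd.measurableSet fun y hy => ?_
      simp only []
      rw [indicator_of_mem (h.graph_mem hy), areaElement]
      have h2 := (h.norm_gradient_pos (h.graph_mem hy)).ne'
      have h3 := abs_ne_zero.2 (h.gradient_ne_zero (h.graph_mem hy))
      field_simp
    · exact hf.div (measurable_indicator_of_continuousOn hDm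
        (continuousOn_gradient h.isOpen_box h.contDiffOn)).norm
  rw [hlimit]
  have hmain : Tendsto (fun ε : ℝ => ∫ y : Space n, ∫ s : ℝ, F ε (ins k s y)) (𝓝[>] 0)
      (𝓝 (∫ y, B.indicator (fun y => f (graph k φ I B y) / |(∇ φ (graph k φ I B y)) k|) y)) := by
    -- On every line the layer has length at most `ε / c` while the integrand is at most `M C / ε`,
    -- so the inner integrals are bounded by `M C / c` for all `ε`.
    refine tendsto_integral_filter_of_dominated_convergence
      (B.indicator fun _ => M * C / c) ?_ ?_ ?_ ?_
    · refine Eventually.of_forall fun ε => ?_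
      have h1 : StronglyMeasurable (fun p : Space n × ℝ => F ε (ins k p.2 p.1)) :=
        ((hFm ε).comp ((continuous_ins k).measurable.comp measurable_swap)).stronglyMeasurable
      exact h1.integral_prod_right'.aestronglyMeasurable
    · filter_upwards [self_mem_nhdsWithin] with ε (hε : 0 < ε)
      refine Eventually.of_forall fun y => ?_
      by_cases hy : y ∈ B
      · rw [indicator_of_mem hy]
        set S : Set ℝ := {s | s ∈ I ∧ φ (ins k s y) ∈ Icc ε (2 * ε)}
        have hS : volume S ≤ ENNReal.ofReal (ε / c) := by
          refine (Real.volume_le_diam _).trans (Metric.ediam_le_of_forall_dist_le fun s hs s' hs' => ?_)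
          rw [Real.dist_eq, le_div_iff₀ h.pos, mul_comm]
          refine (h.expand y hy s hs.1 s' hs'.1).trans ?_
          rw [abs_le]
          constructor <;> linarith [hs.2.1, hs.2.2, hs'.2.1, hs'.2.2]
        have hint : ∫ s : ℝ, F ε (ins k s y) = ∫ s in S, F ε (ins k s y) := by
          refine (setIntegral_eq_integral_of_forall_compl_eq_zero fun s hs => ?_).symm
          by_cases hsI : s ∈ I
          · have : φ (ins k s y) ∉ Icc ε (2 * ε) := fun hcon => hs ⟨hsI, hcon⟩
            simp [hF, deriv_cut_div_eq_zero hε this]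
          · exact hF0 ε _ fun hcon => hsI (ins_mem_box.1 hcon).1
        rw [hint]
        refine (norm_setIntegral_le_of_norm_le_const (C := M * (ε⁻¹ * C))
          (lt_of_le_of_lt hS ENNReal.ofReal_lt_top) fun s _ => hFM ε hε _).trans ?_
        have hS' : volume.real S ≤ ε / c := ENNReal.toReal_le_of_le_ofReal
          (div_nonneg hε.le h.pos.le) hS
        calc M * (ε⁻¹ * C) * volume.real S ≤ M * (ε⁻¹ * C) * (ε / c) := by gcongr
          _ = M * C / c := by field_simp
      · rw [indicator_of_notMem hy]
        have : ∀ s, F ε (ins k s y) = 0 := fun s => hF0 ε _ fun hcon => hy (ins_mem_box.1 hcon).2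
        simp [this]
    · exact (integrable_indicator_iff h.isOpen_snd.measurableSet).2
        (integrableOn_const h.bounded_snd.measure_lt_top.ne)
    · have hc' := (ae_restrict_iff' h.isOpen_snd.measurableSet).1 hc
      filter_upwards [hc'] with y hy
      by_cases hyB : y ∈ B
      · rw [indicator_of_mem hyB]
        have hline : Continuous fun s : ℝ => ins k s y :=
          (continuous_ins k).comp (by fun_prop : Continuous fun s : ℝ => (s, y))
        have hgr : ins k (height k φ I B y) y = graph k φ I B y := rfl
        have hd := hasDerivAt_line (k := k) (h.differentiableAt (h.graph_mem hyB))
        rw [graph, rem_ins, ins_apply_same] at hd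
        have := tendsto_integral_deriv_cut_div (f := fun s => f (ins k s y))
          (φ := fun s => φ (ins k s y)) (s₀ := height k φ I B y) (c := c) (M := M) h.isOpen_fst
          (h.height_mem hyB) (fun s hs => h0 _ fun hcon => hs (ins_mem_box.1 hcon).1)
          (fun s => hM _) (hf.comp hline.measurable)
          (ContinuousAt.comp (f := fun s => ins k s y) (by rw [hgr]; exact hy hyB)
            hline.continuousAt)
          (h.contDiffOn.continuousOn.comp hline.continuousOn fun s hs => ins_mem_box.2 ⟨hs, hyB⟩)
          hd (h.apply_graph hyB) h.pos (fun s hs => h.le_abs_apply hyB hs)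
        exact this
      · rw [indicator_of_notMem hyB]
        have : ∀ ε s, F ε (ins k s y) = 0 := fun ε s =>
          hF0 ε _ fun hcon => hyB (ins_mem_box.1 hcon).2
        simp [this]
  refine hmain.congr' ?_
  filter_upwards [self_mem_nhdsWithin] with ε hε
  exact (integral_eq_integral_ins k (hFi ε hε)).symm

/-- Transversal intersections with another hypersurface are null sets. -/
theorem measure_inter_eq_zero (h : IsGraphBox k φ I B c) {S : Set (Space (n + 1))}
    (hS : MeasurableSet S) {g : Space (n + 1) → ℝ}
    (hg0 : ∀ x ∈ box k I B, φ x = 0 → x ∈ S → g x = 0)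
    (hg : ∀ x ∈ box k I B, φ x = 0 → x ∈ S → DifferentiableAt ℝ g x ∧
      ∃ v, ⟪∇ φ x, v⟫_ℝ = 0 ∧ fderiv ℝ g x v ≠ 0) :
    volume (B ∩ (graph k φ I B) ⁻¹' S) = 0 ∧ μHE[n] ({x ∈ box k I B | φ x = 0} ∩ S) = 0 := by
  -- In the parameter domain `g ∘ graph` vanishes on the set in question. Its derivative there is
  -- non-zero because the tangent vector `v` is the image of `rem k v` under the derivative of the
  -- parametrisation.
  have h1 : volume (B ∩ (graph k φ I B) ⁻¹' S) = 0 := by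
    refine volume_eq_zero_of_hasFDerivWithinAt_zero (u := fun y => g (graph k φ I B y)) ?_ ?_
    · rintro y ⟨hy, hyS⟩
      exact hg0 _ (h.graph_mem hy) (h.apply_graph hy) hyS
    · rintro y ⟨hy, hyS⟩
      obtain ⟨hgd, v, hv, hne⟩ := hg _ (h.graph_mem hy) (h.apply_graph hy) hyS
      refine ⟨(fderiv ℝ g (graph k φ I B y)).comp (graphDeriv k φ (graph k φ I B y)), ?_, ?_⟩
      · intro hcon
        apply hne
        have := congrArg (fun L => L (rem k v)) hcon
        simpa [h.graphDeriv_rem (h.graph_mem hy) hv] using this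
      · exact (hgd.hasFDerivAt.comp y (h.hasStrictFDerivAt_graph hy).hasFDerivAt).hasFDerivWithinAt
  refine ⟨h1, ?_⟩
  rw [h.measure_zero_set_inter hS]
  exact setLIntegral_measure_zero _ _ h1

/-- The surface measure is locally finite. -/
theorem measure_zero_set_inter_le (h : IsGraphBox k φ I B c) {L : ℝ}
    (hL : ∀ x ∈ box k I B, ‖∇ φ x‖ ≤ L) {S : Set (Space (n + 1))} (hS : MeasurableSet S) :
    μHE[n] ({x ∈ box k I B | φ x = 0} ∩ S) ≤
      ENNReal.ofReal (L / c) * volume (B ∩ (graph k φ I B) ⁻¹' S) := by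
  rw [h.measure_zero_set_inter hS, ← setLIntegral_const]
  refine setLIntegral_mono' (h.isOpen_snd.measurableSet.inter (h.measurable_graph hS)) fun y hy =>
    ENNReal.ofReal_le_ofReal ?_
  have h1 := hL _ (h.graph_mem hy.1)
  exact div_le_div₀ ((norm_nonneg _).trans h1) h1 h.pos (h.le_abs_gradient (h.graph_mem hy.1))

end IsGraphBox

/-! ### Local structure of time-dependent level sets -/

theorem fderiv_slice {φ : ℝ → Space d → ℝ} {t : ℝ} {x : Space d}
    (h : DifferentiableAt ℝ (Function.uncurry φ) (t, x)) (v : Space d) :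
    fderiv ℝ (φ t) x v = fderiv ℝ (Function.uncurry φ) (t, x) (0, v) := by
  have h1 := h.hasFDerivAt.comp x (hasFDerivAt_prodMk_right (𝕜 := ℝ) t x)
  have h2 : (Function.uncurry φ ∘ fun y : Space d => (t, y)) = φ t := rfl
  rw [h2] at h1
  rw [h1.fderiv]
  simp

theorem deriv_slice {φ : ℝ → Space d → ℝ} {t : ℝ} {x : Space d}
    (h : DifferentiableAt ℝ (Function.uncurry φ) (t, x)) :
    HasDerivAt (fun s => φ s x) (fderiv ℝ (Function.uncurry φ) (t, x) (1, 0)) t := by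
  have h1 := h.hasFDerivAt.comp t (hasFDerivAt_prodMk_left (𝕜 := ℝ) t x)
  have h2 : (Function.uncurry φ ∘ fun s : ℝ => (s, x)) = fun s => φ s x := rfl
  rw [h2] at h1
  exact h1.hasDerivAt.congr_deriv (by simp)

/-- Strict differentiability in all space-time variables makes the linear approximation along lines
uniform in `t` and `y`. The error `|m| / 2` leaves half of the slope, hence monotone growth along
these lines. -/
theorem exists_nhds_abs_sub_le {φ : ℝ × Space (n + 1) → ℝ} {φ' : ℝ × Space (n + 1) →L[ℝ] ℝ}
    {z₀ : ℝ × Space (n + 1)} (h : HasStrictFDerivAt φ φ' z₀) (k : Fin (n + 1)) {m : ℝ}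
    (hm : φ' (0, EuclideanSpace.single k 1) = m) (hm0 : m ≠ 0) :
    ∃ N ∈ 𝓝 z₀, ∀ t y s s', (t, ins k s y) ∈ N → (t, ins k s' y) ∈ N →
      |φ (t, ins k s y) - φ (t, ins k s' y) - m * (s - s')| ≤ |m| / 2 * |s - s'| := by
  have hb := (hasStrictFDerivAt_iff_isLittleO.1 h).def (by positivity : 0 < |m| / 2)
  rw [nhds_prod_eq] at hb
  obtain ⟨p, hp, q, hq, hpq⟩ := Filter.eventually_prod_iff.1 hb
  refine ⟨{y | p y ∧ q y}, hp.and hq, fun t y s s' hs hs' => ?_⟩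
  have h1 := hpq hs.1 hs'.2
  have h2 : ((t, ins k s y) : ℝ × Space (n + 1)) - (t, ins k s' y) =
      (s - s') • (0, EuclideanSpace.single k 1) := by
    rw [Prod.mk_sub_mk, ins_sub, ins_eq_add, ins_one_zero]
    simp [ins]
  simp only [h2] at h1
  rw [map_smul, hm, norm_smul, Real.norm_eq_abs, Real.norm_eq_abs, smul_eq_mul, mul_comm (s - s')] at h1
  simpa using h1

theorem mul_abs_le_of_abs_sub_le {a m r : ℝ} (h : |a - m * r| ≤ |m| / 2 * |r|) :
    |m| / 2 * |r| ≤ |a| := by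
  have h1 : |m * r| ≤ |a| + |a - m * r| := by
    have := abs_sub_abs_le_abs_sub (m * r) a
    rw [abs_sub_comm (m * r) a] at this
    linarith
  rw [abs_mul] at h1
  linarith

theorem exists_gradient_apply_ne_zero {φ : Space d → ℝ} {x : Space d} (h : ∇ φ x ≠ 0) :
    ∃ k, (∇ φ x) k ≠ 0 := by
  by_contra! hcon
  exact h (by ext k; simpa using hcon k)

/-- Strips of a time-dependent function with non-zero spatial gradient have a volume that is
proportional to their width. -/
theorem exists_nhds_volume_strip_le_of_hasStrictFDerivAt {φ : ℝ → Space (n + 1) → ℝ}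
    {z₀ : ℝ × Space (n + 1)} {U : Set (ℝ × Space (n + 1))} (hU : IsOpen U) (hz : z₀ ∈ U)
    (hφ : ContinuousOn (Function.uncurry φ) U) {φ' : ℝ × Space (n + 1) →L[ℝ] ℝ}
    (hs : HasStrictFDerivAt (Function.uncurry φ) φ' z₀) {k : Fin (n + 1)}
    (hk : φ' (0, EuclideanSpace.single k 1) ≠ 0) :
    ∃ N ∈ 𝓝 z₀, ∃ C, 0 ≤ C ∧ ∀ D ⊆ N, IsOpen D → ∀ t ε, 0 < ε →
      volume {x | (t, x) ∈ D ∧ φ t x ∈ Icc ε (2 * ε)} ≤ ENNReal.ofReal (C * ε) := by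
  obtain ⟨N, hN, h⟩ := exists_nhds_abs_sub_le hs k rfl hk
  set m := φ' (0, EuclideanSpace.single k 1)
  -- Restricting the lines to those over a unit ball makes the base of the strip finite.
  have hN2 : {z : ℝ × Space (n + 1) | rem k z.2 ∈ Metric.ball (rem k z₀.2) 1} ∈ 𝓝 z₀ :=
    (Metric.isOpen_ball.preimage ((continuous_rem k).comp continuous_snd)).mem_nhds
      (Metric.mem_ball_self one_pos)
  set W := (volume (Metric.ball (rem k z₀.2) 1)).toReal
  refine ⟨N ∩ {z | rem k z.2 ∈ Metric.ball (rem k z₀.2) 1} ∩ U,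
    inter_mem (inter_mem hN hN2) (hU.mem_nhds hz),
    (|m| / 2)⁻¹ * W, by positivity, fun D hD hDo t ε hε => ?_⟩
  have hDt : IsOpen {x | (t, x) ∈ D} := hDo.preimage (by fun_prop : Continuous fun x => (t, x))
  have hcont : ContinuousOn (φ t) {x | (t, x) ∈ D} := by
    have : Continuous fun x : Space (n + 1) => (t, x) := by fun_prop
    exact hφ.comp this.continuousOn fun x hx => (hD hx).2
  have hm : MeasurableSet {x ∈ {x | (t, x) ∈ D} | φ t x ∈ Icc ε (2 * ε)} := by
    have h1 : {x ∈ {x | (t, x) ∈ D} | φ t x ∈ Icc ε (2 * ε)} = {x | (t, x) ∈ D} ∩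
        ({x | (t, x) ∈ D}.indicator (φ t)) ⁻¹' Icc ε (2 * ε) := by
      ext x
      constructor
      · rintro ⟨h2, h3⟩
        exact ⟨h2, by rw [mem_preimage, indicator_of_mem h2]; exact h3⟩
      · rintro ⟨h2, h3⟩
        rw [mem_preimage, indicator_of_mem h2] at h3
        exact ⟨h2, h3⟩
    rw [h1]
    exact hDt.measurableSet.inter
      (measurable_indicator_of_continuousOn hDt.measurableSet hcont measurableSet_Icc)
  refine (volume_strip_le k (S := {x | (t, x) ∈ D}) (u := φ t) (c := |m| / 2) (r := 1)
    (y₀ := rem k z₀.2) (by positivity) (fun x hx => (hD hx).1.2)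
    (fun y s s' hs hs' => mul_abs_le_of_abs_sub_le (h t y s s' (hD hs).1.1 (hD hs').1.1)) hm).trans ?_
  have hW : volume (Metric.ball (rem k z₀.2) 1) = ENNReal.ofReal W :=
    (ENNReal.ofReal_toReal measure_ball_lt_top.ne).symm
  rw [hW, ← ENNReal.ofReal_mul (div_nonneg (by linarith) (by positivity))]
  refine ENNReal.ofReal_le_ofReal (le_of_eq ?_)
  field_simp
  ring

/-- Some coordinate has a non-zero partial derivative at `z₀`. The constant does not depend on time,
which allows integration over `[0,T]`. -/
theorem exists_nhds_volume_strip_le {φ : ℝ → Space (n + 1) → ℝ} {z₀ : ℝ × Space (n + 1)}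
    {U : Set (ℝ × Space (n + 1))} (hU : IsOpen U) (hz : z₀ ∈ U)
    (hφ : ContDiffOn ℝ 1 (Function.uncurry φ) U) (hne : ∇ (φ z₀.1) z₀.2 ≠ 0) :
    ∃ N ∈ 𝓝 z₀, ∃ C, 0 ≤ C ∧ ∀ D ⊆ N, IsOpen D → ∀ t ε, 0 < ε →
      volume {x | (t, x) ∈ D ∧ φ t x ∈ Icc ε (2 * ε)} ≤ ENNReal.ofReal (C * ε) := by
  obtain ⟨k, hk⟩ := exists_gradient_apply_ne_zero hne
  have hcd := hφ.contDiffAt (hU.mem_nhds hz)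
  rw [gradient_apply, fderiv_slice (hcd.differentiableAt (by simp))] at hk
  exact exists_nhds_volume_strip_le_of_hasStrictFDerivAt hU hz hφ.continuousOn
    (hcd.hasStrictFDerivAt (by simp)) hk

/-- Near a zero with non-zero spatial gradient, the zero sets of a time-dependent function are
graphs over a fixed box. -/
theorem exists_isGraphBox {φ : ℝ → Space (n + 1) → ℝ} {t₀ : ℝ} {x₀ : Space (n + 1)}
    {U N : Set (ℝ × Space (n + 1))} (hU : IsOpen U) (hz : (t₀, x₀) ∈ U)
    (hφ : ContDiffOn ℝ 1 (Function.uncurry φ) U) (hne : ∇ (φ t₀) x₀ ≠ 0) (h0 : φ t₀ x₀ = 0)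
    (hN : N ∈ 𝓝 (t₀, x₀)) :
    ∃ (k : Fin (n + 1)) (τ : ℝ) (I : Set ℝ) (B : Set (Space n)) (c L : ℝ), 0 < τ ∧
      x₀ ∈ box k I B ∧ ∀ t ∈ Ioo (t₀ - τ) (t₀ + τ), IsGraphBox k (φ t) I B c ∧
        ∀ x ∈ box k I B, (t, x) ∈ N ∧ ‖∇ (φ t) x‖ ≤ L := by
  obtain ⟨k, hk⟩ := exists_gradient_apply_ne_zero hne
  have hcd := hφ.contDiffAt (hU.mem_nhds hz)
  rw [gradient_apply, fderiv_slice (hcd.differentiableAt (by simp))] at hk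
  obtain ⟨N₁, hN₁, h⟩ := exists_nhds_abs_sub_le (hcd.hasStrictFDerivAt (by simp)) k rfl hk
  set m := fderiv ℝ (Function.uncurry φ) (t₀, x₀) (0, EuclideanSpace.single k 1)
  set L := ‖fderiv ℝ (Function.uncurry φ) (t₀, x₀)‖ + 1
  have hcf : ContinuousOn (fderiv ℝ (Function.uncurry φ)) U := hφ.continuousOn_fderiv_of_isOpen hU le_rfl
  have hL : ∀ᶠ z in 𝓝 (t₀, x₀), ‖fderiv ℝ (Function.uncurry φ) z‖ < L :=
    (hcf.continuousAt (hU.mem_nhds hz)).norm.eventually (gt_mem_nhds (by linarith))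
  have hall : N₁ ∩ N ∩ U ∩ {z | ‖fderiv ℝ (Function.uncurry φ) z‖ < L} ∈ 𝓝 (t₀, x₀) :=
    inter_mem (inter_mem (inter_mem hN₁ hN) (hU.mem_nhds hz)) hL
  have hcont : Continuous fun q : ℝ × (ℝ × Space n) => (q.1, ins k q.2.1 q.2.2) :=
    continuous_fst.prodMk ((continuous_ins k).comp continuous_snd)
  have hpre : (fun q : ℝ × (ℝ × Space n) => (q.1, ins k q.2.1 q.2.2)) ⁻¹'
      (N₁ ∩ N ∩ U ∩ {z | ‖fderiv ℝ (Function.uncurry φ) z‖ < L}) ∈ 𝓝 (t₀, (x₀ k, rem k x₀)) := by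
    refine hcont.continuousAt.preimage_mem_nhds ?_
    simpa using hall
  obtain ⟨ρ, hρ, hball⟩ := Metric.mem_nhds_iff.1 hpre
  have hmem : ∀ t s y, |t - t₀| < ρ → |s - x₀ k| < ρ → dist y (rem k x₀) < ρ →
      (t, ins k s y) ∈ N₁ ∩ N ∩ U ∩ {z | ‖fderiv ℝ (Function.uncurry φ) z‖ < L} := by
    intro t s y h1 h2 h3
    refine hball (?_ : (t, (s, y)) ∈ _)
    rw [Metric.mem_ball, Prod.dist_eq, Prod.dist_eq, max_lt_iff, max_lt_iff]
    exact ⟨h1, h2, h3⟩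
  set r := ρ / 2
  have hr : 0 < r := by positivity
  have hrρ : r < ρ := half_lt_self hρ
  have hsign : ∀ s, |s - x₀ k| < ρ → |φ t₀ (ins k s (rem k x₀)) - m * (s - x₀ k)| ≤
      |m| / 2 * |s - x₀ k| := by
    intro s hs
    have h1 := h t₀ (rem k x₀) s (x₀ k) (hmem t₀ s _ (by simpa) hs (by simpa)).1.1.1
      (hmem t₀ _ _ (by simpa) (by simpa) (by simpa)).1.1.1
    simpa [h0] using h1
  -- At time `t₀` the function `m φ` is positive at the upper end and negative at the lower end of
  -- the line through `x₀`. By continuity this persists for nearby `(t, y)`, and the intermediate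
  -- value theorem gives a zero on each of those lines.
  have hup : 0 < m * φ t₀ (ins k (x₀ k + r) (rem k x₀)) := by
    have h1 := abs_le.1 (hsign (x₀ k + r) (by simpa [abs_of_pos hr]))
    rw [add_sub_cancel_left, abs_of_pos hr] at h1
    rcases lt_or_gt_of_ne hk with hneg | hpos
    · rw [abs_of_neg hneg] at h1
      exact mul_pos_of_neg_of_neg hneg (by nlinarith [h1.2, mul_pos_of_neg_of_neg hneg (neg_neg_of_pos hr)])
    · rw [abs_of_pos hpos] at h1
      exact mul_pos hpos (by nlinarith [h1.1, mul_pos hpos hr])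
  have hlo : m * φ t₀ (ins k (x₀ k - r) (rem k x₀)) < 0 := by
    have h1 := abs_le.1 (hsign (x₀ k - r) (by simpa [abs_of_pos hr]))
    rw [sub_sub_cancel_left, abs_neg, abs_of_pos hr] at h1
    rcases lt_or_gt_of_ne hk with hneg | hpos
    · rw [abs_of_neg hneg] at h1
      exact mul_neg_of_neg_of_pos hneg (by nlinarith [h1.1, mul_pos_of_neg_of_neg hneg (neg_neg_of_pos hr)])
    · rw [abs_of_pos hpos] at h1
      exact mul_neg_of_pos_of_neg hpos (by nlinarith [h1.2, mul_pos hpos hr])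
  have hcat : ∀ s, |s - x₀ k| < ρ →
      ContinuousAt (fun q : ℝ × Space n => m * φ q.1 (ins k s q.2)) (t₀, rem k x₀) := by
    intro s hs
    have h1 : ContinuousAt (Function.uncurry φ) (t₀, ins k s (rem k x₀)) :=
      hφ.continuousOn.continuousAt (hU.mem_nhds (hmem t₀ s _ (by simpa) hs (by simpa)).1.2)
    have h2 : Continuous fun q : ℝ × Space n => (q.1, ins k s q.2) :=
      continuous_fst.prodMk ((continuous_ins k).comp (by fun_prop : Continuous
        fun q : ℝ × Space n => (s, q.2)))
    have h3 : ContinuousAt (Function.uncurry φ ∘ fun q : ℝ × Space n => (q.1, ins k s q.2))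
        (t₀, rem k x₀) := ContinuousAt.comp (x := (t₀, rem k x₀)) h1 h2.continuousAt
    exact continuousAt_const.mul h3
  -- One radius `η` serves for time and base point together, so the box does not depend on `t`.
  have hev := ((hcat (x₀ k + r) (by simpa [abs_of_pos hr])).eventually (lt_mem_nhds hup)).and
    ((hcat (x₀ k - r) (by simpa [abs_of_pos hr])).eventually (gt_mem_nhds hlo))
  obtain ⟨η, hη, hηball⟩ := Metric.eventually_nhds_iff.1 hev
  refine ⟨k, min r η, Ioo (x₀ k - r) (x₀ k + r), Metric.ball (rem k x₀) (min r η), |m| / 2, L,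
    lt_min hr hη, ⟨⟨by linarith, by linarith⟩, Metric.mem_ball_self (lt_min hr hη)⟩, fun t ht => ?_⟩
  have ht' : |t - t₀| < min r η := by
    rw [abs_lt]; constructor <;> linarith [ht.1, ht.2]
  have hs' : ∀ s ∈ Icc (x₀ k - r) (x₀ k + r), |s - x₀ k| < ρ := by
    intro s hs
    refine lt_of_le_of_lt (abs_le.2 ⟨?_, ?_⟩) hrρ <;> linarith [hs.1, hs.2]
  have hin : ∀ s ∈ Icc (x₀ k - r) (x₀ k + r), ∀ y ∈ Metric.ball (rem k x₀) (min r η),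
      (t, ins k s y) ∈ N₁ ∩ N ∩ U ∩ {z | ‖fderiv ℝ (Function.uncurry φ) z‖ < L} := fun s hs y hy =>
    hmem t s y (ht'.trans ((min_le_left _ _).trans_lt hrρ)) (hs' s hs)
      ((Metric.mem_ball.1 hy).trans ((min_le_left _ _).trans_lt hrρ))
  have hbox : ∀ x ∈ box k (Ioo (x₀ k - r) (x₀ k + r)) (Metric.ball (rem k x₀) (min r η)),
      (t, x) ∈ N₁ ∩ N ∩ U ∩ {z | ‖fderiv ℝ (Function.uncurry φ) z‖ < L} := by
    intro x hx
    have := hin (x k) (Ioo_subset_Icc_self hx.1) (rem k x) hx.2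
    rwa [ins_rem] at this
  have hmap : Continuous fun x : Space (n + 1) => (t, x) := by fun_prop
  refine ⟨⟨isOpen_Ioo, Metric.isOpen_ball, Metric.isBounded_Ioo _ _, Metric.isBounded_ball,
    by positivity, ?_, ?_, ?_⟩, fun x hx => ⟨(hbox x hx).1.1.2, ?_⟩⟩
  · have h1 : ContDiff ℝ 1 fun x : Space (n + 1) => (t, x) := by fun_prop
    exact hφ.comp h1.contDiffOn fun x hx => (hbox x hx).1.2
  · intro y hy s hs s' hs'
    exact mul_abs_le_of_abs_sub_le (h t y s s' (hin s (Ioo_subset_Icc_self hs) y hy).1.1.1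
      (hin s' (Ioo_subset_Icc_self hs') y hy).1.1.1)
  · intro y hy
    have hd : dist ((t, y) : ℝ × Space n) (t₀, rem k x₀) < η := by
      rw [Prod.dist_eq, max_lt_iff]
      exact ⟨ht'.trans_le (min_le_right _ _), (Metric.mem_ball.1 hy).trans_le (min_le_right _ _)⟩
    obtain ⟨h1, h2⟩ := hηball hd
    have hc : ContinuousOn (fun s => m * φ t (ins k s y)) (Icc (x₀ k - r) (x₀ k + r)) := by
      have h3 : Continuous fun s : ℝ => (t, ins k s y) :=
        continuous_const.prodMk ((continuous_ins k).comp (by fun_prop : Continuous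
          fun s : ℝ => (s, y)))
      exact continuousOn_const.mul (hφ.continuousOn.comp h3.continuousOn
        fun s hs => (hin s hs y hy).1.2)
    obtain ⟨s, hs, hs0⟩ := intermediate_value_Ioo (by linarith) hc (⟨h2, h1⟩ : (0 : ℝ) ∈ Ioo _ _)
    exact ⟨s, hs, (mul_eq_zero.1 hs0).resolve_left hk⟩
  · have hd : DifferentiableAt ℝ (Function.uncurry φ) (t, x) :=
      (hφ.contDiffAt (hU.mem_nhds (hbox x hx).1.2)).differentiableAt (by simp)
    have h1 : ‖fderiv ℝ (φ t) x‖ ≤ ‖fderiv ℝ (Function.uncurry φ) (t, x)‖ := by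
      refine ContinuousLinearMap.opNorm_le_bound _ (norm_nonneg _) fun v => ?_
      rw [fderiv_slice hd]
      refine (ContinuousLinearMap.le_opNorm _ _).trans (le_of_eq ?_)
      simp
    have h2 : ‖∇ (φ t) x‖ = ‖fderiv ℝ (φ t) x‖ := by
      rw [gradient, LinearIsometryEquiv.norm_map]
    rw [h2]
    exact h1.trans (hbox x hx).2.le

/-! ### Level functions of the domain -/

/-- `β` is a defining function of `Ω` on `D`, positive in `Ω`, whose strips have a volume
proportional to their width. -/
structure IsDomainLevel (Ω D : Set (Space d)) (β : Space d → ℝ) : Prop where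
  isOpen : IsOpen D
  smooth : ContDiffOn ℝ ∞ β D
  mem : ∀ x ∈ D, (x ∈ Ω ↔ 0 < β x)
  wall : ∀ x ∈ D, x ∈ frontier Ω → β x = 0 ∧ ∇ β x ≠ 0 ∧
    IsOuterNormal Ω x (-(‖∇ β x‖⁻¹ • ∇ β x))
  strip : ∃ C, 0 ≤ C ∧ ∀ ε, 0 < ε → volume {x ∈ D | β x ∈ Icc ε (2 * ε)} ≤ ENNReal.ofReal (C * ε)

theorem IsDomainLevel.mono {Ω D D' : Set (Space d)} {β : Space d → ℝ} (h : IsDomainLevel Ω D β)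
    (hD' : IsOpen D') (hsub : D' ⊆ D) : IsDomainLevel Ω D' β := by
  refine ⟨hD', h.smooth.mono hsub, fun x hx => h.mem x (hsub hx), fun x hx => h.wall x (hsub hx), ?_⟩
  obtain ⟨C, hC0, hC⟩ := h.strip
  refine ⟨C, hC0, fun ε hε => le_trans (measure_mono ?_) (hC ε hε)⟩
  exact fun x hx => ⟨hsub hx.1, hx.2⟩

theorem IsDomainLevel.nonneg {Ω D : Set (Space d)} {β : Space d → ℝ} (h : IsDomainLevel Ω D β)
    (hΩ : IsOpen Ω) {x : Space d} (hx : x ∈ D) (hxΩ : x ∈ closure Ω) :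
    0 ≤ β x ∧ (β x = 0 → x ∈ frontier Ω) := by
  by_cases hin : x ∈ Ω
  · have := (h.mem x hx).1 hin
    exact ⟨this.le, fun h0 => absurd h0 this.ne'⟩
  · have hfr : x ∈ frontier Ω := by rw [hΩ.frontier_eq]; exact ⟨hxΩ, hin⟩
    exact ⟨(h.wall x hx hfr).1.ge, fun _ => hfr⟩

/-- The strips of a constant function. -/
theorem volume_const_strip_le {D S : Set (Space d)} (hD : volume D < ⊤) (hS : S ⊆ D) {a ε : ℝ}
    (hε : 0 < ε) (ha : a = 1 ∨ a = -1) (hSa : S.Nonempty → a ∈ Icc ε (2 * ε)) :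
    volume S ≤ ENNReal.ofReal (2 * (volume D).toReal * ε) := by
  rcases S.eq_empty_or_nonempty with rfl | hne
  · simp
  -- A non-empty strip forces `1 ≤ 2ε`, so the total volume already is a bound linear in `ε`.
  · have h1 := hSa hne
    rcases ha with rfl | rfl
    · refine (measure_mono hS).trans ?_
      rw [← ENNReal.ofReal_toReal hD.ne]
      refine ENNReal.ofReal_le_ofReal ?_
      rw [ENNReal.toReal_ofReal ENNReal.toReal_nonneg]
      nlinarith [h1.2, ENNReal.toReal_nonneg (a := volume D)]
    · linarith [h1.1]

theorem gradient_neg (g : Space d → ℝ) (x : Space d) : ∇ (fun y => -g y) x = -∇ g x := by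
  rw [gradient, gradient, fderiv_fun_neg, map_neg]

/-- At a boundary point the negative of a defining function serves. Elsewhere a constant does: `1`
inside and `-1` outside, with strips that are empty for small `ε`. Interior and boundary points can
then be treated alike. -/
theorem exists_isDomainLevel {Ω : Set (Space (n + 1))} (hΩ : IsOpen Ω)
    (hs : HasSmoothBoundary Ω) (x₀ : Space (n + 1)) :
    ∃ (D : Set (Space (n + 1))) (β : Space (n + 1) → ℝ), x₀ ∈ D ∧ IsDomainLevel Ω D β := by
  by_cases hx : x₀ ∈ frontier Ω
  · obtain ⟨U, g, hxU, hg⟩ := hs x₀ hx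
    -- A frontier point is a limit of points with `g < 0`, and it is not itself in the open set `Ω`,
    -- so `g` is neither positive nor negative there.
    have hzero : ∀ x ∈ U, x ∈ frontier Ω → g x = 0 := by
      intro x hxU hxf
      rw [hΩ.frontier_eq] at hxf
      refine le_antisymm ?_ (not_lt.1 fun hlt => hxf.2 ((hg.domain x hxU).2 hlt))
      have hc : ContinuousWithinAt g Ω x :=
        (hg.smooth.continuousOn.continuousAt (hg.isOpen.mem_nhds hxU)).continuousWithinAt
      have hne : (𝓝[Ω] x).NeBot := mem_closure_iff_nhdsWithin_neBot.1 hxf.1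
      refine le_of_tendsto hc.tendsto ?_
      filter_upwards [self_mem_nhdsWithin, mem_nhdsWithin_of_mem_nhds (hg.isOpen.mem_nhds hxU)]
        with y hy hyU
      exact ((hg.domain y hyU).1 hy).le
    have hβ : ContDiffOn ℝ ∞ (fun x => -g x) U := hg.smooth.neg
    have hst : ContDiffOn ℝ 1 (Function.uncurry fun (_ : ℝ) x => -g x)
        (Prod.snd ⁻¹' U : Set (ℝ × Space (n + 1))) :=
      (hβ.of_le (by simp)).comp contDiff_snd.contDiffOn fun z hz => hz
    obtain ⟨N, hN, C, hC0, hC⟩ := exists_nhds_volume_strip_le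
      (φ := fun (_ : ℝ) x => -g x) (z₀ := (0, x₀)) (hg.isOpen.preimage continuous_snd) hxU hst
      (by
        rw [gradient_neg]
        exact neg_ne_zero.2 (hg.regular x₀ hxU))
    obtain ⟨D', hD'N, hD'o, hD'⟩ := _root_.mem_nhds_iff.1 hN
    have hmap : Continuous fun x : Space (n + 1) => ((0 : ℝ), x) := by fun_prop
    refine ⟨U ∩ (fun x => ((0 : ℝ), x)) ⁻¹' D', fun x => -g x, ⟨hxU, hD'⟩,
      hg.isOpen.inter (hD'o.preimage hmap), hβ.mono inter_subset_left, ?_, ?_, C, hC0, ?_⟩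
    · intro x hx
      rw [hg.domain x hx.1, neg_pos]
    · intro x hx hxf
      refine ⟨by rw [hzero x hx.1 hxf, neg_zero], ?_, ?_⟩
      · rw [gradient_neg]
        exact neg_ne_zero.2 (hg.regular x hx.1)
      · rw [gradient_neg, norm_neg, smul_neg, neg_neg]
        exact ⟨hxf, U, g, hx.1, hg, rfl⟩
    · intro ε hε
      refine (measure_mono ?_).trans (hC D' hD'N hD'o 0 ε hε)
      rintro x ⟨⟨-, h1⟩, h2⟩
      exact ⟨h1, h2⟩
  · by_cases hxΩ : x₀ ∈ Ω
    · refine ⟨Ω ∩ Metric.ball x₀ 1, fun _ => 1, ⟨hxΩ, Metric.mem_ball_self one_pos⟩,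
        hΩ.inter Metric.isOpen_ball, contDiffOn_const, fun x hx => by simp [hx.1], fun x hx hxf => ?_,
        2 * (volume (Metric.ball x₀ 1)).toReal, by positivity, fun ε hε => ?_⟩
      · rw [hΩ.frontier_eq] at hxf
        exact absurd hx.1 hxf.2
      · exact volume_const_strip_le measure_ball_lt_top (fun x hx => hx.1.2) hε (Or.inl rfl)
          fun ⟨x, hx⟩ => hx.2
    · have hxc : x₀ ∉ closure Ω := fun hc => hx (by rw [hΩ.frontier_eq]; exact ⟨hc, hxΩ⟩)
      refine ⟨(closure Ω)ᶜ ∩ Metric.ball x₀ 1, fun _ => -1, ⟨hxc, Metric.mem_ball_self one_pos⟩,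
        isClosed_closure.isOpen_compl.inter Metric.isOpen_ball, contDiffOn_const,
        fun x hx => ⟨fun h => absurd (subset_closure h) hx.1, fun h => by norm_num at h⟩,
        fun x hx hxf => absurd (frontier_subset_closure hxf) hx.1,
        2 * (volume (Metric.ball x₀ 1)).toReal, by positivity, fun ε hε => ?_⟩
      exact volume_const_strip_le measure_ball_lt_top (fun x hx => hx.1.2) hε (Or.inr rfl)
        fun ⟨x, hx⟩ => hx.2

/-! ### Topology of the phases -/

/-- The index of the other phase. -/
def other (i : Fin 2) : Fin 2 := 1 - i

namespace IsClassicalSolution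

variable {Ω : Set (Space d)} {T σ : ℝ} {b : Fin 2 → ℝ} {Φ : Fin 2 → Space d → ℝ}
  {A : Fin 2 → ℝ → Set (Space d)} {p : Fin 2 → ℝ → Space d → ℝ}

theorem closure_phase_subset (h : IsClassicalSolution Ω T σ b Φ A p) (i : Fin 2) {t : ℝ}
    (ht : t ∈ Icc 0 T) : closure (A i t) ⊆ closure Ω :=
  closure_mono (h.phase_subset i t ht)

theorem interface_subset_closure_phase (i : Fin 2) (t : ℝ) :
    interface A t ⊆ closure (A i t) := by
  intro x hx
  fin_cases i
  · exact frontier_subset_closure hx.1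
  · exact frontier_subset_closure hx.2

theorem interface_subset (h : IsClassicalSolution Ω T σ b Φ A p) {t : ℝ} (ht : t ∈ Icc 0 T) :
    interface A t ⊆ closure Ω :=
  (interface_subset_closure_phase 0 t).trans (h.closure_phase_subset 0 ht)

theorem phase_notMem_interface (h : IsClassicalSolution Ω T σ b Φ A p) (i : Fin 2) {t : ℝ}
    (ht : t ∈ Icc 0 T) {x : Space d} (hx : x ∈ A i t) : x ∉ interface A t := by
  intro hxi
  have h1 : x ∈ frontier (A i t) := by
    fin_cases i
    · exact hxi.1
    · exact hxi.2
  rw [(h.phase_open i t ht).frontier_eq] at h1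
  exact h1.2 hx

theorem phase_cases (h : IsClassicalSolution Ω T σ b Φ A p) (i : Fin 2) {t : ℝ}
    (ht : t ∈ Icc 0 T) {x : Space d} (hx : x ∈ Ω) :
    x ∈ A i t ∨ x ∈ A (other i) t ∨ x ∈ interface A t := by
  have := h.phase_cover t ht hx
  simp only [mem_union] at this
  fin_cases i <;> simp [other] <;> tauto

theorem phase_other_disjoint (h : IsClassicalSolution Ω T σ b Φ A p) (i : Fin 2) {t : ℝ}
    (ht : t ∈ Icc 0 T) {x : Space d} (hx : x ∈ A i t) : x ∉ A (other i) t := by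
  have hd := h.phase_disjoint t ht
  fin_cases i
  · exact fun hx' => disjoint_left.1 hd hx hx'
  · exact fun hx' => disjoint_left.1 hd hx' hx

theorem spaceTime_closure_subset (T : ℝ) (S : ℝ → Set (Space d)) :
    spaceTime T (fun t => closure (S t)) ⊆ closure (spaceTime T S) := by
  rintro ⟨t, x⟩ ⟨ht, hx⟩
  have h1 : Continuous fun y : Space d => (t, y) := by fun_prop
  have h2 : MapsTo (fun y : Space d => (t, y)) (S t) (spaceTime T S) := fun y hy => ⟨ht, hy⟩
  exact map_mem_closure h1 hx h2

/-- One direction is the absence of jumps in time, the other holds because `Γ_t` lies in the closure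
of both phases. As a consequence `Γ` is an intersection of two closed sets of space-time. -/
theorem meet_iff (h : IsClassicalSolution Ω T σ b Φ A p) (i : Fin 2) {z : ℝ × Space d} :
    z ∈ closure (spaceTime T (A i)) ∧ z ∈ closure (spaceTime T (A (other i))) ↔
      z ∈ spaceTime T (interface A) := by
  constructor
  · rintro ⟨h1, h2⟩
    refine h.phase_meet ?_
    fin_cases i
    · exact ⟨h1, h2⟩
    · exact ⟨h2, h1⟩
  · rintro ⟨h1, h2⟩
    exact ⟨spaceTime_closure_subset T _ ⟨h1, interface_subset_closure_phase i _ h2⟩,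
      spaceTime_closure_subset T _ ⟨h1, interface_subset_closure_phase (other i) _ h2⟩⟩

theorem isClosed_spaceTime_interface (h : IsClassicalSolution Ω T σ b Φ A p) :
    IsClosed (spaceTime T (interface A)) := by
  have : spaceTime T (interface A) =
      closure (spaceTime T (A 0)) ∩ closure (spaceTime T (A (other 0))) := by
    ext z; exact (h.meet_iff 0).symm
  rw [this]
  exact isClosed_closure.inter isClosed_closure

/-- Being in a phase is an open condition in space-time relative to `[0,T] × Ω`, although openness
is assumed only at each fixed time. Measurability of the phases and persistence of a phase near a
point follow from this. -/
theorem mem_phase_iff (h : IsClassicalSolution Ω T σ b Φ A p) (i : Fin 2) {t : ℝ} {x : Space d}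
    (ht : t ∈ Icc 0 T) (hx : x ∈ Ω) :
    x ∈ A i t ↔ (t, x) ∉ closure (spaceTime T (A (other i))) := by
  constructor
  · intro hxA hcl
    have : (t, x) ∈ spaceTime T (interface A) :=
      (h.meet_iff i).1 ⟨subset_closure ⟨ht, hxA⟩, hcl⟩
    exact h.phase_notMem_interface i ht hxA this.2
  · intro hcl
    rcases h.phase_cases i ht hx with h1 | h1 | h1
    · exact h1
    · exact absurd (subset_closure (show (t, x) ∈ spaceTime T (A (other i)) from ⟨ht, h1⟩)) hcl
    · exact absurd ((h.meet_iff i).2 ⟨ht, h1⟩).2 hcl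

theorem spaceTime_phase_eq (h : IsClassicalSolution Ω T σ b Φ A p) (i : Fin 2) :
    spaceTime T (A i) = (Icc 0 T ×ˢ Ω) ∩ (closure (spaceTime T (A (other i))))ᶜ := by
  ext ⟨t, x⟩
  constructor
  · rintro ⟨ht, hx⟩
    have hxΩ := h.phase_subset i t ht hx
    exact ⟨⟨ht, hxΩ⟩, (h.mem_phase_iff i ht hxΩ).1 hx⟩
  · rintro ⟨⟨ht, hx⟩, h1⟩
    exact ⟨ht, (h.mem_phase_iff i ht hx).2 h1⟩

theorem measurableSet_spaceTime_phase (h : IsClassicalSolution Ω T σ b Φ A p) (hΩ : IsOpen Ω)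
    (i : Fin 2) : MeasurableSet (spaceTime T (A i)) := by
  rw [h.spaceTime_phase_eq i]
  exact (measurableSet_Icc.prod hΩ.measurableSet).inter isClosed_closure.measurableSet.compl

/-- A space-time limit point of the phase either is also one of the other phase, hence lies on
`Γ_t`, or has a neighbourhood free of the other phase. In that case nearby points of `Ω` at the same
time belong to the phase, and `x` is a limit of such points. -/
theorem isClosed_spaceTime_closure (h : IsClassicalSolution Ω T σ b Φ A p) (i : Fin 2) :
    IsClosed (spaceTime T fun t => closure (A i t)) := by
  refine isClosed_of_closure_subset ?_
  rintro ⟨t, x⟩ hz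
  have hz1 : (t, x) ∈ closure (spaceTime T (A i)) :=
    closure_minimal (spaceTime_closure_subset T (A i)) isClosed_closure hz
  have hcyl : spaceTime T (A i) ⊆ cylinder Ω T := fun z hz =>
    ⟨hz.1, subset_closure (h.phase_subset i _ hz.1 hz.2)⟩
  have hz2 : (t, x) ∈ cylinder Ω T :=
    closure_minimal hcyl (isClosed_Icc.prod isClosed_closure) hz1
  refine ⟨hz2.1, ?_⟩
  by_cases ho : (t, x) ∈ closure (spaceTime T (A (other i)))
  · exact interface_subset_closure_phase i t ((h.meet_iff i).1 ⟨hz1, ho⟩).2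
  · have h1 : Continuous fun y : Space d => (t, y) := by fun_prop
    have h2 : {y | (t, y) ∉ closure (spaceTime T (A (other i)))} ∈ 𝓝 x :=
      (isClosed_closure.isOpen_compl.preimage h1).mem_nhds ho
    rw [mem_closure_iff_nhds]
    intro V hV
    obtain ⟨y, hy1, hy2⟩ := mem_closure_iff_nhds.1 hz2.2 _ (inter_mem hV h2)
    exact ⟨y, hy1.1, (h.mem_phase_iff i hz2.1 hy2).2 hy1.2⟩

theorem isCompact_spaceTime_closure (h : IsClassicalSolution Ω T σ b Φ A p)
    (hΩ : Bornology.IsBounded Ω) (i : Fin 2) :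
    IsCompact (spaceTime T fun t => closure (A i t)) := by
  have hK : IsCompact (cylinder Ω T) := isCompact_Icc.prod hΩ.isCompact_closure
  exact hK.of_isClosed_subset (h.isClosed_spaceTime_closure i) fun z hz =>
    ⟨hz.1, h.closure_phase_subset i hz.1 hz.2⟩

/-- Away from the interface, locally only one of the phases is present. -/
theorem exists_nhds_one_phase (h : IsClassicalSolution Ω T σ b Φ A p) {z : ℝ × Space d}
    (hz : z ∉ spaceTime T (interface A)) :
    ∃ D, IsOpen D ∧ z ∈ D ∧ ∃ i, ∀ t x, (t, x) ∈ D → t ∈ Icc 0 T →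
      x ∉ interface A t ∧ (x ∈ Ω → ∀ j, (x ∈ A j t ↔ j = i)) := by
  have hmain : ∀ i, z ∉ closure (spaceTime T (A (other i))) →
      ∃ D, IsOpen D ∧ z ∈ D ∧ ∃ i, ∀ t x, (t, x) ∈ D → t ∈ Icc 0 T →
      x ∉ interface A t ∧ (x ∈ Ω → ∀ j, (x ∈ A j t ↔ j = i)) := by
    intro i hi
    refine ⟨(closure (spaceTime T (A (other i))))ᶜ, isClosed_closure.isOpen_compl, hi, i,
      fun t x hx ht => ⟨fun hxi => hx ((h.meet_iff i).2 ⟨ht, hxi⟩).2, fun hxΩ j => ?_⟩⟩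
    have hA := (h.mem_phase_iff i ht hxΩ).2 hx
    constructor
    · intro hj
      by_contra hne
      have : j = other i := by
        revert hne; fin_cases i <;> fin_cases j <;> simp [other]
      exact h.phase_other_disjoint i ht hA (this ▸ hj)
    · rintro rfl
      exact hA
  by_cases h1 : z ∈ closure (spaceTime T (A (other 0)))
  · refine hmain 1 fun h2 => hz ((h.meet_iff 0).1 ⟨?_, h1⟩)
    simpa [other] using h2
  · exact hmain 0 h1

end IsClassicalSolution

/-! ### Integration by parts in open sets -/

/-- Fields built from a chart function and a test function supported in the chart become globally
smooth in this way. -/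
theorem contDiff_of_tsupport_subset {E F : Type*} [NormedAddCommGroup E] [NormedSpace ℝ E]
    [NormedAddCommGroup F] [NormedSpace ℝ F] {f : E → F} {U : Set E} {m : WithTop ℕ∞}
    (hU : IsOpen U) (hf : ContDiffOn ℝ m f U) (hs : tsupport f ⊆ U) : ContDiff ℝ m f := by
  refine contDiff_iff_contDiffAt.2 fun x => ?_
  by_cases hx : x ∈ tsupport f
  · exact hf.contDiffAt (hU.mem_nhds (hs hx))
  · exact contDiffAt_const.congr_of_eventuallyEq (notMem_tsupport_iff_eventuallyEq.1 hx)

theorem sum_mul_gradient (q : Space d → ℝ) (x w : Space d) :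
    ∑ k, fderiv ℝ q x (EuclideanSpace.single k 1) * w k = ⟪∇ q x, w⟫_ℝ := by
  rw [PiLp.inner_apply]
  refine Finset.sum_congr rfl fun k _ => ?_
  rw [gradient_apply]
  simp [mul_comm]

theorem div_smul {q : Space d → ℝ} {W : Space d → Space d} {x : Space d}
    (hq : DifferentiableAt ℝ q x) (hW : DifferentiableAt ℝ W x) :
    div (fun y => q y • W y) x = ⟪∇ q x, W x⟫_ℝ + q x * div W x := by
  unfold div
  rw [fderiv_fun_smul hq hW, ← sum_mul_gradient, Finset.mul_sum, ← Finset.sum_add_distrib]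
  refine Finset.sum_congr rfl fun k _ => ?_
  simp [add_comm]

theorem div_eq_zero_of_notMem_tsupport {W : Space d → Space d} {x : Space d}
    (hx : x ∉ tsupport W) : div W x = 0 := by
  have h : fderiv ℝ W x = 0 := by
    have := (tsupport_fderiv_subset ℝ (f := W))
    by_contra hne
    exact hx (this (subset_closure hne))
  simp [div, h]

/-- The vector that represents a linear functional, as a linear map. -/
def rieszCLM (d : ℕ) : StrongDual ℝ (Space d) →L[ℝ] Space d :=
  LinearMap.toContinuousLinearMap
    { toFun := fun L => (InnerProductSpace.toDual ℝ (Space d)).symm L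
      map_add' := fun L M => map_add _ L M
      map_smul' := fun c L => by simp }

/-- In an orthonormal basis both sides are the trace of the second derivative. -/
theorem div_gradient {q : Space d → ℝ} {x : Space d} (hq : ContDiffAt ℝ 2 q x) :
    div (∇ q) x = Laplacian.laplacian q x := by
  rw [InnerProductSpace.laplacian_eq_iteratedFDeriv_orthonormalBasis q
    (EuclideanSpace.basisFun (Fin d) ℝ)]
  unfold div
  refine Finset.sum_congr rfl fun k _ => ?_
  have h1 : DifferentiableAt ℝ (fderiv ℝ q) x :=
    (hq.fderiv_right (m := 1) (by norm_num)).differentiableAt (by simp)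
  have h2 : fderiv ℝ (∇ q) x = (rieszCLM d).comp (fderiv ℝ (fderiv ℝ q) x) :=
    ((rieszCLM d).hasFDerivAt.comp x h1.hasFDerivAt).fderiv
  rw [h2, iteratedFDeriv_two_apply]
  simp only [Matrix.cons_val_zero, Matrix.cons_val_one, EuclideanSpace.basisFun_apply]
  set L := fderiv ℝ (fderiv ℝ q) x (EuclideanSpace.single k 1)
  change ((InnerProductSpace.toDual ℝ (Space d)).symm L) k = L (EuclideanSpace.single k 1)
  rw [← InnerProductSpace.toDual_symm_apply, EuclideanSpace.inner_single_right]
  simp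

/-- Integration by parts without boundary terms. -/
theorem setIntegral_inner_gradient_add_mul_div {S : Set (Space d)} (hS : IsOpen S)
    {q : Space d → ℝ} {W : Space d → Space d} (hq : ContDiffOn ℝ 1 q S) (hW : ContDiffOn ℝ 1 W S)
    (hc : HasCompactSupport fun x => q x • W x) (hs : tsupport (fun x => q x • W x) ⊆ S) :
    ∫ x in S, (⟪∇ q x, W x⟫_ℝ + q x * div W x) = 0 := by
  have h1 := integral_div_eq_zero (contDiff_of_tsupport_subset hS (hq.smul hW) hs) hc
  have h2 : ∫ x in S, div (fun y => q y • W y) x = ∫ x, div (fun y => q y • W y) x :=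
    setIntegral_eq_integral_of_forall_compl_eq_zero fun x hx =>
      div_eq_zero_of_notMem_tsupport fun h => hx (hs h)
  refine Eq.trans ?_ (h2.trans h1)
  refine setIntegral_congr_fun hS.measurableSet fun x hx => ?_
  exact (div_smul ((hq.differentiableOn (by simp)).differentiableAt (hS.mem_nhds hx))
    ((hW.differentiableOn (by simp)).differentiableAt (hS.mem_nhds hx))).symm

theorem contDiffOn_gradient {q : Space d → ℝ} {S : Set (Space d)} (hS : IsOpen S)
    (hq : ContDiffOn ℝ 2 q S) : ContDiffOn ℝ 1 (∇ q) S :=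
  (rieszCLM d).contDiff.comp_contDiffOn (hq.fderiv_of_isOpen hS (m := 1) (by norm_num))

namespace IsClassicalSolution

variable {Ω : Set (Space d)} {T σ : ℝ} {b : Fin 2 → ℝ} {Φ : Fin 2 → Space d → ℝ}
  {A : Fin 2 → ℝ → Set (Space d)} {p : Fin 2 → ℝ → Space d → ℝ}

/-- The velocity is weakly divergence free inside the phases. -/
theorem integral_velocity (h : IsClassicalSolution Ω T σ b Φ A p) (i : Fin 2) {t : ℝ}
    (ht : t ∈ Icc 0 T) {θ : Space d → ℝ} (hθ : ContDiff ℝ 1 θ) (hc : HasCompactSupport θ)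
    (hs : tsupport θ ⊆ A i t) :
    ∫ x in A i t, ⟪velocity (b i) (Φ i) (p i) t x, ∇ θ x⟫_ℝ = 0 := by
  have hA := h.phase_open i t ht
  have hp2 := (h.pressure_regular i).contDiffOn t ht
  have hΦ2 := (h.potential_regular i).contDiffOn t ht
  have hsub : tsupport (fun x => θ x • (∇ (p i t) x + ∇ (Φ i) x)) ⊆ tsupport θ :=
    closure_mono fun x hx => by
      intro h0
      exact hx (by simp [h0])
  have hgp := contDiffOn_gradient hA hp2
  have hgΦ := contDiffOn_gradient hA hΦ2
  have h1 := setIntegral_inner_gradient_add_mul_div hA (q := θ)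
    (W := fun x => ∇ (p i t) x + ∇ (Φ i) x) hθ.contDiffOn (hgp.add hgΦ)
    (hc.mono' ((subset_tsupport _).trans hsub)) (hsub.trans hs)
  have h2 : ∀ x ∈ A i t, ⟪velocity (b i) (Φ i) (p i) t x, ∇ θ x⟫_ℝ = -(b i)⁻¹ *
      (⟪∇ θ x, ∇ (p i t) x + ∇ (Φ i) x⟫_ℝ +
        θ x * div (fun x => ∇ (p i t) x + ∇ (Φ i) x) x) := by
    intro x hx
    have hpx := (hgp.differentiableOn (by simp)).differentiableAt (hA.mem_nhds hx)
    have hΦx := (hgΦ.differentiableOn (by simp)).differentiableAt (hA.mem_nhds hx)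
    -- This is where `-Δpᵢ = ΔΦᵢ` enters.
    have hdiv : div (fun x => ∇ (p i t) x + ∇ (Φ i) x) x = 0 := by
      have h3 : div (fun x => ∇ (p i t) x + ∇ (Φ i) x) x = div (∇ (p i t)) x + div (∇ (Φ i)) x := by
        unfold div
        rw [fderiv_fun_add hpx hΦx, ← Finset.sum_add_distrib]
        rfl
      rw [h3, div_gradient (hp2.contDiffAt (hA.mem_nhds hx)),
        div_gradient (hΦ2.contDiffAt (hA.mem_nhds hx)), ← h.bulk i t ht x hx]
      ring
    rw [hdiv, velocity, inner_neg_left, real_inner_smul_left, real_inner_comm]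
    ring
  rw [setIntegral_congr_fun hA.measurableSet h2, integral_const_mul, h1, mul_zero]

theorem tendsto_inner_of_continuousOn {G : ℝ × Space d → Space d} {S : ℝ → Set (Space d)}
    (hG : ContinuousOn G (spaceTime T fun t => closure (S t))) {t : ℝ} (ht : t ∈ Icc 0 T)
    {x : Space d} (hx : x ∈ closure (S t)) (m : Space d) :
    Tendsto (fun y => ⟪G (t, y), m⟫_ℝ) (𝓝[S t] x) (𝓝 ⟪G (t, x), m⟫_ℝ) := by
  have h1 : ContinuousWithinAt (fun y => G (t, y)) (S t) x := by
    have h2 : ContinuousWithinAt (fun y : Space d => (t, y)) (S t) x := by fun_prop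
    have h3 : ContinuousWithinAt G (spaceTime T fun t => closure (S t)) (t, x) := hG (t, x) ⟨ht, hx⟩
    exact h3.comp h2 fun y hy => ⟨ht, subset_closure hy⟩
  exact (ContinuousWithinAt.inner (𝕜 := ℝ) h1 (continuousWithinAt_const (b := m))).tendsto

/-- The velocity extends continuously to the closure of its phase, moves the interface, and is
tangential to the wall. -/
theorem exists_velocity_extension (h : IsClassicalSolution Ω T σ b Φ A p) (i : Fin 2) :
    ∃ F : ℝ × Space d → Space d, ContinuousOn F (spaceTime T fun t => closure (A i t)) ∧
      (∀ t ∈ Icc 0 T, ∀ x ∈ A i t, F (t, x) = velocity (b i) (Φ i) (p i) t x) ∧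
      (∀ U φ, IsInterfaceChart Ω T A U φ → ∀ t ∈ Icc 0 T, ∀ x ∈ interface A t, (t, x) ∈ U →
        deriv (fun s => φ s x) t + ⟪F (t, x), ∇ (φ t) x⟫_ℝ = 0) ∧
      ∀ t ∈ Icc 0 T, ∀ x ∈ frontier Ω ∩ closure (A i t), ∀ m, IsOuterNormal Ω x m →
        ⟪F (t, x), m⟫_ℝ = 0 := by
  obtain ⟨G₁, hG₁, hG₁'⟩ := (h.pressure_regular i).gradient
  obtain ⟨G₂, hG₂, hG₂'⟩ := (h.potential_regular i).gradient
  obtain ⟨G, hG⟩ : ∃ G : ℝ × Space d → Space d, ∀ z, G z = G₁ z + G₂ z := ⟨_, fun _ => rfl⟩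
  have hGc : ContinuousOn G (spaceTime T fun t => closure (A i t)) :=
    (hG₁.add hG₂).congr fun z _ => hG z
  have hGA : ∀ t ∈ Icc 0 T, ∀ x ∈ A i t, G (t, x) = ∇ (p i t) x + ∇ (Φ i) x :=
    fun t ht x hx => by rw [hG, hG₁' t ht x hx, hG₂' t ht x hx]
  have hFc : ContinuousOn (fun z => -((b i)⁻¹ • G z)) (spaceTime T fun t => closure (A i t)) := by
    fun_prop
  refine ⟨fun z => -((b i)⁻¹ • G z), hFc, fun t ht x hx => ?_,
    fun U φ hφ t ht x hx hxU => ?_, fun t ht x hx m hm => ?_⟩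
  · rw [velocity, ← hGA t ht x hx]
  · have hxc : x ∈ closure (A i t) := interface_subset_closure_phase i t hx
    have hne : (𝓝[A i t] x).NeBot := mem_closure_iff_nhdsWithin_neBot.1 hxc
    have h1 := (tendsto_inner_of_continuousOn hGc ht hxc (-unitNormal φ t x)).const_mul (b i)⁻¹
    have h2 : Tendsto (fun y => (b i)⁻¹ * ⟪G (t, y), -unitNormal φ t x⟫_ℝ) (𝓝[A i t] x)
        (𝓝 (normalSpeed φ t x)) := by
      refine (h.kinematic U φ hφ i t ht x hx hxU).congr' ?_
      filter_upwards [self_mem_nhdsWithin] with y hy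
      rw [real_inner_smul_left, hGA t ht y hy]
    -- The value of the continuous extension and the prescribed trace are limits along the same
    -- filter, which is proper because `x` is in the closure of the phase.
    have h3 := tendsto_nhds_unique h1 h2
    have hn : ‖∇ (φ t) x‖ ≠ 0 := norm_ne_zero_iff.2 (hφ.regular t x hxU)
    rw [unitNormal, normalSpeed, inner_neg_right, real_inner_smul_right, eq_div_iff hn] at h3
    rw [inner_neg_left, real_inner_smul_left]
    have h4 : (b i)⁻¹ * -(‖∇ (φ t) x‖⁻¹ * ⟪G (t, x), ∇ (φ t) x⟫_ℝ) * ‖∇ (φ t) x‖ =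
        -((b i)⁻¹ * ⟪G (t, x), ∇ (φ t) x⟫_ℝ) * (‖∇ (φ t) x‖⁻¹ * ‖∇ (φ t) x‖) := by ring
    rw [h4, inv_mul_cancel₀ hn] at h3
    linarith
  · have hne : (𝓝[A i t] x).NeBot := mem_closure_iff_nhdsWithin_neBot.1 hx.2
    have h1 := tendsto_inner_of_continuousOn hGc ht hx.2 m
    have h2 : Tendsto (fun y => ⟪G (t, y), m⟫_ℝ) (𝓝[A i t] x) (𝓝 0) := by
      refine (h.no_flux i t ht x hx m hm).congr' ?_
      filter_upwards [self_mem_nhdsWithin] with y hy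
      rw [hGA t ht y hy]
    have h3 := tendsto_nhds_unique h1 h2
    rw [inner_neg_left, real_inner_smul_left, h3]
    simp

end IsClassicalSolution

/-! ### The continuity equation near a point -/

/-- On the compact set `{|f| ≥ η}` the function `|g|` has no zero, hence a positive minimum. No
modulus of continuity of `f` is needed, which suits velocities that are merely continuous. -/
theorem exists_forall_abs_le_of_zero {X : Type*} [TopologicalSpace X] {K : Set X} (hK : IsCompact K)
    {f g : X → ℝ} (hf : ContinuousOn f K) (hg : ContinuousOn g K)
    (h : ∀ z ∈ K, g z = 0 → f z = 0) {η : ℝ} (hη : 0 < η) :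
    ∃ δ, 0 < δ ∧ ∀ z ∈ K, |g z| ≤ δ → |f z| ≤ η := by
  set K' := {z ∈ K | η ≤ |f z|} with hK'
  have hK'c : IsCompact K' := by
    have h1 : IsCompact (K ∩ (fun z => |f z|) ⁻¹' Ici η) := by
      obtain ⟨t, ht, hte⟩ := continuousOn_iff_isClosed.1 hf.abs (Ici η) isClosed_Ici
      rw [inter_comm, hte, inter_comm]
      exact hK.inter_right ht
    exact h1
  rcases K'.eq_empty_or_nonempty with he | hne
  · refine ⟨1, one_pos, fun z hz _ => ?_⟩
    by_contra hcon
    have : z ∈ K' := ⟨hz, (not_le.1 hcon).le⟩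
    rw [he] at this
    exact this
  · obtain ⟨z₀, hz₀, hmin⟩ := hK'c.exists_isMinOn hne (hg.abs.mono fun z hz => hz.1)
    have hpos : 0 < |g z₀| := by
      refine abs_pos.2 fun h0 => ?_
      have := h z₀ hz₀.1 h0
      have h2 := hz₀.2
      rw [this, abs_zero] at h2
      linarith
    refine ⟨|g z₀| / 2, by positivity, fun z hz hgz => ?_⟩
    by_contra hcon
    have h3 : |g z₀| ≤ |g z| := hmin (show z ∈ K' from ⟨hz, (not_le.1 hcon).le⟩)
    linarith

/-- A velocity field on the closure of a moving domain that is divergence free inside. -/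
structure IsTransport (T : ℝ) (A : ℝ → Set (Space d)) (F : ℝ × Space d → Space d) : Prop where
  isOpen : ∀ t ∈ Icc 0 T, IsOpen (A t)
  measurable : MeasurableSet (spaceTime T A)
  compact : IsCompact (spaceTime T fun t => closure (A t))
  continuousOn : ContinuousOn F (spaceTime T fun t => closure (A t))
  divFree : ∀ t ∈ Icc 0 T, ∀ θ : Space d → ℝ, ContDiff ℝ 1 θ → HasCompactSupport θ →
    tsupport θ ⊆ A t → ∫ x in A t, ⟪F (t, x), ∇ θ x⟫_ℝ = 0

theorem spaceTime_subset_closure (T : ℝ) (A : ℝ → Set (Space d)) :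
    spaceTime T A ⊆ spaceTime T fun t => closure (A t) :=
  fun _ hz => ⟨hz.1, subset_closure hz.2⟩

/-- Fubini for a domain whose time slices vary, through the indicator of its space-time track. -/
theorem setIntegral_spaceTime {T : ℝ} {A : ℝ → Set (Space d)} (hm : MeasurableSet (spaceTime T A))
    (hA : ∀ t ∈ Icc 0 T, IsOpen (A t)) {f : ℝ × Space d → ℝ} (hf : IntegrableOn f (spaceTime T A)) :
    ∫ z in spaceTime T A, f z = ∫ t in Icc 0 T, ∫ x in A t, f (t, x) := by
  rw [← integral_indicator hm]
  have h1 : Integrable ((spaceTime T A).indicator f) (volume.prod volume) :=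
    (integrable_indicator_iff hm).2 hf
  refine (integral_prod _ h1).trans ?_
  rw [← integral_indicator measurableSet_Icc]
  congr 1
  ext t
  by_cases ht : t ∈ Icc 0 T
  · rw [indicator_of_mem ht, ← integral_indicator (hA t ht).measurableSet]
    congr 1
    ext x
    by_cases hx : x ∈ A t
    · rw [indicator_of_mem hx, indicator_of_mem (show (t, x) ∈ spaceTime T A from ⟨ht, hx⟩)]
    · rw [indicator_of_notMem hx, indicator_of_notMem fun h : (t, x) ∈ spaceTime T A => hx h.2]
  · rw [indicator_of_notMem ht]
    have : ∀ x, (spaceTime T A).indicator f (t, x) = 0 := fun x =>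
      indicator_of_notMem (fun h : (t, x) ∈ spaceTime T A => ht h.1) _
    simp [this]

theorem tsupport_slice_subset (u : ℝ × Space d → ℝ) (t : ℝ) :
    tsupport (fun x => u (t, x)) ⊆ {x | (t, x) ∈ tsupport u} := by
  refine closure_minimal (fun x hx => subset_tsupport u hx) ?_
  exact (isClosed_tsupport u).preimage (by fun_prop : Continuous fun x : Space d => (t, x))

theorem hasCompactSupport_slice {u : ℝ × Space d → ℝ} (hu : HasCompactSupport u) (t : ℝ) :
    HasCompactSupport fun x => u (t, x) := by
  refine HasCompactSupport.intro (hu.image continuous_snd) fun x hx => ?_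
  by_contra hne
  exact hx ⟨(t, x), subset_tsupport u hne, rfl⟩

theorem fderiv_eq_zero_of_notMem_tsupport {E F : Type*} [NormedAddCommGroup E] [NormedSpace ℝ E]
    [NormedAddCommGroup F] [NormedSpace ℝ F] {f : E → F} {x : E} (hx : x ∉ tsupport f) :
    fderiv ℝ f x = 0 := by
  by_contra hne
  exact hx (tsupport_fderiv_subset ℝ (subset_closure hne))

/-- Encodes `∂ₜu + v·∇u` as one directional derivative in space-time, so that the product rule and
the conditions on level functions need no splitting into time and space. -/
theorem fderiv_one_prod {u : ℝ × Space d → ℝ} {t : ℝ} {x v : Space d}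
    (hu : DifferentiableAt ℝ u (t, x)) :
    fderiv ℝ u (t, x) (1, v) = fderiv ℝ u (t, x) (1, 0) + ⟪v, ∇ (fun y => u (t, y)) x⟫_ℝ := by
  have h1 : ((1 : ℝ), v) = (1, 0) + (0, v) := by simp
  rw [h1, map_add, real_inner_comm, inner_gradient_left]
  have := fderiv_slice (φ := fun t y => u (t, y)) (t := t) (x := x) hu v
  rw [this]
  rfl

namespace IsTransport

variable {T : ℝ} {A : ℝ → Set (Space d)} {F : ℝ × Space d → Space d}

theorem continuousOn_fderiv (h : IsTransport T A F) {u : ℝ × Space d → ℝ} (hu : ContDiff ℝ 1 u) :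
    ContinuousOn (fun z => fderiv ℝ u z (1, F z)) (spaceTime T fun t => closure (A t)) := by
  have h1 := (hu.continuous_fderiv (by simp)).continuousOn (s := spaceTime T fun t => closure (A t))
  exact h1.clm_apply (continuousOn_const.prodMk h.continuousOn)

theorem integrableOn_of_continuousOn (h : IsTransport T A F) {f : ℝ × Space d → ℝ}
    (hf : ContinuousOn f (spaceTime T fun t => closure (A t))) : IntegrableOn f (spaceTime T A) :=
  (hf.integrableOn_compact h.compact).mono_set (spaceTime_subset_closure T A)

/-- The fundamental theorem of calculus along each line `x = const`. -/
theorem integral_fderiv_time {u : ℝ × Space d → ℝ} (hT : 0 ≤ T) (hu : ContDiff ℝ 1 u)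
    (hc : HasCompactSupport u) :
    ∫ z in Icc 0 T ×ˢ univ, fderiv ℝ u z (1, 0) = (∫ x, u (T, x)) - ∫ x, u (0, x) := by
  have hcont : Continuous fun z => fderiv ℝ u z (1, 0) := by
    have := hu.continuous_fderiv (by simp)
    fun_prop
  have hint : Integrable fun z => fderiv ℝ u z (1, 0) :=
    hcont.integrable_of_hasCompactSupport
      ((hc.fderiv (𝕜 := ℝ)).comp_left (g := fun L : ℝ × Space d →L[ℝ] ℝ => L (1, 0)) (by simp))
  have hslice : ∀ t, Integrable fun x => u (t, x) := fun t =>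
    (hu.continuous.comp (by fun_prop : Continuous fun x : Space d => (t, x))).integrable_of_hasCompactSupport
      (hasCompactSupport_slice hc t)
  have h1 : (volume : Measure (ℝ × Space d)).restrict (Icc 0 T ×ˢ univ) =
      (volume.restrict (Icc 0 T)).prod volume := by
    rw [Measure.volume_eq_prod, ← Measure.prod_restrict, Measure.restrict_univ]
  rw [h1, integral_prod_symm _ (by rw [← h1]; exact hint.integrableOn), ← integral_sub (hslice T) (hslice 0)]
  congr 1
  ext x
  rw [integral_Icc_eq_integral_Ioc, ← intervalIntegral.integral_of_le hT]
  refine intervalIntegral.integral_eq_sub_of_hasDerivAt (f := fun t => u (t, x)) (fun t _ => ?_) ?_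
  · exact deriv_slice (φ := fun t x => u (t, x)) (hu.differentiable (by simp) (t, x))
  · exact (hcont.comp (by fun_prop : Continuous fun t : ℝ => (t, x))).intervalIntegrable _ _

/-- The continuity equation for test functions that are supported inside the moving domain. -/
theorem integral_of_tsupport (h : IsTransport T A F) (hT : 0 ≤ T) {u : ℝ × Space d → ℝ}
    (hu : ContDiff ℝ 1 u) (hc : HasCompactSupport u)
    (hs : ∀ z ∈ tsupport u, z.1 ∈ Icc 0 T → z.2 ∈ A z.1) :
    ∫ z in spaceTime T A, fderiv ℝ u z (1, F z) =
      (∫ x in A T, u (T, x)) - ∫ x in A 0, u (0, x) := by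
  have hsl : ∀ t ∈ Icc 0 T, ∫ x in A t, u (t, x) = ∫ x, u (t, x) := fun t ht =>
    setIntegral_eq_integral_of_forall_compl_eq_zero fun x hx => by
      by_contra hne
      exact hx (hs (t, x) (subset_tsupport u hne) ht)
  rw [hsl T ⟨hT, le_rfl⟩, hsl 0 ⟨le_rfl, hT⟩, ← integral_fderiv_time hT hu hc]
  have hi : IntegrableOn (fun z => fderiv ℝ u z (1, 0)) (spaceTime T A) := by
    refine h.integrableOn_of_continuousOn (Continuous.continuousOn ?_)
    have := hu.continuous_fderiv (by simp)
    fun_prop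
  -- Within the time interval `u` and its derivative vanish outside the moving domain.
  have h1 : ∫ z in Icc 0 T ×ˢ univ, fderiv ℝ u z (1, 0) =
      ∫ z in spaceTime T A, fderiv ℝ u z (1, 0) := by
    refine (setIntegral_eq_of_subset_of_forall_sdiff_eq_zero (measurableSet_Icc.prod MeasurableSet.univ)
      (fun z hz => ⟨hz.1, mem_univ _⟩) fun z hz => ?_)
    rw [fderiv_eq_zero_of_notMem_tsupport]
    · rfl
    · exact fun hcon => hz.2 ⟨hz.1.1, hs z hcon hz.1.1⟩
  have hsub : IntegrableOn (fun z => fderiv ℝ u z (1, F z) - fderiv ℝ u z (1, 0)) (spaceTime T A) :=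
    (h.integrableOn_of_continuousOn (h.continuousOn_fderiv hu)).sub hi
  rw [h1, ← sub_eq_zero, ← integral_sub (h.integrableOn_of_continuousOn (h.continuousOn_fderiv hu)) hi,
    setIntegral_spaceTime h.measurable h.isOpen hsub]
  -- What remains at time `t` is `F·∇u`, whose integral vanishes because `F` is divergence free.
  refine setIntegral_eq_zero_of_forall_eq_zero fun t ht => ?_
  have h2 : ∀ x, fderiv ℝ u (t, x) (1, F (t, x)) - fderiv ℝ u (t, x) (1, 0) =
      ⟪F (t, x), ∇ (fun y => u (t, y)) x⟫_ℝ := fun x => by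
    rw [fderiv_one_prod (hu.differentiable (by simp) (t, x))]; ring
  simp only [h2]
  exact h.divFree t ht _ (hu.comp (by fun_prop)) (hasCompactSupport_slice hc t)
    ((tsupport_slice_subset u t).trans fun x hx => hs (t, x) hx ht)

end IsTransport

/-- A level function that is transported by the flow on its zero set, with strips of a volume
proportional to their width. -/
structure IsFlowLevel (T : ℝ) (A : ℝ → Set (Space d)) (F : ℝ × Space d → Space d)
    (D : Set (ℝ × Space d)) (a : ℝ × Space d → ℝ) : Prop where
  isOpen : IsOpen D
  smooth : ContDiffOn ℝ 1 a D
  vanish : ∀ z ∈ D, z ∈ (spaceTime T fun t => closure (A t)) → a z = 0 → fderiv ℝ a z (1, F z) = 0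
  strip : ∃ C, 0 ≤ C ∧ ∀ t ∈ Icc 0 T, ∀ ε, 0 < ε →
    volume {x | (t, x) ∈ D ∧ a (t, x) ∈ Icc ε (2 * ε)} ≤ ENNReal.ofReal (C * ε)

namespace IsFlowLevel

variable {T : ℝ} {A : ℝ → Set (Space d)} {F : ℝ × Space d → Space d} {D : Set (ℝ × Space d)}
  {a b : ℝ × Space d → ℝ}

/-- The strips of a flow level function. -/
def layer (T : ℝ) (A : ℝ → Set (Space d)) (D : Set (ℝ × Space d)) (a : ℝ × Space d → ℝ) (ε : ℝ) :
    Set (ℝ × Space d) :=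
  {z | z ∈ spaceTime T A ∧ z ∈ D ∧ a z ∈ Icc ε (2 * ε)}

theorem measurableSet_layer (ha : IsFlowLevel T A F D a) (hA : MeasurableSet (spaceTime T A))
    (ε : ℝ) : MeasurableSet (layer T A D a ε) := by
  have h1 : layer T A D a ε = spaceTime T A ∩ (D ∩ (D.indicator a) ⁻¹' Icc ε (2 * ε)) := by
    ext z
    constructor
    · rintro ⟨h1, h2, h3⟩
      exact ⟨h1, h2, by rw [mem_preimage, indicator_of_mem h2]; exact h3⟩
    · rintro ⟨h1, h2, h3⟩
      rw [mem_preimage, indicator_of_mem h2] at h3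
      exact ⟨h1, h2, h3⟩
  rw [h1]
  exact hA.inter (ha.isOpen.measurableSet.inter (measurable_indicator_of_continuousOn
    ha.isOpen.measurableSet ha.smooth.continuousOn measurableSet_Icc))

theorem exists_volume_layer_le (ha : IsFlowLevel T A F D a) (hT : 0 ≤ T)
    (hA : MeasurableSet (spaceTime T A)) :
    ∃ C, 0 ≤ C ∧ ∀ ε, 0 < ε → volume (layer T A D a ε) ≤ ENNReal.ofReal (C * ε) := by
  obtain ⟨C, hC0, hC⟩ := ha.strip
  refine ⟨C * T, by positivity, fun ε hε => ?_⟩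
  rw [Measure.volume_eq_prod, Measure.prod_apply (ha.measurableSet_layer hA ε)]
  calc ∫⁻ t, volume (Prod.mk t ⁻¹' layer T A D a ε)
      ≤ ∫⁻ t, (Icc 0 T).indicator (fun _ => ENNReal.ofReal (C * ε)) t := by
        refine lintegral_mono fun t => ?_
        by_cases ht : t ∈ Icc 0 T
        · rw [indicator_of_mem ht]
          refine le_trans (measure_mono ?_) (hC t ht ε hε)
          exact fun x hx => ⟨hx.2.1, hx.2.2⟩
        · rw [indicator_of_notMem ht]
          have : Prod.mk t ⁻¹' layer T A D a ε = ∅ := by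
            ext x
            simp only [mem_preimage, mem_empty_iff_false, iff_false]
            exact fun hx => ht hx.1.1
          rw [this]; simp
    _ = ENNReal.ofReal (C * T * ε) := by
        rw [lintegral_indicator measurableSet_Icc, setLIntegral_const, Real.volume_Icc,
          ← ENNReal.ofReal_mul (by positivity)]
        congr 1; ring

/-- The smooth cutoff of a test function along the zero sets of two level functions. -/
def cutoff (a b ψ : ℝ × Space d → ℝ) (ε : ℝ) (z : ℝ × Space d) : ℝ :=
  cut (a z / ε) * cut (b z / ε) * ψ z

theorem tsupport_cutoff_subset (ψ : ℝ × Space d → ℝ) (ε : ℝ) :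
    tsupport (cutoff a b ψ ε) ⊆ tsupport ψ :=
  closure_mono fun z hz h0 => hz (by rw [cutoff, h0, mul_zero])

theorem contDiff_cutoff (ha : IsFlowLevel T A F D a) (hb : IsFlowLevel T A F D b)
    {ψ : ℝ × Space d → ℝ} (hψ : ContDiff ℝ 1 ψ) (hs : tsupport ψ ⊆ D) (ε : ℝ) :
    ContDiff ℝ 1 (cutoff a b ψ ε) := by
  refine contDiff_of_tsupport_subset ha.isOpen ?_ ((tsupport_cutoff_subset ψ ε).trans hs)
  have hcut : ContDiff ℝ 1 cut := contDiff_cut (n := 1)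
  exact ((hcut.comp_contDiffOn (ha.smooth.div_const ε)).mul
    (hcut.comp_contDiffOn (hb.smooth.div_const ε))).mul hψ.contDiffOn

/-- Since `cut` vanishes up to `1` and not merely up to `0`, the cutoff lives on the closed sets `{a
≥ ε}` and `{b ≥ ε}`, so even the closure of its support stays away from the zero levels. -/
theorem levels_of_mem_tsupport_cutoff (ha : IsFlowLevel T A F D a) (hb : IsFlowLevel T A F D b)
    {ψ : ℝ × Space d → ℝ} (hs : tsupport ψ ⊆ D) {ε : ℝ} (hε : 0 < ε) {z : ℝ × Space d}
    (hz : z ∈ tsupport (cutoff a b ψ ε)) : z ∈ D ∧ 0 < a z ∧ 0 < b z := by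
  have hcl : ∀ g : ℝ × Space d → ℝ, ContinuousOn g D → IsClosed (tsupport ψ ∩ g ⁻¹' Ici ε) :=
    fun g hg => (hg.mono hs).preimage_isClosed_of_isClosed (isClosed_tsupport ψ) isClosed_Ici
  have hge : ∀ s : ℝ, cut (s / ε) ≠ 0 → ε ≤ s := by
    intro s hne
    by_contra hlt
    exact hne (cut_of_le ((div_le_one hε).2 (not_le.1 hlt).le))
  have hsub : tsupport (cutoff a b ψ ε) ⊆
      (tsupport ψ ∩ a ⁻¹' Ici ε) ∩ (tsupport ψ ∩ b ⁻¹' Ici ε) := by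
    refine closure_minimal (fun z hz => ?_)
      ((hcl a ha.smooth.continuousOn).inter (hcl b hb.smooth.continuousOn))
    have hne : cut (a z / ε) * cut (b z / ε) * ψ z ≠ 0 := hz
    have h1 := mul_ne_zero_iff.1 hne
    have h2 := mul_ne_zero_iff.1 h1.1
    exact ⟨⟨subset_tsupport ψ h1.2, hge _ h2.1⟩, ⟨subset_tsupport ψ h1.2, hge _ h2.2⟩⟩
  have h := hsub hz
  exact ⟨hs h.1.1, hε.trans_le h.1.2, hε.trans_le h.2.2⟩

theorem fderiv_cutoff (ha : IsFlowLevel T A F D a) (hb : IsFlowLevel T A F D b)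
    {ψ : ℝ × Space d → ℝ} (hψ : ContDiff ℝ 1 ψ) {ε : ℝ} {z : ℝ × Space d} (hz : z ∈ D)
    (v : ℝ × Space d) :
    fderiv ℝ (cutoff a b ψ ε) z v = cut (a z / ε) * cut (b z / ε) * fderiv ℝ ψ z v +
      (ψ z * cut (b z / ε) * (ε⁻¹ * deriv cut (a z / ε)) * fderiv ℝ a z v +
       ψ z * cut (a z / ε) * (ε⁻¹ * deriv cut (b z / ε)) * fderiv ℝ b z v) := by
  have hd : ∀ g : ℝ × Space d → ℝ, ContDiffOn ℝ 1 g D →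
      HasFDerivAt (fun z => cut (g z / ε)) ((deriv cut (g z / ε)) • (ε⁻¹ • fderiv ℝ g z)) z := by
    intro g hg
    have h1 : HasFDerivAt (fun z => g z / ε) (ε⁻¹ • fderiv ℝ g z) z :=
      (((hg.differentiableOn (by simp)).differentiableAt (ha.isOpen.mem_nhds hz)).hasFDerivAt).mul_const ε⁻¹
    exact (hasDerivAt_cut _).comp_hasFDerivAt z h1
  have h2 := ((hd a ha.smooth).mul (hd b hb.smooth)).mul (hψ.differentiable (by simp) z).hasFDerivAt
  have h3 : fderiv ℝ (cutoff a b ψ ε) z = _ := h2.fderiv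
  rw [h3]
  simp only [add_apply, smul_apply, smul_eq_mul, Pi.mul_apply]
  ring

/-- The derivative of `a` along the flow is continuous on a compact set and vanishes where `a` does.
-/
theorem exists_abs_fderiv_le (h : IsTransport T A F) (ha : IsFlowLevel T A F D a)
    {K : Set (ℝ × Space d)} (hK : IsCompact K) (hKD : K ⊆ D) {η : ℝ} (hη : 0 < η) :
    ∃ δ, 0 < δ ∧ ∀ z ∈ K, z ∈ spaceTime T A → |a z| ≤ δ → |fderiv ℝ a z (1, F z)| ≤ η := by
  have hKc : IsCompact (K ∩ spaceTime T fun t => closure (A t)) := hK.inter_right h.compact.isClosed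
  have h1 : ContinuousOn (fun z => fderiv ℝ a z (1, F z)) (K ∩ spaceTime T fun t => closure (A t)) := by
    have h2 := (ha.smooth.continuousOn_fderiv_of_isOpen ha.isOpen le_rfl).mono
      (inter_subset_left.trans hKD : K ∩ (spaceTime T fun t => closure (A t)) ⊆ D)
    exact h2.clm_apply (continuousOn_const.prodMk (h.continuousOn.mono inter_subset_right))
  obtain ⟨δ, hδ, hb⟩ := exists_forall_abs_le_of_zero hKc h1
    (ha.smooth.continuousOn.mono (inter_subset_left.trans hKD))
    (fun z hz => ha.vanish z (hKD hz.1) hz.2) hη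
  exact ⟨δ, hδ, fun z hz hzA => hb z ⟨hz, spaceTime_subset_closure T A hzA⟩⟩

theorem abs_mul_deriv_cut_le {ψ c s L M C η ε : ℝ} (hε : 0 < ε) (hM : |ψ| ≤ M) (hc : |c| ≤ 1)
    (hC : ∀ s, |deriv cut s| ≤ C) (hL : ψ ≠ 0 → s ∈ Icc ε (2 * ε) → |L| ≤ η) {S : Prop} [Decidable S]
    (hS : s ∈ Icc ε (2 * ε) → S) (hη : 0 ≤ η) :
    |ψ * c * (ε⁻¹ * deriv cut (s / ε)) * L| ≤ if S then M * C * η * ε⁻¹ else 0 := by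
  have hM0 : 0 ≤ M := (abs_nonneg _).trans hM
  have hC0 : 0 ≤ C := (abs_nonneg _).trans (hC 0)
  by_cases hψ : ψ = 0
  · rw [hψ]; simp only [zero_mul, abs_zero]; split_ifs <;> positivity
  by_cases hs : s ∈ Icc ε (2 * ε)
  · rw [if_pos (hS hs), abs_mul, abs_mul, abs_mul, abs_mul, abs_of_pos (inv_pos.2 hε)]
    calc |ψ| * |c| * (ε⁻¹ * |deriv cut (s / ε)|) * |L| ≤ M * 1 * (ε⁻¹ * C) * η := by
          gcongr
          · exact hC _
          · exact hL hψ hs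
      _ = M * C * η * ε⁻¹ := by ring
  · rw [deriv_cut_div_eq_zero hε hs]
    simp only [mul_zero, zero_mul, abs_zero]
    split_ifs <;> positivity

/-- Differentiating the two cutoffs costs a factor `ε⁻¹`, but only in the two layers, and there the
factor `∂ₜa + F·∇a` (or the same for `b`) is at most `η` once `ε` is small. The constant `K` does
not depend on `η`. -/
theorem abs_fderiv_cutoff_sub_le (h : IsTransport T A F) (ha : IsFlowLevel T A F D a)
    (hb : IsFlowLevel T A F D b) {ψ : ℝ × Space d → ℝ} (hψ : ContDiff ℝ 1 ψ)
    (hc : HasCompactSupport ψ) (hs : tsupport ψ ⊆ D) :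
    ∃ K, 0 ≤ K ∧ ∀ η, 0 < η → ∀ᶠ ε in 𝓝[>] (0 : ℝ), ∀ z ∈ spaceTime T A,
      |fderiv ℝ (cutoff a b ψ ε) z (1, F z) -
        cut (D.indicator a z / ε) * cut (D.indicator b z / ε) * fderiv ℝ ψ z (1, F z)| ≤
      (layer T A D a ε).indicator (fun _ => K * η * ε⁻¹) z +
        (layer T A D b ε).indicator (fun _ => K * η * ε⁻¹) z := by
  classical
  obtain ⟨M, hM⟩ := hψ.continuous.bounded_above_of_compact_support hc
  obtain ⟨C, hC0, hC⟩ := exists_bound_deriv_cut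
  have hM0 : 0 ≤ M := (norm_nonneg _).trans (hM 0)
  refine ⟨M * C, by positivity, fun η hη => ?_⟩
  obtain ⟨δ₁, hδ₁, h₁⟩ := exists_abs_fderiv_le h ha hc hs hη
  obtain ⟨δ₂, hδ₂, h₂⟩ := exists_abs_fderiv_le h hb hc hs hη
  have hev : Ioo (0 : ℝ) (min δ₁ δ₂ / 2) ∈ 𝓝[>] (0 : ℝ) :=
    Ioo_mem_nhdsGT (by have := lt_min hδ₁ hδ₂; linarith)
  filter_upwards [hev] with ε hε z hz
  have hε0 : 0 < ε := hε.1
  by_cases hzD : z ∈ D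
  · rw [fderiv_cutoff ha hb hψ hzD, indicator_of_mem hzD, indicator_of_mem hzD, add_sub_cancel_left]
    have habs : ∀ s δ, min δ₁ δ₂ ≤ δ → s ∈ Icc ε (2 * ε) → |s| ≤ δ := by
      intro s δ hδ hs'
      rw [abs_of_pos (hε0.trans_le hs'.1)]
      linarith [hs'.2, hε.2]
    refine (abs_add_le _ _).trans (add_le_add ?_ ?_)
    · refine (abs_mul_deriv_cut_le (S := z ∈ layer T A D a ε) hε0 (hM z) (abs_cut_le_one _) hC
        (fun hne hI => h₁ z (subset_tsupport ψ hne) hz (habs _ _ (min_le_left _ _) hI))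
        (fun hI => ⟨hz, hzD, hI⟩) hη.le).trans ?_
      rw [indicator_apply]
    · refine (abs_mul_deriv_cut_le (S := z ∈ layer T A D b ε) hε0 (hM z) (abs_cut_le_one _) hC
        (fun hne hI => h₂ z (subset_tsupport ψ hne) hz (habs _ _ (min_le_right _ _) hI))
        (fun hI => ⟨hz, hzD, hI⟩) hη.le).trans ?_
      rw [indicator_apply]
  · rw [fderiv_eq_zero_of_notMem_tsupport fun hcon => hzD (hs (tsupport_cutoff_subset ψ ε hcon)),
      fderiv_eq_zero_of_notMem_tsupport fun hcon => hzD (hs hcon)]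
    simp only [zero_apply, mul_zero, sub_zero, abs_zero]
    exact add_nonneg (indicator_nonneg (fun _ _ => by positivity) _)
      (indicator_nonneg (fun _ _ => by positivity) _)

theorem setIntegral_indicator_layer_le (ha : IsFlowLevel T A F D a)
    (hA : MeasurableSet (spaceTime T A)) {C ε c : ℝ} (hC : 0 ≤ C) (hε : 0 < ε) (hc : 0 ≤ c)
    (hv : volume (layer T A D a ε) ≤ ENNReal.ofReal (C * ε)) :
    Integrable ((layer T A D a ε).indicator fun _ => c) (volume.restrict (spaceTime T A)) ∧
    ∫ z in spaceTime T A, (layer T A D a ε).indicator (fun _ => c) z ≤ C * ε * c := by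
  have hm := ha.measurableSet_layer hA ε
  have hsub : layer T A D a ε ⊆ spaceTime T A := fun z hz => hz.1
  have hfin : volume (layer T A D a ε) < ⊤ := hv.trans_lt ENNReal.ofReal_lt_top
  constructor
  · refine (integrable_indicator_iff hm).2 ?_
    refine integrableOn_const ((Measure.restrict_apply_le _ _).trans_lt hfin).ne
  · rw [setIntegral_indicator hm, inter_eq_self_of_subset_right hsub, setIntegral_const, smul_eq_mul]
    refine mul_le_mul_of_nonneg_right ?_ hc
    exact ENNReal.toReal_le_of_le_ofReal (by positivity) hv

/-- The error of size `K η / ε` lives on layers of volume `O(ε)`, so it is `O(η)` with `η`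
arbitrary. The main term converges by dominated convergence because both level functions are
positive in the phase. -/
theorem tendsto_integral_fderiv_cutoff (h : IsTransport T A F) (hT : 0 ≤ T)
    (ha : IsFlowLevel T A F D a) (hb : IsFlowLevel T A F D b)
    (hpos : ∀ z ∈ D, z ∈ spaceTime T A → 0 < a z ∧ 0 < b z)
    {ψ : ℝ × Space d → ℝ} (hψ : ContDiff ℝ 1 ψ) (hc : HasCompactSupport ψ) (hs : tsupport ψ ⊆ D) :
    Tendsto (fun ε => ∫ z in spaceTime T A, fderiv ℝ (cutoff a b ψ ε) z (1, F z)) (𝓝[>] 0)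
      (𝓝 (∫ z in spaceTime T A, fderiv ℝ ψ z (1, F z))) := by
  set L : ℝ × Space d → ℝ := fun z => fderiv ℝ ψ z (1, F z) with hL
  have hLi : IntegrableOn L (spaceTime T A) :=
    h.integrableOn_of_continuousOn (h.continuousOn_fderiv hψ)
  have hD := ha.isOpen.measurableSet
  have hcm : Measurable cut := (contDiff_cut (n := 1)).continuous.measurable
  set G : ℝ → ℝ × Space d → ℝ :=
    fun ε z => cut (D.indicator a z / ε) * cut (D.indicator b z / ε) * L z with hG
  have hGm : ∀ ε, AEStronglyMeasurable (G ε) (volume.restrict (spaceTime T A)) := by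
    intro ε
    refine AEStronglyMeasurable.mul (Measurable.aestronglyMeasurable ?_) hLi.aestronglyMeasurable
    exact (hcm.comp ((measurable_indicator_of_continuousOn hD ha.smooth.continuousOn).div_const ε)).mul
      (hcm.comp ((measurable_indicator_of_continuousOn hD hb.smooth.continuousOn).div_const ε))
  have hGb : ∀ ε z, ‖G ε z‖ ≤ ‖L z‖ := by
    intro ε z
    rw [hG]
    simp only [norm_mul]
    have h1 : ‖cut (D.indicator a z / ε)‖ ≤ 1 := abs_cut_le_one _
    have h2 : ‖cut (D.indicator b z / ε)‖ ≤ 1 := abs_cut_le_one _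
    calc _ ≤ 1 * 1 * ‖L z‖ := by gcongr
      _ = ‖L z‖ := by ring
  have hGi : ∀ ε, IntegrableOn (G ε) (spaceTime T A) := fun ε =>
    hLi.norm.mono' (hGm ε) (ae_of_all _ (hGb ε))
  have hlimG : Tendsto (fun ε => ∫ z in spaceTime T A, G ε z) (𝓝[>] 0)
      (𝓝 (∫ z in spaceTime T A, L z)) := by
    refine tendsto_integral_filter_of_dominated_convergence (fun z => ‖L z‖)
      (Eventually.of_forall hGm) (Eventually.of_forall fun ε => ae_of_all _ (hGb ε)) hLi.norm ?_
    refine (ae_restrict_iff' h.measurable).2 (ae_of_all _ fun z hz => ?_)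
    by_cases hzD : z ∈ D
    · have h1 := tendsto_cut_div (D.indicator a z)
      have h2 := tendsto_cut_div (D.indicator b z)
      rw [if_pos (by rw [indicator_of_mem hzD]; exact (hpos z hzD hz).1)] at h1
      rw [if_pos (by rw [indicator_of_mem hzD]; exact (hpos z hzD hz).2)] at h2
      simpa using (h1.mul h2).mul_const (L z)
    · have : L z = 0 := by
        rw [hL]
        simp only
        rw [fderiv_eq_zero_of_notMem_tsupport fun hcon => hzD (hs hcon)]
        rfl
      simp [hG, this]
  have hHi : ∀ ε, IntegrableOn (fun z => fderiv ℝ (cutoff a b ψ ε) z (1, F z)) (spaceTime T A) :=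
    fun ε => h.integrableOn_of_continuousOn (h.continuousOn_fderiv (contDiff_cutoff ha hb hψ hs ε))
  obtain ⟨K, hK0, hK⟩ := abs_fderiv_cutoff_sub_le h ha hb hψ hc hs
  obtain ⟨Ca, hCa0, hCa⟩ := ha.exists_volume_layer_le hT h.measurable
  obtain ⟨Cb, hCb0, hCb⟩ := hb.exists_volume_layer_le hT h.measurable
  have hdiff : Tendsto (fun ε => (∫ z in spaceTime T A, fderiv ℝ (cutoff a b ψ ε) z (1, F z)) -
      ∫ z in spaceTime T A, G ε z) (𝓝[>] 0) (𝓝 0) := by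
    rw [Metric.tendsto_nhds]
    intro r hr
    -- Chosen so that the total error `(Ca + Cb) K η` is less than `r`.
    set η := r / (2 * ((Ca + Cb) * K + 1)) with hη
    have hden : 0 < (Ca + Cb) * K + 1 := by positivity
    have hη0 : 0 < η := by positivity
    filter_upwards [hK η hη0, self_mem_nhdsWithin] with ε hε hε0
    have hε0 : 0 < ε := hε0
    have hc0 : 0 ≤ K * η * ε⁻¹ := by positivity
    obtain ⟨hai, hal⟩ := ha.setIntegral_indicator_layer_le h.measurable hCa0 hε0 hc0 (hCa ε hε0)
    obtain ⟨hbi, hbl⟩ := hb.setIntegral_indicator_layer_le h.measurable hCb0 hε0 hc0 (hCb ε hε0)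
    rw [dist_zero_right, ← integral_sub (hHi ε) (hGi ε)]
    have hab : Integrable (fun z => (layer T A D a ε).indicator (fun _ => K * η * ε⁻¹) z +
        (layer T A D b ε).indicator (fun _ => K * η * ε⁻¹) z) (volume.restrict (spaceTime T A)) :=
      hai.add hbi
    have h1 := norm_integral_le_of_norm_le
      (f := fun z => fderiv ℝ (cutoff a b ψ ε) z (1, F z) - G ε z) hab
      ((ae_restrict_iff' h.measurable).2 (ae_of_all volume fun z hz => hε z hz))
    refine h1.trans_lt ?_
    have h2 : ∫ z in spaceTime T A, ((layer T A D a ε).indicator (fun _ => K * η * ε⁻¹) z +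
        (layer T A D b ε).indicator (fun _ => K * η * ε⁻¹) z) ≤
        Ca * ε * (K * η * ε⁻¹) + Cb * ε * (K * η * ε⁻¹) := by
      rw [integral_add hai hbi]
      exact add_le_add hal hbl
    refine h2.trans_lt ?_
    have h3 : Ca * ε * (K * η * ε⁻¹) + Cb * ε * (K * η * ε⁻¹) = ((Ca + Cb) * K) * η := by
      field_simp
    rw [h3, hη, mul_div_assoc', div_lt_iff₀ (by positivity)]
    nlinarith [mul_nonneg (add_nonneg hCa0 hCb0) hK0]
  have := hdiff.add hlimG
  simpa using this

/-- The continuity equation near a point, for a domain that is described by two level functions. -/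
theorem integral_fderiv_eq (h : IsTransport T A F) (hT : 0 ≤ T)
    (ha : IsFlowLevel T A F D a) (hb : IsFlowLevel T A F D b)
    (hmem : ∀ z ∈ D, z.1 ∈ Icc 0 T → (z.2 ∈ A z.1 ↔ 0 < a z ∧ 0 < b z))
    {ψ : ℝ × Space d → ℝ} (hψ : ContDiff ℝ 1 ψ) (hc : HasCompactSupport ψ) (hs : tsupport ψ ⊆ D) :
    ∫ z in spaceTime T A, fderiv ℝ ψ z (1, F z) =
      (∫ x in A T, ψ (T, x)) - ∫ x in A 0, ψ (0, x) := by
  have h1 := tendsto_integral_fderiv_cutoff h hT ha hb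
    (fun z hz hzA => (hmem z hz hzA.1).1 hzA.2) hψ hc hs
  have hlim : ∀ t ∈ Icc 0 T, Tendsto (fun ε => ∫ x in A t, cutoff a b ψ ε (t, x)) (𝓝[>] 0)
      (𝓝 (∫ x in A t, ψ (t, x))) := by
    intro t ht
    have hpt : Continuous fun x : Space d => (t, x) := by fun_prop
    have hi : Integrable fun x => ψ (t, x) :=
      (hψ.continuous.comp hpt).integrable_of_hasCompactSupport (hasCompactSupport_slice hc t)
    refine tendsto_integral_filter_of_dominated_convergence (fun x => ‖ψ (t, x)‖)
      (Eventually.of_forall fun ε =>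
        ((contDiff_cutoff ha hb hψ hs ε).continuous.comp hpt).aestronglyMeasurable)
      (Eventually.of_forall fun ε => ae_of_all _ fun x => ?_) hi.norm.integrableOn ?_
    · simp only [cutoff, norm_mul]
      have h1 : ‖cut (a (t, x) / ε)‖ ≤ 1 := abs_cut_le_one _
      have h2 : ‖cut (b (t, x) / ε)‖ ≤ 1 := abs_cut_le_one _
      calc _ ≤ 1 * 1 * ‖ψ (t, x)‖ := by gcongr
        _ = ‖ψ (t, x)‖ := by ring
    · refine (ae_restrict_iff' (h.isOpen t ht).measurableSet).2 (ae_of_all _ fun x hx => ?_)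
      by_cases hzD : (t, x) ∈ D
      · have h3 := tendsto_cut_div (a (t, x))
        have h4 := tendsto_cut_div (b (t, x))
        have h5 := (hmem _ hzD ht).1 hx
        rw [if_pos h5.1] at h3
        rw [if_pos h5.2] at h4
        simpa [cutoff] using (h3.mul h4).mul_const (ψ (t, x))
      · have : ψ (t, x) = 0 := by
          by_contra hne
          exact hzD (hs (subset_tsupport ψ hne))
        simp [cutoff, this]
  have h2 := (hlim T ⟨hT, le_rfl⟩).sub (hlim 0 ⟨le_rfl, hT⟩)
  -- For each `ε` the cutoff is supported inside the phase, so the identity holds before the limit;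
  -- both sides converge.
  refine tendsto_nhds_unique (h1.congr' ?_) h2
  filter_upwards [self_mem_nhdsWithin] with ε hε
  refine h.integral_of_tsupport hT (contDiff_cutoff ha hb hψ hs ε)
    (hc.mono' (subset_closure.trans (tsupport_cutoff_subset ψ ε))) fun z hz ht => ?_
  have h3 := levels_of_mem_tsupport_cutoff ha hb hs hε hz
  exact (hmem z h3.1 ht).2 h3.2

end IsFlowLevel

/-! ### Smooth partitions of unity -/

/-- The partition is taken subordinate on a larger compact set, so that the sum equals `1` on a
neighbourhood of `K` and may be differentiated on `K`. Intersecting with unit balls gives compact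
supports. -/
theorem exists_smooth_partition {E : Type*} [NormedAddCommGroup E] [NormedSpace ℝ E]
    [FiniteDimensional ℝ E] {K : Set E} (hK : IsCompact K) {U : E → Set E}
    (hU : ∀ x ∈ K, U x ∈ 𝓝 x) :
    ∃ (s : Finset E) (η : E → E → ℝ), (∀ x ∈ s, x ∈ K) ∧
      (∀ x, ContDiff ℝ ∞ (η x)) ∧ (∀ x ∈ s, HasCompactSupport (η x) ∧ tsupport (η x) ⊆ U x) ∧
      (∀ x y, 0 ≤ η x y) ∧ ∃ V, IsOpen V ∧ K ⊆ V ∧ ∀ y ∈ V, ∑ x ∈ s, η x y = 1 := by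
  classical
  set W : E → Set E := fun x => interior (U x) ∩ Metric.ball x 1 with hW
  have hWo : ∀ x, IsOpen (W x) := fun x => isOpen_interior.inter Metric.isOpen_ball
  obtain ⟨s, hsK, hs⟩ := hK.elim_nhds_subcover W fun x hx =>
    inter_mem (interior_mem_nhds.2 (hU x hx)) (Metric.ball_mem_nhds x one_pos)
  obtain ⟨K', hK', hKK', hK's⟩ := exists_compact_between hK
    (isOpen_biUnion fun x (_ : x ∈ s) => hWo x) hs
  obtain ⟨f, hf⟩ := SmoothPartitionOfUnity.exists_isSubordinate (modelWithCornersSelf ℝ E)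
    hK'.isClosed (fun x : s => W x) (fun x => hWo x) (by
      intro y hy
      obtain ⟨x, hx, hyx⟩ := mem_iUnion₂.1 (hK's hy)
      exact mem_iUnion.2 ⟨⟨x, hx⟩, hyx⟩)
  refine ⟨s, fun x => if hx : x ∈ s then f ⟨x, hx⟩ else 0, hsK, fun x => ?_, fun x hx => ?_,
    fun x y => ?_, interior K', isOpen_interior, hKK', fun y hy => ?_⟩
  · dsimp only
    split_ifs with hx
    · exact (f ⟨x, hx⟩).contMDiff.contDiff
    · exact contDiff_const
  · simp only [hx, dif_pos]
    have h1 : tsupport (f ⟨x, hx⟩) ⊆ W x := hf ⟨x, hx⟩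
    refine ⟨?_, h1.trans (inter_subset_left.trans interior_subset)⟩
    exact Metric.isCompact_of_isClosed_isBounded (isClosed_tsupport _)
      (Metric.isBounded_ball.subset (h1.trans inter_subset_right))
  · dsimp only
    split_ifs with hx
    · exact f.nonneg ⟨x, hx⟩ y
    · exact le_rfl
  · have h1 := f.sum_eq_one (interior_subset hy)
    rw [finsum_eq_sum_of_fintype] at h1
    rw [← h1, ← Finset.sum_coe_sort s]
    exact Finset.sum_congr rfl fun x _ => by simp

/-! ### The continuity equation -/

namespace IsFlowLevel

variable {T : ℝ} {A : ℝ → Set (Space d)} {F : ℝ × Space d → Space d} {D : Set (ℝ × Space d)}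
  {a b : ℝ × Space d → ℝ}

theorem mono (ha : IsFlowLevel T A F D a) {D' : Set (ℝ × Space d)} (hD' : IsOpen D')
    (hsub : D' ⊆ D) : IsFlowLevel T A F D' a := by
  refine ⟨hD', ha.smooth.mono hsub, fun z hz => ha.vanish z (hsub hz), ?_⟩
  obtain ⟨C, hC0, hC⟩ := ha.strip
  refine ⟨C, hC0, fun t ht ε hε => le_trans (measure_mono ?_) (hC t ht ε hε)⟩
  exact fun x hx => ⟨hsub hx.1, hx.2⟩

end IsFlowLevel

/-- The identity is linear in `ψ`, so a partition of unity on the compact closure of the space-time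
track reduces it to the local version. -/
theorem IsTransport.integral_fderiv_eq {T : ℝ} {A : ℝ → Set (Space d)} {F : ℝ × Space d → Space d}
    (h : IsTransport T A F) (hT : 0 ≤ T)
    (hloc : ∀ z, ∃ D a b, z ∈ D ∧ IsFlowLevel T A F D a ∧ IsFlowLevel T A F D b ∧
      ∀ z ∈ D, z.1 ∈ Icc 0 T → (z.2 ∈ A z.1 ↔ 0 < a z ∧ 0 < b z))
    {ψ : ℝ × Space d → ℝ} (hψ : ContDiff ℝ 1 ψ) :
    ∫ z in spaceTime T A, fderiv ℝ ψ z (1, F z) =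
      (∫ x in A T, ψ (T, x)) - ∫ x in A 0, ψ (0, x) := by
  choose D a b hzD ha hb hmem using hloc
  obtain ⟨s, η, -, hη, hηs, -, V, hVo, hKV, hsum⟩ := exists_smooth_partition h.compact
    (U := D) fun z _ => (ha z).isOpen.mem_nhds (hzD z)
  have hη1 : ∀ x, ContDiff ℝ 1 (η x) := fun x => (hη x).of_le (by simp)
  set u : ℝ × Space d → ℝ × Space d → ℝ := fun j z => η j z * ψ z with hu
  have hu1 : ∀ j, ContDiff ℝ 1 (u j) := fun j => (hη1 j).mul hψ
  have huc : ∀ j ∈ s, HasCompactSupport (u j) := fun j hj => (hηs j hj).1.mul_right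
  have heq : ∀ z ∈ V, ∑ j ∈ s, u j z = ψ z := by
    intro z hz
    rw [hu]
    simp only
    rw [← Finset.sum_mul, hsum z hz, one_mul]
  have hfd : ∀ z ∈ spaceTime T A, fderiv ℝ ψ z (1, F z) = ∑ j ∈ s, fderiv ℝ (u j) z (1, F z) := by
    intro z hz
    have h1 : ψ =ᶠ[𝓝 z] fun z => ∑ j ∈ s, u j z := by
      filter_upwards [hVo.mem_nhds (hKV (spaceTime_subset_closure T A hz))] with y hy
      rw [heq y hy]
    rw [h1.fderiv_eq, fderiv_fun_sum fun j _ => (hu1 j).differentiable (by simp) z, sum_apply]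
  have hpt : ∀ t : ℝ, Continuous fun x : Space d => (t, x) := fun t => by fun_prop
  have hsl : ∀ t ∈ Icc 0 T, ∫ x in A t, ψ (t, x) = ∑ j ∈ s, ∫ x in A t, u j (t, x) := by
    intro t ht
    rw [← integral_finsetSum]
    · refine setIntegral_congr_fun (h.isOpen t ht).measurableSet fun x hx => ?_
      have hz : (t, x) ∈ spaceTime T A := ⟨ht, hx⟩
      exact (heq _ (hKV (spaceTime_subset_closure T A hz))).symm
    · exact fun j hj => (((hu1 j).continuous.comp (hpt t)).integrable_of_hasCompactSupport
        (hasCompactSupport_slice (huc j hj) t)).integrableOn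
  rw [setIntegral_congr_fun h.measurable hfd, integral_finsetSum s fun j _ =>
    h.integrableOn_of_continuousOn (h.continuousOn_fderiv (hu1 j)), hsl T ⟨hT, le_rfl⟩,
    hsl 0 ⟨le_rfl, hT⟩, ← Finset.sum_sub_distrib]
  refine Finset.sum_congr rfl fun j hj => ?_
  refine IsFlowLevel.integral_fderiv_eq h hT (ha j) (hb j) (hmem j) (hu1 j) (huc j hj)
    (Subset.trans ?_ (hηs j hj).2)
  exact closure_mono fun z hz h0 => hz (by rw [hu]; simp only; rw [h0, zero_mul])

/-- The sign of the level functions of the interface in the `i`-th phase. -/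
def phaseSign (i : Fin 2) : ℝ := if i = 0 then 1 else -1

theorem phaseSign_ne_zero (i : Fin 2) : phaseSign i ≠ 0 := by
  unfold phaseSign; split_ifs <;> norm_num

theorem IsInterfaceChart.mem_phase {Ω : Set (Space d)} {T : ℝ} {A : Fin 2 → ℝ → Set (Space d)}
    {U : Set (ℝ × Space d)} {φ : ℝ → Space d → ℝ} (hφ : IsInterfaceChart Ω T A U φ) (i : Fin 2)
    {t : ℝ} {x : Space d} (hU : (t, x) ∈ U) (ht : t ∈ Icc 0 T) (hx : x ∈ Ω) :
    x ∈ A i t ↔ 0 < phaseSign i * φ t x := by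
  fin_cases i
  · simpa [phaseSign] using hφ.phase_one t x hU ht hx
  · simpa [phaseSign] using hφ.phase_two t x hU ht hx

theorem gradient_const_mul (c : ℝ) {g : Space d → ℝ} {x : Space d} (hg : DifferentiableAt ℝ g x) :
    ∇ (fun y => c * g y) x = c • ∇ g x := by
  ext k
  rw [gradient_apply, PiLp.smul_apply, gradient_apply, fderiv_const_mul hg]
  rfl

/-- The wall does not move, so the derivative of its level function along `(1, F)` is `F·∇β`, a
multiple of the normal component of `F`; the no-flux condition makes it vanish. -/
theorem IsDomainLevel.isFlowLevel {Ω : Set (Space d)} (hΩ : IsOpen Ω) {D : Set (Space d)}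
    {β : Space d → ℝ} (hβ : IsDomainLevel Ω D β) {T : ℝ} {A : ℝ → Set (Space d)}
    {F : ℝ × Space d → Space d} (hA : ∀ t ∈ Icc 0 T, closure (A t) ⊆ closure Ω)
    (hF : ∀ t ∈ Icc 0 T, ∀ x ∈ frontier Ω ∩ closure (A t), ∀ m, IsOuterNormal Ω x m →
        ⟪F (t, x), m⟫_ℝ = 0) :
    IsFlowLevel T A F (Prod.snd ⁻¹' D) fun z => β z.2 := by
  refine ⟨hβ.isOpen.preimage continuous_snd,
    (hβ.smooth.of_le (by simp)).comp contDiff_snd.contDiffOn fun z hz => hz,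
    fun z hz hzA h0 => ?_, ?_⟩
  · have hz : z.2 ∈ D := hz
    have hfr := (hβ.nonneg hΩ hz (hA _ hzA.1 hzA.2)).2 h0
    obtain ⟨-, hne, hn⟩ := hβ.wall z.2 hz hfr
    have h1 := hF z.1 hzA.1 z.2 ⟨hfr, hzA.2⟩ _ hn
    rw [inner_neg_right, real_inner_smul_right, neg_eq_zero, mul_eq_zero] at h1
    have h2 := h1.resolve_left (inv_ne_zero (norm_ne_zero_iff.2 hne))
    have h3 : HasFDerivAt (fun z : ℝ × Space d => β z.2)
        ((fderiv ℝ β z.2).comp (ContinuousLinearMap.snd ℝ ℝ (Space d))) z :=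
      (((hβ.smooth.differentiableOn (by simp)).differentiableAt
        (hβ.isOpen.mem_nhds hz)).hasFDerivAt).comp z hasFDerivAt_snd
    rw [h3.fderiv]
    rw [real_inner_comm, inner_gradient_left] at h2
    exact h2
  · obtain ⟨C, hC0, hC⟩ := hβ.strip
    exact ⟨C, hC0, fun t _ ε hε => hC ε hε⟩

namespace IsClassicalSolution

variable {Ω : Set (Space d)} {T σ : ℝ} {b : Fin 2 → ℝ} {Φ : Fin 2 → Space d → ℝ}
  {A : Fin 2 → ℝ → Set (Space d)} {p : Fin 2 → ℝ → Space d → ℝ}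

/-- On the interface the signed chart function is used, and the kinematic condition is precisely the
transport condition. Off the interface only one phase is present near the point, also for nearby
times, and a constant of the right sign suffices. -/
theorem exists_isFlowLevel {Ω : Set (Space (n + 1))} {Φ : Fin 2 → Space (n + 1) → ℝ}
    {A : Fin 2 → ℝ → Set (Space (n + 1))} {p : Fin 2 → ℝ → Space (n + 1) → ℝ}
    (h : IsClassicalSolution Ω T σ b Φ A p) (i : Fin 2) {F : ℝ × Space (n + 1) → Space (n + 1)}
    (hF : ∀ U φ, IsInterfaceChart Ω T A U φ → ∀ t ∈ Icc 0 T, ∀ x ∈ interface A t, (t, x) ∈ U →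
        deriv (fun s => φ s x) t + ⟪F (t, x), ∇ (φ t) x⟫_ℝ = 0) (z : ℝ × Space (n + 1)) :
    ∃ D a, z ∈ D ∧ IsFlowLevel T (A i) F D a ∧
      ∀ z ∈ D, z.1 ∈ Icc 0 T → z.2 ∈ Ω → (z.2 ∈ A i z.1 ↔ 0 < a z) := by
  by_cases hz : z ∈ spaceTime T (interface A)
  · obtain ⟨U, φ, hzU, hφ⟩ := h.interface_smooth z.1 hz.1 z.2 hz.2
    have hd : ∀ t x, (t, x) ∈ U → DifferentiableAt ℝ (Function.uncurry φ) (t, x) := fun t x hx =>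
      (hφ.smooth.differentiableOn (by simp)).differentiableAt (hφ.isOpen.mem_nhds hx)
    have hdx : ∀ t x, (t, x) ∈ U → DifferentiableAt ℝ (φ t) x := fun t x hx =>
      (hd t x hx).comp (f := fun y => (t, y)) x (by fun_prop)
    have hs : ContDiffOn ℝ 1 (Function.uncurry fun t x => phaseSign i * φ t x) U :=
      contDiffOn_const.mul (hφ.smooth.of_le (by norm_num))
    obtain ⟨N, hN, C, hC0, hC⟩ := exists_nhds_volume_strip_le (z₀ := z) hφ.isOpen hzU hs (by
      rw [gradient_const_mul _ (hdx z.1 z.2 hzU)]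
      exact smul_ne_zero (phaseSign_ne_zero i) (hφ.regular z.1 z.2 hzU))
    obtain ⟨D', hD'N, hD'o, hzD'⟩ := _root_.mem_nhds_iff.1 hN
    refine ⟨U ∩ D', Function.uncurry fun t x => phaseSign i * φ t x, ⟨hzU, hzD'⟩,
      ⟨hφ.isOpen.inter hD'o, hs.mono inter_subset_left, ?_, C, hC0, fun t _ ε hε =>
        hC _ (inter_subset_right.trans hD'N) (hφ.isOpen.inter hD'o) t ε hε⟩,
      fun y hy ht hx => hφ.mem_phase i hy.1 ht hx⟩
    rintro ⟨t, x⟩ hy hyA h0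
    have h0' : φ t x = 0 := (mul_eq_zero.1 h0).resolve_left (phaseSign_ne_zero i)
    have hxi := (hφ.zero_set t x hy.1 hyA.1 (h.closure_phase_subset i hyA.1 hyA.2)).2 h0'
    have h1 : HasFDerivAt (Function.uncurry fun t x => phaseSign i * φ t x)
        (phaseSign i • fderiv ℝ (Function.uncurry φ) (t, x)) (t, x) :=
      (hd t x hy.1).hasFDerivAt.const_mul (phaseSign i)
    rw [h1.fderiv, smul_apply, fderiv_one_prod (hd t x hy.1)]
    have h2 := hF U φ hφ t hyA.1 x hxi hy.1
    rw [(deriv_slice (hd t x hy.1)).deriv] at h2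
    exact smul_eq_zero_of_right _ h2
  · obtain ⟨D, hDo, hzD, j, hj⟩ := h.exists_nhds_one_phase hz
    set c : ℝ := if i = j then 1 else -1 with hc
    have hc1 : c = 1 ∨ c = -1 := by rw [hc]; split_ifs <;> simp
    have hc0 : c ≠ 0 := by rcases hc1 with h1 | h1 <;> rw [h1] <;> norm_num
    refine ⟨D ∩ Prod.snd ⁻¹' Metric.ball z.2 1, fun _ => c,
      ⟨hzD, Metric.mem_ball_self one_pos⟩,
      ⟨hDo.inter (Metric.isOpen_ball.preimage continuous_snd), contDiffOn_const,
        fun y _ _ h0 => absurd h0 hc0, 2 * (volume (Metric.ball z.2 1)).toReal, by positivity,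
        fun t _ ε hε => volume_const_strip_le measure_ball_lt_top (fun x hx => hx.1.2) hε hc1
          fun ⟨x, hx⟩ => hx.2⟩, fun y hy ht hx => ?_⟩
    rw [(hj y.1 y.2 hy.1 ht).2 hx i, hc]
    split_ifs with hij <;> simp [hij]

/-- The phases satisfy the continuity equation with the velocity of Darcy's law. -/
theorem weakContinuityEq {Ω : Set (Space (n + 1))} {Φ : Fin 2 → Space (n + 1) → ℝ}
    {A : Fin 2 → ℝ → Set (Space (n + 1))} {p : Fin 2 → ℝ → Space (n + 1) → ℝ}
    (h : IsClassicalSolution Ω T σ b Φ A p) (hΩ : IsOpen Ω) (hΩb : Bornology.IsBounded Ω)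
    (hΩs : HasSmoothBoundary Ω) (hT : 0 ≤ T) (i : Fin 2) :
    WeakContinuityEq Ω T (density (A i)) (velocity (b i) (Φ i) (p i)) := by
  obtain ⟨F, hFc, hFv, hFk, hFw⟩ := h.exists_velocity_extension i
  have htr : IsTransport T (A i) F := by
    refine ⟨h.phase_open i, h.measurableSet_spaceTime_phase hΩ i,
      h.isCompact_spaceTime_closure hΩb i, hFc, fun t ht θ hθ hc hs => ?_⟩
    rw [← h.integral_velocity i ht hθ hc hs]
    exact setIntegral_congr_fun (h.phase_open i t ht).measurableSet fun x hx => by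
      simp only [hFv t ht x hx]
  intro ψ hψ
  have hψ1 : ContDiff ℝ 1 (Function.uncurry ψ) := hψ.of_le (by simp)
  have hce := htr.integral_fderiv_eq hT (fun z => by
    obtain ⟨D, a, hzD, ha, hmem⟩ := h.exists_isFlowLevel i hFk z
    obtain ⟨D', β, hzD', hβ⟩ := exists_isDomainLevel hΩ hΩs z.2
    have hβ' := hβ.isFlowLevel (T := T) (A := A i) hΩ
      (fun t ht => h.closure_phase_subset i ht) hFw
    have hDo := ha.isOpen.inter hβ'.isOpen
    -- Locally the phase is the set where both the interface function and the wall function are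
    -- positive; away from the wall or the interface the corresponding function is constant.
    refine ⟨D ∩ Prod.snd ⁻¹' D', a, fun z => β z.2, ⟨hzD, hzD'⟩, ha.mono hDo inter_subset_left,
      hβ'.mono hDo inter_subset_right, fun y hy ht => ?_⟩
    rw [← hβ.mem y.2 hy.2]
    constructor
    · intro hyA
      have hyΩ := h.phase_subset i y.1 ht hyA
      exact ⟨(hmem y hy.1 ht hyΩ).1 hyA, hyΩ⟩
    · exact fun hy' => (hmem y hy.1 ht hy'.2).2 hy'.1) hψ1
  have hpw : ∀ t x, (t, x) ∈ spaceTime T (A i) →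
      ⟪velocity (b i) (Φ i) (p i) t x, ∇ (ψ t) x⟫_ℝ + deriv (fun s => ψ s x) t =
        fderiv ℝ (Function.uncurry ψ) (t, x) (1, F (t, x)) := by
    intro t x hz
    have hd := hψ1.differentiable (by simp) (t, x)
    rw [fderiv_one_prod hd, (deriv_slice hd).deriv, ← hFv t hz.1 x hz.2, add_comm]
    rfl
  have hI : ∀ t ∈ Icc 0 T, ∀ g : Space (n + 1) → ℝ, ∀ x,
      density (A i) t x * g x = (A i t).indicator g x := by
    intro t _ g x
    by_cases hx : x ∈ A i t <;> simp [density, hx]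
  have hkey : ∀ t ∈ Icc 0 T, ∀ x,
      density (A i) t x * ⟪velocity (b i) (Φ i) (p i) t x, ∇ (ψ t) x⟫_ℝ +
        density (A i) t x * deriv (fun s => ψ s x) t =
      (spaceTime T (A i)).indicator (fun z => fderiv ℝ (Function.uncurry ψ) z (1, F z)) (t, x) := by
    intro t ht x
    rw [← mul_add]
    by_cases hx : x ∈ A i t
    · have hz : (t, x) ∈ spaceTime T (A i) := ⟨ht, hx⟩
      rw [indicator_of_mem hz, hpw t x hz, density, indicator_of_mem hx, Pi.one_apply, one_mul]
    · rw [indicator_of_notMem fun hz : (t, x) ∈ spaceTime T (A i) => hx hz.2, density,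
        indicator_of_notMem hx, zero_mul]
  have hLi := htr.integrableOn_of_continuousOn (htr.continuousOn_fderiv hψ1)
  have hslice : ∀ t ∈ Icc 0 T, IntegrableOn (fun x => density (A i) t x * ψ t x) Ω ∧
      ∫ x in Ω, density (A i) t x * ψ t x = ∫ x in A i t, ψ t x := by
    intro t ht
    have hc : Continuous (ψ t) := hψ1.continuous.comp (by fun_prop : Continuous fun x => (t, x))
    have hA := (h.phase_open i t ht).measurableSet
    simp only [hI t ht]
    constructor
    · refine ((hc.continuousOn.integrableOn_compact hΩb.isCompact_closure).mono_set
        subset_closure).indicator hA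
    · rw [setIntegral_indicator hA, inter_eq_self_of_subset_right (h.phase_subset i t ht)]
  refine ⟨?_, (hslice 0 ⟨le_rfl, hT⟩).1, (hslice T ⟨hT, le_rfl⟩).1, ?_⟩
  · have h1 : IntegrableOn ((spaceTime T (A i)).indicator
        fun z => fderiv ℝ (Function.uncurry ψ) z (1, F z)) (Icc 0 T ×ˢ Ω) :=
      ((integrable_indicator_iff htr.measurable).2 hLi).integrableOn
    exact h1.congr_fun (fun z hz => (hkey z.1 hz.1 z.2).symm)
      (measurableSet_Icc.prod hΩ.measurableSet)
  · rw [(hslice 0 ⟨le_rfl, hT⟩).2, (hslice T ⟨hT, le_rfl⟩).2]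
    refine Eq.trans ?_ hce
    rw [setIntegral_spaceTime htr.measurable htr.isOpen hLi, intervalIntegral.integral_of_le hT,
      ← integral_Icc_eq_integral_Ioc]
    refine setIntegral_congr_fun measurableSet_Icc fun t ht => ?_
    have hA := h.phase_open i t ht
    simp only [hkey t ht]
    rw [← inter_eq_self_of_subset_right (h.phase_subset i t ht), ← setIntegral_indicator hA.measurableSet]
    refine integral_congr_ae (ae_of_all _ fun x => ?_)
    by_cases hx : x ∈ A i t
    · simp only [indicator_of_mem hx, indicator_of_mem (show (t, x) ∈ spaceTime T (A i) from ⟨ht, hx⟩)]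
    · simp only [indicator_of_notMem hx,
        indicator_of_notMem fun hz : (t, x) ∈ spaceTime T (A i) => hx hz.2]

end IsClassicalSolution

/-! ### Graph boxes along the moving interface -/

/-- A level function `φ` of the moving interface, whose zero sets are graphs over a fixed box for
all times in `J`, together with a level function `β` of the domain on this box. -/
structure IsInterfaceBox (Ω : Set (Space (n + 1))) (T : ℝ) (A : Fin 2 → ℝ → Set (Space (n + 1)))
    (φ : ℝ → Space (n + 1) → ℝ) (β : Space (n + 1) → ℝ) (k : Fin (n + 1)) (J I : Set ℝ)
    (B : Set (Space n)) (c L : ℝ) : Prop where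
  isOpen : IsOpen J
  chart : ∃ U, IsInterfaceChart Ω T A U φ ∧ ∀ t ∈ J, ∀ x ∈ box k I B, (t, x) ∈ U
  graphBox : ∀ t ∈ J, IsGraphBox k (φ t) I B c
  bound : ∀ t ∈ J, ∀ x ∈ box k I B, ‖∇ (φ t) x‖ ≤ L
  level : IsDomainLevel Ω (box k I B) β

/-- The unit normal of the interface inside the domain, extended by zero. -/
def interfaceNormal (Ω : Set (Space d)) (T : ℝ) (A : Fin 2 → ℝ → Set (Space d)) (t : ℝ)
    (x : Space d) : Space d :=
  open Classical in
  if h : (t ∈ Icc 0 T ∧ x ∈ interface A t ∩ Ω) ∧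
    ∃ φ : ℝ → Space d → ℝ, ∃ U, (t, x) ∈ U ∧ IsInterfaceChart Ω T A U φ
  then unitNormal h.2.choose t x else 0

theorem interfaceNormal_of_notMem {Ω : Set (Space d)} {T : ℝ} {A : Fin 2 → ℝ → Set (Space d)}
    {t : ℝ} {x : Space d} (h : ¬(t ∈ Icc 0 T ∧ x ∈ interface A t ∩ Ω)) :
    interfaceNormal Ω T A t x = 0 :=
  dif_neg fun h' => h h'.1

theorem norm_unitNormal {φ : ℝ → Space d → ℝ} {t : ℝ} {x : Space d} (h : ∇ (φ t) x ≠ 0) :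
    ‖unitNormal φ t x‖ = 1 := by
  rw [unitNormal, norm_smul, norm_inv, norm_norm, inv_mul_cancel₀ (norm_ne_zero_iff.2 h)]

theorem hasDerivAt_comp_line {f : Space d → ℝ} {x : Space d} (hf : DifferentiableAt ℝ f x)
    (w : Space d) : HasDerivAt (fun s : ℝ => f (x + s • w)) ⟪∇ f x, w⟫_ℝ 0 := by
  have h1 : HasDerivAt (fun s : ℝ => x + s • w) w 0 := by
    simpa using ((hasDerivAt_id (0 : ℝ)).smul_const w).const_add x
  have h2 : HasFDerivAt f (fderiv ℝ f x) (x + (0 : ℝ) • w) := by simpa using hf.hasFDerivAt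
  have h3 := h2.comp_hasDerivAt 0 h1
  rw [inner_gradient_left]
  exact h3

/-- The spatial gradient is represented by the restriction of the full derivative to the space
directions, which varies continuously in space-time. -/
theorem continuousOn_spatial_gradient {φ : ℝ → Space d → ℝ} {U : Set (ℝ × Space d)} (hU : IsOpen U)
    (hφ : ContDiffOn ℝ 1 (Function.uncurry φ) U) :
    ContinuousOn (fun z : ℝ × Space d => ∇ (φ z.1) z.2) U := by
  have h1 : ContinuousOn (fun z : ℝ × Space d => rieszCLM d ((fderiv ℝ (Function.uncurry φ) z).comp
      (ContinuousLinearMap.inr ℝ ℝ (Space d)))) U := by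
    have h2 := hφ.continuousOn_fderiv_of_isOpen hU le_rfl
    fun_prop
  refine h1.congr fun z hz => ?_
  have h3 : fderiv ℝ (φ z.1) z.2 = (fderiv ℝ (Function.uncurry φ) z).comp
      (ContinuousLinearMap.inr ℝ ℝ (Space d)) := by
    ext1 v
    exact (fderiv_slice ((hφ.differentiableOn (by simp)).differentiableAt (hU.mem_nhds hz)) v).trans
      (by simp)
  exact congrArg (rieszCLM d) h3

namespace IsInterfaceChart

variable {Ω : Set (Space d)} {T : ℝ} {A : Fin 2 → ℝ → Set (Space d)} {U U' : Set (ℝ × Space d)}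
  {φ φ' : ℝ → Space d → ℝ} {t : ℝ} {x : Space d}

theorem contDiffAt (hφ : IsInterfaceChart Ω T A U φ) (h : (t, x) ∈ U) : ContDiffAt ℝ 2 (φ t) x :=
  (hφ.smooth.contDiffAt (hφ.isOpen.mem_nhds h)).comp (f := fun y => (t, y)) x (by fun_prop)

theorem differentiableAt (hφ : IsInterfaceChart Ω T A U φ) (h : (t, x) ∈ U) :
    DifferentiableAt ℝ (φ t) x := (hφ.contDiffAt h).differentiableAt (by simp)

/-- Two level functions of the interface have the same unit normal in the domain. -/
theorem unitNormal_eq (hφ : IsInterfaceChart Ω T A U φ) (hφ' : IsInterfaceChart Ω T A U' φ')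
    (hΩ : IsOpen Ω) (h : (t, x) ∈ U) (h' : (t, x) ∈ U') (ht : t ∈ Icc 0 T)
    (hx : x ∈ interface A t ∩ Ω) : unitNormal φ t x = unitNormal φ' t x := by
  by_contra hne
  have h0 := (hφ.zero_set t x h ht (subset_closure hx.2)).1 hx.1
  have h0' := (hφ'.zero_set t x h' ht (subset_closure hx.2)).1 hx.1
  have hn := norm_unitNormal (hφ.regular t x h)
  have hn' := norm_unitNormal (hφ'.regular t x h')
  -- If the unit normals differed, `φ` would increase and `φ'` decrease in the direction `w`. A
  -- short step from `x` would then be in the first phase according to one chart and not according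
  -- to the other.
  set w := unitNormal φ t x - unitNormal φ' t x with hw
  have hlt : ⟪unitNormal φ t x, unitNormal φ' t x⟫_ℝ < 1 :=
    (inner_lt_one_iff_real_of_norm_eq_one hn hn').2 hne
  have hpos : 0 < ⟪∇ (φ t) x, w⟫_ℝ := by
    have h1 : 0 < ⟪unitNormal φ t x, w⟫_ℝ := by
      rw [hw, inner_sub_right, real_inner_self_eq_norm_sq, hn]
      linarith
    rw [unitNormal, real_inner_smul_left] at h1
    exact pos_of_mul_pos_right h1 (by positivity)
  have hneg : ⟪∇ (φ' t) x, w⟫_ℝ < 0 := by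
    have h1 : ⟪unitNormal φ' t x, w⟫_ℝ < 0 := by
      rw [hw, inner_sub_right, real_inner_self_eq_norm_sq, hn', real_inner_comm]
      linarith
    rw [unitNormal, real_inner_smul_left] at h1
    by_contra hcon
    exact absurd h1 (not_lt.2 (mul_nonneg (by positivity) (not_lt.1 hcon)))
  have hd := hasDerivAt_comp_line (hφ.differentiableAt h) w
  have hd' := hasDerivAt_comp_line (hφ'.differentiableAt h') w
  have hline : ContinuousAt (fun s : ℝ => x + s • w) 0 := by fun_prop
  have hlineT : ContinuousAt (fun s : ℝ => (t, x + s • w)) 0 := by fun_prop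
  have e1 : ∀ᶠ s in 𝓝[>] (0 : ℝ), 0 < φ t (x + s • w) := by
    have := (hasDerivAt_iff_tendsto_slope.1 hd).eventually_const_lt hpos
    filter_upwards [this.filter_mono (nhdsWithin_mono 0 fun s (hs : 0 < s) => hs.ne'),
      self_mem_nhdsWithin] with s hs hs0
    have hs0 : 0 < s := hs0
    rw [slope_def_field, zero_smul, add_zero, h0, sub_zero, sub_zero] at hs
    by_contra hcon
    exact absurd hs (not_lt.2 (div_nonpos_of_nonpos_of_nonneg (not_lt.1 hcon) hs0.le))
  have e2 : ∀ᶠ s in 𝓝[>] (0 : ℝ), φ' t (x + s • w) < 0 := by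
    have := (hasDerivAt_iff_tendsto_slope.1 hd').eventually_lt_const hneg
    filter_upwards [this.filter_mono (nhdsWithin_mono 0 fun s (hs : 0 < s) => hs.ne'),
      self_mem_nhdsWithin] with s hs hs0
    have hs0 : 0 < s := hs0
    rw [slope_def_field, zero_smul, add_zero, h0', sub_zero, sub_zero] at hs
    by_contra hcon
    exact absurd hs (not_lt.2 (div_nonneg (not_lt.1 hcon) hs0.le))
  have e3 : ∀ᶠ s in 𝓝[>] (0 : ℝ), x + s • w ∈ Ω := by
    refine (hline.eventually_mem (hΩ.mem_nhds ?_)).filter_mono nhdsWithin_le_nhds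
    simpa using hx.2
  have e4 : ∀ᶠ s in 𝓝[>] (0 : ℝ), (t, x + s • w) ∈ U := by
    refine (hlineT.eventually_mem (hφ.isOpen.mem_nhds ?_)).filter_mono nhdsWithin_le_nhds
    simpa using h
  have e5 : ∀ᶠ s in 𝓝[>] (0 : ℝ), (t, x + s • w) ∈ U' := by
    refine (hlineT.eventually_mem (hφ'.isOpen.mem_nhds ?_)).filter_mono nhdsWithin_le_nhds
    simpa using h'
  obtain ⟨s, s1, s2, s3, s4, s5⟩ := (e1.and (e2.and (e3.and (e4.and e5)))).exists
  have := (hφ'.phase_one t _ s5 ht s3).1 ((hφ.phase_one t _ s4 ht s3).2 s1)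
  linarith

theorem interfaceNormal_eq (hφ : IsInterfaceChart Ω T A U φ) (hΩ : IsOpen Ω) (h : (t, x) ∈ U)
    (ht : t ∈ Icc 0 T) (hx : x ∈ interface A t ∩ Ω) :
    interfaceNormal Ω T A t x = unitNormal φ t x := by
  have hex : (t ∈ Icc 0 T ∧ x ∈ interface A t ∩ Ω) ∧
      ∃ φ : ℝ → Space d → ℝ, ∃ U, (t, x) ∈ U ∧ IsInterfaceChart Ω T A U φ :=
    ⟨⟨ht, hx⟩, φ, U, h, hφ⟩
  rw [interfaceNormal, dif_pos hex]
  obtain ⟨V, hV, hψ⟩ := hex.2.choose_spec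
  exact hψ.unitNormal_eq hφ hΩ hV h ht hx

end IsInterfaceChart

namespace IsInterfaceBox

variable {Ω : Set (Space (n + 1))} {T σ : ℝ} {b : Fin 2 → ℝ} {Φ : Fin 2 → Space (n + 1) → ℝ}
  {A : Fin 2 → ℝ → Set (Space (n + 1))} {p : Fin 2 → ℝ → Space (n + 1) → ℝ}
  {φ : ℝ → Space (n + 1) → ℝ} {β : Space (n + 1) → ℝ} {k : Fin (n + 1)} {J I : Set ℝ}
  {B : Set (Space n)} {c L t : ℝ}

theorem interface_inter (h : IsInterfaceBox Ω T A φ β k J I B c L)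
    (hs : IsClassicalSolution Ω T σ b Φ A p) (ht : t ∈ J) (htT : t ∈ Icc 0 T) :
    interface A t ∩ box k I B = {x ∈ box k I B | φ t x = 0} ∩ closure Ω := by
  obtain ⟨U, hφ, hU⟩ := h.chart
  ext x
  constructor
  · rintro ⟨hx, hxb⟩
    have hxc := hs.interface_subset htT hx
    exact ⟨⟨hxb, (hφ.zero_set t x (hU t ht x hxb) htT hxc).1 hx⟩, hxc⟩
  · rintro ⟨⟨hxb, h0⟩, hxc⟩
    exact ⟨(hφ.zero_set t x (hU t ht x hxb) htT hxc).2 h0, hxb⟩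

theorem mem_interface_iff (h : IsInterfaceBox Ω T A φ β k J I B c L) (ht : t ∈ J)
    (htT : t ∈ Icc 0 T) {x : Space (n + 1)} (hx : x ∈ box k I B) (hxc : x ∈ closure Ω) :
    x ∈ interface A t ↔ φ t x = 0 := by
  obtain ⟨U, hφ, hU⟩ := h.chart
  exact hφ.zero_set t x (hU t ht x hx) htT hxc

theorem interfaceNormal_eq (h : IsInterfaceBox Ω T A φ β k J I B c L) (hΩ : IsOpen Ω) (ht : t ∈ J)
    (htT : t ∈ Icc 0 T) {x : Space (n + 1)} (hx : x ∈ box k I B) (hxi : x ∈ interface A t ∩ Ω) :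
    interfaceNormal Ω T A t x = ‖∇ (φ t) x‖⁻¹ • ∇ (φ t) x := by
  obtain ⟨U, hφ, hU⟩ := h.chart
  exact hφ.interfaceNormal_eq hΩ (hU t ht x hx) htT hxi

theorem contDiffOn_two (h : IsInterfaceBox Ω T A φ β k J I B c L) (ht : t ∈ J) :
    ContDiffOn ℝ 2 (φ t) (box k I B) := by
  obtain ⟨U, hφ, hU⟩ := h.chart
  exact fun x hx => (hφ.contDiffAt (hU t ht x hx)).contDiffWithinAt

theorem mem_phase (h : IsInterfaceBox Ω T A φ β k J I B c L) (i : Fin 2) (ht : t ∈ J)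
    (htT : t ∈ Icc 0 T) {x : Space (n + 1)} (hx : x ∈ box k I B) (hxΩ : x ∈ Ω) :
    x ∈ A i t ↔ 0 < phaseSign i * φ t x := by
  obtain ⟨U, hφ, hU⟩ := h.chart
  exact hφ.mem_phase i (hU t ht x hx) htT hxΩ

/-- The contact condition identifies the wall normal with the conormal, and the conormal is tangent
to the interface. So the two hypersurfaces meet at a right angle. -/
theorem inner_gradient_eq_zero (h : IsInterfaceBox Ω T A φ β k J I B c L)
    (hs : IsClassicalSolution Ω T σ b Φ A p) (ht : t ∈ J) (htT : t ∈ Icc 0 T)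
    {x : Space (n + 1)} (hx : x ∈ box k I B) (h0 : φ t x = 0) (hxf : x ∈ frontier Ω) :
    ⟪∇ (φ t) x, ∇ β x⟫_ℝ = 0 := by
  obtain ⟨U, hφ, hU⟩ := h.chart
  have hxU := hU t ht x hx
  have hxi := (hφ.zero_set t x hxU htT (frontier_subset_closure hxf)).2 h0
  obtain ⟨-, hne, hn⟩ := h.level.wall x hx hxf
  have h1 := (hs.contact U φ hφ t htT x ⟨hxi, hxf⟩ hxU _ hn).tangent
  rw [unitNormal, inner_neg_left, real_inner_smul_left, real_inner_smul_right, neg_eq_zero,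
    mul_eq_zero, mul_eq_zero] at h1
  have h2 := (h1.resolve_left (inv_ne_zero (norm_ne_zero_iff.2 hne))).resolve_left
    (inv_ne_zero (norm_ne_zero_iff.2 (hφ.regular t x hxU)))
  rw [real_inner_comm, h2]

theorem inner_gradient_gradient (f : Space d → ℝ) (x : Space d) :
    fderiv ℝ f x (∇ f x) = ‖∇ f x‖ ^ 2 := by
  rw [← inner_gradient_left, real_inner_self_eq_norm_sq]

/-- The interface meets the wall in a null set. -/
theorem measure_inter_frontier (h : IsInterfaceBox Ω T A φ β k J I B c L)
    (hs : IsClassicalSolution Ω T σ b Φ A p) (ht : t ∈ J) (htT : t ∈ Icc 0 T) :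
    volume (B ∩ (graph k (φ t) I B) ⁻¹' frontier Ω) = 0 ∧
      μHE[n] ({x ∈ box k I B | φ t x = 0} ∩ frontier Ω) = 0 := by
  -- The right angle makes `∇β` tangent to the interface, and `β` has derivative `|∇β|² ≠ 0` in this
  -- direction: the intersection with the wall is transversal.
  refine (h.graphBox t ht).measure_inter_eq_zero isClosed_frontier.measurableSet (g := β)
    (fun x hx _ hxf => (h.level.wall x hx hxf).1) fun x hx h0 hxf => ?_
  refine ⟨(h.level.smooth.differentiableOn (by simp)).differentiableAt (h.level.isOpen.mem_nhds hx),
    ∇ β x, h.inner_gradient_eq_zero hs ht htT hx h0 hxf, ?_⟩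
  rw [inner_gradient_gradient]
  exact pow_ne_zero 2 (norm_ne_zero_iff.2 (h.level.wall x hx hxf).2.1)

theorem measure_interface_inter_le (h : IsInterfaceBox Ω T A φ β k J I B c L)
    (hs : IsClassicalSolution Ω T σ b Φ A p) (ht : t ∈ J) (htT : t ∈ Icc 0 T) :
    μHE[n] (interface A t ∩ box k I B) ≤ ENNReal.ofReal (L / c) * volume B := by
  rw [h.interface_inter hs ht htT]
  refine (measure_mono (inter_subset_inter_right _ (subset_univ _))).trans
    (((h.graphBox t ht).measure_zero_set_inter_le (h.bound t ht) MeasurableSet.univ).trans ?_)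
  gcongr
  exact inter_subset_left

theorem measure_interface_inter_frontier (h : IsInterfaceBox Ω T A φ β k J I B c L)
    (hs : IsClassicalSolution Ω T σ b Φ A p) (ht : t ∈ J) (htT : t ∈ Icc 0 T) :
    μHE[n] (interface A t ∩ frontier Ω ∩ box k I B) = 0 := by
  refine measure_mono_null ?_ (h.measure_inter_frontier hs ht htT).2
  rintro x ⟨⟨hx, hxf⟩, hxb⟩
  exact ⟨⟨hxb, (h.mem_interface_iff ht htT hxb (frontier_subset_closure hxf)).1 hx⟩, hxf⟩

end IsInterfaceBox

namespace IsClassicalSolution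

variable {Ω : Set (Space (n + 1))} {T σ : ℝ} {b : Fin 2 → ℝ} {Φ : Fin 2 → Space (n + 1) → ℝ}
  {A : Fin 2 → ℝ → Set (Space (n + 1))} {p : Fin 2 → ℝ → Space (n + 1) → ℝ}

/-- The graph box is taken inside both an interface chart and a domain chart, so both level
functions are available at once. -/
theorem exists_isInterfaceBox (h : IsClassicalSolution Ω T σ b Φ A p) (hΩ : IsOpen Ω)
    (hΩs : HasSmoothBoundary Ω) {t : ℝ} (ht : t ∈ Icc 0 T) {x : Space (n + 1)}
    (hx : x ∈ interface A t) :
    ∃ φ β k J I B c L, t ∈ J ∧ x ∈ box k I B ∧ IsInterfaceBox Ω T A φ β k J I B c L := by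
  obtain ⟨U, φ, hxU, hφ⟩ := h.interface_smooth t ht x hx
  obtain ⟨D, β, hxD, hβ⟩ := exists_isDomainLevel hΩ hΩs x
  have h0 := (hφ.zero_set t x hxU ht (h.interface_subset ht hx)).1 hx
  obtain ⟨k, τ, I, B, c, L, hτ, hxb, hbox⟩ := exists_isGraphBox hφ.isOpen hxU
    (hφ.smooth.of_le (by norm_num)) (hφ.regular t x hxU) h0
    (N := U ∩ Prod.snd ⁻¹' D) (inter_mem (hφ.isOpen.mem_nhds hxU)
      ((hβ.isOpen.preimage continuous_snd).mem_nhds hxD))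
  have htJ : t ∈ Ioo (t - τ) (t + τ) := ⟨by linarith, by linarith⟩
  exact ⟨φ, β, k, Ioo (t - τ) (t + τ), I, B, c, L, htJ, hxb, isOpen_Ioo,
    ⟨U, hφ, fun s hs y hy => ((hbox s hs).2 y hy).1.1⟩, fun s hs => (hbox s hs).1,
    fun s hs y hy => ((hbox s hs).2 y hy).2,
    hβ.mono (hbox t htJ).1.isOpen_box fun y hy => ((hbox t htJ).2 y hy).1.2⟩

theorem isClosed_interface (A : Fin 2 → ℝ → Set (Space d)) (t : ℝ) : IsClosed (interface A t) :=
  isClosed_frontier.inter isClosed_frontier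

/-- The area of the interface is bounded uniformly in time. -/
theorem exists_measure_interface_le (h : IsClassicalSolution Ω T σ b Φ A p) (hΩ : IsOpen Ω)
    (hΩb : Bornology.IsBounded Ω) (hΩs : HasSmoothBoundary Ω) :
    ∃ C : ENNReal, C < ⊤ ∧ ∀ t ∈ Icc 0 T, μHE[n] (interface A t) ≤ C := by
  have hK : IsCompact (cylinder Ω T) := isCompact_Icc.prod hΩb.isCompact_closure
  -- A box bounds the area for an interval of times, and off the closed set `Γ` there is nothing to
  -- measure; compactness of the cylinder makes the bound global.
  have hloc : ∀ z ∈ cylinder Ω T, ∃ D ∈ 𝓝 z, ∃ C : ENNReal, C < ⊤ ∧ ∀ t ∈ Icc 0 T,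
      μHE[n] {x ∈ interface A t | (t, x) ∈ D} ≤ C := by
    intro z hz
    by_cases hzi : z ∈ spaceTime T (interface A)
    · obtain ⟨φ, β, k, J, I, B, c, L, htJ, hxb, hbox⟩ := h.exists_isInterfaceBox hΩ hΩs hzi.1 hzi.2
      have hB := (hbox.graphBox z.1 htJ).bounded_snd.measure_lt_top (μ := volume)
      refine ⟨J ×ˢ box k I B, (hbox.isOpen.prod hbox.level.isOpen).mem_nhds ⟨htJ, hxb⟩,
        ENNReal.ofReal (L / c) * volume B, ENNReal.mul_lt_top ENNReal.ofReal_lt_top hB,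
        fun t ht => ?_⟩
      by_cases htJ' : t ∈ J
      · refine le_trans (measure_mono ?_) (hbox.measure_interface_inter_le h htJ' ht)
        exact fun x hx => ⟨hx.1, hx.2.2⟩
      · have : {x ∈ interface A t | (t, x) ∈ J ×ˢ box k I B} = ∅ :=
          eq_empty_of_forall_notMem fun x hx => htJ' hx.2.1
        rw [this, measure_empty]
        exact zero_le
    · refine ⟨_, h.isClosed_spaceTime_interface.isOpen_compl.mem_nhds hzi, 0, by simp,
        fun t ht => ?_⟩
      have : {x ∈ interface A t | (t, x) ∈ (spaceTime T (interface A))ᶜ} = ∅ :=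
        eq_empty_of_forall_notMem fun x hx => hx.2 ⟨ht, hx.1⟩
      rw [this, measure_empty]
  choose! D hD C hC hDC using hloc
  obtain ⟨s, hsK, hs⟩ := hK.elim_nhds_subcover D hD
  refine ⟨∑ z ∈ s, C z, ENNReal.sum_lt_top.2 fun z hz => hC z (hsK z hz), fun t ht => ?_⟩
  calc μHE[n] (interface A t)
      ≤ μHE[n] (⋃ z ∈ s, {x ∈ interface A t | (t, x) ∈ D z}) := by
        refine measure_mono fun x hx => ?_
        obtain ⟨z, hz, hxz⟩ := mem_iUnion₂.1 (hs (show (t, x) ∈ cylinder Ω T from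
          ⟨ht, h.interface_subset ht hx⟩))
        exact mem_iUnion₂.2 ⟨z, hz, hx, hxz⟩
    _ ≤ ∑ z ∈ s, μHE[n] {x ∈ interface A t | (t, x) ∈ D z} := measure_biUnion_finset_le _ _
    _ ≤ ∑ z ∈ s, C z := Finset.sum_le_sum fun z hz => hDC z (hsK z hz) t ht

/-- The interface meets the wall in a null set. -/
theorem measure_interface_inter_frontier (h : IsClassicalSolution Ω T σ b Φ A p) (hΩ : IsOpen Ω)
    (hΩs : HasSmoothBoundary Ω) {t : ℝ} (ht : t ∈ Icc 0 T) :
    μHE[n] (interface A t ∩ frontier Ω) = 0 := by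
  refine measure_null_of_locally_null _ fun x hx => ?_
  obtain ⟨φ, β, k, J, I, B, c, L, htJ, hxb, hbox⟩ := h.exists_isInterfaceBox hΩ hΩs ht hx.1
  exact ⟨_, inter_mem_nhdsWithin _ (hbox.level.isOpen.mem_nhds hxb),
    hbox.measure_interface_inter_frontier h htJ ht⟩

theorem norm_interfaceNormal (h : IsClassicalSolution Ω T σ b Φ A p) (hΩ : IsOpen Ω) {t : ℝ}
    (ht : t ∈ Icc 0 T) {x : Space (n + 1)} (hx : x ∈ interface A t ∩ Ω) :
    ‖interfaceNormal Ω T A t x‖ = 1 := by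
  obtain ⟨U, φ, hxU, hφ⟩ := h.interface_smooth t ht x hx.1
  rw [hφ.interfaceNormal_eq hΩ hxU ht hx, norm_unitNormal (hφ.regular t x hxU)]

theorem norm_interfaceNormal_le (h : IsClassicalSolution Ω T σ b Φ A p) (hΩ : IsOpen Ω) (t : ℝ)
    (x : Space (n + 1)) : ‖interfaceNormal Ω T A t x‖ ≤ 1 := by
  by_cases hx : t ∈ Icc 0 T ∧ x ∈ interface A t ∩ Ω
  · exact (h.norm_interfaceNormal hΩ hx.1 hx.2).le
  · rw [interfaceNormal_of_notMem hx, norm_zero]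
    exact zero_le_one

/-- The unit normal of the interface is measurable in space-time. -/
theorem measurable_interfaceNormal (h : IsClassicalSolution Ω T σ b Φ A p) (hΩ : IsOpen Ω) :
    Measurable fun z : ℝ × Space (n + 1) => interfaceNormal Ω T A z.1 z.2 := by
  set S : Set (ℝ × Space (n + 1)) := spaceTime T (interface A) ∩ Prod.snd ⁻¹' Ω with hS
  have hSm : MeasurableSet S := h.isClosed_spaceTime_interface.measurableSet.inter
    (measurable_snd hΩ.measurableSet)
  have hind : (fun z : ℝ × Space (n + 1) => interfaceNormal Ω T A z.1 z.2) =
      S.indicator fun z => interfaceNormal Ω T A z.1 z.2 := by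
    ext1 z
    by_cases hz : z ∈ S
    · rw [indicator_of_mem hz]
    · rw [indicator_of_notMem hz]
      exact interfaceNormal_of_notMem fun h' => hz ⟨⟨h'.1, h'.2.1⟩, h'.2.2⟩
  rw [hind]
  -- On `Γ` inside `Ω` the globally chosen normal agrees near each point with the continuous normal
  -- of one chart, so it is continuous there relative to this measurable set.
  refine measurable_indicator_of_continuousOn hSm fun z hz => ?_
  obtain ⟨U, φ, hzU, hφ⟩ := h.interface_smooth z.1 hz.1.1 z.2 hz.1.2
  have hc : ContinuousAt (fun y : ℝ × Space (n + 1) => unitNormal φ y.1 y.2) z := by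
    have hg := (continuousOn_spatial_gradient hφ.isOpen (hφ.smooth.of_le (by norm_num))).continuousAt
      (hφ.isOpen.mem_nhds hzU)
    exact (hg.norm.inv₀ (norm_ne_zero_iff.2 (hφ.regular z.1 z.2 hzU))).smul hg
  refine hc.continuousWithinAt.congr_of_eventuallyEq ?_
    (hφ.interfaceNormal_eq hΩ hzU hz.1.1 ⟨hz.1.2, hz.2⟩)
  filter_upwards [self_mem_nhdsWithin, mem_nhdsWithin_of_mem_nhds (hφ.isOpen.mem_nhds hzU)]
    with y hy hyU
  exact hφ.interfaceNormal_eq hΩ hyU hy.1.1 ⟨hy.1.2, hy.2⟩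

end IsClassicalSolution

/-! ### Integration by parts up to the wall and the interface -/

/-- Integrals over thin layers tend to zero if the integrand vanishes on the level set. -/
theorem tendsto_integral_deriv_cut_zero {X : Type*} [MeasurableSpace X] {ρ : Measure X}
    {b g : X → ℝ} (hb : Measurable b) {C : ℝ} (hC0 : 0 ≤ C)
    (hC : ∀ ε, 0 < ε → ρ {x | b x ∈ Icc ε (2 * ε)} ≤ ENNReal.ofReal (C * ε))
    (hg : ∀ η, 0 < η → ∃ δ, 0 < δ ∧ ∀ᵐ x ∂ρ, 0 < b x → b x ≤ δ → |g x| ≤ η) :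
    Tendsto (fun ε : ℝ => ∫ x, ε⁻¹ * deriv cut (b x / ε) * g x ∂ρ) (𝓝[>] 0) (𝓝 0) := by
  obtain ⟨C', hC'0, hC'⟩ := exists_bound_deriv_cut
  rw [Metric.tendsto_nhds]
  intro r hr
  -- The integrand is at most `C' η / ε` on a layer of measure at most `C ε`; this `η` keeps the
  -- product `C' C η` below `r`.
  set η := r / (2 * (C' * C + 1)) with hη
  have hden : 0 < C' * C + 1 := by positivity
  have hη0 : 0 < η := by positivity
  obtain ⟨δ, hδ0, hδ⟩ := hg η hη0
  filter_upwards [Ioo_mem_nhdsGT (show 0 < δ / 2 by linarith)] with ε hε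
  have hε0 : 0 < ε := hε.1
  rw [dist_zero_right]
  have hsm : MeasurableSet {x | b x ∈ Icc ε (2 * ε)} := hb measurableSet_Icc
  have hfin : ρ {x | b x ∈ Icc ε (2 * ε)} < ⊤ := (hC ε hε0).trans_lt ENNReal.ofReal_lt_top
  have hbd : ∀ᵐ x ∂ρ, ‖ε⁻¹ * deriv cut (b x / ε) * g x‖ ≤
      ({x | b x ∈ Icc ε (2 * ε)}).indicator (fun _ => C' * η * ε⁻¹) x := by
    filter_upwards [hδ] with x hx
    by_cases hI : b x ∈ Icc ε (2 * ε)
    · rw [indicator_of_mem (show x ∈ {x | b x ∈ Icc ε (2 * ε)} from hI)]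
      have h3 := hx (hε0.trans_le hI.1) (by linarith [hI.2, hε.2])
      rw [norm_mul, norm_mul, norm_inv, Real.norm_of_nonneg hε0.le]
      calc ε⁻¹ * ‖deriv cut (b x / ε)‖ * ‖g x‖ ≤ ε⁻¹ * C' * η := by
            gcongr
            · exact hC' _
            · exact h3
        _ = C' * η * ε⁻¹ := by ring
    · rw [deriv_cut_div_eq_zero hε0 hI, mul_zero, zero_mul, norm_zero]
      exact indicator_nonneg (fun _ _ => by positivity) _
  have hbi : Integrable (({x | b x ∈ Icc ε (2 * ε)}).indicator fun _ => C' * η * ε⁻¹) ρ :=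
    (integrable_indicator_iff hsm).2 (integrableOn_const hfin.ne)
  refine (norm_integral_le_of_norm_le hbi hbd).trans_lt ?_
  rw [integral_indicator hsm, setIntegral_const, smul_eq_mul]
  have h4 : ρ.real {x | b x ∈ Icc ε (2 * ε)} ≤ C * ε :=
    ENNReal.toReal_le_of_le_ofReal (by positivity) (hC ε hε0)
  have h5 : C * ε * (C' * η * ε⁻¹) = (C' * C) * η := by field_simp
  refine (mul_le_mul_of_nonneg_right h4 (by positivity)).trans_lt ?_
  rw [h5, hη, mul_div_assoc', div_lt_iff₀ (by positivity)]
  nlinarith [mul_nonneg hC'0.le hC0]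

/-- A `C¹` function on an open set of finite volume that is bounded together with its gradient. -/
structure IsBoundedC1 (S : Set (Space d)) (q : Space d → ℝ) : Prop where
  isOpen : IsOpen S
  finite : volume S < ⊤
  smooth : ContDiffOn ℝ 1 q S
  bound : ∃ M, ∀ x ∈ S, |q x| ≤ M ∧ ‖∇ q x‖ ≤ M

/-- The divergence of `q ζ`, by the product rule. -/
def flux (q : Space d → ℝ) (ζ : Space d → Space d) (x : Space d) : ℝ :=
  ⟪∇ q x, ζ x⟫_ℝ + q x * div ζ x

theorem continuous_div_of_contDiff {ζ : Space d → Space d} (hζ : ContDiff ℝ 1 ζ) :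
    Continuous (div ζ) := by
  have := hζ.continuous_fderiv (by simp)
  unfold div
  fun_prop

theorem hasCompactSupport_div {ζ : Space d → Space d} (hc : HasCompactSupport ζ) :
    HasCompactSupport (div ζ) :=
  HasCompactSupport.intro hc fun _ hx => div_eq_zero_of_notMem_tsupport hx

theorem flux_eq_zero {q : Space d → ℝ} {ζ : Space d → Space d} {x : Space d} (hx : x ∉ tsupport ζ) :
    flux q ζ x = 0 := by
  rw [flux, div_eq_zero_of_notMem_tsupport hx, image_eq_zero_of_notMem_tsupport hx, inner_zero_right,
    mul_zero, add_zero]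

namespace IsBoundedC1

variable {S : Set (Space d)} {q : Space d → ℝ} {ζ : Space d → Space d}

theorem integrableOn_flux (hq : IsBoundedC1 S q) (hζ : ContDiff ℝ 1 ζ) (hc : HasCompactSupport ζ) :
    IntegrableOn (flux q ζ) S := by
  obtain ⟨M, hM⟩ := hq.bound
  obtain ⟨M₁, hM₁⟩ := hζ.continuous.bounded_above_of_compact_support hc
  obtain ⟨M₂, hM₂⟩ := (continuous_div_of_contDiff hζ).bounded_above_of_compact_support
    (hasCompactSupport_div hc)
  have hcont : ContinuousOn (flux q ζ) S := by
    have h1 := continuousOn_gradient hq.isOpen hq.smooth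
    have h2 := hζ.continuous.continuousOn (s := S)
    have h3 := (continuous_div_of_contDiff hζ).continuousOn (s := S)
    exact (ContinuousOn.inner (𝕜 := ℝ) h1 h2).add (hq.smooth.continuousOn.mul h3)
  refine (integrableOn_const (C := M * M₁ + M * M₂) hq.finite.ne).mono'
    (hcont.aestronglyMeasurable hq.isOpen.measurableSet) ?_
  refine (ae_restrict_iff' hq.isOpen.measurableSet).2 (ae_of_all _ fun x hx => ?_)
  obtain ⟨h1, h2⟩ := hM x hx
  have hM0 := (abs_nonneg _).trans h1
  refine (norm_add_le _ _).trans (add_le_add ?_ ?_)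
  · exact (norm_inner_le_norm _ _).trans (mul_le_mul h2 (hM₁ x) (norm_nonneg _) hM0)
  · rw [norm_mul]
    exact mul_le_mul h1 (hM₂ x) (norm_nonneg _) hM0

theorem integral_flux_of_tsupport (hq : IsBoundedC1 S q) (hζ : ContDiff ℝ 1 ζ)
    (hc : HasCompactSupport ζ) (hs : tsupport ζ ⊆ S) : ∫ x in S, flux q ζ x = 0 := by
  have hsub : tsupport (fun x => q x • ζ x) ⊆ tsupport ζ :=
    closure_mono fun x hx h0 => hx (by simp only [h0, smul_zero])
  exact setIntegral_inner_gradient_add_mul_div hq.isOpen hq.smooth hζ.contDiffOn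
    (hc.mono' ((subset_tsupport _).trans hsub)) (hsub.trans hs)

end IsBoundedC1

section cut

variable {D : Set (Space d)} {a : Space d → ℝ} {ζ : Space d → Space d} {ε : ℝ}

theorem tsupport_cut_smul_subset (a : Space d → ℝ) (ζ : Space d → Space d) (ε : ℝ) :
    tsupport (fun x => cut (a x / ε) • ζ x) ⊆ tsupport ζ :=
  closure_mono fun x hx h0 => hx (by simp only [h0, smul_zero])

theorem contDiff_cut_smul (hD : IsOpen D) (ha : ContDiffOn ℝ 1 a D) (hζ : ContDiff ℝ 1 ζ)
    (hs : tsupport ζ ⊆ D) (ε : ℝ) : ContDiff ℝ 1 fun x => cut (a x / ε) • ζ x := by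
  refine contDiff_of_tsupport_subset hD ?_ ((tsupport_cut_smul_subset a ζ ε).trans hs)
  have hcut : ContDiff ℝ 1 cut := contDiff_cut (n := 1)
  exact (hcut.comp_contDiffOn (ha.div_const ε)).smul hζ.contDiffOn

theorem le_of_mem_tsupport_cut_smul (ha : ContinuousOn a D) (hs : tsupport ζ ⊆ D) (hε : 0 < ε)
    {x : Space d} (hx : x ∈ tsupport fun x => cut (a x / ε) • ζ x) : ε ≤ a x := by
  have hcl : IsClosed (tsupport ζ ∩ a ⁻¹' Ici ε) :=
    (ha.mono hs).preimage_isClosed_of_isClosed (isClosed_tsupport ζ) isClosed_Ici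
  refine (closure_minimal (fun y hy => ?_) hcl hx).2
  have hne : cut (a y / ε) • ζ y ≠ 0 := hy
  have h1 := smul_ne_zero_iff.1 hne
  refine ⟨subset_tsupport ζ h1.2, ?_⟩
  by_contra hlt
  exact h1.1 (cut_of_le ((div_le_one hε).2 (not_le.1 hlt).le))

theorem hasCompactSupport_cut_smul (hc : HasCompactSupport ζ) :
    HasCompactSupport fun x => cut (a x / ε) • ζ x :=
  hc.mono' ((subset_tsupport _).trans (tsupport_cut_smul_subset a ζ ε))

theorem gradient_cut_div {x : Space d} (ha : DifferentiableAt ℝ a x) :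
    DifferentiableAt ℝ (fun y => cut (a y / ε)) x ∧
    ∇ (fun y => cut (a y / ε)) x = (ε⁻¹ * deriv cut (a x / ε)) • ∇ a x := by
  have h1 : HasFDerivAt (fun z => a z / ε) (ε⁻¹ • fderiv ℝ a x) x := ha.hasFDerivAt.mul_const ε⁻¹
  have h2 : HasFDerivAt (fun y => cut (a y / ε)) _ x := (hasDerivAt_cut _).comp_hasFDerivAt x h1
  refine ⟨h2.differentiableAt, ?_⟩
  ext k
  rw [gradient_apply, h2.fderiv, PiLp.smul_apply, gradient_apply]
  simp only [smul_apply, smul_eq_mul]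
  ring

theorem div_cut_smul {x : Space d} (ha : DifferentiableAt ℝ a x) (hζ : DifferentiableAt ℝ ζ x) :
    div (fun y => cut (a y / ε) • ζ y) x =
      cut (a x / ε) * div ζ x + ε⁻¹ * deriv cut (a x / ε) * ⟪∇ a x, ζ x⟫_ℝ := by
  obtain ⟨h1, h2⟩ := gradient_cut_div (ε := ε) ha
  rw [div_smul h1 hζ, h2, real_inner_smul_left, add_comm]

/-- The product rule, with `a` extended by zero so that both terms are meaningful everywhere:
outside `D` each of them contains a vanishing factor from `ζ`. -/
theorem flux_cut_smul (q : Space d → ℝ) (hD : IsOpen D) (ha : ContDiffOn ℝ 1 a D)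
    (hζ : ContDiff ℝ 1 ζ) (hs : tsupport ζ ⊆ D) (x : Space d) :
    flux q (fun y => cut (a y / ε) • ζ y) x = cut (D.indicator a x / ε) * flux q ζ x +
      q x * (ε⁻¹ * deriv cut (D.indicator a x / ε)) * ⟪∇ a x, ζ x⟫_ℝ := by
  by_cases hx : x ∈ D
  · rw [indicator_of_mem hx, flux, flux, div_cut_smul
      ((ha.differentiableOn (by simp)).differentiableAt (hD.mem_nhds hx))
      (hζ.differentiable (by simp) x), real_inner_smul_right]
    ring
  · rw [flux_eq_zero fun h => hx (hs (tsupport_cut_smul_subset a ζ ε h)),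
      flux_eq_zero fun h => hx (hs h), image_eq_zero_of_notMem_tsupport fun h => hx (hs h)]
    simp

end cut

namespace IsBoundedC1

variable {S D : Set (Space d)} {q a : Space d → ℝ} {ζ : Space d → Space d}

theorem integrableOn_cut_mul_flux (hq : IsBoundedC1 S q) (hD : IsOpen D) (ha : ContDiffOn ℝ 1 a D)
    (hζ : ContDiff ℝ 1 ζ) (hc : HasCompactSupport ζ) (ε : ℝ) :
    IntegrableOn (fun x => cut (D.indicator a x / ε) * flux q ζ x) S ∧
      ∀ x, ‖cut (D.indicator a x / ε) * flux q ζ x‖ ≤ ‖flux q ζ x‖ := by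
  have hi := hq.integrableOn_flux hζ hc
  have hb : ∀ x, ‖cut (D.indicator a x / ε) * flux q ζ x‖ ≤ ‖flux q ζ x‖ := by
    intro x
    rw [norm_mul]
    have h1 : ‖cut (D.indicator a x / ε)‖ ≤ 1 := abs_cut_le_one _
    exact mul_le_of_le_one_left (norm_nonneg _) h1
  refine ⟨hi.norm.mono' (AEStronglyMeasurable.mul (Measurable.aestronglyMeasurable ?_)
    hi.aestronglyMeasurable) (ae_of_all _ hb), hb⟩
  exact continuous_cut.measurable.comp
    ((measurable_indicator_of_continuousOn hD.measurableSet ha.continuousOn).div_const ε)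

theorem tendsto_integral_cut_mul_flux (hq : IsBoundedC1 S q) (hD : IsOpen D)
    (ha : ContDiffOn ℝ 1 a D) (hζ : ContDiff ℝ 1 ζ) (hc : HasCompactSupport ζ)
    (hs : tsupport ζ ⊆ D) (hpos : ∀ x ∈ tsupport ζ, x ∈ S → 0 < a x) :
    Tendsto (fun ε => ∫ x in S, cut (D.indicator a x / ε) * flux q ζ x) (𝓝[>] 0)
      (𝓝 (∫ x in S, flux q ζ x)) := by
  refine tendsto_integral_filter_of_dominated_convergence (fun x => ‖flux q ζ x‖)
    (Eventually.of_forall fun ε => (hq.integrableOn_cut_mul_flux hD ha hζ hc ε).1.aestronglyMeasurable)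
    (Eventually.of_forall fun ε => ae_of_all _ (hq.integrableOn_cut_mul_flux hD ha hζ hc ε).2)
    (hq.integrableOn_flux hζ hc).norm ?_
  refine (ae_restrict_iff' hq.isOpen.measurableSet).2 (ae_of_all _ fun x hx => ?_)
  by_cases hxs : x ∈ tsupport ζ
  · have h1 := tendsto_cut_div (D.indicator a x)
    rw [indicator_of_mem (hs hxs), if_pos (hpos x hxs hx)] at h1
    rw [indicator_of_mem (hs hxs)]
    simpa using h1.mul_const (flux q ζ x)
  · simp only [flux_eq_zero hxs, mul_zero]
    exact tendsto_const_nhds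

theorem integral_flux_cut_smul (hq : IsBoundedC1 S q) (hD : IsOpen D)
    (ha : ContDiffOn ℝ 1 a D) (hζ : ContDiff ℝ 1 ζ) (hc : HasCompactSupport ζ)
    (hs : tsupport ζ ⊆ D) (ε : ℝ) :
    IntegrableOn (fun x => q x * (ε⁻¹ * deriv cut (D.indicator a x / ε)) * ⟪∇ a x, ζ x⟫_ℝ) S ∧
    ∫ x in S, flux q (fun y => cut (a y / ε) • ζ y) x =
      (∫ x in S, cut (D.indicator a x / ε) * flux q ζ x) +
      ∫ x in S, q x * (ε⁻¹ * deriv cut (D.indicator a x / ε)) * ⟪∇ a x, ζ x⟫_ℝ := by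
  have h1 := hq.integrableOn_flux (contDiff_cut_smul hD ha hζ hs ε)
    (hasCompactSupport_cut_smul (a := a) (ε := ε) hc)
  have h2 := (hq.integrableOn_cut_mul_flux hD ha hζ hc ε).1
  have h3 : IntegrableOn
      (fun x => q x * (ε⁻¹ * deriv cut (D.indicator a x / ε)) * ⟪∇ a x, ζ x⟫_ℝ) S := by
    refine (h1.sub h2).congr (ae_of_all _ fun x => ?_)
    simp only [Pi.sub_apply]
    rw [flux_cut_smul q hD ha hζ hs x]
    ring
  refine ⟨h3, ?_⟩
  rw [← integral_add h2 h3]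
  simp only [flux_cut_smul q hD ha hζ hs]

/-- Integration by parts up to the wall, for vector fields that are tangential to the wall. -/
theorem integral_flux_eq_zero (hq : IsBoundedC1 S q) (hD : IsOpen D) (ha : ContDiffOn ℝ 1 a D)
    {C : ℝ} (hC0 : 0 ≤ C)
    (hC : ∀ ε, 0 < ε → volume {x ∈ D | a x ∈ Icc ε (2 * ε)} ≤ ENNReal.ofReal (C * ε))
    (hζ : ContDiff ℝ 1 ζ) (hc : HasCompactSupport ζ) (hs : tsupport ζ ⊆ D)
    (hmem : ∀ x ∈ tsupport ζ, x ∈ S ↔ 0 < a x)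
    (hwall : ∀ x ∈ tsupport ζ, x ∈ closure S → a x = 0 → ⟪∇ a x, ζ x⟫_ℝ = 0) :
    ∫ x in S, flux q ζ x = 0 := by
  obtain ⟨M, hM⟩ := hq.bound
  obtain ⟨M₁, hM₁0, hM₁⟩ : ∃ M₁, 0 ≤ M₁ ∧ ∀ x ∈ S, |q x| ≤ M₁ :=
    ⟨|M|, abs_nonneg _, fun x hx => (hM x hx).1.trans (le_abs_self _)⟩
  have h1 := hq.tendsto_integral_cut_mul_flux hD ha hζ hc hs fun x hx hxS => (hmem x hx).1 hxS
  -- The cut-off field is compactly supported in `S`, so its flux integrates to zero and only the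
  -- derivative of the cutoff is left over.
  have h2 : ∀ ε, 0 < ε → ∫ x in S, cut (D.indicator a x / ε) * flux q ζ x =
      -∫ x in S, q x * (ε⁻¹ * deriv cut (D.indicator a x / ε)) * ⟪∇ a x, ζ x⟫_ℝ := by
    intro ε hε
    have h3 := (hq.integral_flux_cut_smul hD ha hζ hc hs ε).2
    rw [hq.integral_flux_of_tsupport (contDiff_cut_smul hD ha hζ hs ε)
      (hasCompactSupport_cut_smul hc) fun x hx =>
        (hmem x (tsupport_cut_smul_subset a ζ ε hx)).2
          (hε.trans_le (le_of_mem_tsupport_cut_smul ha.continuousOn hs hε hx))] at h3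
    linarith
  refine tendsto_nhds_unique h1 ?_
  have hK : IsCompact (tsupport ζ ∩ closure S) := hc.inter_right isClosed_closure
  have hac : ContinuousOn (fun x => ⟪∇ a x, ζ x⟫_ℝ) (tsupport ζ ∩ closure S) :=
    ContinuousOn.inner (𝕜 := ℝ) ((continuousOn_gradient hD ha).mono (inter_subset_left.trans hs))
      hζ.continuous.continuousOn
  -- The left-over term contains `∇a·ζ`, which vanishes on the wall because `ζ` is tangential;
  -- boundedness of `q` suffices.
  have h3 := tendsto_integral_deriv_cut_zero (ρ := volume.restrict S) (b := D.indicator a)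
    (g := fun x => q x * ⟪∇ a x, ζ x⟫_ℝ)
    (measurable_indicator_of_continuousOn hD.measurableSet ha.continuousOn) hC0 (fun ε hε => by
      refine (Measure.restrict_apply_le _ _).trans (le_trans (measure_mono ?_) (hC ε hε))
      intro x hx
      have hx : D.indicator a x ∈ Icc ε (2 * ε) := hx
      by_cases hxD : x ∈ D
      · rw [indicator_of_mem hxD] at hx
        exact ⟨hxD, hx⟩
      · rw [indicator_of_notMem hxD] at hx
        exact absurd hx.1 (not_le.2 hε)) fun η hη => by
      obtain ⟨δ, hδ0, hδ⟩ := exists_forall_abs_le_of_zero hK hac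
        (ha.continuousOn.mono (inter_subset_left.trans hs))
        (fun x hx h0 => hwall x hx.1 hx.2 h0) (η := η / (M₁ + 1)) (by positivity)
      refine ⟨δ, hδ0, (ae_restrict_iff' hq.isOpen.measurableSet).2 (ae_of_all _ fun x hx hpos hle => ?_)⟩
      by_cases hxs : x ∈ tsupport ζ
      · rw [indicator_of_mem (hs hxs)] at hpos hle
        have h4 := hδ x ⟨hxs, subset_closure hx⟩ (by rwa [abs_of_pos hpos])
        rw [abs_mul]
        calc |q x| * |⟪∇ a x, ζ x⟫_ℝ| ≤ (M₁ + 1) * (η / (M₁ + 1)) := by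
              gcongr
              exact (hM₁ x hx).trans (by linarith)
          _ = η := by field_simp
      · rw [image_eq_zero_of_notMem_tsupport hxs, inner_zero_right, mul_zero, abs_zero]
        exact hη.le
  have h5 := h3.neg
  rw [neg_zero] at h5
  refine h5.congr' ?_
  filter_upwards [self_mem_nhdsWithin] with ε hε
  rw [h2 ε hε]
  congr 1
  refine integral_congr_ae (ae_of_all _ fun x => ?_)
  ring

end IsBoundedC1

namespace IsDomainLevel

variable {Ω D : Set (Space d)} {β : Space d → ℝ}

theorem inner_gradient_eq_zero (hβ : IsDomainLevel Ω D β) (hΩ : IsOpen Ω) {ξ : Space d → Space d}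
    (hξ : ∀ x m, IsOuterNormal Ω x m → ⟪ξ x, m⟫_ℝ = 0) {x : Space d} (hx : x ∈ D)
    (hxc : x ∈ closure Ω) (h0 : β x = 0) : ⟪∇ β x, ξ x⟫_ℝ = 0 := by
  obtain ⟨-, hne, hn⟩ := hβ.wall x hx ((hβ.nonneg hΩ hx hxc).2 h0)
  have h1 := hξ x _ hn
  rw [inner_neg_right, real_inner_smul_right, neg_eq_zero, mul_eq_zero] at h1
  rw [real_inner_comm]
  exact h1.resolve_left (inv_ne_zero (norm_ne_zero_iff.2 hne))

theorem integral_flux_eq_zero (hβ : IsDomainLevel Ω D β) (hΩ : IsOpen Ω) {S : Set (Space d)}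
    {q : Space d → ℝ} (hq : IsBoundedC1 S q) (hS : S ⊆ Ω) {ζ : Space d → Space d}
    (hζ : ContDiff ℝ 1 ζ) (hc : HasCompactSupport ζ) (hs : tsupport ζ ⊆ D)
    (hmem : ∀ x ∈ tsupport ζ, x ∈ Ω → x ∈ S)
    (hζn : ∀ x m, IsOuterNormal Ω x m → ⟪ζ x, m⟫_ℝ = 0) : ∫ x in S, flux q ζ x = 0 := by
  obtain ⟨C, hC0, hC⟩ := hβ.strip
  refine hq.integral_flux_eq_zero hβ.isOpen (hβ.smooth.of_le (by simp)) hC0 hC hζ hc hs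
    (fun x hx => ?_) fun x hx hxS h0 =>
      hβ.inner_gradient_eq_zero hΩ hζn (hs hx) (closure_mono hS hxS) h0
  rw [← hβ.mem x (hs hx)]
  exact ⟨fun h => hS h, hmem x hx⟩

end IsDomainLevel

/-- Integration by parts up to an interface that is a graph in a box. -/
theorem IsGraphBox.integral_flux {k : Fin (n + 1)} {a β : Space (n + 1) → ℝ} {I : Set ℝ}
    {B : Set (Space n)} {c : ℝ} (h : IsGraphBox k a I B c) {Ω S : Set (Space (n + 1))}
    (hβ : IsDomainLevel Ω (box k I B) β) (hΩ : IsOpen Ω) {q Q : Space (n + 1) → ℝ}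
    (hq : IsBoundedC1 S q) (hS : S ⊆ Ω) (hQ : Continuous Q) {M : ℝ} (hM : ∀ x, |Q x| ≤ M)
    (hqQ : ∀ x ∈ S, q x = Q x) (hmem : ∀ x ∈ box k I B, x ∈ Ω → (x ∈ S ↔ 0 < a x))
    (hnull : volume (B ∩ (graph k a I B) ⁻¹' frontier Ω) = 0) {ξ : Space (n + 1) → Space (n + 1)}
    (hξ : ContDiff ℝ 1 ξ) (hc : HasCompactSupport ξ) (hs : tsupport ξ ⊆ box k I B)
    (hξn : ∀ x m, IsOuterNormal Ω x m → ⟪ξ x, m⟫_ℝ = 0) :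
    ∫ x in S, flux q ξ x =
      -∫ x in {x ∈ box k I B | a x = 0}, Ω.indicator Q x * ⟪∇ a x, ξ x⟫_ℝ / ‖∇ a x‖ ∂μHE[n] := by
  set D := box k I B with hD
  have hDo : IsOpen D := h.isOpen_box
  have ha := h.contDiffOn
  have hgc : Continuous fun x => ⟪∇ a x, ξ x⟫_ℝ := by
    refine contDiff_zero.1 (contDiff_of_tsupport_subset (m := 0) hDo (contDiffOn_zero.2 ?_) ?_)
    · exact ContinuousOn.inner (𝕜 := ℝ) (continuousOn_gradient hDo ha) hξ.continuous.continuousOn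
    · refine (closure_mono ?_).trans hs
      exact fun x (hx : ⟪∇ a x, ξ x⟫_ℝ ≠ 0) h0 => hx (by rw [h0, inner_zero_right])
  have hgs : HasCompactSupport fun x => ⟪∇ a x, ξ x⟫_ℝ :=
    hc.mono fun x (hx : ⟪∇ a x, ξ x⟫_ℝ ≠ 0) h0 => hx (by rw [h0, inner_zero_right])
  obtain ⟨M₁, hM₁⟩ := hgc.bounded_above_of_compact_support hgs
  set f : Space (n + 1) → ℝ := fun x => Ω.indicator Q x * ⟪∇ a x, ξ x⟫_ℝ with hf
  have hM0 : 0 ≤ M := (abs_nonneg _).trans (hM 0)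
  -- The layer integral ignores that `q` is undefined beyond the interface: `q` is replaced by its
  -- extension `Q`, restricted to `Ω`. The indicator of `Ω` is discontinuous only on the wall, which
  -- the graph meets in a null set.
  have hlim := h.tendsto_integral_deriv_cut (f := f) (M := M * M₁)
    ((hQ.measurable.indicator hΩ.measurableSet).mul hgc.measurable) (fun x => by
      rw [hf]
      simp only
      rw [abs_mul]
      refine mul_le_mul ?_ (hM₁ x) (abs_nonneg _) hM0
      by_cases hx : x ∈ Ω
      · rw [indicator_of_mem hx]; exact hM x
      · rw [indicator_of_notMem hx, abs_zero]; exact hM0)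
    (fun x hx => by
      rw [hf]
      simp only
      rw [image_eq_zero_of_notMem_tsupport fun hcon => hx (hs hcon), inner_zero_right, mul_zero]) (by
      rw [ae_restrict_iff' h.isOpen_snd.measurableSet]
      have hnull' : ∀ᵐ y : Space n, ¬(y ∈ B ∩ (graph k a I B) ⁻¹' frontier Ω) :=
        measure_eq_zero_iff_ae_notMem.1 hnull
      filter_upwards [hnull'] with y hy hyB
      refine ContinuousAt.mul ?_ hgc.continuousAt
      have hyf : graph k a I B y ∉ frontier Ω := fun hcon => hy ⟨hyB, hcon⟩
      exact hQ.continuousOn.continuousAt_indicator hyf)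
  have h1 := hq.tendsto_integral_cut_mul_flux hDo ha hξ hc hs fun x hx hxS =>
    (hmem x (hs hx) (hS hxS)).1 hxS
  -- After cutting off along the interface only the wall remains, where the previous result applies,
  -- since multiplication by a scalar keeps the field tangential.
  have h2 : ∀ ε, 0 < ε → ∫ x in S, cut (D.indicator a x / ε) * flux q ξ x =
      -∫ x, f x * (ε⁻¹ * deriv cut (a x / ε)) := by
    intro ε hε
    have h3 := (hq.integral_flux_cut_smul hDo ha hξ hc hs ε).2
    rw [hβ.integral_flux_eq_zero hΩ hq hS (contDiff_cut_smul hDo ha hξ hs ε)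
      (hasCompactSupport_cut_smul hc) ((tsupport_cut_smul_subset a ξ ε).trans hs)
      (fun x hx hxΩ => (hmem x (hs (tsupport_cut_smul_subset a ξ ε hx)) hxΩ).2
        (hε.trans_le (le_of_mem_tsupport_cut_smul ha.continuousOn hs hε hx)))
      (fun x m hm => by rw [real_inner_smul_left, hξn x m hm, mul_zero])] at h3
    -- In the layer `a` is positive, so there `S` and `Ω` coincide, and on `S` the functions `q` and
    -- `Q` agree.
    have h4 : ∫ x in S, q x * (ε⁻¹ * deriv cut (D.indicator a x / ε)) * ⟪∇ a x, ξ x⟫_ℝ =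
        ∫ x, f x * (ε⁻¹ * deriv cut (a x / ε)) := by
      rw [← integral_indicator hq.isOpen.measurableSet]
      congr 1
      ext x
      by_cases hxs : x ∈ tsupport ξ
      · have hxD := hs hxs
        by_cases hI : a x ∈ Icc ε (2 * ε)
        · have hpos : 0 < a x := hε.trans_le hI.1
          by_cases hxΩ : x ∈ Ω
          · have hxS := (hmem x hxD hxΩ).2 hpos
            rw [indicator_of_mem hxS, hf]
            simp only
            rw [indicator_of_mem hxD, indicator_of_mem hxΩ, hqQ x hxS]
            ring
          · rw [indicator_of_notMem fun hxS => hxΩ (hS hxS), hf]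
            simp only
            rw [indicator_of_notMem hxΩ]
            ring
        · rw [deriv_cut_div_eq_zero hε hI, mul_zero, mul_zero]
          by_cases hxS : x ∈ S
          · rw [indicator_of_mem hxS, indicator_of_mem hxD, deriv_cut_div_eq_zero hε hI]
            ring
          · rw [indicator_of_notMem hxS]
      · have h0 := image_eq_zero_of_notMem_tsupport hxs
        rw [hf]
        simp only [h0, inner_zero_right, mul_zero, zero_mul]
        by_cases hxS : x ∈ S <;> simp [hxS, h0]
    rw [h4] at h3
    linarith
  refine tendsto_nhds_unique (h1.congr' ?_) hlim.neg
  filter_upwards [self_mem_nhdsWithin] with ε hε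
  exact h2 ε hε

/-! ### The divergence theorem on the interface -/

/-- The unit normal of the level sets of `φ`. -/
def levelNormal (φ : Space d → ℝ) (x : Space d) : Space d := ‖∇ φ x‖⁻¹ • ∇ φ x

/-- The tangential part of `ξ` along the level sets of `φ`, multiplied by `|∇φ|`. -/
def tangential (φ : Space d → ℝ) (ξ : Space d → Space d) (x : Space d) : Space d :=
  ‖∇ φ x‖ • (ξ x - ⟪ξ x, levelNormal φ x⟫_ℝ • levelNormal φ x)

/-- The tangential divergence of `ξ` without the curvature term. -/
def surfaceDiv (φ : Space d → ℝ) (ξ : Space d → Space d) (x : Space d) : ℝ :=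
  div ξ x - quadGrad ξ (levelNormal φ x) x - ⟪ξ x, levelNormal φ x⟫_ℝ * div (levelNormal φ) x

theorem norm_levelNormal {φ : Space d → ℝ} {x : Space d} (h : ∇ φ x ≠ 0) :
    ‖levelNormal φ x‖ = 1 := by
  rw [levelNormal, norm_smul, norm_inv, norm_norm, inv_mul_cancel₀ (norm_ne_zero_iff.2 h)]

theorem norm_smul_levelNormal {φ : Space d → ℝ} {x : Space d} (h : ∇ φ x ≠ 0) :
    ‖∇ φ x‖ • levelNormal φ x = ∇ φ x := by
  rw [levelNormal, smul_smul, mul_inv_cancel₀ (norm_ne_zero_iff.2 h), one_smul]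

theorem inner_gradient_tangential {φ : Space d → ℝ} {ξ : Space d → Space d} {x : Space d}
    (h : ∇ φ x ≠ 0) : ⟪∇ φ x, tangential φ ξ x⟫_ℝ = 0 := by
  nth_rewrite 1 [← norm_smul_levelNormal h]
  rw [tangential, real_inner_smul_left, real_inner_smul_right, inner_sub_right,
    real_inner_smul_right, real_inner_self_eq_norm_sq, norm_levelNormal h, real_inner_comm]
  ring

theorem tangential_eq_zero {φ : Space d → ℝ} {ξ : Space d → Space d} {x : Space d} (h : ξ x = 0) :
    tangential φ ξ x = 0 := by
  simp [tangential, h]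

theorem tsupport_tangential_subset (φ : Space d → ℝ) (ξ : Space d → Space d) :
    tsupport (tangential φ ξ) ⊆ tsupport ξ :=
  closure_mono fun x (hx : tangential φ ξ x ≠ 0) h => hx (tangential_eq_zero h)

theorem contDiffOn_levelNormal {φ : Space d → ℝ} {D : Set (Space d)} (hD : IsOpen D)
    (hφ : ContDiffOn ℝ 2 φ D) (hne : ∀ x ∈ D, ∇ φ x ≠ 0) : ContDiffOn ℝ 1 (levelNormal φ) D := by
  have h1 := contDiffOn_gradient hD hφ
  exact ((h1.norm ℝ hne).inv fun x hx => norm_ne_zero_iff.2 (hne x hx)).smul h1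

theorem contDiff_tangential {φ : Space d → ℝ} {ξ : Space d → Space d} {D : Set (Space d)}
    (hD : IsOpen D) (hφ : ContDiffOn ℝ 2 φ D) (hne : ∀ x ∈ D, ∇ φ x ≠ 0) (hξ : ContDiff ℝ 1 ξ)
    (hs : tsupport ξ ⊆ D) : ContDiff ℝ 1 (tangential φ ξ) := by
  refine contDiff_of_tsupport_subset hD ?_ ((tsupport_tangential_subset φ ξ).trans hs)
  have h1 := contDiffOn_levelNormal hD hφ hne
  exact ((contDiffOn_gradient hD hφ).norm ℝ hne).smul
    (hξ.contDiffOn.sub ((hξ.contDiffOn.inner ℝ h1).smul h1))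

theorem div_sub {F G : Space d → Space d} {x : Space d} (hF : DifferentiableAt ℝ F x)
    (hG : DifferentiableAt ℝ G x) : div (fun y => F y - G y) x = div F x - div G x := by
  unfold div
  rw [fderiv_fun_sub hF hG, ← Finset.sum_sub_distrib]
  rfl

theorem inner_fderiv_gradient_comm {φ : Space d → ℝ} {x : Space d} (hφ : ContDiffAt ℝ 2 φ x)
    (v w : Space d) : ⟪fderiv ℝ (∇ φ) x v, w⟫_ℝ = ⟪fderiv ℝ (∇ φ) x w, v⟫_ℝ := by
  have h1 : DifferentiableAt ℝ (fderiv ℝ φ) x :=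
    (hφ.fderiv_right (m := 1) (by norm_num)).differentiableAt (by simp)
  have h2 : fderiv ℝ (∇ φ) x = (rieszCLM d).comp (fderiv ℝ (fderiv ℝ φ) x) :=
    ((rieszCLM d).hasFDerivAt.comp x h1.hasFDerivAt).fderiv
  have h3 : ∀ v w, ⟪fderiv ℝ (∇ φ) x v, w⟫_ℝ = fderiv ℝ (fderiv ℝ φ) x v w := by
    intro v w
    rw [h2]
    exact InnerProductSpace.toDual_symm_apply
  rw [h3, h3]
  exact (hφ.isSymmSndFDerivAt (by simp)).eq v w

/-- The divergence of the tangential part of a vector field, up to the factor `|∇φ|`. -/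
theorem div_tangential {φ : Space d → ℝ} {ξ : Space d → Space d} {x : Space d}
    (hφ : ContDiffAt ℝ 2 φ x) (hne : ∇ φ x ≠ 0) (hξ : DifferentiableAt ℝ ξ x) :
    div (tangential φ ξ) x = ‖∇ φ x‖ * surfaceDiv φ ξ x := by
  set ν := levelNormal φ with hν
  have hg : DifferentiableAt ℝ (∇ φ) x :=
    (rieszCLM d).differentiableAt.comp x
      ((hφ.fderiv_right (m := 1) (by norm_num)).differentiableAt (by simp))
  have hev : ∀ᶠ y in 𝓝 x, ∇ φ y ≠ 0 := hg.continuousAt.eventually_ne hne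
  have hN : DifferentiableAt ℝ (fun y => ‖∇ φ y‖) x := hg.norm ℝ hne
  have hνd : DifferentiableAt ℝ ν x := (hN.inv (norm_ne_zero_iff.2 hne)).smul hg
  set N := fun y => ‖∇ φ y‖ with hNdef
  set r : Space d → ℝ := fun y => ⟪ξ y, ν y⟫_ℝ with hr
  have hrd : DifferentiableAt ℝ r x := hξ.inner ℝ hνd
  have hNν : ∀ᶠ y in 𝓝 x, ∇ φ y = N y • ν y := by
    filter_upwards [hev] with y hy
    exact (norm_smul_levelNormal hy).symm
  have hG : ∀ w, fderiv ℝ (∇ φ) x w = N x • fderiv ℝ ν x w + fderiv ℝ N x w • ν x := by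
    intro w
    rw [EventuallyEq.fderiv_eq (f₁ := ∇ φ) (f := fun y => N y • ν y) hNν, fderiv_fun_smul hN hνd]
    simp
  have hν1 : ⟪ν x, ν x⟫_ℝ = 1 := by rw [real_inner_self_eq_norm_sq, norm_levelNormal hne, one_pow]
  -- Differentiate `|ν|² = 1`, which holds near `x`.
  have hνν : ∀ w, ⟪fderiv ℝ ν x w, ν x⟫_ℝ = 0 := by
    intro w
    have h1 : (fun y => ⟪ν y, ν y⟫_ℝ) =ᶠ[𝓝 x] fun _ => 1 := by
      filter_upwards [hev] with y hy
      rw [real_inner_self_eq_norm_sq, norm_levelNormal hy, one_pow]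
    have h2 := h1.fderiv_eq (𝕜 := ℝ)
    rw [fderiv_const_apply] at h2
    have h3 := fderiv_inner_apply ℝ hνd hνd w
    rw [h2, zero_apply] at h3
    have h4 := real_inner_comm (ν x) (fderiv ℝ ν x w)
    linarith
  have hDN : ∀ w, fderiv ℝ N x w = ⟪fderiv ℝ (∇ φ) x w, ν x⟫_ℝ := by
    intro w
    rw [hG, inner_add_left, real_inner_smul_left, real_inner_smul_left, hνν, hν1]
    ring
  have hDr : fderiv ℝ r x (ν x) = ⟪ξ x, fderiv ℝ ν x (ν x)⟫_ℝ + ⟪fderiv ℝ ξ x (ν x), ν x⟫_ℝ :=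
    fderiv_inner_apply ℝ hξ hνd (ν x)
  have hZ : DifferentiableAt ℝ (fun y => ξ y - r y • ν y) x := hξ.sub (hrd.smul hνd)
  have h1 : div (tangential φ ξ) x = ⟪∇ N x, ξ x - r x • ν x⟫_ℝ +
      N x * (div ξ x - (⟪∇ r x, ν x⟫_ℝ + r x * div ν x)) := by
    have hrν : DifferentiableAt ℝ (fun y => r y • ν y) x := hrd.smul hνd
    rw [← div_smul hrd hνd, ← div_sub hξ hrν]
    exact div_smul hN hZ
  -- By the symmetry of the Hessian, `∇|∇φ|` tested with a tangential vector gives `|∇φ|` times the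
  -- derivative of `ν` in the direction `ν`, paired with that vector. This cancels the corresponding
  -- term in the normal derivative of `r`; the factor `|∇φ|` in the field is there for this
  -- cancellation.
  have h2 : ⟪∇ N x, ξ x - r x • ν x⟫_ℝ = N x * ⟪ξ x, fderiv ℝ ν x (ν x)⟫_ℝ := by
    have h3 : ⟪ν x, ξ x - r x • ν x⟫_ℝ = 0 := by
      rw [inner_sub_right, real_inner_smul_right, hν1, hr, real_inner_comm]
      ring
    rw [inner_gradient_left, hDN, inner_fderiv_gradient_comm hφ, hG, inner_add_left,
      real_inner_smul_left, real_inner_smul_left, h3, inner_sub_right, real_inner_smul_right, hνν,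
      real_inner_comm]
    ring
  rw [h1, h2, inner_gradient_left, hDr, surfaceDiv, quadGrad, real_inner_comm (ν x) (fderiv ℝ ξ x (ν x))]
  ring

theorem contDiff_deriv_cut : ContDiff ℝ 1 (deriv cut) := by
  have h : ContDiff ℝ 2 cut := contDiff_cut (n := 2)
  exact (contDiff_succ_iff_deriv (n := 1).1 h).2.2

namespace IsGraphBox

variable {k : Fin (n + 1)} {φ : Space (n + 1) → ℝ} {I : Set ℝ} {B : Set (Space n)} {c : ℝ}

/-- The divergence theorem for vector fields that are tangential to all level sets. -/
theorem integral_div_eq_zero (h : IsGraphBox k φ I B c) {W : Space (n + 1) → Space (n + 1)}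
    (hW : ContDiff ℝ 1 W) (hc : HasCompactSupport W) (hs : tsupport W ⊆ box k I B)
    (ht : ∀ x ∈ box k I B, ⟪∇ φ x, W x⟫_ℝ = 0) :
    ∫ x in {x ∈ box k I B | φ x = 0}, div W x / ‖∇ φ x‖ ∂μHE[n] = 0 := by
  have hdc := continuous_div_of_contDiff hW
  obtain ⟨M, hM⟩ := hdc.bounded_above_of_compact_support (hasCompactSupport_div hc)
  have hlim := h.tendsto_integral_deriv_cut hdc.measurable hM
    (fun x hx => div_eq_zero_of_notMem_tsupport fun hcon => hx (hs hcon))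
    (ae_of_all _ fun y => hdc.continuousAt)
  refine tendsto_nhds_unique hlim (tendsto_const_nhds.congr' ?_)
  filter_upwards [self_mem_nhdsWithin] with ε hε
  have hsub : tsupport (fun x => (ε⁻¹ * deriv cut (φ x / ε)) • W x) ⊆ tsupport W :=
    closure_mono fun x (hx : (ε⁻¹ * deriv cut (φ x / ε)) • W x ≠ 0) h0 => hx (by rw [h0, smul_zero])
  have hsm : ContDiffOn ℝ 1 (fun x => ε⁻¹ * deriv cut (φ x / ε)) (box k I B) :=
    contDiffOn_const.mul (contDiff_deriv_cut.comp_contDiffOn (h.contDiffOn.div_const ε))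
  have hC1 : ContDiff ℝ 1 fun x => (ε⁻¹ * deriv cut (φ x / ε)) • W x :=
    contDiff_of_tsupport_subset h.isOpen_box (hsm.smul hW.contDiffOn) (hsub.trans hs)
  -- The weight `ε⁻¹ cut'(φ/ε)` has a gradient parallel to `∇φ`, hence orthogonal to `W`. So the
  -- weighted divergence of `W` is the divergence of the weighted field, and its integral is zero
  -- for every `ε`, not only in the limit.
  rw [← Muskat.integral_div_eq_zero hC1 (hc.mono' ((subset_tsupport _).trans hsub))]
  congr 1
  ext x
  by_cases hx : x ∈ box k I B
  · have hd := (hsm.differentiableOn (by simp)).differentiableAt (h.isOpen_box.mem_nhds hx)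
    have hdd : DifferentiableAt ℝ (deriv cut) (φ x / ε) :=
      contDiff_deriv_cut.differentiable (by simp) _
    have h1 : HasFDerivAt (fun x => ε⁻¹ * deriv cut (φ x / ε))
        (ε⁻¹ • (deriv (deriv cut) (φ x / ε) • (ε⁻¹ • fderiv ℝ φ x))) x := by
      have h2 : HasFDerivAt (fun x => φ x / ε) (ε⁻¹ • fderiv ℝ φ x) x :=
        (h.differentiableAt hx).hasFDerivAt.mul_const ε⁻¹
      exact (hdd.hasDerivAt.comp_hasFDerivAt x h2).const_mul ε⁻¹
    rw [div_smul hd (hW.differentiable (by simp) x), inner_gradient_left, h1.fderiv]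
    have h2 := ht x hx
    rw [inner_gradient_left] at h2
    simp [h2, mul_comm]
  · rw [div_eq_zero_of_notMem_tsupport fun hcon => hx (hs (hsub hcon)),
      div_eq_zero_of_notMem_tsupport fun hcon => hx (hs hcon), zero_mul]

theorem le_norm_gradient (h : IsGraphBox k φ I B c) {x : Space (n + 1)} (hx : x ∈ box k I B) :
    c ≤ ‖∇ φ x‖ := by
  refine (h.le_abs_gradient hx).trans ?_
  have := PiLp.norm_apply_le (∇ φ x) k
  exact this

/-- The divergence theorem on the part of the interface inside the domain, for vector fields that
are tangential to the interface and, along its boundary, to the wall. -/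
theorem integral_div_inter_eq_zero (h : IsGraphBox k φ I B c) {L : ℝ}
    (hL : ∀ x ∈ box k I B, ‖∇ φ x‖ ≤ L) {Ω D : Set (Space (n + 1))} {β : Space (n + 1) → ℝ}
    (hΩ : IsOpen Ω) (hD : D ⊆ box k I B) (hβ : IsDomainLevel Ω D β) {C : ℝ} (hC0 : 0 ≤ C)
    (hC : ∀ ε, 0 < ε → μHE[n] {x ∈ D | φ x = 0 ∧ β x ∈ Icc ε (2 * ε)} ≤ ENNReal.ofReal (C * ε))
    {W : Space (n + 1) → Space (n + 1)}
    (hW : ContDiff ℝ 1 W) (hc : HasCompactSupport W) (hs : tsupport W ⊆ D)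
    (ht : ∀ x ∈ box k I B, ⟪∇ φ x, W x⟫_ℝ = 0)
    (hw : ∀ x ∈ D, φ x = 0 → x ∈ frontier Ω → ⟪∇ β x, W x⟫_ℝ = 0) :
    ∫ x in {x ∈ box k I B | φ x = 0}, Ω.indicator (fun x => div W x / ‖∇ φ x‖) x ∂μHE[n] = 0 := by
  set Z := {x ∈ box k I B | φ x = 0} with hZ
  have hZm : MeasurableSet Z := h.measurableSet_zero
  have hZfin : μHE[n] Z < ⊤ := by
    have h1 := h.measure_zero_set_inter_le hL MeasurableSet.univ
    rw [inter_univ, preimage_univ, inter_univ] at h1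
    exact h1.trans_lt (ENNReal.mul_lt_top ENNReal.ofReal_lt_top h.bounded_snd.measure_lt_top)
  have hβ1 : ContDiffOn ℝ 1 β D := hβ.smooth.of_le (by simp)
  set b := D.indicator β with hb
  have hbm : Measurable b :=
    measurable_indicator_of_continuousOn hβ.isOpen.measurableSet hβ1.continuousOn
  set N : Space (n + 1) → ℝ := fun x => ‖∇ φ x‖ with hN
  have hNm : AEStronglyMeasurable N (μHE[n].restrict Z) := by
    have h1 : ContinuousOn N (box k I B) := (continuousOn_gradient h.isOpen_box h.contDiffOn).norm
    exact (h1.mono fun x hx => hx.1).aestronglyMeasurable hZm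
  have hFi : ∀ V : Space (n + 1) → Space (n + 1), ContDiff ℝ 1 V → HasCompactSupport V →
      Integrable (fun x => div V x / N x) (μHE[n].restrict Z) := by
    intro V hV hVc
    have hVd := continuous_div_of_contDiff hV
    obtain ⟨M, hM⟩ := hVd.bounded_above_of_compact_support (hasCompactSupport_div hVc)
    refine (integrableOn_const (C := M / c) hZfin.ne).mono'
      (hVd.aestronglyMeasurable.div₀ hNm) ((ae_restrict_iff' hZm).2 (ae_of_all _ fun x hx => ?_))
    rw [norm_div, hN, norm_norm]
    exact div_le_div₀ ((norm_nonneg _).trans (hM x)) (hM x) h.pos (h.le_norm_gradient hx.1)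
  have hF := hFi W hW hc
  have hcb : ∀ ε x, ‖cut (b x / ε) * (div W x / N x)‖ ≤ ‖div W x / N x‖ := by
    intro ε x
    rw [norm_mul]
    have h1 : ‖cut (b x / ε)‖ ≤ 1 := abs_cut_le_one _
    exact mul_le_of_le_one_left (norm_nonneg _) h1
  have hcm : ∀ ε, AEStronglyMeasurable (fun x => cut (b x / ε) * (div W x / N x))
      (μHE[n].restrict Z) := fun ε =>
    ((continuous_cut.measurable.comp (hbm.div_const ε)).aestronglyMeasurable).mul
      hF.aestronglyMeasurable
  -- The cutoff along the wall converges pointwise to the indicator of `Ω`.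
  have hlim : Tendsto (fun ε => ∫ x in Z, cut (b x / ε) * (div W x / N x) ∂μHE[n]) (𝓝[>] 0)
      (𝓝 (∫ x in Z, Ω.indicator (fun x => div W x / N x) x ∂μHE[n])) := by
    refine tendsto_integral_filter_of_dominated_convergence (fun x => ‖div W x / N x‖)
      (Eventually.of_forall hcm) (Eventually.of_forall fun ε => ae_of_all _ (hcb ε)) hF.norm
      (ae_of_all _ fun x => ?_)
    by_cases hx : x ∈ D
    · have h1 := (tendsto_cut_div (b x)).mul_const (div W x / N x)
      convert h1 using 2
      rw [hb, indicator_of_mem hx]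
      by_cases hxΩ : x ∈ Ω
      · rw [indicator_of_mem hxΩ, if_pos ((hβ.mem x hx).1 hxΩ), one_mul]
      · rw [indicator_of_notMem hxΩ, if_neg fun hcon => hxΩ ((hβ.mem x hx).2 hcon), zero_mul]
    · have h1 : div W x = 0 := div_eq_zero_of_notMem_tsupport fun hcon => hx (hs hcon)
      have h2 : Ω.indicator (fun x => div W x / N x) x = 0 := by
        by_cases hxΩ : x ∈ Ω <;> simp [hxΩ, h1]
      rw [h2]
      simp only [h1, zero_div, mul_zero]
      exact tendsto_const_nhds
  have hstrip : ∀ ε, 0 < ε → μHE[n].restrict Z {x | b x ∈ Icc ε (2 * ε)} ≤ ENNReal.ofReal (C * ε) := by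
    intro ε hε
    have hm : MeasurableSet {x | b x ∈ Icc ε (2 * ε)} := hbm measurableSet_Icc
    rw [Measure.restrict_apply hm]
    refine (measure_mono ?_).trans (hC ε hε)
    rintro x ⟨hx, hxZ⟩
    have hx : b x ∈ Icc ε (2 * ε) := hx
    by_cases hxD : x ∈ D
    · rw [hb, indicator_of_mem hxD] at hx
      exact ⟨hxD, hxZ.2, hx⟩
    · rw [hb, indicator_of_notMem hxD] at hx
      exact absurd hx.1 (not_le.2 hε)
  have hK : IsCompact ((tsupport W ∩ φ ⁻¹' {0}) ∩ closure Ω) := by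
    refine IsCompact.inter_right ?_ isClosed_closure
    exact hc.of_isClosed_subset ((h.contDiffOn.continuousOn.mono
      (hs.trans hD)).preimage_isClosed_of_isClosed (isClosed_tsupport W) isClosed_singleton)
      inter_subset_left
  have hKD : (tsupport W ∩ φ ⁻¹' {0}) ∩ closure Ω ⊆ D := fun x hx => hs hx.1.1
  have hgc : ContinuousOn (fun x => ⟪∇ β x, W x⟫_ℝ) ((tsupport W ∩ φ ⁻¹' {0}) ∩ closure Ω) :=
    ContinuousOn.inner (𝕜 := ℝ) ((continuousOn_gradient hβ.isOpen hβ1).mono hKD)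
      hW.continuous.continuousOn
  -- The derivative of the wall cutoff is paired with `∇β·W`, which vanishes where the interface
  -- meets the wall. Dividing by `|∇φ| ≥ c` is harmless, as the threshold `η * c` shows.
  have herr := tendsto_integral_deriv_cut_zero (ρ := μHE[n].restrict Z) (b := b)
    (g := fun x => ⟪∇ β x, W x⟫_ℝ / N x) hbm hC0 hstrip fun η hη => by
      obtain ⟨δ, hδ0, hδ⟩ := exists_forall_abs_le_of_zero hK hgc (hβ1.continuousOn.mono hKD)
        (fun x hx h0 => hw x (hs hx.1.1) hx.1.2 ((hβ.nonneg hΩ (hs hx.1.1) hx.2).2 h0))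
        (η := η * c) (mul_pos hη h.pos)
      refine ⟨δ, hδ0, (ae_restrict_iff' hZm).2 (ae_of_all _ fun x hx hpos hle => ?_)⟩
      by_cases hxs : x ∈ tsupport W
      · rw [hb, indicator_of_mem (hs hxs)] at hpos hle
        have hxΩ := (hβ.mem x (hs hxs)).2 hpos
        have h4 := hδ x ⟨⟨hxs, hx.2⟩, subset_closure hxΩ⟩ (by rwa [abs_of_pos hpos])
        have h5 := h.le_norm_gradient hx.1
        rw [abs_div, hN, abs_norm, div_le_iff₀ (h.pos.trans_le h5)]
        exact h4.trans (by gcongr)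
      · rw [image_eq_zero_of_notMem_tsupport hxs, inner_zero_right, zero_div, abs_zero]
        exact hη.le
  -- The field multiplied by the wall cutoff is still tangential to all level sets of `φ`, so the
  -- theorem without wall applies to it.
  have heq : ∀ ε, 0 < ε → ∫ x in Z, cut (b x / ε) * (div W x / N x) ∂μHE[n] =
      -∫ x in Z, ε⁻¹ * deriv cut (b x / ε) * (⟪∇ β x, W x⟫_ℝ / N x) ∂μHE[n] := by
    intro ε hε
    have hWε := contDiff_cut_smul hβ.isOpen hβ1 hW hs ε
    have hcε : HasCompactSupport fun x => cut (β x / ε) • W x := hasCompactSupport_cut_smul hc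
    have hsε := tsupport_cut_smul_subset β W ε
    have h1 := h.integral_div_eq_zero hWε hcε (hsε.trans (hs.trans hD))
      (fun x hx => by rw [real_inner_smul_right, ht x hx, mul_zero])
    have h2 : ∀ x, div (fun x => cut (β x / ε) • W x) x / N x = cut (b x / ε) * (div W x / N x) +
        ε⁻¹ * deriv cut (b x / ε) * (⟪∇ β x, W x⟫_ℝ / N x) := by
      intro x
      by_cases hx : x ∈ D
      · rw [hb, indicator_of_mem hx, div_cut_smul
          ((hβ1.differentiableOn (by simp)).differentiableAt (hβ.isOpen.mem_nhds hx))
          (hW.differentiable (by simp) x)]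
        ring
      · rw [div_eq_zero_of_notMem_tsupport fun hcon => hx (hs (hsε hcon)),
          div_eq_zero_of_notMem_tsupport fun hcon => hx (hs hcon),
          image_eq_zero_of_notMem_tsupport fun hcon => hx (hs hcon)]
        simp
    have h3 : Integrable (fun x => cut (b x / ε) * (div W x / N x)) (μHE[n].restrict Z) :=
      hF.norm.mono' (hcm ε) (ae_of_all _ (hcb ε))
    have h4 : Integrable (fun x => ε⁻¹ * deriv cut (b x / ε) * (⟪∇ β x, W x⟫_ℝ / N x))
        (μHE[n].restrict Z) := by
      refine ((hFi _ hWε hcε).sub h3).congr (ae_of_all _ fun x => ?_)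
      simp only [Pi.sub_apply]
      rw [h2]
      ring
    have h5 : ∫ x in Z, (cut (b x / ε) * (div W x / N x) +
        ε⁻¹ * deriv cut (b x / ε) * (⟪∇ β x, W x⟫_ℝ / N x)) ∂μHE[n] = 0 := by
      rw [← h1]
      exact integral_congr_ae (ae_of_all _ fun x => (h2 x).symm)
    rw [integral_add h3 h4] at h5
    linarith
  have herr' := herr.neg
  rw [neg_zero] at herr'
  refine tendsto_nhds_unique hlim (herr'.congr' ?_)
  filter_upwards [self_mem_nhdsWithin] with ε hε
  rw [heq ε hε]

end IsGraphBox

/-! ### Surface integrals over the interface -/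

/-- The surface measure of the part of the interface inside the domain. -/
def interfaceMeasure (Ω : Set (Space (n + 1))) (A : Fin 2 → ℝ → Set (Space (n + 1))) (t : ℝ) :
    Measure (Space (n + 1)) := μHE[n].restrict (interface A t ∩ Ω)

/-- The vector field is tangential to the wall. -/
def IsWallTangent (Ω : Set (Space d)) (ξ : Space d → Space d) : Prop :=
  ∀ x m, IsOuterNormal Ω x m → ⟪ξ x, m⟫_ℝ = 0

theorem IsWallTangent.smul {Ω : Set (Space d)} {ξ : Space d → Space d} (h : IsWallTangent Ω ξ)
    (η : Space d → ℝ) : IsWallTangent Ω fun x => η x • ξ x := fun x m hm => by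
  rw [real_inner_smul_left, h x m hm, mul_zero]

/-- Allows the function `-φ`, positive in the second phase, to be used with the same box and the
same graph. -/
theorem IsGraphBox.const_mul {k : Fin (n + 1)} {φ : Space (n + 1) → ℝ} {I : Set ℝ}
    {B : Set (Space n)} {c : ℝ} (h : IsGraphBox k φ I B c) {s : ℝ} (hs : |s| = 1) :
    IsGraphBox k (fun x => s * φ x) I B c ∧
      ∀ y ∈ B, graph k (fun x => s * φ x) I B y = graph k φ I B y := by
  have hg : IsGraphBox k (fun x => s * φ x) I B c := by
    refine ⟨h.isOpen_fst, h.isOpen_snd, h.bounded_fst, h.bounded_snd, h.pos,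
      contDiffOn_const.mul h.contDiffOn, fun y hy r hr r' hr' => ?_, fun y hy => ?_⟩
    · rw [← mul_sub, abs_mul, hs, one_mul]
      exact h.expand y hy r hr r' hr'
    · obtain ⟨r, hr, h0⟩ := h.zero y hy
      exact ⟨r, hr, by rw [h0, mul_zero]⟩
  have hs0 : s ≠ 0 := fun h0 => by simp [h0] at hs
  refine ⟨hg, fun y hy => ?_⟩
  have h1 := (mul_eq_zero.1 (hg.apply_graph hy)).resolve_left hs0
  rw [graph, graph, h.eq_height hy (hg.height_mem hy) h1]

theorem abs_phaseSign (i : Fin 2) : |phaseSign i| = 1 := by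
  unfold phaseSign; split_ifs <;> simp

namespace IsInterfaceBox

variable {Ω : Set (Space (n + 1))} {T σ : ℝ} {b : Fin 2 → ℝ} {Φ : Fin 2 → Space (n + 1) → ℝ}
  {A : Fin 2 → ℝ → Set (Space (n + 1))} {p : Fin 2 → ℝ → Space (n + 1) → ℝ}
  {φ : ℝ → Space (n + 1) → ℝ} {β : Space (n + 1) → ℝ} {k : Fin (n + 1)} {J I : Set ℝ}
  {B : Set (Space n)} {c L t : ℝ}

/-- Surface integrals over the interface in coordinates. -/
theorem integral_interfaceMeasure (h : IsInterfaceBox Ω T A φ β k J I B c L) (hΩ : IsOpen Ω)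
    (ht : t ∈ J) (htT : t ∈ Icc 0 T) {f g : Space (n + 1) → ℝ} (h0 : ∀ x, x ∉ box k I B → f x = 0)
    (hfg : ∀ x ∈ box k I B, φ t x = 0 → x ∈ Ω → f x = g x) :
    ∫ x, f x ∂(interfaceMeasure Ω A t) =
      ∫ x in {x ∈ box k I B | φ t x = 0}, Ω.indicator g x ∂μHE[n] := by
  have hZ := (h.graphBox t ht).measurableSet_zero
  have hb := (h.graphBox t ht).isOpen_box.measurableSet
  have hΓ : MeasurableSet (interface A t ∩ Ω) :=
    (IsClassicalSolution.isClosed_interface A t).measurableSet.inter hΩ.measurableSet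
  rw [setIntegral_indicator hΩ.measurableSet, interfaceMeasure]
  have h1 : {x ∈ box k I B | φ t x = 0} ∩ Ω = (interface A t ∩ Ω) ∩ box k I B := by
    ext x
    constructor
    · rintro ⟨⟨hxb, hx0⟩, hxΩ⟩
      exact ⟨⟨(h.mem_interface_iff ht htT hxb (subset_closure hxΩ)).2 hx0, hxΩ⟩, hxb⟩
    · rintro ⟨⟨hxi, hxΩ⟩, hxb⟩
      exact ⟨⟨hxb, (h.mem_interface_iff ht htT hxb (subset_closure hxΩ)).1 hxi⟩, hxΩ⟩
  have h2 : ∫ x in {x ∈ box k I B | φ t x = 0} ∩ Ω, g x ∂μHE[n] =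
      ∫ x in {x ∈ box k I B | φ t x = 0} ∩ Ω, f x ∂μHE[n] :=
    setIntegral_congr_fun (hZ.inter hΩ.measurableSet) fun x hx =>
      (hfg x hx.1.1 hx.1.2 hx.2).symm
  rw [h2, h1]
  exact (setIntegral_eq_of_subset_of_forall_sdiff_eq_zero hΓ inter_subset_left fun x hx =>
    h0 x fun hxb => hx.2 ⟨hx.1, hxb⟩)

/-- Near a point of the interface, the strips along the wall have small area. -/
theorem exists_strip (h : IsInterfaceBox Ω T A φ β k J I B c L)
    (hs : IsClassicalSolution Ω T σ b Φ A p) (hΩ : IsOpen Ω) (ht : t ∈ J) (htT : t ∈ Icc 0 T)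
    {x₀ : Space (n + 1)} (hx₀ : x₀ ∈ box k I B) (hxi : x₀ ∈ interface A t) :
    ∃ D ⊆ box k I B, IsOpen D ∧ x₀ ∈ D ∧ ∃ C, 0 ≤ C ∧ ∀ ε, 0 < ε →
      μHE[n] {x ∈ D | φ t x = 0 ∧ β x ∈ Icc ε (2 * ε)} ≤ ENNReal.ofReal (C * ε) := by
  have hG := h.graphBox t ht
  have hxc := hs.interface_subset htT hxi
  have h0 := (h.mem_interface_iff ht htT hx₀ hxc).1 hxi
  have hLc : 0 ≤ L / c := div_nonneg ((norm_nonneg _).trans (h.bound t ht x₀ hx₀)) hG.pos.le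
  have hβc := h.level.smooth.continuousOn
  by_cases hxf : x₀ ∈ frontier Ω
  · obtain ⟨y₀, hy₀, hgy₀⟩ : x₀ ∈ graph k (φ t) I B '' B := by
      rw [← hG.zero_set_eq]; exact ⟨hx₀, h0⟩
    have hβs : HasStrictFDerivAt β (fderiv ℝ β x₀) x₀ :=
      ((h.level.smooth.of_le (by simp : (1 : WithTop ℕ∞) ≤ ∞)).contDiffAt
        (h.level.isOpen.mem_nhds hx₀)).hasStrictFDerivAt (by simp)
    have hgs := hG.hasStrictFDerivAt_graph hy₀
    rw [hgy₀] at hgs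
    have hcomp : HasStrictFDerivAt (fun y => β (graph k (φ t) I B y))
        ((fderiv ℝ β x₀).comp (IsGraphBox.graphDeriv k (φ t) x₀)) y₀ := by
      refine HasStrictFDerivAt.comp y₀ (g := β) ?_ hgs
      rw [hgy₀]
      exact hβs
    -- At the wall the interface is transversal: `∇β x₀` is tangent to it, and `β` has a non-zero
    -- derivative in that direction. Hence strips of `β` along the graph correspond to strips of
    -- small volume in the parameter domain.
    have hne : ∃ j, (fderiv ℝ β x₀).comp (IsGraphBox.graphDeriv k (φ t) x₀) (EuclideanSpace.single j 1) ≠ 0 := by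
      by_contra! hcon
      have hzero : (fderiv ℝ β x₀).comp (IsGraphBox.graphDeriv k (φ t) x₀) = 0 := by
        refine ContinuousLinearMap.coe_injective ((EuclideanSpace.basisFun (Fin n) ℝ).toBasis.ext ?_)
        intro j
        simpa using hcon j
      have h1 := hG.graphDeriv_rem hx₀ (h.inner_gradient_eq_zero hs ht htT hx₀ h0 hxf)
      have h2 : (fderiv ℝ β x₀).comp (IsGraphBox.graphDeriv k (φ t) x₀) (rem k (∇ β x₀)) = ‖∇ β x₀‖ ^ 2 := by
        rw [ContinuousLinearMap.comp_apply, h1, inner_gradient_gradient]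
      rw [hzero, zero_apply] at h2
      exact pow_ne_zero 2 (norm_ne_zero_iff.2 (h.level.wall x₀ hx₀ hxf).2.1) h2.symm
    obtain ⟨j, hj⟩ := hne
    -- With a zero-dimensional base there is no direction `j`, so this case does not occur.
    obtain _ | m := n
    · exact j.elim0
    have hst : HasStrictFDerivAt (Function.uncurry fun (_ : ℝ) y => β (graph k (φ t) I B y))
        (((fderiv ℝ β x₀).comp (IsGraphBox.graphDeriv k (φ t) x₀)).comp
          (ContinuousLinearMap.snd ℝ ℝ (Space (m + 1)))) ((0 : ℝ), y₀) :=
      HasStrictFDerivAt.comp ((0 : ℝ), y₀) (g := fun y => β (graph k (φ t) I B y))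
        (f := Prod.snd) hcomp hasStrictFDerivAt_snd
    have hcont : ContinuousOn (Function.uncurry fun (_ : ℝ) y => β (graph k (φ t) I B y))
        (Prod.snd ⁻¹' B) := by
      have h1 : ContinuousOn (fun y => β (graph k (φ t) I B y)) B :=
        hβc.comp (fun y hy => (hG.continuousAt_graph hy).continuousWithinAt)
          fun y hy => hG.graph_mem hy
      exact h1.comp continuous_snd.continuousOn fun z hz => hz
    obtain ⟨N, hN, C, hC0, hC⟩ := exists_nhds_volume_strip_le_of_hasStrictFDerivAt
      (hG.isOpen_snd.preimage continuous_snd) (z₀ := ((0 : ℝ), y₀)) hy₀ hcont hst (k := j)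
      (by simpa using hj)
    obtain ⟨N', hN'N, hN'o, hN'⟩ := _root_.mem_nhds_iff.1 hN
    have hNy : IsOpen {y : Space (m + 1) | ((0 : ℝ), y) ∈ N'} :=
      hN'o.preimage (by fun_prop : Continuous fun y : Space (m + 1) => ((0 : ℝ), y))
    have hDo : IsOpen (box k I B ∩ rem k ⁻¹' {y : Space (m + 1) | ((0 : ℝ), y) ∈ N'}) :=
      hG.isOpen_box.inter (hNy.preimage (continuous_rem k))
    refine ⟨_, inter_subset_left, hDo,
      ⟨hx₀, ?_⟩, L / c * C, by positivity, fun ε hε => ?_⟩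
    · rw [mem_preimage, ← hgy₀, graph, rem_ins]
      exact hN'
    · set D := box k I B ∩ rem k ⁻¹' {y : Space (m + 1) | ((0 : ℝ), y) ∈ N'} with hD
      have hSm : MeasurableSet (D ∩ (D.indicator β) ⁻¹' Icc ε (2 * ε)) :=
        hDo.measurableSet.inter (measurable_indicator_of_continuousOn hDo.measurableSet
          (hβc.mono inter_subset_left) measurableSet_Icc)
      have h1 := hG.measure_zero_set_inter_le (h.bound t ht) hSm
      calc μHE[m + 1] {x ∈ D | φ t x = 0 ∧ β x ∈ Icc ε (2 * ε)}
          ≤ μHE[m + 1] ({x ∈ box k I B | φ t x = 0} ∩ (D ∩ (D.indicator β) ⁻¹' Icc ε (2 * ε))) := by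
            refine measure_mono ?_
            rintro x ⟨hxD, hx0, hxβ⟩
            refine ⟨⟨hxD.1, hx0⟩, hxD, ?_⟩
            rw [mem_preimage, indicator_of_mem hxD]
            exact hxβ
        _ ≤ _ := h1
        -- The area element is at most `L / c`, which transfers the volume bound to the surface.
        _ ≤ ENNReal.ofReal (L / c) * ENNReal.ofReal (C * ε) := by
            gcongr
            refine le_trans (measure_mono ?_) (hC N' hN'N hN'o 0 ε hε)
            rintro y ⟨hy, hyD, hyβ⟩
            rw [mem_preimage, indicator_of_mem hyD] at hyβ
            have h2 := hyD.2
            rw [mem_preimage, graph, rem_ins] at h2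
            exact ⟨h2, hyβ⟩
        _ = ENNReal.ofReal (L / c * C * ε) := by
            rw [← ENNReal.ofReal_mul hLc, mul_assoc]
  -- At an interior point `β` exceeds `β x₀ / 2` nearby, so a non-empty strip forces `4ε ≥ β x₀`,
  -- and the crude bound on the total area is linear in `ε`.
  · have hβ0 : 0 < β x₀ := by
      refine (h.level.mem x₀ hx₀).1 ?_
      by_contra hcon
      exact hxf (by rw [hΩ.frontier_eq]; exact ⟨hxc, hcon⟩)
    have hDo : IsOpen (box k I B ∩ β ⁻¹' Ioi (β x₀ / 2)) :=
      hβc.isOpen_inter_preimage hG.isOpen_box isOpen_Ioi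
    have hB := hG.bounded_snd.measure_lt_top (μ := volume)
    refine ⟨_, inter_subset_left, hDo, ⟨hx₀, by
      show β x₀ / 2 < β x₀
      linarith⟩, 4 / β x₀ * (L / c * (volume B).toReal), by positivity, fun ε hε => ?_⟩
    rcases Set.eq_empty_or_nonempty
      {x ∈ box k I B ∩ β ⁻¹' Ioi (β x₀ / 2) | φ t x = 0 ∧ β x ∈ Icc ε (2 * ε)} with he | ⟨x, hx⟩
    · rw [he, measure_empty]
      exact zero_le
    · have h1 := hG.measure_zero_set_inter_le (h.bound t ht) MeasurableSet.univ
      rw [inter_univ, preimage_univ, inter_univ] at h1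
      have h2 : 1 ≤ 4 / β x₀ * ε := by
        have h3 : β x₀ / 2 < β x := hx.1.2
        have h4 := hx.2.2.2
        rw [div_mul_eq_mul_div, le_div_iff₀ hβ0]
        linarith
      calc _ ≤ μHE[n] {x ∈ box k I B | φ t x = 0} := by
            refine measure_mono ?_
            exact fun x hx => ⟨hx.1.1, hx.2.1⟩
        _ ≤ _ := h1
        _ = ENNReal.ofReal (L / c * (volume B).toReal) := by
            rw [ENNReal.ofReal_mul hLc, ENNReal.ofReal_toReal hB.ne]
        _ ≤ _ := by
            refine ENNReal.ofReal_le_ofReal ?_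
            have h5 : 0 ≤ L / c * (volume B).toReal := by positivity
            nlinarith

/-- The curvature identity near a point of the interface. -/
theorem exists_integral_curvature (h : IsInterfaceBox Ω T A φ β k J I B c L)
    (hs : IsClassicalSolution Ω T σ b Φ A p) (hΩ : IsOpen Ω) (ht : t ∈ J) (htT : t ∈ Icc 0 T)
    {x₀ : Space (n + 1)} (hx₀ : x₀ ∈ box k I B) (hxi : x₀ ∈ interface A t) :
    ∃ D ∈ 𝓝 x₀, ∀ ξ : Space (n + 1) → Space (n + 1), ContDiff ℝ 1 ξ → HasCompactSupport ξ →
      tsupport ξ ⊆ D → IsWallTangent Ω ξ →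
      ∫ x, (σ / 2 * (div ξ x - quadGrad ξ (interfaceNormal Ω T A t x) x) -
        (p 0 t x - p 1 t x) * ⟪ξ x, interfaceNormal Ω T A t x⟫_ℝ) ∂(interfaceMeasure Ω A t) = 0 := by
  have hG := h.graphBox t ht
  obtain ⟨D, hDb, hDo, hxD, C, hC0, hC⟩ := h.exists_strip hs hΩ ht htT hx₀ hxi
  refine ⟨D, hDo.mem_nhds hxD, fun ξ hξ hc hsup hwt => ?_⟩
  have hne : ∀ x ∈ box k I B, ∇ (φ t) x ≠ 0 := fun x hx =>
    norm_pos_iff.1 (hG.norm_gradient_pos hx)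
  have hW := contDiff_tangential hG.isOpen_box (h.contDiffOn_two ht) hne hξ (hsup.trans hDb)
  have hWs := tsupport_tangential_subset (φ t) ξ
  have hβD := h.level.mono hDo hDb
  -- Near the wall the tangential part of `ξ` is again tangential to the wall: `ξ` is by assumption,
  -- and the removed normal component is orthogonal to `∇β` by the right contact angle.
  have h1 := hG.integral_div_inter_eq_zero (h.bound t ht) hΩ hDb hβD hC0 hC hW
    (hc.mono' ((subset_tsupport _).trans hWs)) (hWs.trans hsup)
    (fun x hx => inner_gradient_tangential (hne x hx)) (fun x hx h0 hxf => by
      have h2 := h.inner_gradient_eq_zero hs ht htT (hDb hx) h0 hxf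
      have h3 := hβD.inner_gradient_eq_zero hΩ hwt hx (frontier_subset_closure hxf)
        (hβD.wall x hx hxf).1
      rw [tangential, real_inner_smul_right, inner_sub_right, h3, levelNormal,
        real_inner_smul_right, real_inner_smul_right, real_inner_smul_right,
        real_inner_comm (∇ (φ t) x) (∇ β x), h2]
      ring)
  obtain ⟨U, hφ, hU⟩ := h.chart
  rw [h.integral_interfaceMeasure hΩ ht htT
    (g := fun x => σ / 2 * (div (tangential (φ t) ξ) x / ‖∇ (φ t) x‖))]
  · have h4 : ∀ x, Ω.indicator (fun x => σ / 2 * (div (tangential (φ t) ξ) x / ‖∇ (φ t) x‖)) x =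
        σ / 2 * Ω.indicator (fun x => div (tangential (φ t) ξ) x / ‖∇ (φ t) x‖) x := by
      intro x
      by_cases hx : x ∈ Ω <;> simp [hx]
    simp only [h4]
    rw [integral_const_mul, h1, mul_zero]
  · intro x hx
    have hxs : x ∉ tsupport ξ := fun hcon => hx (hDb (hsup hcon))
    have hfd : fderiv ℝ ξ x = 0 := fderiv_eq_zero_of_notMem_tsupport hxs
    rw [div_eq_zero_of_notMem_tsupport hxs, image_eq_zero_of_notMem_tsupport hxs, quadGrad, hfd]
    simp
  -- The jump condition turns `p₁ - p₂` into `(σ/2) div ν`, so the integrand is `σ/2` times the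
  -- surface divergence of the tangential part.
  · intro x hx h0 hxΩ
    have hxi := (h.mem_interface_iff ht htT hx (subset_closure hxΩ)).2 h0
    have hj := hs.jump U φ hφ t htT x hxi (hU t ht x hx)
    rw [h.interfaceNormal_eq hΩ ht htT hx ⟨hxi, hxΩ⟩, div_tangential
      ((h.contDiffOn_two ht).contDiffAt (hG.isOpen_box.mem_nhds hx)) (hne x hx)
      (hξ.differentiable (by simp) x), mul_div_cancel_left₀ _ (hG.norm_gradient_pos hx).ne',
      hj, surfaceDiv]
    have h5 : meanCurvature φ t x = div (levelNormal (φ t)) x := rfl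
    rw [h5, levelNormal]
    ring

/-- Integration by parts near a point of the interface. -/
theorem integral_flux (h : IsInterfaceBox Ω T A φ β k J I B c L)
    (hs : IsClassicalSolution Ω T σ b Φ A p) (hΩ : IsOpen Ω) (hΩb : Bornology.IsBounded Ω)
    (ht : t ∈ J) (htT : t ∈ Icc 0 T) (i : Fin 2) {q : Space (n + 1) → ℝ}
    (hq : IsBoundedC1 (A i t) q) (hqc : ContinuousOn q (closure (A i t)))
    {ξ : Space (n + 1) → Space (n + 1)} (hξ : ContDiff ℝ 1 ξ) (hc : HasCompactSupport ξ)
    (hsup : tsupport ξ ⊆ box k I B) (hwt : IsWallTangent Ω ξ) :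
    ∫ x in A i t, flux q ξ x = -(phaseSign i *
      ∫ x, q x * ⟪ξ x, interfaceNormal Ω T A t x⟫_ℝ ∂(interfaceMeasure Ω A t)) := by
  have hK : IsCompact (closure (A i t)) :=
    (hΩb.subset (hs.phase_subset i t htT)).isCompact_closure
  obtain ⟨M, hM⟩ := hK.exists_bound_of_continuousOn hqc
  -- Tietze extension: `q` is continuous only on the closure of its phase, while the layer limit
  -- requires a bounded continuous function around the interface.
  obtain ⟨Q, hQm, hQ⟩ := ContinuousMap.exists_restrict_eq_forall_mem_of_closed
    (⟨(closure (A i t)).domRestrict q, hqc.domRestrict⟩ : C(closure (A i t), ℝ))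
    (t := Icc (-|M|) |M|) (fun x => by
      have := (hM x x.2).trans (le_abs_self M)
      rw [Real.norm_eq_abs, abs_le] at this
      exact this) ⟨0, by simp⟩ isClosed_closure
  have hqQ : ∀ x ∈ closure (A i t), q x = Q x := fun x hx =>
    (congrArg (fun f : C(closure (A i t), ℝ) => f ⟨x, hx⟩) hQ).symm
  have hG := h.graphBox t ht
  obtain ⟨hGs, hgr⟩ := hG.const_mul (abs_phaseSign i)
  have hnull : volume (B ∩ (graph k (fun x => phaseSign i * φ t x) I B) ⁻¹' frontier Ω) = 0 := by
    refine measure_mono_null ?_ (h.measure_inter_frontier hs ht htT).1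
    rintro y ⟨hy, hyf⟩
    rw [mem_preimage, hgr y hy] at hyf
    exact ⟨hy, hyf⟩
  have h1 := hGs.integral_flux h.level hΩ hq (hs.phase_subset i t htT) Q.continuous (M := |M|)
    (fun x => abs_le.2 (hQm x)) (fun x hx => hqQ x (subset_closure hx))
    (fun x hx hxΩ => h.mem_phase i ht htT hx hxΩ) hnull hξ hc hsup hwt
  have hset : {x ∈ box k I B | phaseSign i * φ t x = 0} = {x ∈ box k I B | φ t x = 0} := by
    ext x
    simp [phaseSign_ne_zero i]
  rw [h1, hset, ← integral_const_mul, h.integral_interfaceMeasure hΩ ht htT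
    (g := fun x => Q x * ⟪∇ (fun x => phaseSign i * φ t x) x, ξ x⟫_ℝ /
      ‖∇ (fun x => phaseSign i * φ t x) x‖)]
  · congr 1
    refine integral_congr_ae (ae_of_all _ fun x => ?_)
    by_cases hx : x ∈ Ω <;> simp [hx]
  · intro x hx
    rw [image_eq_zero_of_notMem_tsupport fun hcon => hx (hsup hcon), inner_zero_left]
    ring
  · intro x hx h0 hxΩ
    have hxi := (h.mem_interface_iff ht htT hx (subset_closure hxΩ)).2 h0
    rw [h.interfaceNormal_eq hΩ ht htT hx ⟨hxi, hxΩ⟩, gradient_const_mul _ (hG.differentiableAt hx),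
      norm_smul, Real.norm_eq_abs, abs_phaseSign, one_mul, real_inner_smul_left,
      real_inner_smul_right, real_inner_comm,
      hqQ x (IsClassicalSolution.interface_subset_closure_phase i t hxi)]
    ring

end IsInterfaceBox

/-! ### Identities at a fixed time -/

/-- A functional of vector fields that is additive and local vanishes if it vanishes locally. -/
theorem eq_zero_of_local {Ω K : Set (Space d)} (hK : IsCompact K)
    (ℓ : (Space d → Space d) → ℝ)
    (hsum : ∀ (s : Finset (Space d)) (u : Space d → Space d → Space d),
      (∀ j ∈ s, ContDiff ℝ 1 (u j) ∧ HasCompactSupport (u j)) →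
      ℓ (fun x => ∑ j ∈ s, u j x) = ∑ j ∈ s, ℓ (u j))
    (hcongr : ∀ ξ ξ' : Space d → Space d, (∀ x ∈ K, ξ =ᶠ[𝓝 x] ξ') → ℓ ξ = ℓ ξ')
    (hloc : ∀ x ∈ K, ∃ D ∈ 𝓝 x, ∀ ξ, ContDiff ℝ 1 ξ → HasCompactSupport ξ → tsupport ξ ⊆ D →
      IsWallTangent Ω ξ → ℓ ξ = 0)
    {ξ : Space d → Space d} (hξ : ContDiff ℝ 1 ξ) (hwt : IsWallTangent Ω ξ) : ℓ ξ = 0 := by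
  choose! D hD hℓ using hloc
  obtain ⟨s, η, hsK, hη, hηs, -, V, hVo, hKV, h1⟩ := exists_smooth_partition hK hD
  set u : Space d → Space d → Space d := fun j x => η j x • ξ x with hu
  have hu1 : ∀ j, ContDiff ℝ 1 (u j) := fun j => ((hη j).of_le (by simp)).smul hξ
  have huc : ∀ j ∈ s, HasCompactSupport (u j) := fun j hj => (hηs j hj).1.smul_right
  -- The partition sums to one on a neighbourhood of `K`, so the field and the sum of its pieces
  -- have equal germs at the points of `K`; the pieces inherit tangency to the wall.
  have h2 : ℓ ξ = ℓ fun x => ∑ j ∈ s, u j x := by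
    refine hcongr _ _ fun x hx => ?_
    filter_upwards [hVo.mem_nhds (hKV hx)] with y hy
    rw [hu]
    simp only
    rw [← Finset.sum_smul, h1 y hy, one_smul]
  rw [h2, hsum s u fun j hj => ⟨hu1 j, huc j hj⟩]
  refine Finset.sum_eq_zero fun j hj => hℓ j (hsK j hj) _ (hu1 j) (huc j hj) ?_ (hwt.smul (η j))
  refine Subset.trans (closure_mono ?_) (hηs j hj).2
  exact fun x (hx : η j x • ξ x ≠ 0) h0 => hx (by rw [h0, zero_smul])

theorem div_sum {s : Finset (Space d)} {u : Space d → Space d → Space d}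
    (hu : ∀ j ∈ s, ContDiff ℝ 1 (u j)) (x : Space d) :
    div (fun x => ∑ j ∈ s, u j x) x = ∑ j ∈ s, div (u j) x := by
  unfold div
  rw [fderiv_fun_sum fun j hj => (hu j hj).differentiable (by simp) x, Finset.sum_comm]
  refine Finset.sum_congr rfl fun k _ => ?_
  rw [sum_apply]
  simp

theorem quadGrad_sum {s : Finset (Space d)} {u : Space d → Space d → Space d}
    (hu : ∀ j ∈ s, ContDiff ℝ 1 (u j)) (w x : Space d) :
    quadGrad (fun x => ∑ j ∈ s, u j x) w x = ∑ j ∈ s, quadGrad (u j) w x := by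
  unfold quadGrad
  rw [fderiv_fun_sum fun j hj => (hu j hj).differentiable (by simp) x, sum_apply, inner_sum]

theorem flux_sum (q : Space d → ℝ) {s : Finset (Space d)} {u : Space d → Space d → Space d}
    (hu : ∀ j ∈ s, ContDiff ℝ 1 (u j)) (x : Space d) :
    flux q (fun x => ∑ j ∈ s, u j x) x = ∑ j ∈ s, flux q (u j) x := by
  simp only [flux]
  rw [div_sum hu, inner_sum, Finset.mul_sum, Finset.sum_add_distrib]

theorem div_congr {ξ ξ' : Space d → Space d} {x : Space d} (h : ξ =ᶠ[𝓝 x] ξ') :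
    div ξ x = div ξ' x := by
  rw [div, div, h.fderiv_eq]

theorem continuous_quadGrad {ξ : Space d → Space d} (hξ : ContDiff ℝ 1 ξ) :
    Continuous fun z : Space d × Space d => quadGrad ξ z.2 z.1 := by
  have h1 : Continuous fun z : Space d × Space d => fderiv ℝ ξ z.1 :=
    (hξ.continuous_fderiv (by simp)).comp continuous_fst
  exact continuous_snd.inner (h1.clm_apply continuous_snd)

namespace IsClassicalSolution

variable {Ω : Set (Space (n + 1))} {T σ : ℝ} {b : Fin 2 → ℝ} {Φ : Fin 2 → Space (n + 1) → ℝ}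
  {A : Fin 2 → ℝ → Set (Space (n + 1))} {p : Fin 2 → ℝ → Space (n + 1) → ℝ} {t : ℝ}

theorem measurableSet_interface_inter (hΩ : IsOpen Ω) (t : ℝ) :
    MeasurableSet (interface A t ∩ Ω) :=
  (isClosed_interface A t).measurableSet.inter hΩ.measurableSet

theorem isFiniteMeasure_interfaceMeasure (h : IsClassicalSolution Ω T σ b Φ A p) (hΩ : IsOpen Ω)
    (hΩb : Bornology.IsBounded Ω) (hΩs : HasSmoothBoundary Ω) (ht : t ∈ Icc 0 T) :
    IsFiniteMeasure (interfaceMeasure Ω A t) := by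
  obtain ⟨C, hC, hCt⟩ := h.exists_measure_interface_le hΩ hΩb hΩs
  refine ⟨?_⟩
  rw [interfaceMeasure, Measure.restrict_apply_univ]
  exact ((measure_mono inter_subset_left).trans (hCt t ht)).trans_lt hC

/-- Functions of the position and the normal are integrable over the interface. -/
theorem integrable_interface_mul (h : IsClassicalSolution Ω T σ b Φ A p) (hΩ : IsOpen Ω)
    (hΩb : Bornology.IsBounded Ω) (hΩs : HasSmoothBoundary Ω) (ht : t ∈ Icc 0 T)
    {f : Space (n + 1) → ℝ} (hf : ContinuousOn f (interface A t))
    {G : Space (n + 1) × Space (n + 1) → ℝ} (hG : Continuous G) :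
    Integrable (fun x => f x * G (x, interfaceNormal Ω T A t x)) (interfaceMeasure Ω A t) := by
  have := h.isFiniteMeasure_interfaceMeasure hΩ hΩb hΩs ht
  have hΓ := measurableSet_interface_inter (A := A) hΩ t
  have hK : IsCompact (interface A t) := hΩb.isCompact_closure.of_isClosed_subset
    (isClosed_interface A t) (h.interface_subset ht)
  obtain ⟨M, hM⟩ := hK.exists_bound_of_continuousOn hf
  obtain ⟨M', hM'⟩ := (hΩb.isCompact_closure.prod
    (isCompact_closedBall (0 : Space (n + 1)) 1)).exists_bound_of_continuousOn hG.continuousOn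
  have hν : Measurable (interfaceNormal Ω T A t) :=
    (h.measurable_interfaceNormal hΩ).comp (measurable_const.prodMk measurable_id)
  refine Integrable.of_bound (AEStronglyMeasurable.mul
    ((hf.mono inter_subset_left).aestronglyMeasurable hΓ)
    (hG.measurable.comp (measurable_id.prodMk hν)).aestronglyMeasurable) (M * M')
    ((ae_restrict_iff' hΓ).2 (ae_of_all _ fun x hx => ?_))
  rw [norm_mul]
  have h1 := hM x hx.1
  refine mul_le_mul h1 (hM' _ ⟨h.interface_subset ht hx.1, ?_⟩) (norm_nonneg _)
    ((norm_nonneg _).trans h1)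
  rw [mem_closedBall_zero_iff]
  exact h.norm_interfaceNormal_le hΩ t x

theorem integrable_interface (h : IsClassicalSolution Ω T σ b Φ A p) (hΩ : IsOpen Ω)
    (hΩb : Bornology.IsBounded Ω) (hΩs : HasSmoothBoundary Ω) (ht : t ∈ Icc 0 T)
    {G : Space (n + 1) × Space (n + 1) → ℝ} (hG : Continuous G) :
    Integrable (fun x => G (x, interfaceNormal Ω T A t x)) (interfaceMeasure Ω A t) := by
  simpa using h.integrable_interface_mul hΩ hΩb hΩs ht (f := fun _ => 1) continuousOn_const hG

theorem continuousOn_pressure (h : IsClassicalSolution Ω T σ b Φ A p) (ht : t ∈ Icc 0 T)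
    (i : Fin 2) : ContinuousOn (p i t) (closure (A i t)) :=
  (h.pressure_regular i).continuousOn.comp (f := fun x => (t, x)) (by fun_prop)
    fun x hx => ⟨ht, hx⟩

theorem isBoundedC1_pressure (h : IsClassicalSolution Ω T σ b Φ A p)
    (hΩb : Bornology.IsBounded Ω) (ht : t ∈ Icc 0 T) (i : Fin 2) :
    IsBoundedC1 (A i t) (p i t) := by
  have hAb := hΩb.subset (h.phase_subset i t ht)
  obtain ⟨G, hG, hGA⟩ := (h.pressure_regular i).gradient
  have hGt : ContinuousOn (fun x => G (t, x)) (closure (A i t)) :=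
    hG.comp (f := fun x => (t, x)) (by fun_prop) fun x hx => ⟨ht, hx⟩
  obtain ⟨M₁, hM₁⟩ := hAb.isCompact_closure.exists_bound_of_continuousOn (h.continuousOn_pressure ht i)
  obtain ⟨M₂, hM₂⟩ := hAb.isCompact_closure.exists_bound_of_continuousOn hGt
  refine ⟨h.phase_open i t ht, hAb.measure_lt_top,
    ((h.pressure_regular i).contDiffOn t ht).of_le (by norm_num), max M₁ M₂, fun x hx => ?_⟩
  have hxc := subset_closure hx
  refine ⟨(hM₁ x hxc).trans (le_max_left _ _), ?_⟩
  rw [← hGA t ht x hx]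
  exact (hM₂ x hxc).trans (le_max_right _ _)

/-- Integration by parts in a phase. -/
theorem integral_flux (h : IsClassicalSolution Ω T σ b Φ A p) (hΩ : IsOpen Ω)
    (hΩb : Bornology.IsBounded Ω) (hΩs : HasSmoothBoundary Ω) (ht : t ∈ Icc 0 T) (i : Fin 2)
    {q : Space (n + 1) → ℝ} (hq : IsBoundedC1 (A i t) q) (hqc : ContinuousOn q (closure (A i t)))
    {ξ : Space (n + 1) → Space (n + 1)} (hξ : ContDiff ℝ 1 ξ) (hwt : IsWallTangent Ω ξ) :
    ∫ x in A i t, flux q ξ x = -(phaseSign i *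
      ∫ x, q x * ⟪ξ x, interfaceNormal Ω T A t x⟫_ℝ ∂(interfaceMeasure Ω A t)) := by
  have hA := (h.phase_open i t ht).measurableSet
  have hΓ := measurableSet_interface_inter (A := A) hΩ t
  rw [← sub_eq_zero, sub_neg_eq_add]
  refine eq_zero_of_local hΩb.isCompact_closure (fun ξ => (∫ x in A i t, flux q ξ x) + phaseSign i *
      ∫ x, q x * ⟪ξ x, interfaceNormal Ω T A t x⟫_ℝ ∂(interfaceMeasure Ω A t))
    (fun s u hu => ?_) (fun ξ ξ' hξξ' => ?_) (fun x hx => ?_) hξ hwt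
  · have h1 : ∀ x, q x * ⟪∑ j ∈ s, u j x, interfaceNormal Ω T A t x⟫_ℝ =
        ∑ j ∈ s, q x * ⟪u j x, interfaceNormal Ω T A t x⟫_ℝ := fun x => by
      rw [sum_inner, Finset.mul_sum]
    simp only [flux_sum q fun j hj => (hu j hj).1, h1]
    rw [integral_finsetSum s fun j hj => hq.integrableOn_flux (hu j hj).1 (hu j hj).2,
      integral_finsetSum s fun j hj => h.integrable_interface_mul hΩ hΩb hΩs ht
        (hqc.mono (interface_subset_closure_phase i t)) (G := fun z => ⟪u j z.1, z.2⟫_ℝ) (by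
          have := (hu j hj).1.continuous
          fun_prop), Finset.mul_sum, Finset.sum_add_distrib]
  · have h1 : ∫ x in A i t, flux q ξ x = ∫ x in A i t, flux q ξ' x :=
      setIntegral_congr_fun hA fun x hx => by
        have h2 := hξξ' x (h.closure_phase_subset i ht (subset_closure hx))
        rw [flux, flux, h2.eq_of_nhds, div_congr h2]
    have h3 : ∫ x, q x * ⟪ξ x, interfaceNormal Ω T A t x⟫_ℝ ∂(interfaceMeasure Ω A t) =
        ∫ x, q x * ⟪ξ' x, interfaceNormal Ω T A t x⟫_ℝ ∂(interfaceMeasure Ω A t) :=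
      setIntegral_congr_fun hΓ fun x hx => by
        simp only [(hξξ' x (h.interface_subset ht hx.1)).eq_of_nhds]
    rw [h1, h3]
  · by_cases hxi : x ∈ interface A t
    · obtain ⟨φ, β, k, J, I, B, c, L, htJ, hxb, hbox⟩ := h.exists_isInterfaceBox hΩ hΩs ht hxi
      refine ⟨_, hbox.level.isOpen.mem_nhds hxb, fun ξ hξ hc hs hwt => ?_⟩
      rw [hbox.integral_flux h hΩ hΩb htJ ht i hq hqc hξ hc hs hwt]
      ring
    · obtain ⟨D, hDo, hxD, j, hj⟩ := h.exists_nhds_one_phase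
        (z := (t, x)) fun hcon => hxi hcon.2
      obtain ⟨D', β, hxD', hβ⟩ := exists_isDomainLevel hΩ hΩs x
      have hDt : IsOpen {y | (t, y) ∈ D} := hDo.preimage (by fun_prop : Continuous fun y => (t, y))
      refine ⟨{y | (t, y) ∈ D} ∩ D', inter_mem (hDt.mem_nhds hxD) (hβ.isOpen.mem_nhds hxD'),
        fun ξ hξ hc hs hwt => ?_⟩
      have h1 : ∫ x, q x * ⟪ξ x, interfaceNormal Ω T A t x⟫_ℝ ∂(interfaceMeasure Ω A t) = 0 := by
        refine setIntegral_eq_zero_of_forall_eq_zero fun y hy => ?_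
        have hys : y ∉ tsupport ξ := fun hcon => (hj t y (hs hcon).1 ht).1 hy.1
        rw [image_eq_zero_of_notMem_tsupport hys, inner_zero_left, mul_zero]
      have h2 : ∫ x in A i t, flux q ξ x = 0 := by
        -- Away from the interface either the phase fills the domain near the point and only the
        -- wall matters, or it is absent.
        by_cases hij : i = j
        · exact hβ.integral_flux_eq_zero hΩ hq (h.phase_subset i t ht) hξ hc
            (hs.trans inter_subset_right)
            (fun y hy hyΩ => ((hj t y (hs hy).1 ht).2 hyΩ i).2 hij) hwt
        · refine setIntegral_eq_zero_of_forall_eq_zero fun y hy => flux_eq_zero fun hcon => ?_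
          exact hij (((hj t y (hs hcon).1 ht).2 (h.phase_subset i t ht hy) i).1 hy)
      rw [h1, h2, mul_zero, add_zero]

/-- The curvature identity on the interface. -/
theorem integral_curvature (h : IsClassicalSolution Ω T σ b Φ A p) (hΩ : IsOpen Ω)
    (hΩb : Bornology.IsBounded Ω) (hΩs : HasSmoothBoundary Ω) (ht : t ∈ Icc 0 T)
    {ξ : Space (n + 1) → Space (n + 1)} (hξ : ContDiff ℝ 1 ξ) (hwt : IsWallTangent Ω ξ) :
    ∫ x, (σ / 2 * (div ξ x - quadGrad ξ (interfaceNormal Ω T A t x) x) -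
        (p 0 t x - p 1 t x) * ⟪ξ x, interfaceNormal Ω T A t x⟫_ℝ) ∂(interfaceMeasure Ω A t) = 0 := by
  have hΓ := measurableSet_interface_inter (A := A) hΩ t
  have hpc : ∀ i, ContinuousOn (p i t) (interface A t) := fun i =>
    (h.continuousOn_pressure ht i).mono (interface_subset_closure_phase i t)
  refine eq_zero_of_local hΩb.isCompact_closure (fun ξ =>
    ∫ x, (σ / 2 * (div ξ x - quadGrad ξ (interfaceNormal Ω T A t x) x) -
        (p 0 t x - p 1 t x) * ⟪ξ x, interfaceNormal Ω T A t x⟫_ℝ) ∂(interfaceMeasure Ω A t))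
    (fun s u hu => ?_) (fun ξ ξ' hξξ' => ?_) (fun x hx => ?_) hξ hwt
  · have h1 : ∀ x, σ / 2 * (div (fun x => ∑ j ∈ s, u j x) x -
          quadGrad (fun x => ∑ j ∈ s, u j x) (interfaceNormal Ω T A t x) x) -
        (p 0 t x - p 1 t x) * ⟪∑ j ∈ s, u j x, interfaceNormal Ω T A t x⟫_ℝ =
        ∑ j ∈ s, (σ / 2 * (div (u j) x - quadGrad (u j) (interfaceNormal Ω T A t x) x) -
        (p 0 t x - p 1 t x) * ⟪u j x, interfaceNormal Ω T A t x⟫_ℝ) := fun x => by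
      rw [div_sum fun j hj => (hu j hj).1, quadGrad_sum fun j hj => (hu j hj).1, sum_inner,
        Finset.mul_sum, ← Finset.sum_sub_distrib, Finset.mul_sum, ← Finset.sum_sub_distrib]
    simp only [h1]
    refine integral_finsetSum s fun j hj => ?_
    have h2 := continuous_quadGrad (hu j hj).1
    have h3 := (continuous_div_of_contDiff (hu j hj).1)
    have h4 := (hu j hj).1.continuous
    exact (h.integrable_interface hΩ hΩb hΩs ht
      (G := fun z => σ / 2 * (div (u j) z.1 - quadGrad (u j) z.2 z.1)) (by fun_prop)).sub
      (h.integrable_interface_mul hΩ hΩb hΩs ht ((hpc 0).sub (hpc 1))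
        (G := fun z => ⟪u j z.1, z.2⟫_ℝ) (by fun_prop))
  · refine setIntegral_congr_fun hΓ fun x hx => ?_
    have h2 := hξξ' x (h.interface_subset ht hx.1)
    simp only [quadGrad, h2.eq_of_nhds, div_congr h2, h2.fderiv_eq]
  · by_cases hxi : x ∈ interface A t
    · obtain ⟨φ, β, k, J, I, B, c, L, htJ, hxb, hbox⟩ := h.exists_isInterfaceBox hΩ hΩs ht hxi
      exact hbox.exists_integral_curvature h hΩ htJ ht hxb hxi
    · refine ⟨_, (isClosed_interface A t).isOpen_compl.mem_nhds hxi, fun ξ hξ hc hs hwt => ?_⟩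
      refine setIntegral_eq_zero_of_forall_eq_zero fun y hy => ?_
      have hys : y ∉ tsupport ξ := fun hcon => hs hcon hy.1
      rw [div_eq_zero_of_notMem_tsupport hys, image_eq_zero_of_notMem_tsupport hys, quadGrad,
        fderiv_eq_zero_of_notMem_tsupport hys]
      simp

/-- The weak form of the curvature equation at a fixed time. -/
theorem sum_integral_flux (h : IsClassicalSolution Ω T σ b Φ A p) (hΩ : IsOpen Ω)
    (hΩb : Bornology.IsBounded Ω) (hΩs : HasSmoothBoundary Ω) (ht : t ∈ Icc 0 T)
    {ξ : Space (n + 1) → Space (n + 1)} (hξ : ContDiff ℝ 1 ξ) (hwt : IsWallTangent Ω ξ) :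
    ∑ i, ∫ x in A i t, flux (p i t) ξ x =
      -(σ / 2 * ∫ x, (div ξ x - quadGrad ξ (interfaceNormal Ω T A t x) x)
        ∂(interfaceMeasure Ω A t)) := by
  -- The signs of the two phases are opposite, so the surface terms add up to the pressure jump,
  -- which the curvature identity evaluates.
  have h1 := fun i => h.integral_flux hΩ hΩb hΩs ht i (h.isBoundedC1_pressure hΩb ht i)
    (h.continuousOn_pressure ht i) hξ hwt
  have hpc : ∀ i, ContinuousOn (p i t) (interface A t) := fun i =>
    (h.continuousOn_pressure ht i).mono (interface_subset_closure_phase i t)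
  have h2 := continuous_quadGrad hξ
  have h3 := continuous_div_of_contDiff hξ
  have h4 := hξ.continuous
  have hi : ∀ i, Integrable (fun x => p i t x * ⟪ξ x, interfaceNormal Ω T A t x⟫_ℝ)
      (interfaceMeasure Ω A t) := fun i =>
    h.integrable_interface_mul hΩ hΩb hΩs ht (hpc i) (G := fun z => ⟪ξ z.1, z.2⟫_ℝ) (by fun_prop)
  have hd : Integrable (fun x => div ξ x - quadGrad ξ (interfaceNormal Ω T A t x) x)
      (interfaceMeasure Ω A t) :=
    h.integrable_interface hΩ hΩb hΩs ht (G := fun z => div ξ z.1 - quadGrad ξ z.2 z.1)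
      (by fun_prop)
  have hcurv := h.integral_curvature hΩ hΩb hΩs ht hξ hwt
  have hsub : Integrable (fun x => (p 0 t x - p 1 t x) * ⟪ξ x, interfaceNormal Ω T A t x⟫_ℝ)
      (interfaceMeasure Ω A t) :=
    ((hi 0).sub (hi 1)).congr (ae_of_all _ fun x => by simp only [Pi.sub_apply]; ring)
  have h5 : ∫ x, (p 0 t x - p 1 t x) * ⟪ξ x, interfaceNormal Ω T A t x⟫_ℝ ∂(interfaceMeasure Ω A t) =
      (∫ x, p 0 t x * ⟪ξ x, interfaceNormal Ω T A t x⟫_ℝ ∂(interfaceMeasure Ω A t)) -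
      ∫ x, p 1 t x * ⟪ξ x, interfaceNormal Ω T A t x⟫_ℝ ∂(interfaceMeasure Ω A t) := by
    rw [← integral_sub (hi 0) (hi 1)]
    simp only [sub_mul]
  rw [integral_sub (hd.const_mul _) hsub, integral_const_mul, h5] at hcurv
  rw [Fin.sum_univ_two, h1, h1]
  simp only [phaseSign]
  simp
  linarith

/-- The distributional derivative of the indicator function of a phase. -/
theorem isPolarDerivative (h : IsClassicalSolution Ω T σ b Φ A p) (hΩ : IsOpen Ω)
    (hΩb : Bornology.IsBounded Ω) (hΩs : HasSmoothBoundary Ω) (ht : t ∈ Icc 0 T) (i : Fin 2) :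
    IsPolarDerivative Ω (density (A i) t) (interfaceMeasure Ω A t)
      (fun x => phaseSign i • interfaceNormal Ω T A t x) := by
  have hA := (h.phase_open i t ht).measurableSet
  have hAs := h.phase_subset i t ht
  have hν : Measurable (interfaceNormal Ω T A t) :=
    (h.measurable_interfaceNormal hΩ).comp (measurable_const.prodMk measurable_id)
  have hνi : Measurable fun x => phaseSign i • interfaceNormal Ω T A t x := by fun_prop
  refine ⟨?_, h.isFiniteMeasure_interfaceMeasure hΩ hΩb hΩs ht, ?_, hνi, ?_, ?_⟩
  · exact (integrableOn_const (C := (1 : ℝ)) hΩb.measure_lt_top.ne).indicator hA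
  · rw [interfaceMeasure, Measure.restrict_apply hΩ.measurableSet.compl]
    have : Ωᶜ ∩ (interface A t ∩ Ω) = ∅ := by
      ext x
      simp only [mem_inter_iff, mem_compl_iff, mem_empty_iff_false, iff_false]
      tauto
    rw [this, measure_empty]
  · refine (ae_restrict_iff' (measurableSet_interface_inter hΩ t)).2 (ae_of_all _ fun x hx => ?_)
    rw [norm_smul, Real.norm_eq_abs, abs_phaseSign, one_mul, h.norm_interfaceNormal hΩ ht hx]
  · intro ζ hζ hc hs
    -- A field with compact support in `Ω` vanishes on the wall, so integration by parts with `q =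
    -- 1` has only the interface term.
    have hwt : IsWallTangent Ω ζ := fun x m hm => by
      have hx : x ∉ Ω := by
        have := hm.1
        rw [hΩ.frontier_eq] at this
        exact this.2
      rw [image_eq_zero_of_notMem_tsupport fun hcon => hx (hs hcon), inner_zero_left]
    have hq : IsBoundedC1 (A i t) fun _ => (1 : ℝ) :=
      ⟨h.phase_open i t ht, (hΩb.subset hAs).measure_lt_top, contDiffOn_const, 1, fun x _ => by
        simp [gradient]⟩
    have h1 := h.integral_flux hΩ hΩb hΩs ht i hq continuousOn_const hζ hwt
    have h2 : ∀ x, flux (fun _ => (1 : ℝ)) ζ x = div ζ x := fun x => by simp [flux, gradient]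
    have h3 : ∀ x, density (A i) t x * div ζ x = (A i t).indicator (div ζ) x := fun x => by
      by_cases hx : x ∈ A i t <;> simp [density, hx]
    simp only [h2, one_mul] at h1
    simp only [h3, real_inner_smul_right]
    rw [setIntegral_indicator hA, inter_eq_self_of_subset_right hAs, h1, integral_const_mul]

end IsClassicalSolution

/-! ### The surface measure of the moving interface -/

namespace IsInterfaceBox

variable {Ω : Set (Space (n + 1))} {T σ : ℝ} {b : Fin 2 → ℝ} {Φ : Fin 2 → Space (n + 1) → ℝ}
  {A : Fin 2 → ℝ → Set (Space (n + 1))} {p : Fin 2 → ℝ → Space (n + 1) → ℝ}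
  {φ : ℝ → Space (n + 1) → ℝ} {β : Space (n + 1) → ℝ} {k : Fin (n + 1)} {J I : Set ℝ}
  {B : Set (Space n)} {c L : ℝ}

/-- Surface integrals of functions supported near a point of the interface depend measurably on
time. -/
theorem measurable_integral_interfaceMeasure (h : IsInterfaceBox Ω T A φ β k J I B c L)
    (hs : IsClassicalSolution Ω T σ b Φ A p) (hΩ : IsOpen Ω) (hJ : J.Nonempty)
    {f : ℝ × Space (n + 1) → ℝ}
    (hf : Continuous f) (hc : HasCompactSupport f) (hsup : tsupport f ⊆ J ×ˢ box k I B) :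
    Measurable ((Icc 0 T).indicator fun t => ∫ x, f (t, x) ∂(interfaceMeasure Ω A t)) := by
  obtain ⟨s, hsJ⟩ := hJ
  have hDo : IsOpen (J ×ˢ box k I B) := h.isOpen.prod (h.graphBox s hsJ).isOpen_box
  obtain ⟨U, hφ, hU⟩ := h.chart
  have hDU : J ×ˢ box k I B ⊆ U := fun z hz => hU z.1 hz.1 z.2 hz.2
  have hφc : ContinuousOn (Function.uncurry φ) (J ×ˢ box k I B) :=
    hφ.smooth.continuousOn.mono hDU
  have hgc := (continuousOn_spatial_gradient hφ.isOpen (hφ.smooth.of_le (by norm_num))).mono hDU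
  -- The factor `|∇φ|` compensates the weight `1 / |∇φ|` in the limit of layer integrals.
  set G : ℝ × Space (n + 1) → ℝ := fun z => f z * ‖∇ (φ z.1) z.2‖ with hG
  have hGs : tsupport G ⊆ tsupport f :=
    closure_mono fun z (hz : G z ≠ 0) h0 => hz (by rw [hG]; simp only [h0, zero_mul])
  have hGc : Continuous G := by
    refine continuous_of_tsupport fun z hz => ?_
    exact hf.continuousAt.mul (hgc.continuousAt (hDo.mem_nhds (hsup (hGs hz)))).norm
  obtain ⟨M, hM⟩ := hGc.bounded_above_of_compact_support (hc.mono' (subset_tsupport _ |>.trans hGs))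
  have hM0 : 0 ≤ M := (norm_nonneg _).trans (hM (0, 0))
  have hGz : ∀ z, z ∉ J ×ˢ box k I B → f z = 0 ∧ G z = 0 := fun z hz =>
    ⟨image_eq_zero_of_notMem_tsupport fun hcon => hz (hsup hcon),
      image_eq_zero_of_notMem_tsupport fun hcon => hz (hsup (hGs hcon))⟩
  set H : ℝ × Space (n + 1) → ℝ := (Prod.snd ⁻¹' Ω).indicator G with hH
  have hHm : Measurable H := hGc.measurable.indicator (measurable_snd hΩ.measurableSet)
  have hHz : ∀ z, z ∉ J ×ˢ box k I B → H z = 0 := fun z hz => by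
    rw [hH]
    exact indicator_apply_eq_zero.2 fun _ => (hGz z hz).2
  have hHM : ∀ z, |H z| ≤ M := fun z => by
    by_cases hz : z ∈ Prod.snd ⁻¹' Ω
    · rw [hH, indicator_of_mem hz]
      exact hM z
    · rw [hH, indicator_of_notMem hz]
      simpa using hM0
  set ψ : ℝ × Space (n + 1) → ℝ := (J ×ˢ box k I B).indicator (Function.uncurry φ) with hψ
  have hψm : Measurable ψ := measurable_indicator_of_continuousOn hDo.measurableSet hφc
  set F : ℝ → ℝ × Space (n + 1) → ℝ := fun ε z => H z * (ε⁻¹ * deriv cut (ψ z / ε)) with hF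
  have hcut : Continuous (deriv cut) := (contDiff_cut (n := 1)).continuous_deriv (by simp)
  have hFm : ∀ ε, Measurable (F ε) := fun ε =>
    hHm.mul ((hcut.measurable.comp (hψm.div_const ε)).const_mul _)
  have hlim : Tendsto (fun m : ℕ => 1 / ((m : ℝ) + 1)) atTop (𝓝[>] 0) :=
    tendsto_nhdsWithin_iff.2 ⟨tendsto_one_div_add_atTop_nhds_zero_nat,
      Eventually.of_forall fun m => by
        show (0 : ℝ) < 1 / ((m : ℝ) + 1)
        positivity⟩
  -- Layer integrals are Lebesgue integrals of jointly measurable functions, hence measurable in `t`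
  -- by Fubini. Along `ε = 1 / (m + 1)` they converge at every time.
  refine measurable_of_tendsto_metrizable
    (f := fun m : ℕ => (Icc 0 T).indicator fun t => ∫ x, F (1 / ((m : ℝ) + 1)) (t, x))
    (fun m => ?_) (tendsto_pi_nhds.2 fun t => ?_)
  · exact ((hFm _).stronglyMeasurable.integral_prod_right').measurable.indicator measurableSet_Icc
  by_cases htT : t ∈ Icc 0 T
  swap
  · simp only [indicator_of_notMem htT]
    exact tendsto_const_nhds
  simp only [indicator_of_mem htT]
  by_cases htJ : t ∈ J
  swap
  · have h1 : ∀ x, f (t, x) = 0 := fun x => (hGz (t, x) fun hcon => htJ hcon.1).1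
    have h2 : ∀ ε x, F ε (t, x) = 0 := fun ε x => by
      simp only [hF]
      rw [hHz (t, x) fun hcon => htJ hcon.1, zero_mul]
    simp only [h1, h2, integral_zero]
    exact tendsto_const_nhds
  have hGB := h.graphBox t htJ
  have h1 := hGB.tendsto_integral_deriv_cut (f := fun x => H (t, x)) (M := M)
    (hHm.comp (by fun_prop)) (fun x => hHM (t, x)) (fun x hx => hHz (t, x) fun hcon => hx hcon.2) (by
      have hn := (h.measure_inter_frontier hs htJ htT).1
      have h2 : ∀ᵐ y ∂volume.restrict B, graph k (φ t) I B y ∉ frontier Ω := by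
        rw [ae_restrict_iff' hGB.isOpen_snd.measurableSet, ae_iff]
        refine measure_mono_null ?_ hn
        exact fun y hy => by simpa using hy
      filter_upwards [h2] with y hy
      have h3 : Continuous fun x => G (t, x) := hGc.comp (by fun_prop)
      exact h3.continuousOn.continuousAt_indicator hy)
  have h2 : ∫ x, f (t, x) ∂(interfaceMeasure Ω A t) =
      ∫ x in {x ∈ box k I B | φ t x = 0}, H (t, x) / ‖∇ (φ t) x‖ ∂μHE[n] := by
    rw [h.integral_interfaceMeasure hΩ htJ htT (g := fun x => f (t, x))
      (fun x hx => (hGz (t, x) fun hcon => hx hcon.2).1) fun _ _ _ _ => rfl]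
    refine setIntegral_congr_fun hGB.measurableSet_zero fun x hx => ?_
    by_cases hxΩ : x ∈ Ω
    · have : H (t, x) = f (t, x) * ‖∇ (φ t) x‖ :=
        indicator_of_mem (show (t, x) ∈ Prod.snd ⁻¹' Ω from hxΩ) _
      simp only [this, indicator_of_mem hxΩ]
      rw [mul_div_cancel_right₀ _ (hGB.norm_gradient_pos hx.1).ne']
    · have : H (t, x) = 0 :=
        indicator_of_notMem (show (t, x) ∉ Prod.snd ⁻¹' Ω from hxΩ) _
      simp only [this, indicator_of_notMem hxΩ, zero_div]
  rw [h2]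
  refine (h1.comp hlim).congr fun m => integral_congr_ae (ae_of_all _ fun x => ?_)
  simp only [hF]
  by_cases hx : x ∈ box k I B
  · have : ψ (t, x) = φ t x := indicator_of_mem (show (t, x) ∈ J ×ˢ box k I B from ⟨htJ, hx⟩) _
    rw [this]
  · rw [hHz (t, x) fun hcon => hx hcon.2, zero_mul, zero_mul]

end IsInterfaceBox

namespace IsClassicalSolution

variable {Ω : Set (Space (n + 1))} {T σ : ℝ} {b : Fin 2 → ℝ} {Φ : Fin 2 → Space (n + 1) → ℝ}
  {A : Fin 2 → ℝ → Set (Space (n + 1))} {p : Fin 2 → ℝ → Space (n + 1) → ℝ}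

/-- Surface integrals of continuous functions depend measurably on time. -/
theorem measurable_integral_interfaceMeasure (h : IsClassicalSolution Ω T σ b Φ A p)
    (hΩ : IsOpen Ω) (hΩb : Bornology.IsBounded Ω) (hΩs : HasSmoothBoundary Ω)
    {f : ℝ × Space (n + 1) → ℝ} (hf : Continuous f) :
    Measurable ((Icc 0 T).indicator fun t => ∫ x, f (t, x) ∂(interfaceMeasure Ω A t)) := by
  have hloc : ∀ z ∈ cylinder Ω T, ∃ D ∈ 𝓝 z, ∀ g : ℝ × Space (n + 1) → ℝ, Continuous g →
      HasCompactSupport g → tsupport g ⊆ D →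
      Measurable ((Icc 0 T).indicator fun t => ∫ x, g (t, x) ∂(interfaceMeasure Ω A t)) := by
    rintro ⟨t, x⟩ ⟨ht, hx⟩
    by_cases hxi : x ∈ interface A t
    · obtain ⟨φ, β, k, J, I, B, c, L, htJ, hxb, hbox⟩ := h.exists_isInterfaceBox hΩ hΩs ht hxi
      exact ⟨_, (hbox.isOpen.prod hbox.level.isOpen).mem_nhds ⟨htJ, hxb⟩, fun g hg hgc hgs =>
        hbox.measurable_integral_interfaceMeasure h hΩ ⟨t, htJ⟩ hg hgc hgs⟩
    · refine ⟨_, h.isClosed_spaceTime_interface.isOpen_compl.mem_nhds fun hcon => hxi hcon.2,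
        fun g hg hgc hgs => ?_⟩
      have h0 : ((Icc 0 T).indicator fun t => ∫ x, g (t, x) ∂(interfaceMeasure Ω A t)) = 0 := by
        ext1 s
        by_cases hs : s ∈ Icc 0 T
        · rw [indicator_of_mem hs]
          refine setIntegral_eq_zero_of_forall_eq_zero fun y hy => ?_
          exact image_eq_zero_of_notMem_tsupport fun hcon => hgs hcon ⟨hs, hy.1⟩
        · rw [indicator_of_notMem hs]
          rfl
      rw [h0]
      exact measurable_zero
  choose! D hD hD' using hloc
  -- A space-time partition of unity reduces the claim to functions supported in one box, or off the
  -- interface, where the integral is zero.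
  obtain ⟨s, η, hsK, hη, hηs, -, V, -, hKV, h1⟩ :=
    exists_smooth_partition (isCompact_Icc.prod hΩb.isCompact_closure) hD
  have hsum : ((Icc 0 T).indicator fun t => ∫ x, f (t, x) ∂(interfaceMeasure Ω A t)) =
      fun t => ∑ j ∈ s, (Icc 0 T).indicator (fun t =>
        ∫ x, η j (t, x) * f (t, x) ∂(interfaceMeasure Ω A t)) t := by
    ext1 t
    by_cases ht : t ∈ Icc 0 T
    · simp only [indicator_of_mem ht]
      rw [← integral_finsetSum]
      · refine setIntegral_congr_fun (measurableSet_interface_inter hΩ t) fun x hx => ?_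
        rw [← Finset.sum_mul, h1 (t, x) (hKV ⟨ht, h.interface_subset ht hx.1⟩), one_mul]
      · intro j hj
        have := (hη j).continuous
        exact h.integrable_interface hΩ hΩb hΩs ht
          (G := fun z => η j (t, z.1) * f (t, z.1)) (by fun_prop)
    · simp only [indicator_of_notMem ht, Finset.sum_const_zero]
  rw [hsum]
  refine Finset.measurable_fun_sum s fun j hj => hD' j (hsK j hj) _ ((hη j).continuous.mul hf)
    (hηs j hj).1.mul_right ((tsupport_mul_subset_left).trans (hηs j hj).2)

end IsClassicalSolution

open ProbabilityTheory in
/-- A family of finite measures is a kernel if the integrals of continuous functions are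
measurable. -/
theorem measurable_of_measurable_integral {α X : Type*} [MeasurableSpace α] [TopologicalSpace X]
    [HasOuterApproxClosed X] [MeasurableSpace X] [BorelSpace X] {κ : α → Measure X}
    [∀ a, IsFiniteMeasure (κ a)]
    (h : ∀ f : X → ℝ, Continuous f → Measurable fun a => ∫ x, f x ∂(κ a)) : Measurable κ := by
  -- The measure of a closed set is a limit of integrals of continuous functions decreasing to its
  -- indicator; the closed sets form a π-system generating the Borel sets.
  have hc : ∀ s : Set X, IsClosed s → Measurable fun a => κ a s := by
    intro s hs
    refine measurable_of_tendsto_metrizable (f := fun m a => ∫⁻ x, hs.apprSeq m x ∂(κ a))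
      (fun m => ?_) (tendsto_pi_nhds.2 fun a =>
        HasOuterApproxClosed.tendsto_lintegral_apprSeq hs (⟨κ a, inferInstance⟩ : FiniteMeasure X))
    have h1 : ∀ a, ∫⁻ x, hs.apprSeq m x ∂(κ a) =
        ENNReal.ofReal (∫ x, (hs.apprSeq m x : ℝ) ∂(κ a)) := fun a => by
      refine lintegral_coe_eq_integral _ ?_
      refine Integrable.mono' (integrable_const (1 : ℝ)) ?_ (ae_of_all _ fun x => ?_)
      · exact (by fun_prop : Continuous fun x => (hs.apprSeq m x : ℝ)).measurable.aestronglyMeasurable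
      · simpa using HasOuterApproxClosed.apprSeq_apply_le_one hs m x
    simp only [h1]
    exact (h _ (by fun_prop)).ennreal_ofReal
  exact Measurable.measure_of_isPiSystem (BorelSpace.measurable_eq.trans
    borel_eq_generateFrom_isClosed) isPiSystem_isClosed (fun s hs => hc s hs) (hc _ isClosed_univ)

namespace IsClassicalSolution

open ProbabilityTheory

variable {Ω : Set (Space (n + 1))} {T σ : ℝ} {b : Fin 2 → ℝ} {Φ : Fin 2 → Space (n + 1) → ℝ}
  {A : Fin 2 → ℝ → Set (Space (n + 1))} {p : Fin 2 → ℝ → Space (n + 1) → ℝ}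
  {κ : Kernel ℝ (Space (n + 1))}

/-- The surface measures of the moving interface form a finite kernel. -/
theorem exists_kernel (h : IsClassicalSolution Ω T σ b Φ A p)
    (hΩ : IsOpen Ω) (hΩb : Bornology.IsBounded Ω) (hΩs : HasSmoothBoundary Ω) :
    ∃ κ : Kernel ℝ (Space (n + 1)), IsFiniteKernel κ ∧
      ∀ t ∈ Icc 0 T, κ t = interfaceMeasure Ω A t := by
  classical
  obtain ⟨C, hC, hCt⟩ := h.exists_measure_interface_le hΩ hΩb hΩs
  -- Outside `[0,T]` nothing is known about the interface, so the kernel is set to zero there. The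
  -- uniform area bound makes it finite.
  set m : ℝ → Measure (Space (n + 1)) := fun t =>
    if t ∈ Icc 0 T then interfaceMeasure Ω A t else 0 with hm
  have hmt : ∀ t ∈ Icc 0 T, m t = interfaceMeasure Ω A t := fun t ht => if_pos ht
  have hmn : ∀ t, t ∉ Icc 0 T → m t = 0 := fun t ht => if_neg ht
  have hmC : ∀ t, m t univ ≤ C := fun t => by
    by_cases ht : t ∈ Icc 0 T
    · rw [hmt t ht, interfaceMeasure, Measure.restrict_apply_univ]
      exact (measure_mono inter_subset_left).trans (hCt t ht)
    · rw [hmn t ht]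
      exact zero_le
  have : ∀ t, IsFiniteMeasure (m t) := fun t => ⟨(hmC t).trans_lt hC⟩
  have hmm : Measurable m := by
    refine measurable_of_measurable_integral fun f hf => ?_
    convert h.measurable_integral_interfaceMeasure hΩ hΩb hΩs (f := fun z => f z.2)
      (hf.comp continuous_snd) using 1
    ext1 t
    by_cases ht : t ∈ Icc 0 T
    · rw [hmt t ht, indicator_of_mem ht]
    · rw [hmn t ht, indicator_of_notMem ht, integral_zero_measure]
  exact ⟨⟨m, hmm⟩, ⟨C, hC, hmC⟩, hmt⟩

/-- `Γ_t` includes its contact points with the wall, whereas `|Dρᵢ|` only sees `Ω`. The difference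
is a null set. -/
theorem measure_interface_inter (h : IsClassicalSolution Ω T σ b Φ A p) (hΩ : IsOpen Ω)
    (hΩs : HasSmoothBoundary Ω) {t : ℝ} (ht : t ∈ Icc 0 T) {S : Set (Space (n + 1))}
    (hS : MeasurableSet S) : μHE[n] (interface A t ∩ S) = interfaceMeasure Ω A t S := by
  rw [interfaceMeasure, Measure.restrict_apply hS]
  refine le_antisymm ?_ (measure_mono ?_)
  · have h1 : interface A t ∩ S ⊆ (S ∩ (interface A t ∩ Ω)) ∪ (interface A t ∩ frontier Ω) := by
      rintro x ⟨hx, hxS⟩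
      by_cases hxΩ : x ∈ Ω
      · exact Or.inl ⟨hxS, hx, hxΩ⟩
      · exact Or.inr ⟨hx, by rw [hΩ.frontier_eq]; exact ⟨h.interface_subset ht hx, hxΩ⟩⟩
    refine (measure_mono h1).trans ((measure_union_le _ _).trans ?_)
    rw [h.measure_interface_inter_frontier hΩ hΩs ht, add_zero]
  · exact fun x hx => ⟨hx.2.1, hx.1⟩

/-- The composition-product of Lebesgue measure with the kernel is, by construction, the measure
with the prescribed disintegration. -/
theorem isSurfaceMeasure_compProd (h : IsClassicalSolution Ω T σ b Φ A p) (hΩ : IsOpen Ω)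
    (hΩs : HasSmoothBoundary Ω) [IsFiniteKernel κ]
    (hκ : ∀ t ∈ Icc 0 T, κ t = interfaceMeasure Ω A t) :
    IsSurfaceMeasure T (interface A) ((volume.restrict (Icc 0 T)) ⊗ₘ κ) := by
  intro B hB
  have h1 : (fun t => κ t (Prod.mk t ⁻¹' B)) =ᵐ[volume.restrict (Icc 0 T)]
      fun t => μHE[n] (interface A t ∩ {x | (t, x) ∈ B}) := by
    refine (ae_restrict_iff' measurableSet_Icc).2 (ae_of_all _ fun t ht => ?_)
    simp only
    rw [hκ t ht, ← h.measure_interface_inter hΩ hΩs ht (measurable_prodMk_left hB)]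
    rfl
  have h2 := Kernel.measurable_kernel_prodMk_left (κ := κ) hB
  refine ⟨(h2.aemeasurable).congr h1, ?_⟩
  rw [Measure.compProd_apply hB]
  exact lintegral_congr_ae h1

/-- The surface measure of the moving interface is concentrated on the cylinder. -/
theorem ae_mem_cylinder (hΩ : IsOpen Ω) [IsFiniteKernel κ]
    (hκ : ∀ t ∈ Icc 0 T, κ t = interfaceMeasure Ω A t) :
    ∀ᵐ z ∂((volume.restrict (Icc 0 T)) ⊗ₘ κ), z ∈ cylinder Ω T := by
  refine Measure.ae_compProd_of_ae_ae (measurableSet_Icc.prod measurableSet_closure) ?_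
  refine (ae_restrict_iff' measurableSet_Icc).2 (ae_of_all _ fun t ht => ?_)
  rw [hκ t ht]
  refine (ae_restrict_iff' (measurableSet_interface_inter hΩ t)).2 (ae_of_all _ fun x hx => ?_)
  exact ⟨ht, subset_closure hx.2⟩

/-- Surface integrals over the moving interface as iterated integrals. -/
theorem integral_compProd_interface (hT : 0 ≤ T) [IsFiniteKernel κ]
    (hκ : ∀ t ∈ Icc 0 T, κ t = interfaceMeasure Ω A t) {f : ℝ × Space (n + 1) → ℝ}
    (hf : Integrable f ((volume.restrict (Icc 0 T)) ⊗ₘ κ)) :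
    IntervalIntegrable (fun t => ∫ x, f (t, x) ∂(interfaceMeasure Ω A t)) volume 0 T ∧
      ∫ z, f z ∂((volume.restrict (Icc 0 T)) ⊗ₘ κ) =
        ∫ t in (0 : ℝ)..T, ∫ x, f (t, x) ∂(interfaceMeasure Ω A t) := by
  have h1 : (fun t => ∫ x, f (t, x) ∂(κ t)) =ᵐ[volume.restrict (Icc 0 T)]
      fun t => ∫ x, f (t, x) ∂(interfaceMeasure Ω A t) := by
    refine (ae_restrict_iff' measurableSet_Icc).2 (ae_of_all _ fun t ht => ?_)
    simp only
    rw [hκ t ht]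
  have h2 : Integrable (fun t => ∫ x, f (t, x) ∂(κ t)) (volume.restrict (Icc 0 T)) := by
    have h3 := Integrable.integral_compProd (κ := Kernel.const Unit (volume.restrict (Icc 0 T)))
      (η := Kernel.prodMkLeft Unit κ) (a := ()) (f := f) hf
    simpa using h3
  constructor
  · rw [intervalIntegrable_iff_integrableOn_Icc_of_le hT]
    exact h2.congr h1
  · rw [Measure.integral_compProd hf, intervalIntegral.integral_of_le hT,
      ← integral_Icc_eq_integral_Ioc]
    exact integral_congr_ae h1

end IsClassicalSolution

/-! ### The pressure functional and the weak curvature equation -/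

/-- Integration over a compact set with an integrable weight is a bounded functional. -/
theorem exists_integral_functional {X : Type*} [TopologicalSpace X] [MeasurableSpace X]
    [BorelSpace X] {K : Set X} (hK : IsCompact K) (hKm : MeasurableSet K) (ρ : Measure X)
    {w : X → ℝ} (hw : IntegrableOn w K ρ) :
    ∃ P : C(K, ℝ) →L[ℝ] ℝ, ∀ f : C(X, ℝ), P (f.restrict K) = ∫ x in K, w x * f x ∂ρ := by
  have : CompactSpace K := isCompact_iff_compactSpace.1 hK
  have hwi : Integrable (fun x : K => w x) (ρ.comap (↑)) :=
    ((MeasurableEmbedding.subtype_coe hKm).integrableOn_range_iff_comap).1 (by simpa using hw)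
  have hi : ∀ f : C(K, ℝ), Integrable (fun x : K => w x * f x) (ρ.comap (↑)) := fun f =>
    hwi.mul_bdd (c := ‖f‖) f.continuous.aestronglyMeasurable (ae_of_all _ f.norm_coe_le_norm)
  -- The operator norm is bounded by the `L¹` norm of the weight on `K`.
  refine ⟨LinearMap.mkContinuous ⟨⟨fun f => ∫ x : K, w x * f x ∂(ρ.comap (↑)), fun f g => ?_⟩,
    fun a f => ?_⟩ (∫ x : K, ‖w x‖ ∂(ρ.comap (↑))) fun f => ?_, fun f => ?_⟩
  · rw [← integral_add (hi f) (hi g)]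
    simp only [ContinuousMap.add_apply, mul_add]
  · rw [RingHom.id_apply, smul_eq_mul, ← integral_const_mul]
    simp only [ContinuousMap.smul_apply, smul_eq_mul, mul_left_comm]
  · refine (norm_integral_le_of_norm_le (hwi.norm.mul_const ‖f‖) (ae_of_all _ fun x => ?_)).trans_eq
      (integral_mul_const _ _)
    rw [norm_mul]
    exact mul_le_mul_of_nonneg_left (f.norm_coe_le_norm x) (norm_nonneg _)
  · exact integral_subtype_comap hKm fun x => w x * f x

/-- Integrals over a space-time cylinder as iterated integrals. -/
theorem intervalIntegrable_setIntegral {Ω : Set (Space d)} {T : ℝ} (hT : 0 ≤ T)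
    {f : ℝ × Space d → ℝ} (hf : IntegrableOn f (Icc 0 T ×ˢ Ω)) :
    IntervalIntegrable (fun t => ∫ x in Ω, f (t, x)) volume 0 T ∧
      ∫ z in Icc 0 T ×ˢ Ω, f z = ∫ t in (0 : ℝ)..T, ∫ x in Ω, f (t, x) := by
  have h1 : Integrable f ((volume.restrict (Icc 0 T)).prod (volume.restrict Ω)) := by
    rw [Measure.prod_restrict]
    exact hf
  constructor
  · rw [intervalIntegrable_iff_integrableOn_Icc_of_le hT]
    exact h1.integral_prod_left
  · rw [intervalIntegral.integral_of_le hT, ← integral_Icc_eq_integral_Ioc]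
    exact setIntegral_prod f hf

theorem quadGrad_smul (ξ : Space d → Space d) (s : ℝ) (w x : Space d) :
    quadGrad ξ (s • w) x = s ^ 2 * quadGrad ξ w x := by
  rw [quadGrad, quadGrad, map_smul, real_inner_smul_left, real_inner_smul_right]
  ring

namespace IsClassicalSolution

open ProbabilityTheory

variable {Ω : Set (Space (n + 1))} {T σ t : ℝ} {b : Fin 2 → ℝ} {Φ : Fin 2 → Space (n + 1) → ℝ}
  {A : Fin 2 → ℝ → Set (Space (n + 1))} {p : Fin 2 → ℝ → Space (n + 1) → ℝ}
  {κ : Kernel ℝ (Space (n + 1))} {F : ℝ × Space (n + 1) → ℝ}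

/-- Continuous functions on a phase are integrable in space-time. -/
theorem integrableOn_density_mul (h : IsClassicalSolution Ω T σ b Φ A p) (hΩ : IsOpen Ω)
    (hΩb : Bornology.IsBounded Ω) (i : Fin 2)
    (hF : ContinuousOn F (spaceTime T fun t => closure (A i t))) :
    IntegrableOn (fun z => density (A i) z.1 z.2 * F z) (Icc 0 T ×ˢ Ω) := by
  have hm := h.measurableSet_spaceTime_phase hΩ i
  have h1 : IntegrableOn ((spaceTime T (A i)).indicator F) (Icc 0 T ×ˢ Ω) := by
    refine Integrable.integrableOn ((integrable_indicator_iff hm).2 ?_)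
    exact (hF.integrableOn_compact (h.isCompact_spaceTime_closure hΩb i)).mono_set
      (spaceTime_subset_closure T (A i))
  refine h1.congr_fun (fun z hz => ?_) (measurableSet_Icc.prod hΩ.measurableSet)
  by_cases hx : z ∈ spaceTime T (A i)
  · simp [density, hx, hx.2]
  · have h2 : z.2 ∉ A i z.1 := fun hcon => hx ⟨hz.1, hcon⟩
    simp [density, hx, h2]

/-- Continuous functions on a phase are integrable at each time. -/
theorem integrableOn_density_mul_slice (h : IsClassicalSolution Ω T σ b Φ A p)
    (hΩb : Bornology.IsBounded Ω) (ht : t ∈ Icc 0 T) (i : Fin 2)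
    (hF : ContinuousOn F (spaceTime T fun t => closure (A i t))) :
    IntegrableOn (fun x => density (A i) t x * F (t, x)) Ω := by
  have h1 : ContinuousOn (fun x => F (t, x)) (closure (A i t)) :=
    hF.comp (f := fun x => (t, x)) (by fun_prop) fun x hx => ⟨ht, hx⟩
  have h2 : IntegrableOn (fun x => F (t, x)) (A i t) :=
    (h1.integrableOn_compact (hΩb.subset (h.phase_subset i t ht)).isCompact_closure).mono_set
      subset_closure
  have h3 : (fun x => density (A i) t x * F (t, x)) = (A i t).indicator fun x => F (t, x) := by
    ext1 x
    by_cases hx : x ∈ A i t <;> simp [density, hx]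
  rw [h3]
  exact ((integrable_indicator_iff (h.phase_open i t ht).measurableSet).2 h2).integrableOn

/-- The pressure of a classical solution as a functional on `C([0,T] × closure Ω)`. -/
theorem exists_isWeakPressure (h : IsClassicalSolution Ω T σ b Φ A p) (hΩ : IsOpen Ω)
    (hΩb : Bornology.IsBounded Ω) (hT : 0 ≤ T) [IsFiniteKernel κ]
    (hκ : ∀ t ∈ Icc 0 T, κ t = interfaceMeasure Ω A t) :
    ∃ P, IsWeakPressure Ω T σ (fun i => density (A i)) p ((volume.restrict (Icc 0 T)) ⊗ₘ κ) P := by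
  have hK : IsCompact (cylinder Ω T) := isCompact_Icc.prod hΩb.isCompact_closure
  have hKm : MeasurableSet (cylinder Ω T) := hK.measurableSet
  have hsub : Icc 0 T ×ˢ Ω ⊆ cylinder Ω T := prod_mono le_rfl subset_closure
  have hm : MeasurableSet (Icc (0 : ℝ) T ×ˢ Ω) := measurableSet_Icc.prod hΩ.measurableSet
  have hw : ∀ f : ℝ × Space (n + 1) → ℝ, Continuous f → IntegrableOn
      (fun z : ℝ × Space (n + 1) => (∑ i, p i z.1 z.2 * density (A i) z.1 z.2) * f z)
      (Icc 0 T ×ˢ Ω) := fun f hf => by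
    refine (integrable_finsetSum Finset.univ fun i _ => h.integrableOn_density_mul hΩ hΩb i
      ((h.pressure_regular i).continuousOn.mul hf.continuousOn)).congr (ae_of_all _ fun z => ?_)
    simp only [Finset.sum_mul, Pi.mul_apply, Function.uncurry]
    exact Finset.sum_congr rfl fun i _ => by ring
  obtain ⟨P₁, hP₁⟩ := exists_integral_functional hK hKm volume
    (w := (Icc 0 T ×ˢ Ω).indicator fun z => ∑ i, p i z.1 z.2 * density (A i) z.1 z.2)
    (Integrable.integrableOn ((integrable_indicator_iff hm).2 (by
      simpa using hw (fun _ => 1) continuous_const)))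
  obtain ⟨P₂, hP₂⟩ := exists_integral_functional hK hKm ((volume.restrict (Icc 0 T)) ⊗ₘ κ)
    (w := fun _ => 1) (integrable_const _)
  -- The surface measure does not charge the complement of the cylinder, so integrating over the
  -- cylinder loses nothing.
  have hμ : ((volume.restrict (Icc 0 T)) ⊗ₘ κ).restrict (cylinder Ω T) =
      (volume.restrict (Icc 0 T)) ⊗ₘ κ := Measure.restrict_eq_self_of_ae_mem (ae_mem_cylinder hΩ hκ)
  refine ⟨P₁ + σ • P₂, fun f => ⟨hw f f.continuous, ?_, ?_⟩⟩
  · rw [← hμ]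
    exact f.continuous.continuousOn.integrableOn_compact hK
  · rw [add_apply, smul_apply, hP₁, hP₂, hμ, smul_eq_mul,
      ← (intervalIntegrable_setIntegral hT (hw f f.continuous)).2]
    simp only [one_mul, add_left_inj]
    have h1 : ∀ z, (Icc 0 T ×ˢ Ω).indicator (fun z => ∑ i, p i z.1 z.2 * density (A i) z.1 z.2) z *
        f z = (Icc 0 T ×ˢ Ω).indicator
          (fun z => (∑ i, p i z.1 z.2 * density (A i) z.1 z.2) * f z) z := fun z => by
      by_cases hz : z ∈ Icc 0 T ×ˢ Ω
      · rw [indicator_of_mem hz, indicator_of_mem hz]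
      · rw [indicator_of_notMem hz, indicator_of_notMem hz, zero_mul]
    simp only [h1]
    rw [setIntegral_indicator hm, inter_eq_self_of_subset_right hsub]

/-- The identity at each time is integrated over `[0,T]`. Both polar derivatives have total
variation equal to the surface measure of `Γ_t` in `Ω`, and their directions are `±ν`. -/
theorem weakCurvatureEq (h : IsClassicalSolution Ω T σ b Φ A p) (hΩ : IsOpen Ω)
    (hΩb : Bornology.IsBounded Ω) (hΩs : HasSmoothBoundary Ω) (hT : 0 ≤ T) (hσ : σ ≠ 0)
    (hb : ∀ i, b i ≠ 0) [IsFiniteKernel κ] (hκ : ∀ t ∈ Icc 0 T, κ t = interfaceMeasure Ω A t)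
    {P : C(cylinder Ω T, ℝ) →L[ℝ] ℝ} (hP : IsWeakPressure Ω T σ (fun i => density (A i)) p
      ((volume.restrict (Icc 0 T)) ⊗ₘ κ) P) :
    WeakCurvatureEq Ω T σ b Φ (fun i => density (A i)) (fun i => velocity (b i) (Φ i) (p i)) P := by
  refine ⟨fun _ t => interfaceMeasure Ω A t, fun i t x => phaseSign i • interfaceNormal Ω T A t x,
    fun i t ht => h.isPolarDerivative hΩ hΩb hΩs ht i, fun ξ hξ hwall => ?_⟩
  have hξ1 : ∀ t, ContDiff ℝ 1 (ξ t) := fun t =>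
    (hξ.of_le (by simp)).comp (contDiff_prodMk_right t)
  -- In the phase `bᵢvᵢ + ∇Φᵢ = -∇pᵢ`; replacing `∇pᵢ` by its continuous extension gives
  -- integrability in space-time and at each time.
  choose G hG hGA using fun i => (h.pressure_regular i).gradient
  have hF : ∀ i, ContinuousOn (fun z => -⟪G i z, ξ z.1 z.2⟫_ℝ) (spaceTime T fun t => closure (A i t)) :=
    fun i => ((hG i).inner (𝕜 := ℝ) hξ.continuous.continuousOn).neg
  have hE : ∀ i, ∀ t ∈ Icc 0 T, ∀ x, density (A i) t x * ⟪b i • velocity (b i) (Φ i) (p i) t x +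
      ∇ (Φ i) x, ξ t x⟫_ℝ = density (A i) t x * -⟪G i (t, x), ξ t x⟫_ℝ := by
    intro i t ht x
    by_cases hx : x ∈ A i t
    · rw [hGA i t ht x hx, velocity, smul_neg, smul_inv_smul₀ (hb i), ← inner_neg_left]
      congr 3
      abel
    · have h0 : density (A i) t x = 0 := indicator_of_notMem hx _
      rw [h0, zero_mul, zero_mul]
  have hi1 : IntegrableOn (fun z : ℝ × Space (n + 1) => ∑ i, density (A i) z.1 z.2 *
      ⟪b i • velocity (b i) (Φ i) (p i) z.1 z.2 + ∇ (Φ i) z.2, ξ z.1 z.2⟫_ℝ) (Icc 0 T ×ˢ Ω) := by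
    have h1 : IntegrableOn (fun z => ∑ i, density (A i) z.1 z.2 * -⟪G i z, ξ z.1 z.2⟫_ℝ)
        (Icc 0 T ×ˢ Ω) :=
      integrable_finsetSum Finset.univ fun i _ => h.integrableOn_density_mul hΩ hΩb i (hF i)
    refine h1.congr_fun (fun z hz => ?_) (measurableSet_Icc.prod hΩ.measurableSet)
    exact Finset.sum_congr rfl fun i _ => (hE i z.1 hz.1 z.2).symm
  obtain ⟨hi2, hi3, hPdiv⟩ := hP ⟨fun z => div (ξ z.1) z.2, continuous_div hξ⟩
  obtain ⟨hs, hsμ⟩ := integral_compProd_interface hT hκ hi3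
  have he1 := (intervalIntegrable_setIntegral hT hi1).1
  have he2 := (intervalIntegrable_setIntegral hT hi2).1
  have hq : ∀ t ∈ Icc 0 T, Integrable (fun x => quadGrad (ξ t) (interfaceNormal Ω T A t x) x)
      (interfaceMeasure Ω A t) := fun t ht => by
    have := continuous_quadGrad (hξ1 t)
    exact h.integrable_interface hΩ hΩb hΩs ht (G := fun z => quadGrad (ξ t) z.2 z.1) (by fun_prop)
  have hd : ∀ t ∈ Icc 0 T, Integrable (div (ξ t)) (interfaceMeasure Ω A t) := fun t ht => by
    have := continuous_div_of_contDiff (hξ1 t)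
    exact h.integrable_interface hΩ hΩb hΩs ht (G := fun z => div (ξ t) z.1) (by fun_prop)
  -- The contraction is quadratic in the normal, so its orientation is irrelevant.
  have hqs : ∀ t x, quadGrad (ξ t) (phaseSign 0 • interfaceNormal Ω T A t x) x =
      quadGrad (ξ t) (interfaceNormal Ω T A t x) x := fun t x => by
    rw [quadGrad_smul, ← sq_abs, abs_phaseSign, one_pow, one_mul]
  simp only [hqs]
  have hqd : ∀ t ∈ Icc 0 T, Integrable (fun x => quadGrad (ξ t) (interfaceNormal Ω T A t x) x +
      div (ξ t) x) (interfaceMeasure Ω A t) := fun t ht => (hq t ht).add (hd t ht)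
  have hflux : ∀ t ∈ Icc 0 T,
      (∫ x in Ω, ∑ i, density (A i) t x *
        ⟪b i • velocity (b i) (Φ i) (p i) t x + ∇ (Φ i) x, ξ t x⟫_ℝ) -
      (∫ x in Ω, (∑ i, p i t x * density (A i) t x) * div (ξ t) x) =
      σ / 2 * ∫ x, (div (ξ t) x - quadGrad (ξ t) (interfaceNormal Ω T A t x) x)
        ∂(interfaceMeasure Ω A t) := by
    intro t ht
    have h1 := h.sum_integral_flux hΩ hΩb hΩs ht (hξ1 t) (hwall t ht)
    have hj1 : ∀ i, IntegrableOn (fun x => density (A i) t x * -⟪G i (t, x), ξ t x⟫_ℝ) Ω :=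
      fun i => h.integrableOn_density_mul_slice hΩb ht i (hF i)
    have hj2 : ∀ i, IntegrableOn (fun x => density (A i) t x * (p i t x * div (ξ t) x)) Ω :=
      fun i => h.integrableOn_density_mul_slice hΩb ht i
        ((h.pressure_regular i).continuousOn.mul (continuous_div hξ).continuousOn)
    have h2 : ∀ i, ∫ x in A i t, flux (p i t) (ξ t) x =
        (∫ x in Ω, density (A i) t x * (p i t x * div (ξ t) x)) -
        ∫ x in Ω, density (A i) t x * -⟪G i (t, x), ξ t x⟫_ℝ := by
      intro i
      rw [← integral_sub (hj2 i) (hj1 i), ← inter_eq_self_of_subset_right (h.phase_subset i t ht),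
        ← setIntegral_indicator (h.phase_open i t ht).measurableSet]
      refine integral_congr_ae (ae_of_all _ fun x => ?_)
      by_cases hx : x ∈ A i t
      · simp only [indicator_of_mem hx, density, flux, hGA i t ht x hx, Pi.one_apply]
        ring
      · simp [density, hx]
    have h3 : ∫ x in Ω, ∑ i, density (A i) t x *
        ⟪b i • velocity (b i) (Φ i) (p i) t x + ∇ (Φ i) x, ξ t x⟫_ℝ =
        ∑ i, ∫ x in Ω, density (A i) t x * -⟪G i (t, x), ξ t x⟫_ℝ := by
      simp only [hE _ t ht]
      exact integral_finsetSum _ fun i _ => hj1 i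
    have h4 : ∫ x in Ω, (∑ i, p i t x * density (A i) t x) * div (ξ t) x =
        ∑ i, ∫ x in Ω, density (A i) t x * (p i t x * div (ξ t) x) := by
      rw [← integral_finsetSum _ fun i _ => hj2 i]
      refine integral_congr_ae (ae_of_all _ fun x => ?_)
      simp only [Finset.sum_mul]
      exact Finset.sum_congr rfl fun i _ => by ring
    simp only [h2, Finset.sum_sub_distrib] at h1
    rw [h3, h4]
    linarith
  let e1 : ℝ → ℝ := fun t => ∫ x in Ω, ∑ i, density (A i) t x *
        ⟪b i • velocity (b i) (Φ i) (p i) t x + ∇ (Φ i) x, ξ t x⟫_ℝ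
  let e2 : ℝ → ℝ := fun t => ∫ x in Ω, (∑ i, p i t x * density (A i) t x) * div (ξ t) x
  let s : ℝ → ℝ := fun t => ∫ x, div (ξ t) x ∂(interfaceMeasure Ω A t)
  replace he1 : IntervalIntegrable e1 volume 0 T := he1
  replace he2 : IntervalIntegrable e2 volume 0 T := he2
  replace hs : IntervalIntegrable s volume 0 T := hs
  -- The identity at time `t` is `e1 - e2 = (σ/2)(s - q)`, with `q` the surface integral of the
  -- contraction. Solving for `q`, with the surface counted twice, gives `2(q + s) = 4s - (4/σ)(e1 -
  -- e2)`. Integrability in time of the curvature term thus follows from that of the other terms,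
  -- without a separate argument for the normal.
  have he4 : ∀ t ∈ Icc 0 T, ∫ x, (quadGrad (ξ t) (interfaceNormal Ω T A t x) x + div (ξ t) x)
      ∂(interfaceMeasure Ω A t + interfaceMeasure Ω A t) = 4 * s t - 4 / σ * (e1 t - e2 t) := by
    intro t ht
    have h1 := hflux t ht
    rw [integral_sub (hd t ht) (hq t ht)] at h1
    rw [integral_add_measure (hqd t ht) (hqd t ht), integral_add (hq t ht) (hd t ht)]
    have h2 : e1 t - e2 t = σ / 2 * (s t -
      ∫ x, quadGrad (ξ t) (interfaceNormal Ω T A t x) x ∂(interfaceMeasure Ω A t)) := h1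
    rw [h2]
    simp only [s]
    field_simp
    ring
  have hI : uIcc 0 T = Icc 0 T := uIcc_of_le hT
  have hint : IntervalIntegrable (fun t => 4 * s t - 4 / σ * (e1 t - e2 t)) volume 0 T :=
    (hs.const_mul 4).sub ((he1.sub he2).const_mul _)
  refine ⟨hi1, fun t ht => (hqd t ht).add_measure (hqd t ht), (intervalIntegrable_congr fun t ht => ?_).1 hint, ?_⟩
  · exact (he4 t (hI ▸ uIoc_subset_uIcc ht)).symm
  · have hPd : P (divOn Ω T ξ hξ) = (∫ t in (0 : ℝ)..T, e2 t) + σ * ∫ t in (0 : ℝ)..T, s t :=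
      hPdiv.trans (congrArg₂ _ rfl (congrArg _ hsμ))
    have h5 : ∫ t in (0 : ℝ)..T, 1 / 2 * ∫ x, (quadGrad (ξ t) (interfaceNormal Ω T A t x) x +
        div (ξ t) x) ∂(interfaceMeasure Ω A t + interfaceMeasure Ω A t) =
        ∫ t in (0 : ℝ)..T, 1 / 2 * (4 * s t - 4 / σ * (e1 t - e2 t)) :=
      intervalIntegral.integral_congr fun t ht => by
        simp only [he4 t (hI ▸ ht)]
    rw [h5, hPd, intervalIntegral.integral_const_mul, intervalIntegral.integral_sub (hs.const_mul 4)
      ((he1.sub he2).const_mul _), intervalIntegral.integral_const_mul,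
      intervalIntegral.integral_const_mul, intervalIntegral.integral_sub he1 he2]
    field_simp
    ring

end IsClassicalSolution

end

end Muskat

/-! ### The main theorem -/

theorem mainTheorem4 {d : ℕ} (hd : 1 ≤ d)
    (Ω : Set (Muskat.Space d)) (hΩ_open : IsOpen Ω) (hΩ_bdd : Bornology.IsBounded Ω)
    (hΩ_convex : Convex ℝ Ω) (hΩ_smooth : Muskat.HasSmoothBoundary Ω)
    (T σ : ℝ) (hT : 0 < T) (hσ : 0 < σ)
    (b : Fin 2 → ℝ) (hb : ∀ i, 0 < b i)
    (Φ : Fin 2 → Muskat.Space d → ℝ) (hΦ : ∀ i, ∃ K, LipschitzOnWith K (Φ i) Ω)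
    (A : Fin 2 → ℝ → Set (Muskat.Space d)) (p : Fin 2 → ℝ → Muskat.Space d → ℝ)
    (hsol : Muskat.IsClassicalSolution Ω T σ b Φ A p) :
    (∀ i, Muskat.WeakContinuityEq Ω T (Muskat.density (A i))
      (Muskat.velocity (b i) (Φ i) (p i))) ∧
    ∃ (μ : Measure (ℝ × Muskat.Space d)) (P : C(Muskat.cylinder Ω T, ℝ) →L[ℝ] ℝ),
      IsFiniteMeasure μ ∧
      Muskat.IsSurfaceMeasure T (Muskat.interface A) μ ∧
      Muskat.IsWeakPressure Ω T σ (fun i => Muskat.density (A i)) p μ P ∧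
      Muskat.WeakCurvatureEq Ω T σ b Φ (fun i => Muskat.density (A i))
        (fun i => Muskat.velocity (b i) (Φ i) (p i)) P := by
  -- The graph arguments split off one coordinate of `ℝⁿ⁺¹`; the interface then has dimension `n = d
  -- - 1`.
  obtain ⟨n, rfl⟩ : ∃ n, d = n + 1 := ⟨d - 1, by omega⟩
  refine ⟨fun i => hsol.weakContinuityEq hΩ_open hΩ_bdd hΩ_smooth hT.le i, ?_⟩
  obtain ⟨κ, hκf, hκ⟩ := hsol.exists_kernel hΩ_open hΩ_bdd hΩ_smooth
  obtain ⟨P, hP⟩ := hsol.exists_isWeakPressure hΩ_open hΩ_bdd hT.le hκ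
  exact ⟨_, P, inferInstance, hsol.isSurfaceMeasure_compProd hΩ_open hΩ_smooth hκ, hP,
    hsol.weakCurvatureEq hΩ_open hΩ_bdd hΩ_smooth hT.le hσ.ne' (fun i => (hb i).ne') hκ hP⟩
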